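/- **Theorem (Antiholomorphic Root Extraction Problem).** Let $g$ be a holomorphic parabolic germ of codimension $k\ge 1$ at $0\in\mathbb C$, i.e. $g(z)=z+az^{k+1}+o(z^{k+1})$ with $a\neq 0$. Let $h$ be a germ of holomorphic coordinate with $h(0)=0$, $h'(0)\ne0$, in which $g$ is prenormalized: $G=h\circ g\circ h^{-1}$ satisfies $$G(z)=z+z^{k+1}+\Bigl(\tfrac{k+1}{2}-b\Bigr)z^{2k+1}+o(z^{2k+1}),\qquad b\in\mathbb C .$$ Let $n\ge 2$ be even. An antiholomorphic germ $f$ fixing $0$ (or a formal power series in $\bar z$ without constant term) is an $n$-th root of $g$ if $f^{\circ n}=g$. It is said to be tangent to the axis $e^{i\pi\ell/k}\mathbb R$, $0\le\ell<k$, if $h\circ f\circ h^{-1}$ has linear part $e^{2\pi i\ell/k}\bar z$. Let $v^t$ be the time-$t$ map of $\dot z=z^{k+1}/(1+bz^k)$, $\sigma_\ell(z)=e^{2\pi i\ell/k}\bar z$, $\Sigma(W)=\overline W$ and $T_C(W)=W+C$. *Modulus.* Index modulo $2k$. The petal $j$ is a sector $S_j$ at $0$ centred on the ray of argument $j\pi/k$,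 of half-opening $\alpha$ with $\frac{\pi}{2k}<\alpha<\frac{\pi}{k}$; it is repelling for $j$ even and attracting for $j$ odd. A Fatou coordinate $\varphi_j$ on $S_j$ is an injective holomorphic function with $\varphi_j\circ G=T_1\circ\varphi_j$. In the overlap of $S_{j-1}$ and $S_j$ lying between the rays $j-1$ and $j$, the transition function is $\Psi_j=\varphi_j\circ\varphi_{j-1}^{-1}$ for $j$ odd and $\Psi_j=\varphi_{j-1}\circ\varphi_j^{-1}$ for $j$ even. It commutes with $T_1$ and is regarded as a holomorphic germ at $\operatorname{Im}W\to+\infty$ ($j$ odd) or $\operatorname{Im}W\to-\infty$ ($j$ even). The family $(\Psi_j)$ is normalized if $\Psi_j(W)-W\to-\frac{i\pi b}{k}$ for $j$ odd and $\to\frac{i\pi b}{k}$ for $j$ even. The normalized families form one class under simultaneous conjugacy by $T_C$, $C\in\mathbb C$; they are the representatives of the Écalle–Voronin modulus of $g$ in the coordinate $h$. The reflection of indices in the axis $e^{i\pi\ell/k}\mathbb R$ is $s_\ell(j)=2\ell+1-j \pmod{2k}$. Then: 1. If $b$ is real, $g$ has exactly $k$ one-parameter families of formal antiholomorphic $n$-th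 roots, one for each axis. Precisely, there is a formal change of coordinate $\hat h$, with $\hat h(0)=0$ and $\hat h'(0)=h'(0)$, such that $\hat h\circ g=v^1\circ\hat h$, and the formal antiholomorphic $n$-th roots of $g$ are the series $f_{\ell,y}=\hat h^{-1}\circ\sigma_\ell\circ v^{\frac1n+iy}\circ\hat h$, $0\le\ell<k$, $y\in\mathbb R$. These are pairwise distinct, and $f_{\ell,y}$ is tangent to the axis $e^{i\pi\ell/k}\mathbb R$. 2. For $0\le \ell<k$, $g$ has a convergent antiholomorphic $n$-th root tangent to the axis $e^{i\pi\ell/k}\mathbb R$ if and only if there is a representative $(\Psi_j)$ of its modulus such that, for all $j$, $$\Psi_j\circ\Sigma\circ T_{1/n}=\Sigma\circ T_{1/n}\circ\Psi_{s_\ell(j)} .\qquad (*)_\ell$$ 3. Suppose that $g$ is not analytically conjugate to its normal form $v^1$. - i) For each $\ell$, $g$ has at most one convergent antiholomorphic $n$-th root tangent to the axis $e^{i\pi\ell/k}\mathbb R$; so $g$ has at most $k$ distinct convergent antiholomorphic $n$-th roots. - ii) Suppose that $g$ has $m\ge1$ convergent antiholomorphic $n$-th roots, tangent to the axes $e^{i\pi\ell_i/k}\mathbb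 R$ with $\ell_1,\dots,\ell_m$ distinct. Then the modulus of $g$ has a representative that satisfies $(*)_{\ell_1},\dots,(*)_{\ell_m}$ simultaneously, and these symmetries leave $d=\gcd(\ell_m-\ell_1,\dots,\ell_m-\ell_{m-1},k)$ independent transition functions. This means that there are $d$ indices modulo $2k$ such that a family of normalized germs satisfying $(*)_{\ell_1},\dots,(*)_{\ell_m}$ is determined by its members with these $d$ indices, and these $d$ members can be prescribed arbitrarily among the normalized germs that commute with $T_{2/n}=(\Sigma\circ T_{1/n})^{\circ2}$ (as all members of such a family do). Here a normalized germ of index $j$ is a holomorphic germ at $\operatorname{Im}W\to\pm\infty$ ($+$ for $j$ odd, $-$ for $j$ even) that commutes with $T_1$ and has the normalized constant term of index $j$. -/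

import Mathlib

open Filter Topology Complex
open scoped ComplexConjugate

noncomputable section

namespace AntiholomorphicRoot

/-! Germs at the origin are represented by functions on the complex plane, compared by
eventual equality near the origin. -/

/-- `g` is a holomorphic parabolic germ of codimension `k ≥ 1` at the origin:
`g(z) = z + a z ^ (k + 1) + o(z ^ (k + 1))` with `a ≠ 0`. -/
def IsParabolicGerm (k : ℕ) (g : ℂ → ℂ) : Prop :=
  1 ≤ k ∧ AnalyticAt ℂ g 0 ∧ g 0 = 0 ∧
    analyticOrderAt (fun z => g z - z) 0 = ((k + 1 : ℕ) : ℕ∞)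

/-- `h` is a germ of a holomorphic diffeomorphism fixing the origin. -/
def IsLocalChart (h : ℂ → ℂ) : Prop :=
  AnalyticAt ℂ h 0 ∧ h 0 = 0 ∧ deriv h 0 ≠ 0

/-- The holomorphic germ `G` is prenormalized, with codimension `k` and formal invariant `b`. -/
def IsPrenormalized (k : ℕ) (b : ℂ) (G : ℂ → ℂ) : Prop :=
  AnalyticAt ℂ G 0 ∧
    (fun z : ℂ => G z - (z + z ^ (k + 1) + (((k : ℂ) + 1) / 2 - b) * z ^ (2 * k + 1)))
      =o[𝓝 0] fun z : ℂ => z ^ (2 * k + 1)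

/-- `h` is a holomorphic coordinate at the origin in which `g` is the prenormalized germ `G`. -/
def IsPrenormalization (k : ℕ) (b : ℂ) (g h G : ℂ → ℂ) : Prop :=
  IsLocalChart h ∧ IsPrenormalized k b G ∧ (∀ᶠ z in 𝓝 (0 : ℂ), h (g z) = G (h z))

/-! ### Antiholomorphic germs and roots -/

/-- `f` is a germ of an antiholomorphic map fixing the origin: `z ↦ f (conj z)` is
holomorphic near `0`. -/
def IsAntiholomorphicGerm (f : ℂ → ℂ) : Prop :=
  AnalyticAt ℂ (fun z => f (conj z)) 0 ∧ f 0 = 0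

/-- The coefficient `a₁` of `f(z) = a₁ conj(z) + a₂ conj(z) ^ 2 + ⋯`. -/
def antiLinearCoeff (f : ℂ → ℂ) : ℂ := deriv (fun z => f (conj z)) 0

/-- `f` is a (convergent) antiholomorphic `n`-th root of `g`. -/
def IsAntiholomorphicRoot (n : ℕ) (g f : ℂ → ℂ) : Prop :=
  IsAntiholomorphicGerm f ∧ f^[n] =ᶠ[𝓝 0] g

/-- The linear part of the reflection `σ_ℓ(z) = e^{2πiℓ/k} conj(z)` in the axis
`e^{iπℓ/k} ℝ`. -/
def axisCoeff (k ℓ : ℕ) : ℂ := exp (2 * Real.pi * I * ℓ / k)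

/-- An antiholomorphic germ, or formal antiholomorphic series, with linear part `a conj(z)`
is tangent to the axis `e^{iπℓ/k} ℝ` of the coordinate `h`: written in the coordinate `h`,
it has the linear part `e^{2πiℓ/k} conj(z)`. -/
def IsTangentToAxis (k ℓ : ℕ) (h : ℂ → ℂ) (a : ℂ) : Prop :=
  deriv h 0 * a = axisCoeff k ℓ * conj (deriv h 0)

/-! ### Formal series -/

/-- The Taylor series of a germ at the origin. -/
def taylor (g : ℂ → ℂ) : PowerSeries ℂ :=
  PowerSeries.mk fun m => iteratedDeriv m g 0 / (m.factorial : ℂ)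

/-- The series with complex conjugate coefficients. -/
def conjSeries (A : PowerSeries ℂ) : PowerSeries ℂ := PowerSeries.map (starRingEnd ℂ) A

/-- The composition `A ∘ B` of formal series (`B` without constant term). -/
def comp (A B : PowerSeries ℂ) : PowerSeries ℂ := PowerSeries.subst B A

/-- The series of the `m`-th iterate of the formal antiholomorphic germ `f(z) = A(conj z)`,
in the variable `z` if `m` is even and in `conj z` if `m` is odd. -/
def antiIterate (A : PowerSeries ℂ) : ℕ → PowerSeries ℂ
  | 0 => PowerSeries.X
  | m + 1 => comp A (conjSeries (antiIterate A m))

/-- For `n` even: `f(z) = A(conj z)` is a formal antiholomorphic `n`-th root of `g`. -/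
def IsFormalAntiholomorphicRoot (n : ℕ) (g : ℂ → ℂ) (A : PowerSeries ℂ) : Prop :=
  PowerSeries.constantCoeff A = 0 ∧ antiIterate A n = taylor g

/-- The Taylor series of the vector field `v(z) = z ^ (k + 1) / (1 + b z ^ k)`. -/
def vectorField (k : ℕ) (b : ℂ) : PowerSeries ℂ :=
  PowerSeries.X ^ (k + 1) * (1 + PowerSeries.C b * PowerSeries.X ^ k)⁻¹

/-- The `m`-fold application of the derivation `v d/dz` to the function `z`. -/
def lieIterate (k : ℕ) (b : ℂ) : ℕ → PowerSeries ℂ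
  | 0 => PowerSeries.X
  | m + 1 => vectorField k b * PowerSeries.derivative ℂ (lieIterate k b m)

/-- The series of the time-`t` map `v^t` of the vector field `v`, as the Lie series
`∑ m, t ^ m / m! (v d/dz)^m z`; the `m`-th term has order greater than `m`. -/
def flow (k : ℕ) (b t : ℂ) : PowerSeries ℂ :=
  PowerSeries.mk fun N => ∑ m ∈ Finset.range (N + 1),
    t ^ m / (m.factorial : ℂ) * PowerSeries.coeff N (lieIterate k b m)

/-- `g` is analytically conjugate to its normal form, the (convergent) time-one map `v^1`. -/
def IsConjugateToNormalForm (k : ℕ) (b : ℂ) (g : ℂ → ℂ) : Prop :=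
  ∃ N H : ℂ → ℂ, AnalyticAt ℂ N 0 ∧ taylor N = flow k b 1 ∧ IsLocalChart H ∧
    ∀ᶠ z in 𝓝 (0 : ℂ), H (g z) = N (H z)

/-! ### Fatou coordinates and the Écalle–Voronin modulus

Petals and transition functions are indexed modulo `2k`. The petal `j` is centred on the ray
of argument `jπ/k`: it is repelling for `j` even and attracting for `j` odd. The transition
function `Ψ_j` belongs to the sector between the rays `j - 1` and `j`. Thus the functions
`Ψ_{-1}, …, Ψ_{-k}` have here the indices `0, …, 1 - k`. -/

/-- The truncated sector of radius `r` and half-opening `α` about the ray of argument `θ`. -/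
def sector (θ α r : ℝ) : Set ℂ :=
  {z | 0 < ‖z‖ ∧ ‖z‖ < r ∧ |arg (z * exp (-(θ * I)))| < α}

/-- `φ` is a Fatou coordinate of `G` on `S`: an injective holomorphic function that conjugates
`G` to the translation by `1`. -/
def IsFatouCoordinate (G : ℂ → ℂ) (S : Set ℂ) (φ : ℂ → ℂ) : Prop :=
  DifferentiableOn ℂ φ S ∧ Set.InjOn φ S ∧ ∀ z ∈ S, G z ∈ S → φ (G z) = φ z + 1

/-- The end of the cylinder at which `Ψ_j` is defined: `Im W → +∞` for `j` odd and
`Im W → -∞` for `j` even. -/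
def cylinderEnd (k : ℕ) (j : ZMod (2 * k)) : Filter ℂ :=
  if Odd j.val then comap Complex.im atTop else comap Complex.im atBot

/-- The constant term of a normalized transition function: `-iπb/k` for `j` odd, and `iπb/k`
for `j` even. -/
def normalizedConstant (k : ℕ) (b : ℂ) (j : ZMod (2 * k)) : ℂ :=
  if Odd j.val then -(I * Real.pi * b / k) else I * Real.pi * b / k

/-- `Ψ` is the germ, at the end of the cylinder with index `j`, of a holomorphic map commuting
with `W ↦ W + 1`, whose Fourier expansion `Ψ(W) = W + c + ⋯` has the normalized constant
term `c`. -/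
def IsNormalizedGerm (k : ℕ) (b : ℂ) (j : ZMod (2 * k)) (Ψ : ℂ → ℂ) : Prop :=
  (∀ᶠ W in cylinderEnd k j, DifferentiableAt ℂ Ψ W) ∧
  (∀ᶠ W in cylinderEnd k j, Ψ (W + 1) = Ψ W + 1) ∧
  Tendsto (fun W => Ψ W - W) (cylinderEnd k j) (𝓝 (normalizedConstant k b j))

/-- `Ψ` is a family of normalized transition functions of the prenormalized germ `G`, that is,
a representative of its Écalle–Voronin modulus (in the given coordinate, so up to a simultaneous
conjugacy by a translation `W ↦ W + C` with `C` complex). The petals are sectors of half-opening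
`α` between `π/(2k)` and `π/k`, so that consecutive ones meet in a sector of half-opening
`α - π/(2k)`. There `Ψ_j` maps the Fatou coordinate of the repelling petal to the one of the
attracting petal. -/
def IsModulusRepresentative (k : ℕ) (b : ℂ) (G : ℂ → ℂ) (Ψ : ZMod (2 * k) → ℂ → ℂ) : Prop :=
  ∃ (α r : ℝ) (φ : ZMod (2 * k) → ℂ → ℂ),
    Real.pi / (2 * k) < α ∧ α < Real.pi / k ∧ 0 < r ∧
    (∀ j, IsFatouCoordinate G (sector (j.val * Real.pi / k) α r) (φ j)) ∧
    (∀ j, IsNormalizedGerm k b j (Ψ j)) ∧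
    ∀ j, ∀ᶠ z in
        𝓝[sector ((2 * j.val - 1) * Real.pi / (2 * k)) (α - Real.pi / (2 * k)) r] (0 : ℂ),
      if Odd j.val then Ψ j (φ (j - 1) z) = φ j z else Ψ j (φ j z) = φ (j - 1) z

/-- The permutation of the `2k` sectors induced by the reflection in the axis `e^{iπℓ/k} ℝ`,
which exchanges the rays `i` and `2ℓ - i`. -/
def reflectIndex (k ℓ : ℕ) (j : ZMod (2 * k)) : ZMod (2 * k) := 2 * (ℓ : ZMod (2 * k)) + 1 - j

/-- The map `Σ ∘ T_{1/n}`, where `Σ` is complex conjugation and `T_C(W) = W + C`. -/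
def conjTranslate (n : ℕ) (W : ℂ) : ℂ := conj (W + 1 / n)

/-- The symmetry `Ψ_j ∘ Σ ∘ T_{1/n} = Σ ∘ T_{1/n} ∘ Ψ_{s_ℓ(j)}` for all `j`. -/
def HasAxisSymmetry (k n ℓ : ℕ) (Ψ : ZMod (2 * k) → ℂ → ℂ) : Prop :=
  ∀ j, ∀ᶠ W in cylinderEnd k (reflectIndex k ℓ j),
    Ψ j (conjTranslate n W) = conjTranslate n (Ψ (reflectIndex k ℓ j) W)

/-- Among normalized families with the axis symmetries for all `ℓ` in `L`, exactly `d` functions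
are independent: there are `d` indices such that the functions with these indices can be
prescribed arbitrarily, among the normalized germs commuting with `T_{2/n} = (Σ ∘ T_{1/n})^2`
(as every member of a symmetric family does), and determine the whole family. -/
def HasIndependentCount (k : ℕ) (b : ℂ) (n : ℕ) (L : Set ℕ) (d : ℕ) : Prop :=
  ∃ R : Finset (ZMod (2 * k)), R.card = d ∧
    (∀ Θ : ZMod (2 * k) → ℂ → ℂ,
      (∀ j ∈ R, IsNormalizedGerm k b j (Θ j) ∧
        ∀ᶠ W in cylinderEnd k j, Θ j (W + 2 / n) = Θ j W + 2 / n) →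
      ∃ Ψ : ZMod (2 * k) → ℂ → ℂ, (∀ j, IsNormalizedGerm k b j (Ψ j)) ∧
        (∀ ℓ ∈ L, HasAxisSymmetry k n ℓ Ψ) ∧ ∀ j ∈ R, Ψ j =ᶠ[cylinderEnd k j] Θ j) ∧
    ∀ Ψ Ψ' : ZMod (2 * k) → ℂ → ℂ,
      (∀ j, IsNormalizedGerm k b j (Ψ j)) → (∀ j, IsNormalizedGerm k b j (Ψ' j)) →
      (∀ ℓ ∈ L, HasAxisSymmetry k n ℓ Ψ) → (∀ ℓ ∈ L, HasAxisSymmetry k n ℓ Ψ') →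
      (∀ j ∈ R, Ψ j =ᶠ[cylinderEnd k j] Ψ' j) → ∀ j, Ψ j =ᶠ[cylinderEnd k j] Ψ' j

end AntiholomorphicRoot

end

open AntiholomorphicRoot

/-!
Everything is read in the Fatou coordinates of the prenormalized germ `G`. On every petal the Abel
equation `φ (G z) = φ z + 1` has an injective solution asymptotic to the time coordinate of the
vector field `z ^ (k + 1) / (1 + b z ^ k)`: an approximate solution is corrected by a series along
the orbits (`exists_abel_solution`, `exists_fatou_family`). Such coordinates are unique up to
additive constants (`fatou_unique`), because an injective holomorphic map of a half-plane that
commutes with `W ↦ W + 1` is a translation: it extends to an injective entire map.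

An antiholomorphic root `F` of `G` commutes with `G`. Its linear part permutes the petals by the
reflection in its axis, so by uniqueness it acts in the Fatou coordinates as `W ↦ conj (W + C)`.
Comparing the asymptotic jumps of the coordinates across an overlap and across its mirror image
shows that `C` is the same on all petals and that `b` is real, and `F^[n] = G` gives
`C = 1 / n + i y` with `y` real (`exists_antiShift`, `antiShift_const`). Translating all coordinates
by `i y / 2` gives a representative of the modulus with the required symmetry
(`exists_modulus_of_roots`). Conversely, for a symmetric representative the formula
`W ↦ conj W + 1 / n` defines an antiholomorphic map from each petal to its mirror image; the symmetry
says that these maps agree on the overlaps, and they glue to a root by the removable singularity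
theorem (`exists_root_of_symmetric`, `exists_root_of_modulus`).

Suppose that two roots have different constants `y`. Then an iterate of their composite acts as a
translation by a non-real number `T`. The transition functions commute with `W ↦ W + T`, hence are
translations; the Fatou coordinates then differ from the time coordinates by a germ analytic at the
origin, and `G` is conjugate to the time-one map of the vector field
(`exists_conjugacy_of_shift`). So if `g` is not conjugate to its normal form, all roots share one
constant `y` (`eq_of_not_conjugate`): a root is determined by its axis, and one translation of the
coordinates makes all the symmetries hold simultaneously. The symmetries transport transition
functions along the orbits of the indices modulo `2k` under the reflections. These orbits are
represented by the even indices `0, 2, …, 2(d - 1)`, which gives the count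
(`hasIndependentCount`).

In the formal classification the equations to be solved are triangular (`IsTriangular`): changing a
series `A` tangent to the identity by `c X ^ N` changes the equation by `(N - k - 1) c X ^ (N + k)`
to leading order. Hence a solution is determined by its coefficient of degree `k + 1`, and exists as
soon as the equation holds up to the resonant order. This yields a formal conjugacy of `G` to the
time-one map (`exists_formal_conjugacy`), identifies the centralizer of the time-one map with the
flow (`eq_flow_of_commute`), and characterizes the flow by `v A' = v ∘ A` (`eq_flow`). The flow
commutes with the rotations of order dividing `k` and, `b` being real, satisfies
`conj ∘ v^t ∘ conj = v^(conj t)`; the formal roots of the normal form follow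
(`antiIterate_eq_flow_one_iff`, `exists_formal_roots`). Finally `IsTimeOneMap.taylor_eq` identifies
the Taylor series of the convergent time-one map with the formal one.
-/

open Filter Topology Complex
open scoped ComplexConjugate

noncomputable section

namespace AntiholomorphicRoot

/-! ### The Abel equation near infinity -/

/-- The complement of a wedge around the negative real axis: a neighbourhood of infinity in every
sector `|arg w| < θ` with `θ < 3π/4`, forward invariant under maps close to `w ↦ w + 1`. -/
def wedgeDomain (R : ℝ) : Set ℂ := {w | R < w.re + |w.im|}

lemma isOpen_wedgeDomain (R : ℝ) : IsOpen (wedgeDomain R) :=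
  isOpen_lt continuous_const (by fun_prop)

lemma wedgeDomain_anti {R R' : ℝ} (h : R ≤ R') : wedgeDomain R' ⊆ wedgeDomain R :=
  fun _ hw => lt_of_le_of_lt h hw

lemma re_add_abs_im_le (w : ℂ) : w.re + |w.im| ≤ 2 * ‖w‖ := by
  have := abs_re_le_norm w
  have := abs_im_le_norm w
  have := le_abs_self w.re
  linarith

lemma norm_lower_of_mem_wedgeDomain {R : ℝ} {w : ℂ} (hw : w ∈ wedgeDomain R) : R / 2 < ‖w‖ := by
  have h : R < w.re + |w.im| := hw
  have := re_add_abs_im_le w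
  linarith

section Abel

variable {p : ℂ → ℂ} {R : ℝ}

lemma wedge_step {w v : ℂ} (h : ‖v - w - 1‖ ≤ 1 / 10) :
    w.re + |w.im| + 1 / 2 ≤ v.re + |v.im| ∧ w.re + 1 / 2 ≤ v.re := by
  have h1 := (abs_re_le_norm (v - w - 1)).trans h
  have h2 := (abs_im_le_norm (v - w - 1)).trans h
  simp only [sub_re, one_re, sub_im, one_im, sub_zero] at h1 h2
  have h3 := abs_sub_abs_le_abs_sub w.im v.im
  rw [abs_sub_comm w.im] at h3
  have := abs_le.1 h1
  constructor <;> linarith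

lemma wedge_iterate (hp1 : ∀ w ∈ wedgeDomain R, ‖p w - w - 1‖ ≤ 1 / 10) {w : ℂ}
    (hw : w ∈ wedgeDomain R) (n : ℕ) :
    w.re + |w.im| + n / 2 ≤ (p^[n] w).re + |(p^[n] w).im| ∧ w.re + n / 2 ≤ (p^[n] w).re := by
  induction n with
  | zero => simp
  | succ n ih =>
    have hm : p^[n] w ∈ wedgeDomain R := by
      have h : R < w.re + |w.im| := hw
      have : (0 : ℝ) ≤ n / 2 := by positivity
      show R < _
      linarith [ih.1]
    rw [Function.iterate_succ_apply']
    have := wedge_step (hp1 _ hm)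
    push_cast
    constructor <;> linarith [ih.1, ih.2, this.1, this.2]

lemma wedge_iterate_mem (hp1 : ∀ w ∈ wedgeDomain R, ‖p w - w - 1‖ ≤ 1 / 10) {R' : ℝ}
    (hR' : R ≤ R') {w : ℂ}
    (hw : w ∈ wedgeDomain R') (n : ℕ) : p^[n] w ∈ wedgeDomain (R' + n / 2) := by
  have h : R' < w.re + |w.im| := hw
  have := (wedge_iterate hp1 (wedgeDomain_anti hR' hw) n).1
  show R' + n / 2 < _
  linarith

/-- Solution of the Abel equation: an approximate Fatou coordinate `ψ` at infinity is corrected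
by the sum of its defects along the orbit. -/
theorem exists_abel_solution {ψ : ℂ → ℂ} {C s : ℝ} (hR : 0 < R) (hs : 1 < s)
    (hp : DifferentiableOn ℂ p (wedgeDomain R)) (hψ : DifferentiableOn ℂ ψ (wedgeDomain R))
    (hp1 : ∀ w ∈ wedgeDomain R, ‖p w - w - 1‖ ≤ 1 / 10)
    (hC : ∀ w ∈ wedgeDomain R, ‖ψ (p w) - ψ w - 1‖ ≤ C * ‖w‖ ^ (-s)) :
    ∃ φ : ℂ → ℂ, DifferentiableOn ℂ φ (wedgeDomain R) ∧
      (∀ w ∈ wedgeDomain R, φ (p w) = φ w + 1) ∧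
      ∀ ε > 0, ∃ R₁, ∀ w ∈ wedgeDomain R₁, ‖φ w - ψ w‖ ≤ ε := by
  have hmem : ∀ (n : ℕ) (w) (_ : w ∈ wedgeDomain R), p^[n] w ∈ wedgeDomain R := by
    intro n w hw
    refine wedgeDomain_anti ?_ (wedge_iterate_mem hp1 le_rfl hw n)
    have : (0 : ℝ) ≤ n / 2 := by positivity
    linarith
  have hC0 : 0 ≤ C := by
    have hw : ((R + 1 : ℝ) : ℂ) ∈ wedgeDomain R := by simp [wedgeDomain]
    have h1 := (norm_nonneg _).trans (hC _ hw)
    have : 0 < ‖((R + 1 : ℝ) : ℂ)‖ ^ (-s) := by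
      apply Real.rpow_pos_of_pos
      simp only [norm_real, Real.norm_eq_abs, abs_pos]; linarith
    exact nonneg_of_mul_nonneg_left h1 this
  -- `e` is the defect of the Abel equation for the approximate solution `ψ`; its sum along an
  -- orbit telescopes.
  let e : ℂ → ℂ := fun w => ψ (p w) - ψ w - 1
  -- A summable majorant of the defects along an orbit: the orbit moves to the right with speed
  -- at least `1 / 2`.
  let u : ℝ → ℕ → ℝ := fun T n => C * ((T + n / 2) / 2) ^ (-s)
  have hpos : ∀ T, R ≤ T → ∀ n : ℕ, 0 < (T + n / 2) / 2 := by
    intro T hT n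
    have : (0 : ℝ) ≤ n / 2 := by positivity
    linarith
  have hbound : ∀ T, R ≤ T → ∀ (n : ℕ) (w) (_ : w ∈ wedgeDomain T), ‖e (p^[n] w)‖ ≤ u T n := by
    intro T hT n w hw
    have h1 := wedge_iterate_mem hp1 hT hw n
    have h2 := norm_lower_of_mem_wedgeDomain h1
    refine (hC _ (hmem n w (wedgeDomain_anti hT hw))).trans ?_
    refine mul_le_mul_of_nonneg_left ?_ hC0
    exact Real.rpow_le_rpow_of_nonpos (hpos T hT n) h2.le (by linarith)
  have hsum : Summable (u R) := by
    refine Summable.mul_left _ ?_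
    have h1 : Summable fun n : ℕ => ((n : ℝ) / 4) ^ (-s) := by
      have : (fun n : ℕ => ((n : ℝ) / 4) ^ (-s)) = fun n : ℕ => (n : ℝ) ^ (-s) * (4 ^ s) := by
        ext n
        rw [Real.div_rpow (by positivity) (by norm_num), Real.rpow_neg (by norm_num : (0:ℝ) ≤ 4)]
        rw [div_inv_eq_mul]
      rw [this]
      exact (Real.summable_nat_rpow.2 (by linarith)).mul_right _
    refine (summable_nat_add_iff 1).1 (Summable.of_nonneg_of_le ?_ ?_ ((summable_nat_add_iff 1).2 h1))
    · intro n
      exact Real.rpow_nonneg (hpos R le_rfl _).le _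
    · intro n
      refine Real.rpow_le_rpow_of_nonpos (by positivity) ?_ (by linarith)
      linarith
  refine ⟨fun w => ψ w + ∑' n, e (p^[n] w), ?_, ?_, ?_⟩
  · refine hψ.add (differentiableOn_tsum_of_summable_norm hsum ?_ (isOpen_wedgeDomain R)
      (hbound R le_rfl))
    intro n
    have hit : DifferentiableOn ℂ p^[n] (wedgeDomain R) := by
      induction n with
      | zero => simpa using differentiableOn_id
      | succ n ih =>
        rw [Function.iterate_succ']
        exact hp.comp ih (hmem n)
    have he : DifferentiableOn ℂ e (wedgeDomain R) :=
      ((hψ.comp hp (hmem 1)).sub hψ).sub_const 1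
    exact he.comp hit (hmem n)
  · intro w hw
    have hS : Summable fun n => e (p^[n] w) :=
      Summable.of_norm_bounded hsum fun n => hbound R le_rfl n w hw
    beta_reduce
    rw [hS.tsum_eq_zero_add]
    simp only [Function.iterate_succ_apply, Function.iterate_zero, id]
    simp only [e]
    ring
  · intro ε hε
    have hlim : Tendsto (fun T => ∑' n, u T n) atTop (𝓝 (∑' _ : ℕ, (0 : ℝ))) := by
      refine tendsto_tsum_of_dominated_convergence hsum ?_ ?_
      · intro n
        have h1 : Tendsto (fun T : ℝ => (T + n / 2) / 2) atTop atTop :=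
          (tendsto_atTop_add_const_right _ _ tendsto_id).atTop_div_const (by norm_num)
        have := ((tendsto_rpow_neg_atTop (by linarith : 0 < s)).comp h1).const_mul C
        simpa [u] using this
      · filter_upwards [eventually_ge_atTop R] with T hT n
        rw [Real.norm_of_nonneg (mul_nonneg hC0 (Real.rpow_nonneg (hpos T hT n).le _))]
        refine mul_le_mul_of_nonneg_left ?_ hC0
        refine Real.rpow_le_rpow_of_nonpos (hpos R le_rfl n) (by linarith) (by linarith)
    rw [tsum_zero] at hlim
    obtain ⟨T, hT, hTR⟩ := ((hlim.eventually (ge_mem_nhds hε)).and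
      (eventually_ge_atTop R)).exists
    refine ⟨T, fun w hw => ?_⟩
    have hle : ∀ n, u T n ≤ u R n := fun n => by
      refine mul_le_mul_of_nonneg_left ?_ hC0
      exact Real.rpow_le_rpow_of_nonpos (hpos R le_rfl n) (by linarith) (by linarith)
    have hsT : Summable (u T) := Summable.of_nonneg_of_le
      (fun n => mul_nonneg hC0 (Real.rpow_nonneg (hpos T hTR n).le _)) hle hsum
    have h1 : ‖∑' n, e (p^[n] w)‖ ≤ ∑' n, u T n :=
      tsum_of_norm_bounded hsT.hasSum fun n => hbound T hTR n w hw
    simpa using h1.trans hT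

/-- A solution of the Abel equation asymptotic to the identity is injective, since it is so on
a right half-plane, which every orbit enters. -/
theorem abel_solution_injOn {φ : ℂ → ℂ} (hR : 0 < R)
    (hp1 : ∀ w ∈ wedgeDomain R, ‖p w - w - 1‖ ≤ 1 / 10) (hpinj : Set.InjOn p (wedgeDomain R))
    (hφ : DifferentiableOn ℂ φ (wedgeDomain R)) (hφp : ∀ w ∈ wedgeDomain R, φ (p w) = φ w + 1)
    (hlin : ∃ R₁, ∀ w ∈ wedgeDomain R₁, ‖φ w - w‖ ≤ 1 / 10 * ‖w‖) :
    Set.InjOn φ (wedgeDomain R) := by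
  obtain ⟨R₁, hR₁⟩ := hlin
  set T := max R R₁ with hT
  have hTpos : 0 < T := lt_of_lt_of_le hR (le_max_left _ _)
  have hT1 : ∀ w ∈ wedgeDomain T, ‖φ w - w‖ ≤ 1 / 10 * ‖w‖ := fun w hw =>
    hR₁ w (wedgeDomain_anti (le_max_right _ _) hw)
  have hTd : DifferentiableOn ℂ φ (wedgeDomain T) := hφ.mono (wedgeDomain_anti (le_max_left _ _))
  -- On `H` Cauchy's estimate bounds the derivative of `φ - id` by `1 / 2`, so `φ` is injective
  -- there.
  let H : Set ℂ := {w | 2 * T < w.re}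
  have hHconv : Convex ℝ H := convex_halfSpace_re_gt _
  have hball : ∀ w ∈ H, Metric.closedBall w (‖w‖ / 4) ⊆ wedgeDomain T := by
    intro w hw v hv
    have hw' : 2 * T < w.re := hw
    have hre := re_le_norm w
    rw [Metric.mem_closedBall, dist_eq_norm] at hv
    have h1 := (abs_re_le_norm (v - w)).trans hv
    have h2 := (abs_im_le_norm (v - w)).trans hv
    simp only [sub_re, sub_im] at h1 h2
    have h3 := abs_sub_abs_le_abs_sub w.im v.im
    rw [abs_sub_comm w.im] at h3
    have h4 := norm_le_abs_re_add_abs_im w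
    rw [abs_of_pos (show 0 < w.re by linarith)] at h4
    have := abs_le.1 h1
    show T < _
    linarith
  have hHW : H ⊆ wedgeDomain T := fun w hw =>
    hball w hw (Metric.mem_closedBall_self (by positivity))
  have hdiff : ∀ w ∈ H, DifferentiableAt ℂ (fun w => φ w - w) w := fun w hw =>
    ((hTd.sub differentiableOn_id) w (hHW hw)).differentiableAt
      ((isOpen_wedgeDomain T).mem_nhds (hHW hw))
  have hder : ∀ w ∈ H, ‖deriv (fun w => φ w - w) w‖ ≤ 1 / 2 := by
    intro w hw
    have hw' : 2 * T < w.re := hw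
    have hwpos : 0 < ‖w‖ := lt_of_lt_of_le (by linarith) (re_le_norm w)
    have hd : DiffContOnCl ℂ (fun w => φ w - w) (Metric.ball w (‖w‖ / 4)) := by
      refine DifferentiableOn.diffContOnCl ?_
      rw [closure_ball _ (by positivity)]
      exact (hTd.sub differentiableOn_id).mono (hball w hw)
    have := norm_deriv_le_of_forall_mem_sphere_norm_le (C := 1 / 8 * ‖w‖) (by positivity) hd
      (fun v hv => by
        have hv' : v ∈ Metric.closedBall w (‖w‖ / 4) := Metric.sphere_subset_closedBall hv
        have h1 := hT1 v (hball w hw hv')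
        rw [Metric.mem_closedBall, dist_eq_norm] at hv'
        have h2 : ‖v‖ ≤ ‖v - w‖ + ‖w‖ := by simpa using norm_add_le (v - w) w
        linarith)
    refine this.trans (le_of_eq ?_)
    field_simp
    norm_num
  have hinjH : Set.InjOn φ H := by
    intro w hw v hv hwv
    have h := hHconv.norm_image_sub_le_of_norm_deriv_le hdiff hder hw hv
    have h2 : φ v - v - (φ w - w) = w - v := by rw [hwv]; ring
    rw [h2, norm_sub_rev] at h
    have : ‖v - w‖ = 0 := by linarith [norm_nonneg (v - w)]
    exact (sub_eq_zero.1 (norm_eq_zero.1 this)).symm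
  have hmem : ∀ (n : ℕ) (w) (_ : w ∈ wedgeDomain R), p^[n] w ∈ wedgeDomain R := by
    intro n w hw
    refine wedgeDomain_anti ?_ (wedge_iterate_mem hp1 le_rfl hw n)
    have : (0 : ℝ) ≤ n / 2 := by positivity
    linarith
  have hφn : ∀ (n : ℕ) (w) (_ : w ∈ wedgeDomain R), φ (p^[n] w) = φ w + n := by
    intro n w hw
    induction n with
    | zero => simp
    | succ n ih =>
      rw [Function.iterate_succ_apply', hφp _ (hmem n w hw), ih]; push_cast; ring
  have hpn : ∀ n : ℕ, Set.InjOn p^[n] (wedgeDomain R) := by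
    intro n
    induction n with
    | zero => exact fun _ _ _ _ h => h
    | succ n ih =>
      rw [Function.iterate_succ']
      exact hpinj.comp ih fun w hw => hmem n w hw
  -- Both orbits enter `H`.
  intro w hw v hv hwv
  obtain ⟨n, hn⟩ := exists_nat_gt (2 * (2 * T - min w.re v.re))
  have h1 := (wedge_iterate hp1 hw n).2
  have h2 := (wedge_iterate hp1 hv n).2
  have h3 := min_le_left w.re v.re
  have h4 := min_le_right w.re v.re
  refine hpn n hw hv (hinjH ?_ ?_ ?_)
  · show 2 * T < _
    linarith
  · show 2 * T < _
    linarith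
  · rw [hφn n w hw, hφn n v hv, hwv]

end Abel

/-! ### Sectors in logarithmic coordinates -/

/-- A sector is the image under the exponential of a half-strip. -/
lemma mem_sector_iff {θ α r : ℝ} (hα : α ≤ Real.pi) {z : ℂ} :
    z ∈ sector θ α r ↔ ∃ ζ : ℂ, Real.exp ζ.re < r ∧ |ζ.im - θ| < α ∧ exp ζ = z := by
  constructor
  · rintro ⟨h0, h1, h2⟩
    have hz : z ≠ 0 := norm_pos_iff.1 h0
    have hz' : z * exp (-(θ * I)) ≠ 0 := mul_ne_zero hz (exp_ne_zero _)
    refine ⟨log (z * exp (-(θ * I))) + θ * I, ?_, ?_, ?_⟩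
    · have : ‖exp (-(θ * I))‖ = 1 := by
        rw [norm_exp]; simp
      simp only [add_re, log_re, norm_mul, this, mul_one, mul_re, ofReal_re, I_re, mul_zero,
        ofReal_im, I_im, sub_self, add_zero]
      rwa [Real.exp_log h0]
    · simpa [log_im] using h2
    · rw [exp_add, exp_log hz', mul_assoc, ← exp_add]
      simp
  · rintro ⟨ζ, h1, h2, rfl⟩
    refine ⟨norm_pos_iff.2 (exp_ne_zero _), by rwa [norm_exp], ?_⟩
    rw [← exp_add, ← log_im, log_exp]
    · simpa [sub_eq_add_neg] using h2
    · have := abs_lt.1 h2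
      simp; linarith
    · have := abs_lt.1 h2
      simp; linarith

lemma ne_zero_of_mem_sector {θ α r : ℝ} {z : ℂ} (h : z ∈ sector θ α r) : z ≠ 0 :=
  norm_pos_iff.1 h.1

lemma sector_mono {θ α α' r r' : ℝ} (hα : α ≤ α') (hr : r ≤ r') :
    sector θ α r ⊆ sector θ α' r' :=
  fun _ h => ⟨h.1, h.2.1.trans_le hr, h.2.2.trans_le hα⟩

lemma isOpen_sector {θ α r : ℝ} (hα : α ≤ Real.pi) : IsOpen (sector θ α r) := by
  have : sector θ α r =
      {z | ‖z‖ < r} ∩ ((fun z => z * exp (-(θ * I))) ⁻¹' (slitPlane ∩ {z | |arg z| < α})) := by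
    ext z
    constructor
    · rintro ⟨h0, h1, h2⟩
      refine ⟨h1, ?_, h2⟩
      show _ ∈ slitPlane
      rw [mem_slitPlane_iff_arg]
      refine ⟨fun h => ?_, mul_ne_zero (norm_pos_iff.1 h0) (exp_ne_zero _)⟩
      rw [h, abs_of_pos Real.pi_pos] at h2
      linarith
    · rintro ⟨h1, h3, h2⟩
      refine ⟨norm_pos_iff.2 ?_, h1, h2⟩
      rintro rfl
      simp at h3
  rw [this]
  refine (isOpen_lt continuous_norm continuous_const).inter (IsOpen.preimage (by fun_prop) ?_)
  have hc : ContinuousOn (fun z : ℂ => |arg z|) slitPlane :=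
    fun z hz => (continuousAt_arg hz).abs.continuousWithinAt
  exact hc.isOpen_inter_preimage isOpen_slitPlane isOpen_Iio

lemma cos_add_abs_sin_lower {x : ℝ} (hx : |x| < 2 * Real.pi / 3) :
    3 / 10 ≤ Real.cos x + |Real.sin x| := by
  have hc : -(1 / 2) < Real.cos x := by
    have h1 : Real.cos (2 * Real.pi / 3) = -(1 / 2) := by
      rw [show 2 * Real.pi / 3 = Real.pi - Real.pi / 3 by ring, Real.cos_pi_sub, Real.cos_pi_div_three]
    rw [← h1, ← Real.cos_abs x]
    exact Real.cos_lt_cos_of_nonneg_of_le_pi (abs_nonneg _) (by linarith [Real.pi_pos]) hx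
  have h2 := Real.sin_sq_add_cos_sq x
  rw [← sq_abs (Real.sin x)] at h2
  have h3 := abs_nonneg (Real.sin x)
  by_cases h : 0 ≤ Real.cos x
  · nlinarith
  · push Not at h
    nlinarith

lemma arg_bound_of_mem_wedgeDomain {w : ℂ} (hw : w ∈ wedgeDomain 0) :
    |arg w| < 3 * Real.pi / 4 := by
  have hw' : 0 < w.re + |w.im| := hw
  have hw0 : w ≠ 0 := by rintro rfl; simp at hw'
  have hn : 0 < ‖w‖ := norm_pos_iff.2 hw0
  by_contra hcon
  push Not at hcon
  set x := |arg w| with hx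
  have hxpi : x ≤ Real.pi := abs_arg_le_pi w
  have h1 : w.re = ‖w‖ * Real.cos x := by
    rw [hx, Real.cos_abs, Complex.cos_arg hw0]; field_simp
  have h2 : |w.im| = ‖w‖ * Real.sin x := by
    rw [hx, ← Real.abs_sin_eq_sin_abs_of_abs_le_pi hxpi, Complex.sin_arg, abs_div, abs_norm]
    field_simp
  have h3 : Real.sin (x + Real.pi / 4) ≤ 0 := by
    have h4 : Real.sin (x + Real.pi / 4) = -Real.sin (x + Real.pi / 4 - Real.pi) := by
      rw [Real.sin_sub_pi]; ring
    rw [h4, neg_nonpos]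
    exact Real.sin_nonneg_of_nonneg_of_le_pi (by linarith) (by linarith [Real.pi_pos])
  rw [Real.sin_add, Real.cos_pi_div_four, Real.sin_pi_div_four] at h3
  have h5 : 0 < √2 / 2 := by positivity
  have h6 : Real.sin x + Real.cos x ≤ 0 := by nlinarith
  rw [h1, h2] at hw'
  nlinarith

/-! ### Fatou coordinates of a parabolic germ, in one direction -/

/-- The half-opening of the petals on which Fatou coordinates are constructed. -/
def petalOpening (k : ℕ) : ℝ := 2 * Real.pi / (3 * k)

lemma petalOpening_le_pi {k : ℕ} (hk : 1 ≤ k) : petalOpening k ≤ Real.pi := by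
  have : (1 : ℝ) ≤ k := by exact_mod_cast hk
  rw [petalOpening, div_le_iff₀ (by positivity)]
  nlinarith [Real.pi_pos]

/-- The Fatou coordinate of `z ↦ z e^{γ(z)} = z - z^{k+1} + ⋯` in the attracting petal around the
positive real axis, where `γ` solves the Abel equation for `1/(k z^k) + β log z` up to
`O(z^{k+1})`. -/
theorem exists_fatou_of_exponent {k : ℕ} (hk : 1 ≤ k) {β : ℂ} {γ : ℂ → ℂ}
    (hγ : AnalyticAt ℂ γ 0) (hγ0 : γ 0 = 0)
    (he : (fun z : ℂ => (exp (-(k * γ z)) - 1) / (k * z ^ k) + β * γ z - 1)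
      =O[𝓝[≠] 0] fun z : ℂ => z ^ (k + 1)) :
    ∃ (r : ℝ) (φ : ℂ → ℂ), 0 < r ∧ DifferentiableOn ℂ φ (sector 0 (petalOpening k) r) ∧
      Set.InjOn φ (sector 0 (petalOpening k) r) ∧
      (∀ z ∈ sector 0 (petalOpening k) r, φ (z * exp (γ z)) = φ z + 1) ∧
      Tendsto (fun z => φ z - (1 / (k * z ^ k) + β * log z))
        (𝓝[sector 0 (petalOpening k) r] 0) (𝓝 0) := by
  have hkR : (1 : ℝ) ≤ k := by exact_mod_cast hk
  have hk0 : (k : ℂ) ≠ 0 := by exact_mod_cast (by omega : k ≠ 0)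
  have hkne : k ≠ 0 := by omega
  have hπ := Real.pi_pos
  have hπ3 := Real.pi_gt_three
  obtain ⟨C, hC⟩ := he.bound
  have hg0 : Tendsto γ (𝓝 0) (𝓝 0) := by simpa [hγ0] using hγ.continuousAt.tendsto
  have hE0 : Tendsto (fun z : ℂ => (exp (-(k * γ z)) - 1) / (k * z ^ k) - 1) (𝓝[≠] 0) (𝓝 0) := by
    have h1 : Tendsto (fun z : ℂ => z ^ (k + 1)) (𝓝[≠] 0) (𝓝 0) := by
      have : Tendsto (fun z : ℂ => z ^ (k + 1)) (𝓝 0) (𝓝 (0 ^ (k + 1))) :=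
        (continuous_pow (k + 1)).tendsto 0
      rw [zero_pow (by omega)] at this
      exact this.mono_left nhdsWithin_le_nhds
    have h2 := (he.trans_tendsto h1).sub
      ((hg0.mono_left (nhdsWithin_le_nhds (s := {0}ᶜ))).const_mul β)
    simp only [mul_zero, sub_zero] at h2
    refine h2.congr fun z => by ring
  -- a radius below which all smallness conditions hold
  have hall : ∀ᶠ z : ℂ in 𝓝 0, DifferentiableAt ℂ γ z ∧ ‖γ z‖ < 1 / (2 * k) ∧
      ‖deriv γ z * z‖ < 1 / 2 ∧ (z ≠ 0 →
        ‖(exp (-(k * γ z)) - 1) / (k * z ^ k) + β * γ z - 1‖ ≤ C * ‖z ^ (k + 1)‖ ∧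
        ‖(exp (-(k * γ z)) - 1) / (k * z ^ k) - 1‖ < 1 / 10) := by
    have h1 : ∀ᶠ z in 𝓝 (0 : ℂ), DifferentiableAt ℂ γ z :=
      hγ.eventually_analyticAt.mono fun z hz => hz.differentiableAt
    have h2 : ∀ᶠ z in 𝓝 (0 : ℂ), ‖γ z‖ < 1 / (2 * k) := by
      have := hg0.norm
      rw [norm_zero] at this
      exact this.eventually (gt_mem_nhds (by positivity))
    have h3 : ∀ᶠ z in 𝓝 (0 : ℂ), ‖deriv γ z * z‖ < 1 / 2 := by
      have : Tendsto (fun z => ‖deriv γ z * z‖) (𝓝 0) (𝓝 ‖deriv γ 0 * 0‖) :=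
        (hγ.deriv.continuousAt.mul continuousAt_id).norm
      rw [mul_zero, norm_zero] at this
      exact this.eventually (gt_mem_nhds (by norm_num))
    have h4 := eventually_nhdsWithin_iff.1 hC
    have h5 : ∀ᶠ z in 𝓝[≠] (0 : ℂ), ‖(exp (-(k * γ z)) - 1) / (k * z ^ k) - 1‖ < 1 / 10 := by
      have := hE0.norm
      rw [norm_zero] at this
      exact this.eventually (gt_mem_nhds (by norm_num))
    filter_upwards [h1, h2, h3, h4, eventually_nhdsWithin_iff.1 h5] with z a1 a2 a3 a4 a5
    exact ⟨a1, a2, a3, fun hz => ⟨a4 hz, a5 hz⟩⟩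
  obtain ⟨ρ, hρ, hball⟩ := Metric.eventually_nhds_iff.1 hall
  simp only [dist_zero_right] at hball
  -- In the coordinate `w = 1 / (k z ^ k)`: `ζ` is `log z`, `Z` is `z`, `p` is the germ and `ψ`
  -- is an approximate Fatou coordinate, with a defect of order `|w| ^ (-1 - 1 / k)`.
  let ζ : ℂ → ℂ := fun w => -log (k * w) / k
  let Z : ℂ → ℂ := fun w => exp (ζ w)
  let p : ℂ → ℂ := fun w => w * exp (-(k * γ (Z w)))
  let ψ : ℂ → ℂ := fun w => w + β * ζ w
  set R : ℝ := 4 / (k * ρ ^ k) with hR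
  have hRpos : 0 < R := by positivity
  have hslit : ∀ w ∈ wedgeDomain R, (k : ℂ) * w ∈ slitPlane := by
    intro w hw
    have hw' : R < w.re + |w.im| := hw
    rw [mem_slitPlane_iff]
    simp only [mul_re, natCast_re, natCast_im, zero_mul, sub_zero, mul_im, add_zero]
    by_cases h : w.im = 0
    · rw [h, abs_zero, add_zero] at hw'
      left
      have : 0 < w.re := by linarith
      positivity
    · right
      exact mul_ne_zero (by positivity) h
  have hw0 : ∀ w ∈ wedgeDomain R, w ≠ 0 := by
    intro w hw h
    have h1 := hslit w hw
    simp [h] at h1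
  have hZk : ∀ w ∈ wedgeDomain R, Z w ^ k = 1 / (k * w) := by
    intro w hw
    have h1 : (k : ℂ) * w ≠ 0 := mul_ne_zero hk0 (hw0 w hw)
    simp only [Z, ζ]
    rw [← exp_nat_mul, mul_div_cancel₀ _ hk0, exp_neg, exp_log h1, one_div]
  have hZn : ∀ w ∈ wedgeDomain R, ‖Z w‖ < ρ := by
    intro w hw
    have h1 := norm_lower_of_mem_wedgeDomain hw
    have h2 := congrArg norm (hZk w hw)
    rw [norm_pow, norm_div, norm_one, norm_mul, Complex.norm_natCast] at h2
    refine lt_of_pow_lt_pow_left₀ k hρ.le ?_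
    have hwpos : 0 < ‖w‖ := by linarith
    rw [h2, div_lt_iff₀ (by positivity)]
    have h3 : R / 2 = 2 / (k * ρ ^ k) := by rw [hR]; ring
    rw [h3, div_lt_iff₀ (by positivity)] at h1
    nlinarith
  have hZ0 : ∀ w, Z w ≠ 0 := fun w => exp_ne_zero _
  have hwk : ∀ w ∈ wedgeDomain R, w = 1 / (k * Z w ^ k) := by
    intro w hw
    rw [hZk w hw]
    have := hw0 w hw
    field_simp
  have hζd : DifferentiableOn ℂ ζ (wedgeDomain R) := by
    intro w hw
    refine DifferentiableAt.differentiableWithinAt ?_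
    have : DifferentiableAt ℂ (fun w : ℂ => (k : ℂ) * w) w := by fun_prop
    exact ((this.clog (hslit w hw)).neg).div_const _
  have hpd : DifferentiableOn ℂ p (wedgeDomain R) := by
    intro w hw
    have h1 : DifferentiableWithinAt ℂ (fun w => γ (Z w)) (wedgeDomain R) w :=
      ((hball (hZn w hw)).1).comp_differentiableWithinAt w (hζd w hw).cexp
    exact differentiableWithinAt_id.mul ((h1.const_mul _).neg).cexp
  have hψd : DifferentiableOn ℂ ψ (wedgeDomain R) := differentiableOn_id.add (hζd.const_mul _)
  have hpw : ∀ w ∈ wedgeDomain R, p w - w = (exp (-(k * γ (Z w))) - 1) / (k * Z w ^ k) := by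
    intro w hw
    have h1 := hwk w hw
    have h2 : p w - w = w * (exp (-(k * γ (Z w))) - 1) := by simp only [p]; ring
    rw [h2, div_eq_mul_one_div, ← h1, mul_comm]
  have hp1 : ∀ w ∈ wedgeDomain R, ‖p w - w - 1‖ ≤ 1 / 10 := by
    intro w hw
    rw [hpw w hw]
    exact ((hball (hZn w hw)).2.2.2 (hZ0 w)).2.le
  have hargR : ∀ w ∈ wedgeDomain R, |arg ((k : ℂ) * w)| < 3 * Real.pi / 4 := by
    intro w hw
    have : arg ((k : ℂ) * w) = arg w := by
      have := arg_real_mul w (by positivity : (0 : ℝ) < k)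
      simpa using this
    rw [this]
    exact arg_bound_of_mem_wedgeDomain (wedgeDomain_anti hRpos.le hw)
  have hζp : ∀ w ∈ wedgeDomain R, ζ (p w) = ζ w + γ (Z w) := by
    intro w hw
    have hkw : (k : ℂ) * w ≠ 0 := mul_ne_zero hk0 (hw0 w hw)
    have h1 : (k : ℂ) * p w = exp (log (k * w) - k * γ (Z w)) := by
      rw [sub_eq_add_neg, exp_add, exp_log hkw]; simp only [p]; ring
    have h2 : |((k : ℂ) * γ (Z w)).im| ≤ 1 / 2 := by
      refine (abs_im_le_norm _).trans ?_
      rw [norm_mul, Complex.norm_natCast]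
      have := (hball (hZn w hw)).2.1
      rw [lt_div_iff₀ (by positivity)] at this
      linarith
    have h3 := abs_lt.1 (hargR w hw)
    have h4 := abs_le.1 h2
    have h5 : log ((k : ℂ) * p w) = log (k * w) - k * γ (Z w) := by
      rw [h1, log_exp]
      · rw [sub_im, log_im]; linarith
      · rw [sub_im, log_im]; linarith
    simp only [ζ] at h5 ⊢
    rw [h5]
    field_simp
    ring
  have hdef : ∀ w ∈ wedgeDomain R,
      ‖ψ (p w) - ψ w - 1‖ ≤ (C * (k : ℝ) ^ (-(1 + 1 / k : ℝ))) * ‖w‖ ^ (-(1 + 1 / k : ℝ)) := by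
    intro w hw
    have h1 : ψ (p w) - ψ w - 1 =
        (exp (-(k * γ (Z w))) - 1) / (k * Z w ^ k) + β * γ (Z w) - 1 := by
      rw [← hpw w hw]
      simp only [ψ, hζp w hw]
      ring
    rw [h1]
    refine ((hball (hZn w hw)).2.2.2 (hZ0 w)).1.trans (le_of_eq ?_)
    rw [mul_assoc, ← Real.mul_rpow (by positivity) (norm_nonneg _)]
    congr 1
    have hpos : 0 < (k : ℝ) * ‖w‖ := mul_pos (by positivity) (norm_pos_iff.2 (hw0 w hw))
    have h2 : ‖Z w‖ = ((k : ℝ) * ‖w‖) ^ (-(1 / k : ℝ)) := by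
      simp only [Z, ζ]
      rw [norm_exp, Real.rpow_def_of_pos hpos]
      congr 1
      have : (-log ((k : ℂ) * w) / k).re = -Real.log ((k : ℝ) * ‖w‖) / k := by
        rw [div_natCast_re, neg_re, log_re, norm_mul, Complex.norm_natCast]
      rw [this]; ring
    rw [norm_pow, h2, ← Real.rpow_natCast, ← Real.rpow_mul hpos.le]
    congr 1
    push_cast
    field_simp
  have hs1 : (1 : ℝ) < 1 + 1 / k := by
    have : (0 : ℝ) < 1 / k := by positivity
    linarith
  obtain ⟨φ, hφd, hφp, hφlim⟩ := exists_abel_solution hRpos hs1 hpd hψd hp1 hdef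
  -- In the logarithmic coordinate the germ is `ζ ↦ ζ + γ (exp ζ)`, a small perturbation of the
  -- identity.
  have hpinj : Set.InjOn p (wedgeDomain R) := by
    intro w hw v hv hwv
    have h1 : ζ w + γ (Z w) = ζ v + γ (Z v) := by rw [← hζp w hw, ← hζp v hv, hwv]
    let Hs : Set ℂ := {x | x.re < Real.log ρ}
    have hHs : Convex ℝ Hs := convex_halfSpace_re_lt _
    have hin : ∀ x ∈ Hs, ‖exp x‖ < ρ := by
      intro x hx
      rw [norm_exp]
      exact (Real.lt_log_iff_exp_lt hρ).1 hx
    have hmem : ∀ w ∈ wedgeDomain R, ζ w ∈ Hs := by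
      intro w hw
      have := hZn w hw
      simp only [Z] at this
      rw [norm_exp] at this
      exact (Real.lt_log_iff_exp_lt hρ).2 this
    have hda : ∀ x ∈ Hs, HasDerivAt (fun x => γ (exp x)) (deriv γ (exp x) * exp x) x := by
      intro x hx
      exact (hball (hin x hx)).1.hasDerivAt.comp x (hasDerivAt_exp x)
    have h2 := hHs.norm_image_sub_le_of_norm_hasDerivWithin_le
      (fun x hx => (hda x hx).hasDerivWithinAt)
      (fun x hx => (hball (hin x hx)).2.2.1.le) (hmem w hw) (hmem v hv)
    have h3 : γ (exp (ζ v)) - γ (exp (ζ w)) = ζ w - ζ v := by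
      have : γ (exp (ζ w)) = ζ v + γ (exp (ζ v)) - ζ w := by
        rw [eq_sub_iff_add_eq, add_comm]; exact h1
      rw [this]; ring
    rw [h3, norm_sub_rev] at h2
    have h4 : ‖ζ v - ζ w‖ = 0 := by linarith [norm_nonneg (ζ v - ζ w)]
    have h5 : ζ w = ζ v := (sub_eq_zero.1 (norm_eq_zero.1 h4)).symm
    rw [hwk w hw, hwk v hv]
    simp only [Z, h5]
  -- `φ - w` is at most logarithmic.
  have hlin : ∃ R₁, ∀ w ∈ wedgeDomain R₁, ‖φ w - w‖ ≤ 1 / 10 * ‖w‖ := by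
    obtain ⟨R₁, hR₁⟩ := hφlim 1 one_pos
    have hlog : ∀ᶠ x : ℝ in atTop, 1 + ‖β‖ * ((Real.log x + Real.pi) / k) ≤ 1 / 10 * (x / k) := by
      have h1 : (fun x : ℝ => 1 + ‖β‖ * ((Real.log x + Real.pi) / k)) =o[atTop] fun x : ℝ => x := by
        have hc : ∀ c : ℝ, (fun _ : ℝ => c) =o[atTop] fun x : ℝ => x := fun c =>
          Asymptotics.isLittleO_const_id_atTop c
        have := (Real.isLittleO_log_id_atTop.add (hc Real.pi)).const_mul_left (‖β‖ / k)
        refine ((hc 1).add this).congr_left fun x => ?_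
        ring
      have h2 := h1.bound (show (0 : ℝ) < 1 / 10 / k by positivity)
      filter_upwards [h2, eventually_ge_atTop (0 : ℝ)] with x hx hx0
      have := (le_abs_self _).trans hx
      rw [Real.norm_of_nonneg hx0] at this
      refine this.trans (le_of_eq (by ring))
    obtain ⟨T, hT⟩ := eventually_atTop.1 hlog
    refine ⟨max (max R R₁) (2 * max T 1), fun w hw => ?_⟩
    have hwR : w ∈ wedgeDomain R :=
      wedgeDomain_anti ((le_max_left _ _).trans (le_max_left _ _)) hw
    have hwR₁ : w ∈ wedgeDomain R₁ :=
      wedgeDomain_anti ((le_max_right _ _).trans (le_max_left _ _)) hw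
    have hwT : max T 1 < ‖w‖ := by
      have := norm_lower_of_mem_wedgeDomain hw
      have h2 := le_max_right (max R R₁) (2 * max T 1)
      linarith
    have hT1 : max T 1 < k * ‖w‖ := by nlinarith [norm_nonneg w]
    have h1 := hT (k * ‖w‖) ((le_max_left _ _).trans hT1.le)
    have h2 : ‖ζ w‖ ≤ (Real.log (k * ‖w‖) + Real.pi) / k := by
      simp only [ζ]
      rw [norm_div, norm_neg, Complex.norm_natCast]
      gcongr
      refine (norm_le_abs_re_add_abs_im _).trans ?_
      rw [log_re, log_im, norm_mul, Complex.norm_natCast]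
      have h3 : 0 ≤ Real.log (k * ‖w‖) :=
        Real.log_nonneg ((le_max_right T 1).trans hT1.le)
      rw [abs_of_nonneg h3]
      gcongr
      exact abs_arg_le_pi _
    have h4 : φ w - w = (φ w - ψ w) + β * ζ w := by simp only [ψ]; ring
    rw [h4]
    refine (norm_add_le _ _).trans ?_
    rw [norm_mul]
    have h5 := hR₁ w hwR₁
    have h6 : ‖β‖ * ‖ζ w‖ ≤ ‖β‖ * ((Real.log (k * ‖w‖) + Real.pi) / k) := by gcongr
    have h7 : (k : ℝ) * ‖w‖ / k = ‖w‖ := by field_simp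
    rw [h7] at h1
    linarith
  have hφinj := abel_solution_injOn hRpos hp1 hpinj hφd hφp hlin
  -- passage to the variable `z`
  have hsec : ∀ (T r : ℝ), 0 < T → 0 < r → r ^ k ≤ 3 / (10 * k * T) →
      ∀ z ∈ sector 0 (petalOpening k) r, 1 / ((k : ℂ) * z ^ k) ∈ wedgeDomain T := by
    intro T r hT hr hrT z hz
    obtain ⟨x, hx1, hx2, rfl⟩ := (mem_sector_iff (petalOpening_le_pi hk)).1 hz
    rw [sub_zero, petalOpening, lt_div_iff₀ (by positivity)] at hx2
    have hx3 : |-(k * x.im)| < 2 * Real.pi / 3 := by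
      rw [abs_neg, abs_mul, abs_of_pos (by positivity : (0 : ℝ) < k)]; linarith
    have h1 := cos_add_abs_sin_lower hx3
    have h2 : 1 / ((k : ℂ) * exp x ^ k) = ((1 / k : ℝ) : ℂ) * exp (-(k * x)) := by
      rw [← exp_nat_mul, exp_neg]; push_cast; field_simp
    rw [h2]
    show T < _
    rw [re_ofReal_mul, im_ofReal_mul, exp_re, exp_im]
    have him : (-((k : ℂ) * x)).im = -(k * x.im) := by simp
    have hre : (-((k : ℂ) * x)).re = -(k * x.re) := by simp
    rw [him, hre, abs_mul, abs_mul, abs_of_pos (Real.exp_pos _),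
      abs_of_pos (by positivity : (0 : ℝ) < 1 / k)]
    have h3 : T * (10 * k) / 3 < Real.exp (-(k * x.re)) := by
      have h4 : Real.exp (k * x.re) < 3 / (10 * k * T) := by
        rw [Real.exp_nat_mul]
        exact (pow_lt_pow_left₀ hx1 (Real.exp_pos _).le hkne).trans_le hrT
      rw [Real.exp_neg, ← one_div, lt_one_div (by positivity) (Real.exp_pos _)]
      refine h4.trans_le (le_of_eq ?_)
      field_simp
    have h5 : T < 1 / k * (Real.exp (-(k * x.re)) * (3 / 10)) := by
      have h6 : T = 1 / k * (T * (10 * k) / 3 * (3 / 10)) := by field_simp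
      nth_rewrite 1 [h6]
      gcongr
    refine h5.trans_le ?_
    have := Real.exp_pos (-(k * x.re))
    rw [← mul_add, ← mul_add]
    gcongr
  have hζz : ∀ z ∈ sector 0 (petalOpening k) (1 : ℝ), ζ (1 / ((k : ℂ) * z ^ k)) = log z := by
    intro z hz
    obtain ⟨x, -, hx2, rfl⟩ := (mem_sector_iff (petalOpening_le_pi hk)).1 hz
    rw [sub_zero, petalOpening, lt_div_iff₀ (by positivity)] at hx2
    have hx3 : |(k : ℝ) * x.im| < 2 * Real.pi / 3 := by
      rw [abs_mul, abs_of_pos (by positivity : (0 : ℝ) < k)]; linarith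
    have hx4 : |x.im| < 2 * Real.pi / 3 := by nlinarith [abs_nonneg x.im]
    have h3 := abs_lt.1 hx3
    have h4 := abs_lt.1 hx4
    have h2 : (k : ℂ) * (1 / ((k : ℂ) * exp x ^ k)) = exp (-(k * x)) := by
      rw [← exp_nat_mul, exp_neg]; field_simp
    simp only [ζ]
    rw [h2, log_exp, log_exp]
    · field_simp
    · linarith
    · linarith
    · simp; linarith
    · simp; linarith
  have hr : ∀ T : ℝ, 0 < T → ∃ r : ℝ, 0 < r ∧ r ≤ 1 ∧ r ^ k ≤ 3 / (10 * k * T) := by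
    intro T hT
    have : Tendsto (fun r : ℝ => r ^ k) (𝓝 0) (𝓝 (0 ^ k)) := (continuous_pow k).tendsto 0
    rw [zero_pow hkne] at this
    have h1 := this.eventually (gt_mem_nhds (show 0 < 3 / (10 * k * T) by positivity))
    obtain ⟨δ, hδ, h2⟩ := Metric.eventually_nhds_iff.1 h1
    refine ⟨min (δ / 2) 1, by positivity, min_le_right _ _, (h2 ?_).le⟩
    rw [dist_zero_right, Real.norm_of_nonneg (by positivity)]
    exact (min_le_left _ _).trans_lt (by linarith)
  obtain ⟨r, hr0, hr1, hrR⟩ := hr R hRpos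
  have hinD := hsec R r hRpos hr0 hrR
  have hZz : ∀ z ∈ sector 0 (petalOpening k) r, Z (1 / ((k : ℂ) * z ^ k)) = z := by
    intro z hz
    simp only [Z]
    rw [hζz z (sector_mono le_rfl hr1 hz), exp_log (ne_zero_of_mem_sector hz)]
  refine ⟨r, fun z => φ (1 / ((k : ℂ) * z ^ k)), hr0, ?_, ?_, ?_, ?_⟩
  · refine hφd.comp (fun z hz => ?_) hinD
    have hz0 := ne_zero_of_mem_sector hz
    refine DifferentiableAt.differentiableWithinAt ?_
    refine (differentiableAt_const _).div (by fun_prop) ?_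
    exact mul_ne_zero hk0 (pow_ne_zero _ hz0)
  · intro z hz z' hz' h
    have h1 := hφinj (hinD z hz) (hinD z' hz') h
    rw [← hZz z hz, ← hZz z' hz', h1]
  · intro z hz
    have h1 := hφp _ (hinD z hz)
    beta_reduce
    rw [← h1]
    congr 1
    simp only [p]
    rw [hZz z hz, mul_pow, ← exp_nat_mul, exp_neg]
    have hz0 := ne_zero_of_mem_sector hz
    have := exp_ne_zero ((k : ℂ) * γ z)
    field_simp
  · rw [Metric.tendsto_nhds]
    intro ε hε
    obtain ⟨R₁, hR₁⟩ := hφlim (ε / 2) (half_pos hε)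
    obtain ⟨r', hr'0, hr'1, hr'R⟩ := hr (max R₁ 1) (by positivity)
    rw [eventually_nhdsWithin_iff]
    filter_upwards [Metric.ball_mem_nhds (0 : ℂ) hr'0] with z hz hzS
    rw [mem_ball_zero_iff] at hz
    have hzS' : z ∈ sector 0 (petalOpening k) r' := ⟨hzS.1, hz, hzS.2.2⟩
    have h1 := hR₁ _ (wedgeDomain_anti (le_max_left _ _)
      (hsec (max R₁ 1) r' (by positivity) hr'0 hr'R z hzS'))
    simp only [ψ] at h1
    rw [hζz z (sector_mono le_rfl hr1 hzS)] at h1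
    rw [dist_zero_right]
    linarith

/-! ### The exponents of a prenormalized germ and of its inverse -/

lemma pow_isBigO_pow {m n : ℕ} (h : n ≤ m) :
    (fun z : ℂ => z ^ m) =O[𝓝 0] fun z : ℂ => z ^ n := by
  obtain ⟨d, rfl⟩ := Nat.exists_eq_add_of_le h
  have h1 : (fun z : ℂ => z ^ d) =O[𝓝 0] fun _ : ℂ => (1 : ℂ) :=
    ((continuous_pow d).tendsto 0).isBigO_one ℂ
  have := (Asymptotics.isBigO_refl (fun z : ℂ => z ^ n) (𝓝 0)).mul h1
  simpa [pow_add] using this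

/-- An analytic germ which is `o(z^m)` is divisible by `z^(m+1)`. -/
lemma exists_eq_pow_mul_of_isLittleO {f : ℂ → ℂ} {m : ℕ} (hf : AnalyticAt ℂ f 0)
    (h : f =o[𝓝 0] fun z : ℂ => z ^ m) :
    ∃ g : ℂ → ℂ, AnalyticAt ℂ g 0 ∧ ∀ᶠ z in 𝓝 (0 : ℂ), f z = z ^ (m + 1) * g z := by
  have key : ((m + 1 : ℕ) : ℕ∞) ≤ analyticOrderAt f 0 := by
    by_contra hcon
    push Not at hcon
    obtain ⟨n, hn⟩ := ENat.ne_top_iff_exists.1 (ne_top_of_lt hcon)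
    rw [← hn] at hcon
    have hnm : n ≤ m := Nat.lt_succ_iff.1 (by exact_mod_cast hcon)
    obtain ⟨g, hg, hg0, hfg⟩ := (hf.analyticOrderAt_eq_natCast).1 hn.symm
    simp only [sub_zero, smul_eq_mul] at hfg
    have h1 : g =o[𝓝[≠] 0] fun _ : ℂ => (1 : ℂ) := by
      have h2 : f =o[𝓝[≠] 0] fun z : ℂ => z ^ n :=
        (h.trans_isBigO (pow_isBigO_pow hnm)).mono nhdsWithin_le_nhds
      have h3 := (Asymptotics.isBigO_refl (fun z : ℂ => (z ^ n)⁻¹) (𝓝[≠] 0)).mul_isLittleO h2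
      refine h3.congr' ?_ ?_
      · filter_upwards [hfg.filter_mono nhdsWithin_le_nhds, self_mem_nhdsWithin] with z hz hz0
        have : z ^ n ≠ 0 := pow_ne_zero _ hz0
        rw [hz]; field_simp
      · filter_upwards [self_mem_nhdsWithin] with z hz0
        have : z ^ n ≠ 0 := pow_ne_zero _ hz0
        field_simp
    rw [Asymptotics.isLittleO_one_iff] at h1
    have h2 : Tendsto g (𝓝[≠] 0) (𝓝 (g 0)) :=
      hg.continuousAt.tendsto.mono_left nhdsWithin_le_nhds
    exact hg0 (tendsto_nhds_unique h2 h1)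
  obtain ⟨g, hg, hfg⟩ := (natCast_le_analyticOrderAt hf).1 key
  exact ⟨g, hg, by simpa using hfg⟩

lemma IsPrenormalized.map_zero {k : ℕ} {b : ℂ} {G : ℂ → ℂ} (hk : 1 ≤ k)
    (hG : IsPrenormalized k b G) : G 0 = 0 := by
  have h1 := (hG.2.bound one_pos).self_of_nhds
  simpa [show k ≠ 0 by omega, show 2 * k + 1 ≠ 0 by omega] using h1

/-- A prenormalized germ is `z ↦ z exp (γ z)`, where `γ` satisfies to the order `k` the
condition `-(e^{-kγ} - 1)/(k z^k) + b γ = 1`, which characterizes the time-one map of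
`z^{k+1}/(1 + b z^k)`. -/
theorem exists_exponent {k : ℕ} (hk : 1 ≤ k) {b : ℂ} {G : ℂ → ℂ} (hG : IsPrenormalized k b G) :
    ∃ γ : ℂ → ℂ, AnalyticAt ℂ γ 0 ∧ γ 0 = 0 ∧ (∀ᶠ z in 𝓝 (0 : ℂ), G z = z * exp (γ z)) ∧
      (fun z : ℂ => -((exp (-(k * γ z)) - 1) / (k * z ^ k)) + b * γ z - 1)
        =O[𝓝[≠] 0] fun z : ℂ => z ^ (k + 1) := by
  have hk0 : (k : ℂ) ≠ 0 := by exact_mod_cast (by omega : k ≠ 0)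
  set c : ℂ := ((k : ℂ) + 1) / 2 - b with hc
  have han : AnalyticAt ℂ (fun z : ℂ => G z - (z + z ^ (k + 1) + c * z ^ (2 * k + 1))) 0 :=
    hG.1.sub (by fun_prop)
  obtain ⟨R, hR, hGR⟩ := exists_eq_pow_mul_of_isLittleO han hG.2
  let u : ℂ → ℂ := fun z => z ^ k + c * z ^ (2 * k) + z ^ (2 * k + 1) * R z
  have hu : AnalyticAt ℂ u 0 := by
    have : AnalyticAt ℂ (fun z : ℂ => z ^ k + c * z ^ (2 * k)) 0 := by fun_prop
    exact this.add ((by fun_prop : AnalyticAt ℂ (fun z : ℂ => z ^ (2 * k + 1)) 0).mul hR)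
  have hu0 : u 0 = 0 := by simp [u, show k ≠ 0 by omega]
  let γ : ℂ → ℂ := fun z => log (1 + u z)
  have hγ : AnalyticAt ℂ γ 0 := (analyticAt_const.add hu).clog (by simp [hu0])
  have hγ0 : γ 0 = 0 := by simp [γ, hu0]
  have hut : Tendsto u (𝓝 0) (𝓝 0) := by simpa [hu0] using hu.continuousAt.tendsto
  have hγt : Tendsto γ (𝓝 0) (𝓝 0) := by simpa [hγ0] using hγ.continuousAt.tendsto
  have hexp : ∀ᶠ z in 𝓝 (0 : ℂ), exp (γ z) = 1 + u z := by
    have h1 : ∀ᶠ z in 𝓝 (0 : ℂ), 1 + u z ≠ 0 := by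
      have : Tendsto (fun z => 1 + u z) (𝓝 0) (𝓝 (1 + 0)) := hut.const_add 1
      exact this.eventually_ne (by simp)
    filter_upwards [h1] with z hz
    exact exp_log hz
  refine ⟨γ, hγ, hγ0, ?_, ?_⟩
  · filter_upwards [hexp, hGR] with z h1 h2
    rw [h1]
    rw [sub_eq_iff_eq_add] at h2
    rw [h2]
    simp only [u]
    ring
  -- Expansions modulo `z ^ (2 * k + 1)`, with `G z = z * (1 + u z)` and `γ = log (1 + u)`.
  have hR1 : R =O[𝓝 0] fun _ : ℂ => (1 : ℂ) := hR.continuousAt.tendsto.isBigO_one ℂ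
  have hzR : (fun z : ℂ => z ^ (2 * k + 1) * R z) =O[𝓝 0] fun z : ℂ => z ^ (2 * k + 1) := by
    simpa using (Asymptotics.isBigO_refl (fun z : ℂ => z ^ (2 * k + 1)) (𝓝 0)).mul hR1
  have huk : (fun z => u z - z ^ k) =O[𝓝 0] fun z : ℂ => z ^ (2 * k) := by
    have := ((Asymptotics.isBigO_refl (fun z : ℂ => z ^ (2 * k)) (𝓝 0)).const_mul_left c).add
      (hzR.trans (pow_isBigO_pow (by omega)))
    exact this.congr_left fun z => by simp only [u]; ring
  have hexpand : ∀ (v : ℂ → ℂ), Tendsto v (𝓝 0) (𝓝 0) → v =O[𝓝 0] (fun z : ℂ => z ^ k) →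
      (fun z => exp (v z) - 1 - v z - v z ^ 2 / 2) =O[𝓝 0] fun z : ℂ => z ^ (2 * k + 1) := by
    intro v hv hvk
    have h1 := (exp_sub_sum_range_isBigO_pow 3).comp_tendsto hv
    have h2 : (fun z => v z ^ 3) =O[𝓝 0] fun z : ℂ => z ^ (2 * k + 1) := by
      refine (hvk.pow 3).trans ?_
      simp only [← pow_mul]
      exact pow_isBigO_pow (by omega)
    refine (h1.trans h2).congr_left fun z => ?_
    simp [Finset.sum_range_succ]
    ring
  have hγu : γ =O[𝓝 0] fun z : ℂ => z ^ k := by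
    have h1 : (fun x : ℂ => log (1 + x)) =O[𝓝 0] fun x : ℂ => x := by
      have hd : HasDerivAt (fun x : ℂ => log (1 + x)) (1 / (1 + 0)) 0 :=
        ((hasDerivAt_id (0 : ℂ)).const_add 1).clog (by simp)
      simpa using hd.isBigO_sub
    have h2 : u =O[𝓝 0] fun z : ℂ => z ^ k := by
      have := (huk.trans (pow_isBigO_pow (by omega : k ≤ 2 * k))).add
        (Asymptotics.isBigO_refl (fun z : ℂ => z ^ k) (𝓝 0))
      exact this.congr_left fun z => by ring
    exact (h1.comp_tendsto hut).trans h2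
  have hE := hexpand γ hγt hγu
  have hγ2 : (fun z => γ z ^ 2) =O[𝓝 0] fun z : ℂ => z ^ (2 * k) := by
    refine (hγu.pow 2).congr_right fun z => ?_
    rw [← pow_mul, mul_comm]
  have hδ : (fun z => γ z - z ^ k) =O[𝓝 0] fun z : ℂ => z ^ (2 * k) := by
    have h1 := (huk.sub (hγ2.const_mul_left (1 / 2))).sub (hE.trans (pow_isBigO_pow (by omega)))
    refine h1.congr' ?_ EventuallyEq.rfl
    filter_upwards [hexp] with z hz
    rw [hz]; ring
  have h3k : (fun z : ℂ => z ^ k * z ^ (2 * k)) =O[𝓝 0] fun z : ℂ => z ^ (2 * k + 1) := by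
    simp only [← pow_add]
    exact pow_isBigO_pow (by omega)
  have hzδ : (fun z => z ^ k * (γ z - z ^ k)) =O[𝓝 0] fun z : ℂ => z ^ (2 * k + 1) :=
    ((Asymptotics.isBigO_refl (fun z : ℂ => z ^ k) (𝓝 0)).mul hδ).trans h3k
  have hγδ : (fun z => γ z * (γ z - z ^ k)) =O[𝓝 0] fun z : ℂ => z ^ (2 * k + 1) :=
    (hγu.mul hδ).trans h3k
  have hE1 : (fun z => γ z - z ^ k - (c - 1 / 2) * z ^ (2 * k)) =O[𝓝 0]
      fun z : ℂ => z ^ (2 * k + 1) := by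
    have h1 := ((hzR.sub (hzδ.const_mul_left (1 / 2))).sub (hγδ.const_mul_left (1 / 2))).sub hE
    refine h1.congr' ?_ EventuallyEq.rfl
    filter_upwards [hexp] with z hz
    rw [hz]; simp only [u]; ring
  have hE2 := hexpand (fun z => -(k * γ z)) (by simpa using (hγt.const_mul (k : ℂ)).neg)
    ((hγu.const_mul_left (k : ℂ)).neg_left)
  have hnum : (fun z => -(exp (-(k * γ z)) - 1) + k * b * z ^ k * γ z - k * z ^ k) =O[𝓝 0]
      fun z : ℂ => z ^ (2 * k + 1) := by
    have h1 := ((((hE1.const_mul_left (k : ℂ)).sub (hzδ.const_mul_left ((k : ℂ) ^ 2 / 2))).sub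
      (hγδ.const_mul_left ((k : ℂ) ^ 2 / 2))).add (hzδ.const_mul_left (k * b))).sub hE2
    refine h1.congr_left fun z => ?_
    rw [hc]; ring
  have hinv := (hnum.mono (nhdsWithin_le_nhds (s := {0}ᶜ))).mul
    (Asymptotics.isBigO_refl (fun z : ℂ => (z ^ k)⁻¹) (𝓝[≠] 0))
  refine (hinv.const_mul_left (1 / k : ℂ)).congr' ?_ ?_
  · filter_upwards [self_mem_nhdsWithin] with z hz
    have : z ^ k ≠ 0 := pow_ne_zero _ hz
    field_simp
  · filter_upwards [self_mem_nhdsWithin] with z hz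
    have : z ^ k ≠ 0 := pow_ne_zero _ hz
    rw [show 2 * k + 1 = k + 1 + k by ring, pow_add]
    field_simp

/-- The inverse of an analytic germ with nonzero derivative. -/
theorem exists_analytic_inverse {f : ℂ → ℂ} (hf : AnalyticAt ℂ f 0) (hf0 : f 0 = 0)
    (hf' : deriv f 0 ≠ 0) :
    ∃ g : ℂ → ℂ, AnalyticAt ℂ g 0 ∧ g 0 = 0 ∧ deriv g 0 = (deriv f 0)⁻¹ ∧
      (∀ᶠ z in 𝓝 (0 : ℂ), g (f z) = z) ∧ ∀ᶠ z in 𝓝 (0 : ℂ), f (g z) = z := by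
  have hs := hf.hasStrictDerivAt
  have h1 := hf.analyticAt_localInverse hf'
  have h2 := hs.to_localInverse hf'
  rw [hf0] at h1 h2
  have hl := (hs.hasStrictFDerivAt_equiv hf').eventually_left_inverse
  have hr := (hs.hasStrictFDerivAt_equiv hf').eventually_right_inverse
  rw [hf0] at hr
  refine ⟨hs.localInverse f _ 0 hf', h1, ?_, h2.hasDerivAt.deriv, hl, hr⟩
  have := hl.self_of_nhds
  rwa [hf0] at this

lemma deriv_eq_one_of_exponent {γ G : ℂ → ℂ} (hγ : AnalyticAt ℂ γ 0) (hγ0 : γ 0 = 0)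
    (hG : ∀ᶠ z in 𝓝 (0 : ℂ), G z = z * exp (γ z)) : HasDerivAt G 1 0 := by
  have h1 : HasDerivAt (fun z => z * exp (γ z)) 1 0 := by
    have := (hasDerivAt_id' (0 : ℂ)).fun_mul hγ.differentiableAt.hasDerivAt.cexp
    simpa [hγ0] using this
  exact h1.congr_of_eventuallyEq hG

/-- The exponent of the inverse germ satisfies the same condition with reversed time. -/
theorem exists_exponent_inverse {k : ℕ} {b : ℂ} {G γ : ℂ → ℂ}
    (hGan : AnalyticAt ℂ G 0)
    (hγ : AnalyticAt ℂ γ 0) (hγ0 : γ 0 = 0) (hGγ : ∀ᶠ z in 𝓝 (0 : ℂ), G z = z * exp (γ z))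
    (he : (fun z : ℂ => -((exp (-(k * γ z)) - 1) / (k * z ^ k)) + b * γ z - 1)
        =O[𝓝[≠] 0] fun z : ℂ => z ^ (k + 1)) :
    ∃ γ' : ℂ → ℂ, AnalyticAt ℂ γ' 0 ∧ γ' 0 = 0 ∧
      (∀ᶠ z in 𝓝 (0 : ℂ), G z * exp (γ' (G z)) = z) ∧
      (fun z : ℂ => (exp (-(k * γ' z)) - 1) / (k * z ^ k) + -b * γ' z - 1)
        =O[𝓝[≠] 0] fun z : ℂ => z ^ (k + 1) := by
  have hd := deriv_eq_one_of_exponent hγ hγ0 hGγ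
  have hG0 : G 0 = 0 := by simpa using hGγ.self_of_nhds
  obtain ⟨F, hF, hF0, hF', hFG, hGF⟩ := exists_analytic_inverse hGan hG0
    (by rw [hd.deriv]; exact one_ne_zero)
  have hFt : Tendsto F (𝓝 0) (𝓝 0) := by simpa [hF0] using hF.continuousAt.tendsto
  have hFt' : Tendsto F (𝓝[≠] 0) (𝓝[≠] 0) := by
    refine tendsto_nhdsWithin_iff.2 ⟨hFt.mono_left nhdsWithin_le_nhds, ?_⟩
    filter_upwards [hGF.filter_mono nhdsWithin_le_nhds, self_mem_nhdsWithin] with z hz hz0 h0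
    rw [Set.mem_singleton_iff] at h0
    rw [h0, hG0] at hz
    exact hz0 hz.symm
  -- The inverse `F` of `G` is `z ↦ z * exp (-γ (F z))`.
  refine ⟨fun z => -γ (F z), (hγ.comp_of_eq hF hF0).neg, by simp [hF0, hγ0], ?_, ?_⟩
  · filter_upwards [hFG, hGγ] with z h1 h2
    rw [h1, h2, mul_assoc, ← exp_add]
    simp
  · have h1 := he.comp_tendsto hFt'
    have h2 : (fun z => F z ^ (k + 1)) =O[𝓝[≠] 0] fun z : ℂ => z ^ (k + 1) := by
      have h3 : F =O[𝓝 0] fun z : ℂ => z := by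
        simpa [hF0] using hF.differentiableAt.isBigO_sub
      exact (h3.mono nhdsWithin_le_nhds).pow _
    refine (h1.trans h2).congr' ?_ EventuallyEq.rfl
    filter_upwards [hGF.filter_mono nhdsWithin_le_nhds, hFt'.eventually self_mem_nhdsWithin,
      (hFt.eventually hGγ).filter_mono nhdsWithin_le_nhds] with z h4 h5 h6
    have h5' : F z ^ k ≠ 0 := pow_ne_zero _ h5
    have h7 : z ^ k = F z ^ k * exp (k * γ (F z)) := by
      rw [exp_nat_mul, ← mul_pow, ← h6, h4]
    simp only [Function.comp]
    rw [h7, mul_neg, neg_neg, exp_neg]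
    have h8 := exp_ne_zero ((k : ℂ) * γ (F z))
    by_cases hk : (k : ℂ) = 0
    · simp [hk]
    field_simp
    ring

/-! ### Fatou coordinates in all petals -/

lemma mem_sector_rotate {θ α r : ℝ} {z : ℂ} :
    z ∈ sector θ α r ↔ z * exp (-(θ * I)) ∈ sector 0 α r := by
  have : ‖exp (-((θ : ℂ) * I))‖ = 1 := by rw [norm_exp]; simp
  simp [sector, this]

/-- The principal part `-1/(k z^k) + b log (z e^{-iθ})` of the Fatou coordinates on the ray of
argument `θ`, with the branch of the logarithm which is real on this ray. -/
def timeCoordinate (k : ℕ) (b : ℂ) (θ : ℝ) (z : ℂ) : ℂ :=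
  -1 / (k * z ^ k) + b * log (z * exp (-(θ * I)))

/-- A prenormalized germ has Fatou coordinates on all petals, asymptotic to the time coordinate
of the vector field `z^{k+1}/(1 + b z^k)`. -/
theorem exists_fatou_family {k : ℕ} (hk : 1 ≤ k) {b : ℂ} {G : ℂ → ℂ}
    (hG : IsPrenormalized k b G) :
    ∃ (r : ℝ) (φ : ZMod (2 * k) → ℂ → ℂ), 0 < r ∧
      (∀ j, IsFatouCoordinate G (sector (j.val * Real.pi / k) (petalOpening k) r) (φ j)) ∧
      ∀ j, Tendsto (fun z => φ j z - timeCoordinate k b (j.val * Real.pi / k) z)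
        (𝓝[sector (j.val * Real.pi / k) (petalOpening k) r] 0) (𝓝 0) := by
  have : NeZero (2 * k) := ⟨by omega⟩
  have hk0 : (k : ℂ) ≠ 0 := by exact_mod_cast (by omega : k ≠ 0)
  suffices h : ∀ j : ZMod (2 * k), ∃ (r : ℝ) (φ : ℂ → ℂ), 0 < r ∧
      IsFatouCoordinate G (sector (j.val * Real.pi / k) (petalOpening k) r) φ ∧
      Tendsto (fun z => φ z - timeCoordinate k b (j.val * Real.pi / k) z)
        (𝓝[sector (j.val * Real.pi / k) (petalOpening k) r] 0) (𝓝 0) by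
    choose r φ hr h1 h2 using h
    obtain ⟨j₀, hj₀⟩ := Finite.exists_min r
    refine ⟨r j₀, φ, hr j₀, fun j => ?_, fun j => ?_⟩
    · have hsub := sector_mono (θ := j.val * Real.pi / k) (le_refl (petalOpening k)) (hj₀ j)
      exact ⟨(h1 j).1.mono hsub, (h1 j).2.1.mono hsub,
        fun z hz hz' => (h1 j).2.2 z (hsub hz) (hsub hz')⟩
    · exact (h2 j).mono_left (nhdsWithin_mono _ (sector_mono le_rfl (hj₀ j)))
  intro j
  set θ : ℝ := j.val * Real.pi / k with hθ
  -- Rotation by `ρ` carries the positive axis to the ray `j`, and `ρ ^ k` is `1` or `-1`.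
  set ρ : ℂ := exp (θ * I) with hρ
  have hρ0 : ρ ≠ 0 := exp_ne_zero _
  have hρi : exp (-(θ * I)) = ρ⁻¹ := exp_neg _
  have hρk : ρ ^ k = (-1) ^ j.val := by
    rw [hρ, ← exp_nat_mul, ← exp_pi_mul_I, ← exp_nat_mul, hθ]
    congr 1
    push_cast
    field_simp
  obtain ⟨γ, hγ, hγ0, hGγ, he⟩ := exists_exponent hk hG
  have hrot : Tendsto (fun z : ℂ => ρ * z) (𝓝 0) (𝓝 0) := by
    simpa using (continuous_const_mul ρ).tendsto 0
  have hrot' : Tendsto (fun z : ℂ => ρ * z) (𝓝[≠] 0) (𝓝[≠] 0) := by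
    refine tendsto_nhdsWithin_iff.2 ⟨hrot.mono_left nhdsWithin_le_nhds, ?_⟩
    filter_upwards [self_mem_nhdsWithin] with z hz
    exact mul_ne_zero hρ0 hz
  have hrotO : (fun z : ℂ => (ρ * z) ^ (k + 1)) =O[𝓝[≠] 0] fun z : ℂ => z ^ (k + 1) := by
    simp only [mul_pow]
    exact (Asymptotics.isBigO_refl _ _).const_mul_left _
  have hrotA : ∀ {f : ℂ → ℂ}, AnalyticAt ℂ f 0 → AnalyticAt ℂ (fun z => f (ρ * z)) 0 := by
    intro f hf
    exact hf.comp_of_eq (by fun_prop) (by simp)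
  have hback : ∀ {r : ℝ} {z : ℂ}, z ∈ sector θ (petalOpening k) r →
      z * ρ⁻¹ ∈ sector 0 (petalOpening k) r := by
    intro r z hz
    rw [← hρi]
    exact mem_sector_rotate.1 hz
  have hinj : ∀ {r : ℝ} {φ : ℂ → ℂ}, Set.InjOn φ (sector 0 (petalOpening k) r) →
      Set.InjOn (fun z => φ (z * ρ⁻¹)) (sector θ (petalOpening k) r) := by
    intro r φ hφ z hz z' hz' h
    exact mul_right_cancel₀ (inv_ne_zero hρ0) (hφ (hback hz) (hback hz') h)
  have hdiff : ∀ {r : ℝ} {φ : ℂ → ℂ}, DifferentiableOn ℂ φ (sector 0 (petalOpening k) r) →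
      DifferentiableOn ℂ (fun z => φ (z * ρ⁻¹)) (sector θ (petalOpening k) r) := by
    intro r φ hφ
    exact hφ.comp (by fun_prop) fun z hz => hback hz
  have hlim : ∀ r : ℝ, Tendsto (fun z : ℂ => z * ρ⁻¹) (𝓝[sector θ (petalOpening k) r] 0)
      (𝓝[sector 0 (petalOpening k) r] 0) := by
    intro r
    refine tendsto_nhdsWithin_iff.2 ⟨?_, ?_⟩
    · have : Tendsto (fun z : ℂ => z * ρ⁻¹) (𝓝 0) (𝓝 (0 * ρ⁻¹)) :=
        (continuous_mul_const _).tendsto 0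
      rw [zero_mul] at this
      exact this.mono_left nhdsWithin_le_nhds
    · filter_upwards [self_mem_nhdsWithin] with z hz using hback hz
  rcases Nat.even_or_odd j.val with hj | hj
  · -- repelling petals: attracting for the inverse germ
    rw [hj.neg_one_pow] at hρk
    obtain ⟨γ', hγ', hγ'0, hGγ', he'⟩ := exists_exponent_inverse hG.1 hγ hγ0 hGγ he
    have he2 := ((he'.comp_tendsto hrot').trans hrotO).congr_left (f₂ := fun z : ℂ =>
      (exp (-(k * γ' (ρ * z))) - 1) / (k * z ^ k) + -b * γ' (ρ * z) - 1) (fun z => by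
        simp only [Function.comp, mul_pow, hρk, one_mul])
    obtain ⟨r, φ, hr, h1, h2, h3, h4⟩ := exists_fatou_of_exponent hk (hrotA hγ')
      (by simpa using hγ'0) he2
    obtain ⟨δ, hδ, hδG⟩ := Metric.eventually_nhds_iff.1 hGγ'
    have hsub : sector θ (petalOpening k) (min r δ) ⊆ sector θ (petalOpening k) r :=
      sector_mono le_rfl (min_le_left _ _)
    refine ⟨min r δ, fun z => -φ (z * ρ⁻¹), lt_min hr hδ,
      ⟨((hdiff h1).mono hsub).neg, ?_, ?_⟩, ?_⟩
    · intro z hz z' hz' h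
      exact hinj h2 (hsub hz) (hsub hz') (neg_injective h)
    · intro z hz hGz
      have h5 := h3 _ (hback (hsub hGz))
      have h6 : ρ * (G z * ρ⁻¹) = G z := by field_simp
      have h7 : G z * ρ⁻¹ * exp (γ' (G z)) = z * ρ⁻¹ := by
        have := hδG (y := z) (by rw [dist_zero_right]; exact hz.2.1.trans_le (min_le_right _ _))
        linear_combination ρ⁻¹ * this
      rw [h6, h7] at h5
      beta_reduce
      rw [h5]; ring
    · have h5 := (h4.comp (hlim r)).neg
      rw [neg_zero] at h5
      refine (h5.mono_left (nhdsWithin_mono _ hsub)).congr fun z => ?_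
      simp only [Function.comp, timeCoordinate, hρi, mul_pow, inv_pow, hρk]
      ring
  -- Attracting petals: orbits of `G` converge to the origin, and no inversion is needed.
  · rw [hj.neg_one_pow] at hρk
    have he2 := ((he.comp_tendsto hrot').trans hrotO).congr_left (f₂ := fun z : ℂ =>
      (exp (-(k * γ (ρ * z))) - 1) / (k * z ^ k) + b * γ (ρ * z) - 1) (fun z => by
        simp only [Function.comp, mul_pow, hρk, neg_mul, one_mul, mul_neg, div_neg, neg_neg])
    obtain ⟨r, φ, hr, h1, h2, h3, h4⟩ := exists_fatou_of_exponent hk (hrotA hγ)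
      (by simpa using hγ0) he2
    obtain ⟨δ, hδ, hδG⟩ := Metric.eventually_nhds_iff.1 hGγ
    have hsub : sector θ (petalOpening k) (min r δ) ⊆ sector θ (petalOpening k) r :=
      sector_mono le_rfl (min_le_left _ _)
    refine ⟨min r δ, fun z => φ (z * ρ⁻¹), lt_min hr hδ,
      ⟨(hdiff h1).mono hsub, (hinj h2).mono hsub, ?_⟩, ?_⟩
    · intro z hz _
      have h5 := h3 _ (hback (hsub hz))
      have h6 : ρ * (z * ρ⁻¹) = z := by field_simp
      have h7 : z * ρ⁻¹ * exp (γ z) = G z * ρ⁻¹ := by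
        have := hδG (y := z) (by rw [dist_zero_right]; exact hz.2.1.trans_le (min_le_right _ _))
        rw [this]; ring
      rw [h6, h7] at h5
      exact h5
    · refine ((h4.comp (hlim r)).mono_left (nhdsWithin_mono _ hsub)).congr fun z => ?_
      simp only [Function.comp, timeCoordinate, hρi, mul_pow, inv_pow, hρk]
      have : ((k : ℂ) * (z ^ k * (-1)⁻¹)) = -(k * z ^ k) := by norm_num
      rw [this]
      ring

/-! ### Maps close to the identity on sectors -/

lemma isPreconnected_sector {θ α r : ℝ} (hα : α ≤ Real.pi) : IsPreconnected (sector θ α r) := by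
  by_cases hr : 0 < r
  · have h : sector θ α r = exp '' ({ζ | ζ.re < Real.log r} ∩ {ζ | ζ.im < θ + α} ∩
        {ζ | θ - α < ζ.im}) := by
      ext z
      rw [mem_sector_iff hα]
      constructor
      · rintro ⟨ζ, h1, h2, h3⟩
        have := abs_lt.1 h2
        exact ⟨ζ, ⟨⟨(Real.lt_log_iff_exp_lt hr).2 h1, show ζ.im < _ by linarith⟩,
          show _ < ζ.im by linarith⟩, h3⟩
      · rintro ⟨ζ, ⟨⟨h1, h2⟩, h4⟩, h3⟩
        have h2' : ζ.im < θ + α := h2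
        have h4' : θ - α < ζ.im := h4
        exact ⟨ζ, (Real.lt_log_iff_exp_lt hr).1 h1, abs_lt.2 ⟨by linarith, by linarith⟩, h3⟩
    rw [h]
    refine IsPreconnected.image ?_ _ continuous_exp.continuousOn
    exact (((convex_halfSpace_re_lt _).inter (convex_halfSpace_im_lt _)).inter
      (convex_halfSpace_im_gt _)).isPreconnected
  · have h : sector θ α r = ∅ := by
      ext z
      simp only [Set.mem_empty_iff_false, iff_false]
      intro hz
      exact hr (hz.1.trans hz.2.1)
    rw [h]
    exact isPreconnected_empty

lemma mul_exp_mem_sector {θ α r ε : ℝ} (hα : α + ε ≤ Real.pi) {z x : ℂ}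
    (hz : z ∈ sector θ α r) (hx : ‖x‖ ≤ ε) : z * exp x ∈ sector θ (α + ε) (r * Real.exp ε) := by
  have hε : 0 ≤ ε := (norm_nonneg x).trans hx
  obtain ⟨ζ, h1, h2, rfl⟩ := (mem_sector_iff (by linarith)).1 hz
  refine (mem_sector_iff hα).2 ⟨ζ + x, ?_, ?_, exp_add _ _⟩
  · rw [add_re, Real.exp_add]
    have h3 : x.re ≤ ε := (re_le_norm x).trans hx
    exact mul_lt_mul h1 (Real.exp_le_exp.2 h3) (Real.exp_pos _) (h1.le.trans' (Real.exp_pos _).le)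
  · rw [add_im]
    have h3 : |x.im| ≤ ε := (abs_im_le_norm x).trans hx
    calc |ζ.im + x.im - θ| = |(ζ.im - θ) + x.im| := by ring_nf
      _ ≤ |ζ.im - θ| + |x.im| := abs_add_le _ _
      _ < α + ε := by linarith

lemma exists_exp_eq_of_tendsto_one {ι : Type*} {l : Filter ι} {q : ι → ℂ}
    (hq : Tendsto q l (𝓝 1)) {ε : ℝ} (hε : 0 < ε) :
    ∀ᶠ i in l, ∃ x : ℂ, ‖x‖ < ε ∧ q i = exp x := by
  have h1 : Tendsto (fun i => log (q i)) l (𝓝 (log 1)) := hq.clog (by simp)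
  rw [log_one] at h1
  have h2 := h1.norm
  rw [norm_zero] at h2
  filter_upwards [h2.eventually (gt_mem_nhds hε), hq.eventually_ne one_ne_zero] with i h3 h4
  exact ⟨log (q i), h3, (exp_log h4).symm⟩

lemma tendsto_div_of_hasDerivAt {T : ℂ → ℂ} {a : ℂ} (hT : HasDerivAt T a 0) (hT0 : T 0 = 0) :
    Tendsto (fun z => T z / z) (𝓝[≠] 0) (𝓝 a) := by
  have := hT.tendsto_slope_zero
  simpa [hT0, div_eq_inv_mul] using this

/-- A germ tangent to the identity is a multiplication by `exp x` with small `x`. -/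
lemma exists_exp_of_hasDerivAt_one {T : ℂ → ℂ} (hT : HasDerivAt T 1 0) (hT0 : T 0 = 0) {ε : ℝ}
    (hε : 0 < ε) : ∃ r > 0, ∀ z : ℂ, z ≠ 0 → ‖z‖ < r → ∃ x, ‖x‖ < ε ∧ T z = z * exp x := by
  have h1 := exists_exp_eq_of_tendsto_one (tendsto_div_of_hasDerivAt hT hT0) hε
  rw [eventually_nhdsWithin_iff] at h1
  obtain ⟨r, hr, h2⟩ := Metric.eventually_nhds_iff.1 h1
  refine ⟨r, hr, fun z hz hzr => ?_⟩
  obtain ⟨x, hx, h3⟩ := h2 (by simpa using hzr) hz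
  refine ⟨x, hx, ?_⟩
  rw [← h3]; field_simp

/-- Local behaviour of a function asymptotic to `-1/(k z^k)` on a sector: on a smaller sector it
has no critical points, and around each point it covers a disc of comparable size. -/
theorem sector_local_control {k : ℕ} (hk : 1 ≤ k) {θ α r ε : ℝ} {φ : ℂ → ℂ} (hα : α ≤ Real.pi)
    (hr : 0 < r) (hφ : DifferentiableOn ℂ φ (sector θ α r))
    (hlim : Tendsto (fun z => φ z * z ^ k) (𝓝[sector θ α r] 0) (𝓝 (-1 / k)))
    (hε : 0 < ε) (hkε : k * ε ≤ 1 / 4) :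
    ∃ r' > 0, ∀ z₀ ∈ sector θ (α - 2 * ε) r', deriv φ z₀ ≠ 0 ∧
      ∀ W : ℂ, ‖W * z₀ ^ k + 1 / k‖ ≤ ε / 32 →
        ∃ x, ‖x‖ ≤ ε ∧ z₀ * exp x ∈ sector θ α r ∧ φ (z₀ * exp x) = W := by
  have hkR : (1 : ℝ) ≤ k := by exact_mod_cast hk
  have hk0 : (k : ℂ) ≠ 0 := by exact_mod_cast (by omega : k ≠ 0)
  have hε1 : ε ≤ 1 / 4 := by nlinarith
  have hη : 0 < ε / 32 := by positivity
  have h1 := (Metric.tendsto_nhds.1 hlim) (ε / 32) hη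
  rw [eventually_nhdsWithin_iff] at h1
  obtain ⟨δ, hδ, h2⟩ := Metric.eventually_nhds_iff.1 h1
  refine ⟨min δ r / 4, by positivity, fun z₀ hz₀ => ?_⟩
  have hz0 : z₀ ≠ 0 := ne_zero_of_mem_sector hz₀
  have hexp2 : Real.exp (2 * ε) ≤ 4 := by
    have h3 : Real.exp (2 * ε) ≤ Real.exp 1 := Real.exp_le_exp.2 (by linarith)
    have := Real.exp_one_lt_d9
    linarith
  have hin : ∀ x : ℂ, ‖x‖ ≤ 2 * ε → z₀ * exp x ∈ sector θ α (min δ r) := by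
    intro x hx
    have h3 := mul_exp_mem_sector (by linarith) hz₀ hx
    refine sector_mono (by linarith) ?_ h3
    have : 0 < min δ r := lt_min hδ hr
    nlinarith
  -- `f x` is close to `-exp (-k x) / k`.
  let f : ℂ → ℂ := fun x => φ (z₀ * exp x) * z₀ ^ k
  have hfd : DifferentiableOn ℂ f (Metric.ball 0 (2 * ε)) := by
    refine DifferentiableOn.mul_const ?_ _
    refine hφ.comp (by fun_prop) fun x hx => ?_
    rw [mem_ball_zero_iff] at hx
    exact sector_mono le_rfl (min_le_right _ _) (hin x hx.le)
  have hfa : ∀ x : ℂ, ‖x‖ ≤ 2 * ε → ‖f x + exp (-(k * x)) / k‖ ≤ ε / 16 := by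
    intro x hx
    have h3 := hin x hx
    have h4 := h2 (y := z₀ * exp x) (by
      rw [dist_zero_right]; exact h3.2.1.trans_le (min_le_left _ _))
      (sector_mono le_rfl (min_le_right _ _) h3)
    have h5 : f x + exp (-(k * x)) / k =
        (φ (z₀ * exp x) * (z₀ * exp x) ^ k - -1 / k) * exp (-(k * x)) := by
      have h6 : (exp x) ^ k * exp (-(k * x)) = 1 := by
        rw [← exp_nat_mul, ← exp_add]; simp
      simp only [f]
      rw [mul_pow]
      linear_combination (-φ (z₀ * exp x) * z₀ ^ k) * h6
    rw [h5, norm_mul]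
    rw [dist_eq_norm] at h4
    have h7 : ‖exp (-(k * x))‖ ≤ 2 := by
      rw [norm_exp]
      have h8 : (-((k : ℂ) * x)).re ≤ 1 / 2 := by
        refine (re_le_norm _).trans ?_
        rw [norm_neg, norm_mul, Complex.norm_natCast]
        nlinarith
      have h9 : Real.exp (-((k : ℂ) * x)).re ≤ Real.exp (1 / 2) := Real.exp_le_exp.2 h8
      have h10 : Real.exp (1 / 2) * Real.exp (1 / 2) = Real.exp 1 := by
        rw [← Real.exp_add]; norm_num
      have := Real.exp_one_lt_d9
      nlinarith [Real.exp_pos (1 / 2)]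
    nlinarith [norm_nonneg (φ (z₀ * exp x) * (z₀ * exp x) ^ k - -1 / k),
      norm_nonneg (exp (-((k : ℂ) * x)))]
  have hf0 : ‖f 0 + 1 / k‖ ≤ ε / 32 := by
    have h3 := hin 0 (by rw [norm_zero]; positivity)
    rw [exp_zero, mul_one] at h3
    have h4 := h2 (y := z₀) (by
      rw [dist_zero_right]; exact h3.2.1.trans_le (min_le_left _ _))
      (sector_mono le_rfl (min_le_right _ _) h3)
    rw [dist_eq_norm] at h4
    have : f 0 + 1 / k = φ z₀ * z₀ ^ k - -1 / k := by simp only [f, exp_zero, mul_one]; ring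
    rw [this]
    exact h4.le
  have hcl : Metric.closedBall (0 : ℂ) ε ⊆ Metric.ball 0 (2 * ε) :=
    Metric.closedBall_subset_ball (by linarith)
  have hdc : DiffContOnCl ℂ f (Metric.ball 0 ε) := by
    refine DifferentiableOn.diffContOnCl ?_
    rw [closure_ball _ hε.ne']
    exact hfd.mono hcl
  constructor
  · -- the derivative, by Cauchy's estimate
    have hd0 : DifferentiableAt ℂ φ z₀ := by
      have h3 := hin 0 (by rw [norm_zero]; positivity)
      rw [exp_zero, mul_one] at h3
      exact (hφ z₀ (sector_mono le_rfl (min_le_right _ _) h3)).differentiableAt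
        ((isOpen_sector hα).mem_nhds (sector_mono le_rfl (min_le_right _ _) h3))
    intro hd
    have hfder : HasDerivAt f 0 0 := by
      have h3 : HasDerivAt (fun x : ℂ => z₀ * exp x) z₀ 0 := by
        simpa using (hasDerivAt_exp (0 : ℂ)).const_mul z₀
      have h4 : HasDerivAt φ 0 (z₀ * exp 0) := by
        rw [exp_zero, mul_one, ← hd]; exact hd0.hasDerivAt
      simpa using (h4.comp 0 h3).mul_const (z₀ ^ k)
    have hgder : HasDerivAt (fun x : ℂ => f x + exp (-(k * x)) / k) (-1) 0 := by
      have h3 : HasDerivAt (fun x : ℂ => exp (-(k * x)) / k) (-1) 0 := by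
        have h4 : HasDerivAt (fun x : ℂ => -((k : ℂ) * x)) (-k) 0 := by
          simpa using ((hasDerivAt_id' (0 : ℂ)).const_mul (k : ℂ)).fun_neg
        have h5 := h4.cexp.div_const (k : ℂ)
        simpa [hk0, neg_div] using h5
      simpa using hfder.fun_add h3
    have hdc' : DiffContOnCl ℂ (fun x : ℂ => f x + exp (-(k * x)) / k) (Metric.ball 0 ε) := by
      refine hdc.add (Differentiable.diffContOnCl (by fun_prop))
    have h6 := norm_deriv_le_of_forall_mem_sphere_norm_le (C := ε / 16) hε hdc' (fun x hx => by
      rw [mem_sphere_zero_iff_norm] at hx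
      exact hfa x (by linarith))
    rw [hgder.deriv, norm_neg, norm_one, le_div_iff₀ hε] at h6
    linarith
  · intro W hW
    have hsph : ∀ x ∈ Metric.sphere (0 : ℂ) ε, ε / 4 ≤ ‖f x - f 0‖ := by
      intro x hx
      rw [mem_sphere_zero_iff_norm] at hx
      have h3 := hfa x (by linarith)
      have h4 : ‖-((k : ℂ) * x)‖ = k * ε := by
        rw [norm_neg, norm_mul, Complex.norm_natCast, hx]
      have h5 : k * ε / 2 ≤ ‖exp (-((k : ℂ) * x)) - 1‖ := by
        have h6 := norm_exp_sub_one_sub_id_le (x := -((k : ℂ) * x)) (by rw [h4]; linarith)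
        rw [h4] at h6
        have h7 := norm_sub_norm_le (-((k : ℂ) * x)) (-((k : ℂ) * x) - (exp (-((k : ℂ) * x)) - 1))
        rw [sub_sub_cancel, h4, norm_sub_rev _ (exp (-((k : ℂ) * x)) - 1)] at h7
        have h8 : 0 ≤ k * ε := by positivity
        nlinarith [mul_le_mul_of_nonneg_left hkε h8]
      have h8 : ‖(exp (-((k : ℂ) * x)) - 1) / k‖ = ‖exp (-((k : ℂ) * x)) - 1‖ / k := by
        rw [norm_div, Complex.norm_natCast]
      have h9 : ε / 2 ≤ ‖(exp (-((k : ℂ) * x)) - 1) / k‖ := by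
        rw [h8, le_div_iff₀ (by positivity)]; linarith
      have h10 : (exp (-((k : ℂ) * x)) - 1) / k =
          (f x + exp (-((k : ℂ) * x)) / k) - (f 0 + 1 / k) - (f x - f 0) := by ring
      rw [h10] at h9
      have h11 := norm_sub_le ((f x + exp (-((k : ℂ) * x)) / k) - (f 0 + 1 / k)) (f x - f 0)
      have h12 := norm_sub_le (f x + exp (-((k : ℂ) * x)) / k) (f 0 + 1 / k)
      linarith
    have hnc : ∃ᶠ x in 𝓝 (0 : ℂ), f x ≠ f 0 := by
      intro hcon
      simp only [not_not] at hcon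
      have h3 : AnalyticOnNhd ℂ f (Metric.ball 0 (2 * ε)) := hfd.analyticOnNhd Metric.isOpen_ball
      have h4 := h3.eqOn_of_preconnected_of_eventuallyEq (g := fun _ => f 0)
        analyticOnNhd_const (convex_ball _ _).isPreconnected
        (Metric.mem_ball_self (by positivity)) hcon
      have h5 : (ε : ℂ) ∈ Metric.sphere (0 : ℂ) ε := by
        simp [abs_of_pos hε]
      have h6 := hsph _ h5
      rw [h4 (hcl (Metric.sphere_subset_closedBall h5)), sub_self, norm_zero] at h6
      linarith
    -- A lower bound for `‖f x - f 0‖` on the circle `‖x‖ = ε` gives a disc covered by `f`.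
    have hsub := hdc.ball_subset_image_closedBall hε hsph hnc
    have hmem : W * z₀ ^ k ∈ Metric.ball (f 0) (ε / 4 / 2) := by
      rw [mem_ball_iff_norm]
      have h3 : W * z₀ ^ k - f 0 = (W * z₀ ^ k + 1 / k) - (f 0 + 1 / k) := by ring
      rw [h3]
      have := norm_sub_le (W * z₀ ^ k + 1 / k) (f 0 + 1 / k)
      linarith
    obtain ⟨x, hx, hfx⟩ := hsub hmem
    rw [mem_closedBall_zero_iff] at hx
    refine ⟨x, hx, sector_mono le_rfl (min_le_right _ _) (hin x (by linarith)), ?_⟩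
    exact mul_right_cancel₀ (pow_ne_zero k hz0) hfx

/-! ### Injective maps commuting with the unit translation -/

/-- An injective entire function commuting with the unit translation is a translation. -/
theorem entire_injective_commute_translation {F : ℂ → ℂ} (hF : Differentiable ℂ F)
    (hinj : Function.Injective F) (h1 : ∀ W, F (W + 1) = F W + 1) : ∃ C, ∀ W, F W = W + C := by
  -- a base point which is not critical
  obtain ⟨p, hp⟩ : ∃ p, deriv F p ≠ 0 := by
    by_contra hcon
    push Not at hcon
    have := is_const_of_deriv_eq_zero hF hcon 0 1
    have h2 := h1 0
    rw [zero_add] at h2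
    rw [← this] at h2
    simp at h2
  let f : ℂ → ℂ := fun W => F (W + p) - F p
  have hfd : Differentiable ℂ f := by fun_prop
  have hf0 : f 0 = 0 := by simp [f]
  have hfinj : Function.Injective f := by
    intro a c hac
    have : F (a + p) = F (c + p) := by simpa [f] using hac
    exact add_right_cancel (hinj this)
  have hfm : ∀ m : ℕ, f m = m := by
    intro m
    induction m with
    | zero => simpa using hf0
    | succ m ih =>
      have : f ((m + 1 : ℕ) : ℂ) = f m + 1 := by
        simp only [f]
        rw [show (((m + 1 : ℕ) : ℂ) + p) = (m + p) + 1 by push_cast; ring, h1]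
        ring
      rw [this, ih]; push_cast; ring
  have hder : deriv f 0 ≠ 0 := by
    have : HasDerivAt f (deriv F p) 0 := by
      have h2 : HasDerivAt F (deriv F p) (0 + p) := by rw [zero_add]; exact (hF p).hasDerivAt
      exact (h2.comp_add_const 0 p).sub_const _
    rwa [this.deriv]
  have hdsl : ∀ g : ℂ → ℂ, Differentiable ℂ g → Differentiable ℂ (dslope g 0) := by
    intro g hg
    rw [← differentiableOn_univ]
    exact (differentiableOn_dslope Filter.univ_mem).2 hg.differentiableOn
  -- `f W / W` has no zeros, so `g W = W / f W` is entire; it has at most linear growth and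
  -- equals `1` at the positive integers.
  let q := dslope f 0
  have hqd : Differentiable ℂ q := hdsl f hfd
  have hq0 : ∀ W, q W ≠ 0 := by
    intro W
    by_cases hW : W = 0
    · subst hW; simpa [q] using hder
    · simp only [q]
      rw [dslope_of_ne _ hW, slope_def_field, hf0, sub_zero, sub_zero]
      refine div_ne_zero (fun h => hW (hfinj (h.trans hf0.symm))) hW
  have hqm : ∀ m : ℕ, m ≠ 0 → q m = 1 := by
    intro m hm
    have hm' : (m : ℂ) ≠ 0 := by exact_mod_cast hm
    simp only [q]
    rw [dslope_of_ne _ hm', slope_def_field, hf0, hfm]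
    simp [hm']
  let g : ℂ → ℂ := fun W => (q W)⁻¹
  have hgd : Differentiable ℂ g := fun W => (hqd W).inv (hq0 W)
  -- `f` omits a disc outside the unit disc, so `g` grows at most linearly
  obtain ⟨δ, hδ, hfδ⟩ : ∃ δ > 0, ∀ W : ℂ, 1 ≤ ‖W‖ → δ ≤ ‖f W‖ := by
    have h2 : f '' Metric.ball 0 1 ∈ 𝓝 (f 0) := by
      have h3 := (hfd.analyticAt 0).eventually_constant_or_nhds_le_map_nhds
      rcases h3 with h3 | h3
      · exfalso
        have h4 : deriv f 0 = 0 := by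
          have h5 : f =ᶠ[𝓝 0] fun _ => f 0 := h3
          rw [h5.deriv_eq]; simp
        exact hder h4
      · exact h3 (image_mem_map (Metric.ball_mem_nhds _ one_pos))
    rw [hf0] at h2
    obtain ⟨δ, hδ, h3⟩ := Metric.mem_nhds_iff.1 h2
    refine ⟨δ, hδ, fun W hW => ?_⟩
    by_contra hcon
    push Not at hcon
    obtain ⟨V, hV, hVW⟩ := h3 (mem_ball_zero_iff.2 hcon)
    rw [hfinj hVW, mem_ball_zero_iff] at hV
    linarith
  have hgW : ∀ W : ℂ, 1 ≤ ‖W‖ → ‖g W‖ ≤ ‖W‖ / δ := by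
    intro W hW
    have hW0 : W ≠ 0 := by rintro rfl; simp at hW; linarith
    simp only [g, q]
    rw [dslope_of_ne _ hW0, slope_def_field, hf0, sub_zero, sub_zero, inv_div, norm_div]
    exact div_le_div_of_nonneg_left (norm_nonneg _) hδ (hfδ W hW)
  obtain ⟨c, hc⟩ : ∃ c, ∀ W, dslope g 0 W = c := by
    refine (hdsl g hgd).exists_const_forall_eq_of_bounded ?_
    obtain ⟨M, hM⟩ := (isCompact_closedBall (0 : ℂ) 1).exists_bound_of_continuousOn
      (hdsl g hgd).continuous.continuousOn
    refine isBounded_iff_forall_norm_le.2 ⟨max M (1 / δ + ‖g 0‖), ?_⟩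
    rintro _ ⟨W, rfl⟩
    by_cases hW : ‖W‖ ≤ 1
    · exact (hM W (mem_closedBall_zero_iff.2 hW)).trans (le_max_left _ _)
    · push Not at hW
      have hW0 : W ≠ 0 := by rintro rfl; simp at hW; linarith
      refine le_trans ?_ (le_max_right _ _)
      rw [dslope_of_ne _ hW0, slope_def_field, sub_zero, norm_div, div_le_iff₀ (by linarith)]
      have h3 := hgW W hW.le
      have h4 := norm_sub_le (g W) (g 0)
      have h5 : ‖W‖ / δ = 1 / δ * ‖W‖ := by ring
      nlinarith [norm_nonneg (g 0)]
  have hglin : ∀ W, g W = g 0 + c * W := by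
    intro W
    have := sub_smul_dslope g 0 W
    rw [hc] at this
    simp only [sub_zero, smul_eq_mul] at this
    linear_combination -this
  have hg1 : ∀ m : ℕ, m ≠ 0 → g m = 1 := by
    intro m hm
    simp only [g]; rw [hqm m hm, inv_one]
  have e1 := hglin 1
  have e2 := hglin 2
  have e3 := hg1 1 one_ne_zero
  have e4 := hg1 2 two_ne_zero
  push_cast at e3 e4
  have hc0 : c = 0 := by
    have h5 : g 0 + c * 1 = 1 := by rw [← e1, e3]
    have h6 : g 0 + c * 2 = 1 := by rw [← e2, e4]
    linear_combination h6 - h5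
  have hgone : ∀ W, g W = 1 := by
    intro W
    rw [hglin W, hc0]
    have : g 0 + c * 1 = 1 := by rw [← e1, e3]
    rw [hc0] at this
    linear_combination this
  have hf : ∀ W, f W = W := by
    intro W
    have h5 := sub_smul_dslope f 0 W
    have h6 : q W = 1 := inv_eq_one.1 (hgone W)
    simp only [q] at h6
    rw [h6, hf0] at h5
    simpa using h5.symm
  refine ⟨F p - p, fun W => ?_⟩
  have := hf (W - p)
  simp only [f, sub_add_cancel] at this
  linear_combination this

/-- An injective holomorphic map of a right half-plane commuting with the unit translation is a
translation: it extends to an injective entire map. -/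
theorem halfplane_injective_commute_translation {E : ℂ → ℂ} {R : ℝ}
    (hE : DifferentiableOn ℂ E {W | R < W.re}) (hinj : Set.InjOn E {W | R < W.re})
    (h1 : ∀ W : ℂ, R < W.re → E (W + 1) = E W + 1) : ∃ C, ∀ W : ℂ, R < W.re → E W = W + C := by
  have hshift : ∀ (m : ℕ) (W : ℂ), R < W.re → E (W + m) = E W + m := by
    intro m
    induction m with
    | zero => simp
    | succ m ih =>
      intro W hW
      have h2 : R < (W + m).re := by
        simp only [add_re, natCast_re]
        have : (0 : ℝ) ≤ m := by positivity
        linarith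
      rw [show W + ((m + 1 : ℕ) : ℂ) = (W + m) + 1 by push_cast; ring, h1 _ h2, ih W hW]
      push_cast; ring
  have hcomp : ∀ (n m : ℕ) (W : ℂ), R < (W + n).re → R < (W + m).re →
      E (W + n) - n = E (W + m) - m := by
    intro n m W hn hm
    wlog hnm : n ≤ m generalizing n m
    · exact (this m n hm hn (by omega)).symm
    obtain ⟨d, rfl⟩ := Nat.exists_eq_add_of_le hnm
    rw [show W + ((n + d : ℕ) : ℂ) = (W + n) + d by push_cast; ring, hshift d _ hn]
    push_cast; ring
  have hex : ∀ W : ℂ, ∃ n : ℕ, R < (W + n).re := by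
    intro W
    obtain ⟨n, hn⟩ := exists_nat_gt (R - W.re)
    exact ⟨n, by simp only [add_re, natCast_re]; linarith⟩
  choose N hN using hex
  -- Extension by the functional equation.
  let F : ℂ → ℂ := fun W => E (W + N W) - N W
  have hFE : ∀ (m : ℕ) (W : ℂ), R < (W + m).re → F W = E (W + m) - m := fun m W hm =>
    hcomp _ _ W (hN W) hm
  have hopen : IsOpen {W : ℂ | R < W.re} := isOpen_lt continuous_const continuous_re
  have hFd : Differentiable ℂ F := by
    intro W
    have h2 : ∀ᶠ V in 𝓝 W, F V = E (V + N W) - N W := by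
      have : ∀ᶠ V : ℂ in 𝓝 W, R < (V + (N W : ℂ)).re :=
        (isOpen_lt continuous_const (by fun_prop)).mem_nhds (hN W)
      exact this.mono fun V hV => hFE _ V hV
    have h3 : DifferentiableAt ℂ E (W + N W) :=
      (hE _ (hN W)).differentiableAt (hopen.mem_nhds (hN W))
    have h4 : DifferentiableAt ℂ (fun V => E (V + N W) - N W) W :=
      (h3.comp W (differentiableAt_id.add_const _)).sub_const _
    exact h4.congr_of_eventuallyEq h2
  have hFinj : Function.Injective F := by
    intro V W hVW
    have hm1 : R < (V + (N V + N W : ℕ)).re := by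
      have := hN V
      have h0 : (0 : ℝ) ≤ N W := by positivity
      simp only [add_re, natCast_re, Nat.cast_add] at this ⊢
      linarith
    have hm2 : R < (W + (N V + N W : ℕ)).re := by
      have := hN W
      have h0 : (0 : ℝ) ≤ N V := by positivity
      simp only [add_re, natCast_re, Nat.cast_add] at this ⊢
      linarith
    rw [hFE _ V hm1, hFE _ W hm2] at hVW
    exact add_right_cancel (hinj hm1 hm2 (sub_left_injective hVW))
  have hF1 : ∀ W, F (W + 1) = F W + 1 := by
    intro W
    have h2 : R < (W + (N W + 1 : ℕ)).re := by
      have := hN W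
      simp only [add_re, natCast_re, Nat.cast_add, Nat.cast_one, one_re] at this ⊢
      linarith
    have h3 : (W + 1) + (N W : ℂ) = W + (N W + 1 : ℕ) := by push_cast; ring
    rw [hFE (N W + 1) W h2, hFE (N W) (W + 1) (by rw [h3]; exact h2), h3]
    push_cast; ring
  obtain ⟨C, hC⟩ := entire_injective_commute_translation hFd hFinj hF1
  refine ⟨C, fun W hW => ?_⟩
  have := hFE 0 W (by simpa using hW)
  rw [← hC W, this]
  simp

/-- The same for a right (`s = 1`) or left (`s = -1`) half-plane. -/
theorem signed_halfplane_commute_translation {E : ℂ → ℂ} {R s : ℝ} (hs : s = 1 ∨ s = -1)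
    (hE : DifferentiableOn ℂ E {W | R < s * W.re}) (hinj : Set.InjOn E {W | R < s * W.re})
    (h1 : ∀ W : ℂ, R < s * W.re → R < s * (W + 1).re → E (W + 1) = E W + 1) :
    ∃ C, ∀ W : ℂ, R < s * W.re → E W = W + C := by
  rcases hs with rfl | rfl
  · simp only [one_mul] at *
    refine halfplane_injective_commute_translation hE hinj fun W hW => h1 W hW ?_
    simp only [add_re, one_re]; linarith
  · simp only [neg_mul, one_mul] at *
    have hmap : ∀ W : ℂ, R < W.re → R < -(-W).re := by simp
    obtain ⟨C, hC⟩ := halfplane_injective_commute_translation (E := fun W => -E (-W)) (R := R)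
      ((hE.comp (by fun_prop) fun W hW => hmap W hW).neg)
      (fun V hV W hW h => by
        exact neg_injective (hinj (hmap V hV) (hmap W hW) (neg_injective h)))
      (fun W hW => by
        have h2 : R < -(-(W + 1)).re := by simp only [neg_re, add_re, one_re]; linarith
        have h3 := h1 (-(W + 1)) h2 (by simp only [neg_re, add_re, one_re]; linarith)
        rw [show -(W + 1) + 1 = -W by ring] at h3
        rw [h3]; ring)
    refine ⟨-C, fun W hW => ?_⟩
    have := hC (-W) (by simpa using hW)
    simp only [neg_neg] at this
    linear_combination -this

/-! ### Values of Fatou coordinates and their uniqueness -/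

/-- A function asymptotic to `-1/(k z^k)` on a sector takes there all values asymptotic to those
of `-1/(k z^k)` on a smaller sector. -/
theorem exists_preimage {k : ℕ} (hk : 1 ≤ k) {θ α α₁ α₂ r r₁ : ℝ} {φ : ℂ → ℂ}
    (hα : α ≤ Real.pi) (hr : 0 < r) (hφ : DifferentiableOn ℂ φ (sector θ α r))
    (hlim : Tendsto (fun z => φ z * z ^ k) (𝓝[sector θ α r] 0) (𝓝 (-1 / k)))
    (h12 : α₁ < α₂) (h2 : α₂ ≤ α) (hr₁ : 0 < r₁) :
    ∃ R > 0, ∀ V : ℂ, R < ‖V‖ → |arg V| < k * α₁ →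
      ∃ z ∈ sector θ α₂ r₁, deriv φ z ≠ 0 ∧ φ z = -V * exp (-(k * (θ * I))) := by
  have hkR : (1 : ℝ) ≤ k := by exact_mod_cast hk
  have hk0 : (k : ℂ) ≠ 0 := by exact_mod_cast (by omega : k ≠ 0)
  set ε : ℝ := min ((α₂ - α₁) / 4) (1 / (4 * k)) with hε
  have hεpos : 0 < ε := lt_min (by linarith) (by positivity)
  have hε1 : ε ≤ (α₂ - α₁) / 4 := min_le_left _ _
  have hkε : k * ε ≤ 1 / 4 := by
    have h3 : ε ≤ 1 / (4 * k) := min_le_right _ _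
    rw [le_div_iff₀ (by positivity)] at h3
    linarith
  have hε2 : ε ≤ 1 / 4 := by nlinarith
  obtain ⟨r', hr', hloc⟩ := sector_local_control hk hα hr hφ hlim hεpos hkε
  set ρ : ℝ := min r' (min r r₁) / 2 with hρ
  have hρpos : 0 < ρ := by positivity
  have hexp : Real.exp ε ≤ 2 := by
    have h3 : Real.exp ε ≤ Real.exp (1 / 4) := Real.exp_le_exp.2 hε2
    have h4 : Real.exp (1 / 4) ^ 4 = Real.exp 1 := by
      rw [← Real.exp_nat_mul]; norm_num
    have := Real.exp_one_lt_d9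
    by_contra hcon
    push Not at hcon
    have h5 : (2 : ℝ) ^ 4 < Real.exp (1 / 4) ^ 4 :=
      pow_lt_pow_left₀ (hcon.trans_le h3) (by norm_num) (by norm_num)
    rw [h4] at h5
    linarith
  refine ⟨1 / (k * ρ ^ k), by positivity, fun V hV hVarg => ?_⟩
  have hVpos : 0 < ‖V‖ := lt_trans (by positivity) hV
  have hV0 : V ≠ 0 := norm_pos_iff.1 hVpos
  have hkV0 : (k : ℂ) * V ≠ 0 := mul_ne_zero hk0 hV0
  -- `exp ζ` solves the equation with the leading term `-1 / (k z ^ k)` in place of the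
  -- coordinate.
  set ζ : ℂ := -log (k * V) / k + θ * I with hζ
  have hζim : ζ.im - θ = -arg V / k := by
    have h3 : arg ((k : ℂ) * V) = arg V := by
      simpa using arg_real_mul V (by positivity : (0 : ℝ) < k)
    rw [hζ, add_im, div_natCast_im, neg_im, log_im, h3]
    simp
  have hζre : ζ.re = -Real.log (k * ‖V‖) / k := by
    rw [hζ, add_re, div_natCast_re, neg_re, log_re, norm_mul, Complex.norm_natCast]
    simp
  have hζk : exp ζ ^ k = 1 / (k * V) * exp (k * (θ * I)) := by
    rw [← exp_nat_mul, hζ, mul_add, exp_add, mul_div_cancel₀ _ hk0, exp_neg, exp_log hkV0, one_div]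
  have hζn : Real.exp ζ.re < ρ := by
    refine lt_of_pow_lt_pow_left₀ k hρpos.le ?_
    rw [← Real.exp_nat_mul, hζre, mul_div_cancel₀ _ (by positivity), Real.exp_neg,
      Real.exp_log (by positivity), inv_lt_comm₀ (by positivity) (by positivity)]
    rw [div_lt_iff₀ (by positivity)] at hV
    rw [inv_lt_iff_one_lt_mul₀ (by positivity)]
    linarith
  have hζ1 : |ζ.im - θ| < α₁ := by
    rw [hζim, abs_div, abs_neg, abs_of_pos (by positivity : (0 : ℝ) < k), div_lt_iff₀ (by positivity)]
    linarith
  have hmin : min r' (min r r₁) = 2 * ρ := by rw [hρ]; ring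
  have hle1 : 2 * ρ ≤ r' := hmin ▸ min_le_left _ _
  have hle3 : 2 * ρ ≤ r₁ := hmin ▸ (min_le_right _ _).trans (min_le_right _ _)
  have hz₀ : exp ζ ∈ sector θ α₁ ρ := (mem_sector_iff (by linarith)).2 ⟨ζ, hζn, hζ1, rfl⟩
  obtain ⟨-, hcov⟩ := hloc (exp ζ) (sector_mono (by linarith) (by linarith) hz₀)
  obtain ⟨x, hx, -, hval⟩ := hcov (-V * exp (-(k * (θ * I)))) (by
    rw [hζk]
    have h3 : exp (-((k : ℂ) * (θ * I))) * exp (k * (θ * I)) = 1 := by rw [← exp_add]; simp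
    have h4 : -V * exp (-((k : ℂ) * (θ * I))) * (1 / (k * V) * exp (k * (θ * I))) + 1 / k = 0 := by
      generalize exp (-((k : ℂ) * (θ * I))) = e₁ at h3 ⊢
      generalize exp ((k : ℂ) * (θ * I)) = e₂ at h3 ⊢
      field_simp
      linear_combination -h3
    rw [h4, norm_zero]; positivity)
  have hz : exp ζ * exp x ∈ sector θ (α₁ + ε) (ρ * Real.exp ε) :=
    mul_exp_mem_sector (by linarith) hz₀ hx
  have hρe : ρ * Real.exp ε ≤ 2 * ρ := by nlinarith
  refine ⟨exp ζ * exp x, sector_mono (by linarith) (by linarith) hz, ?_, hval⟩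
  exact (hloc _ (sector_mono (by linarith) (by linarith) hz)).1

lemma hasDerivAt_invFunOn {φ : ℂ → ℂ} {S : Set ℂ} (hS : IsOpen S) (hφ : DifferentiableOn ℂ φ S)
    (hinj : Set.InjOn φ S) {z : ℂ} (hz : z ∈ S) (hd : deriv φ z ≠ 0) :
    HasDerivAt (Function.invFunOn φ S) (deriv φ z)⁻¹ (φ z) := by
  have h1 : AnalyticAt ℂ φ z := hφ.analyticAt (hS.mem_nhds hz)
  refine (h1.hasStrictDerivAt.to_local_left_inverse hd ?_).hasDerivAt
  filter_upwards [hS.mem_nhds hz] with x hx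
  exact hinj.leftInvOn_invFunOn hx

lemma invFunOn_eq {φ : ℂ → ℂ} {S : Set ℂ} (hinj : Set.InjOn φ S) {z W : ℂ} (hz : z ∈ S)
    (h : φ z = W) : Function.invFunOn φ S W = z := by
  rw [← h]
  exact hinj.leftInvOn_invFunOn hz

/-- Fatou coordinates on a petal of half-opening larger than `π/(2k)` are unique up to an additive
constant: the change of coordinate is injective on a half-plane and commutes with the unit
translation. -/
theorem fatou_unique {k : ℕ} (hk : 1 ≤ k) {G : ℂ → ℂ} (hG0 : G 0 = 0) (hG1 : HasDerivAt G 1 0)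
    {θ s α α' r r' : ℝ} (hs : s = 1 ∨ s = -1) (hθ : exp (k * (θ * I)) = -s)
    (hα : α ≤ Real.pi) (hα1 : Real.pi / (2 * k) < α) (hα' : Real.pi / (2 * k) < α')
    (hr : 0 < r) (hr' : 0 < r') {φ φ' : ℂ → ℂ}
    (hφ : IsFatouCoordinate G (sector θ α r) φ)
    (hlim : Tendsto (fun z => φ z * z ^ k) (𝓝[sector θ α r] 0) (𝓝 (-1 / k)))
    (hφ' : IsFatouCoordinate G (sector θ α' r') φ') :
    ∃ C, ∀ z ∈ sector θ (min α α') (min r r'), φ' z = φ z + C := by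
  have hkR : (1 : ℝ) ≤ k := by exact_mod_cast hk
  set α₀ := min α α' with hα₀
  set r₀ := min r r' with hr₀
  have hr₀pos : 0 < r₀ := lt_min hr hr'
  have hα₀1 : Real.pi / (2 * k) < α₀ := lt_min hα1 hα'
  have hα₀π : α₀ ≤ Real.pi := (min_le_left _ _).trans hα
  have hsub : sector θ α₀ r₀ ⊆ sector θ α r := sector_mono (min_le_left _ _) (min_le_left _ _)
  have hsub' : sector θ α₀ r₀ ⊆ sector θ α' r' := sector_mono (min_le_right _ _) (min_le_right _ _)
  have hopen : IsOpen (sector θ α₀ r₀) := isOpen_sector hα₀π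
  have hφd := hφ.1.mono hsub
  have hφi := hφ.2.1.mono hsub
  set ε := (α₀ - Real.pi / (2 * k)) / 2 with hε
  have hεpos : 0 < ε := by rw [hε]; linarith
  obtain ⟨rG, hrG, hGx⟩ := exists_exp_of_hasDerivAt_one hG1 hG0 hεpos
  set r₁ := min (r₀ / Real.exp ε) rG with hr₁
  have hr₁pos : 0 < r₁ := lt_min (div_pos hr₀pos (Real.exp_pos _)) hrG
  have hGS : ∀ z ∈ sector θ (α₀ - ε) r₁, G z ∈ sector θ α₀ r₀ := by
    intro z hz
    obtain ⟨x, hx, hGz⟩ := hGx z (ne_zero_of_mem_sector hz) (hz.2.1.trans_le (min_le_right _ _))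
    rw [hGz]
    have h1 := mul_exp_mem_sector (by linarith) hz hx.le
    refine sector_mono (by linarith) ?_ h1
    have : r₁ ≤ r₀ / Real.exp ε := min_le_left _ _
    rwa [le_div_iff₀ (Real.exp_pos _)] at this
  have hr₁r₀ : r₁ ≤ r₀ := by
    refine (min_le_left _ _).trans (div_le_self hr₀pos.le ?_)
    exact Real.one_le_exp hεpos.le
  have hS1 : sector θ (α₀ - ε) r₁ ⊆ sector θ α₀ r₀ := sector_mono (by linarith) hr₁r₀
  obtain ⟨R, hRpos, hpre⟩ := exists_preimage (α₁ := Real.pi / (2 * k)) (α₂ := α₀ - ε) hk hα₀π hr₀pos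
    hφd (hlim.mono_left (nhdsWithin_mono _ hsub)) (by rw [hε]; linarith) (by linarith) hr₁pos
  have hs2 : (s : ℂ) * s = 1 := by rcases hs with rfl | rfl <;> norm_num
  have hpreW : ∀ W : ℂ, R < s * W.re → ∃ z ∈ sector θ (α₀ - ε) r₁, deriv φ z ≠ 0 ∧ φ z = W := by
    intro W hW
    have hre : ((s : ℂ) * W).re = s * W.re := by simp
    obtain ⟨z, hz, hd, hv⟩ := hpre (s * W) (hW.trans_le (hre ▸ re_le_norm _)) (by
      have h1 : |arg ((s : ℂ) * W)| < Real.pi / 2 := by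
        rw [abs_arg_lt_pi_div_two_iff]
        left; rw [hre]; linarith
      have h2 : (k : ℝ) * (Real.pi / (2 * k)) = Real.pi / 2 := by field_simp
      rwa [h2])
    refine ⟨z, hz, hd, ?_⟩
    rw [hv, exp_neg, hθ]
    rcases hs with rfl | rfl <;> simp
  let g := Function.invFunOn φ (sector θ α₀ r₀)
  have hg : ∀ W : ℂ, R < s * W.re → g W ∈ sector θ (α₀ - ε) r₁ ∧ deriv φ (g W) ≠ 0 ∧ φ (g W) = W := by
    intro W hW
    obtain ⟨z, hz, hd, hv⟩ := hpreW W hW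
    have : g W = z := invFunOn_eq hφi (hS1 hz) hv
    rw [this]
    exact ⟨hz, hd, hv⟩
  have hgd : ∀ W : ℂ, R < s * W.re → DifferentiableAt ℂ g W := by
    intro W hW
    obtain ⟨h1, h2, h3⟩ := hg W hW
    have := hasDerivAt_invFunOn hopen hφd hφi (hS1 h1) h2
    rw [h3] at this
    exact this.differentiableAt
  -- The change of coordinate, on a half-plane of values of `φ`.
  let E : ℂ → ℂ := fun W => φ' (g W)
  obtain ⟨C, hC⟩ := signed_halfplane_commute_translation (E := E) (R := R) hs
    (fun W hW => by
      have h1 : DifferentiableAt ℂ φ' (g W) :=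
        (hφ'.1.mono hsub').differentiableAt (hopen.mem_nhds (hS1 (hg W hW).1))
      exact (h1.comp W (hgd W hW)).differentiableWithinAt)
    (fun V hV W hW h => by
      have h1 := hφ'.2.1 (hsub' (hS1 (hg V hV).1)) (hsub' (hS1 (hg W hW).1)) h
      rw [← (hg V hV).2.2, ← (hg W hW).2.2, h1])
    (fun W hW hW1 => by
      obtain ⟨h1, -, h3⟩ := hg W hW
      have h4 := hφ.2.2 _ (hsub (hS1 h1)) (hsub (hGS _ h1))
      have h5 : g (W + 1) = G (g W) := by
        refine invFunOn_eq hφi (hGS _ h1) ?_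
        rw [h4, h3]
      simp only [E]
      rw [h5]
      exact hφ'.2.2 _ (hsub' (hS1 h1)) (hsub' (hGS _ h1)))
  refine ⟨C, ?_⟩
  -- the identity theorem on the connected sector
  set W₀ : ℂ := ((s * (R + 1) : ℝ) : ℂ) with hW₀
  have hs2R : s * s = 1 := by rcases hs with rfl | rfl <;> norm_num
  have hW₀R : R < s * W₀.re := by
    rw [hW₀, ofReal_re, ← mul_assoc, hs2R]; linarith
  obtain ⟨z₀, hz₀, -, hv⟩ := hpreW W₀ hW₀R
  have hana : AnalyticOnNhd ℂ φ' (sector θ α₀ r₀) := (hφ'.1.mono hsub').analyticOnNhd hopen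
  have hanb : AnalyticOnNhd ℂ (fun z => φ z + C) (sector θ α₀ r₀) :=
    (hφd.add_const C).analyticOnNhd hopen
  refine hana.eqOn_of_preconnected_of_eventuallyEq hanb (isPreconnected_sector hα₀π) (hS1 hz₀) ?_
  have hcont : ContinuousAt φ z₀ :=
    (hφd.differentiableAt (hopen.mem_nhds (hS1 hz₀))).continuousAt
  have hH : ∀ᶠ W : ℂ in 𝓝 (φ z₀), R < s * W.re := by
    rw [hv]
    exact (isOpen_lt continuous_const (by fun_prop)).mem_nhds hW₀R
  filter_upwards [hcont.eventually hH, hopen.mem_nhds (hS1 hz₀)] with z h1 h2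
  have h3 := hC (φ z) h1
  simp only [E, g] at h3
  rwa [invFunOn_eq hφi h2 rfl] at h3

/-! ### Asymptotics of the time coordinate -/

lemma tendsto_pow_mul_log {k : ℕ} (hk : 1 ≤ k) (ρ : ℂ) (hρ : ‖ρ‖ = 1) :
    Tendsto (fun z : ℂ => z ^ k * log (z * ρ)) (𝓝[≠] 0) (𝓝 0) := by
  rw [tendsto_zero_iff_norm_tendsto_zero]
  have h1 : Tendsto (fun x : ℝ => |Real.log x * x| + Real.pi * x) (𝓝[>] 0) (𝓝 0) := by
    have h2 : Tendsto (fun x : ℝ => Real.log x * x) (𝓝[>] 0) (𝓝 0) := by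
      simpa using tendsto_log_mul_rpow_nhdsGT_zero (one_pos)
    have h3 : Tendsto (fun x : ℝ => Real.pi * x) (𝓝[>] 0) (𝓝 0) := by
      have : Tendsto (fun x : ℝ => Real.pi * x) (𝓝 0) (𝓝 (Real.pi * 0)) :=
        (continuous_const_mul _).tendsto 0
      rw [mul_zero] at this
      exact this.mono_left nhdsWithin_le_nhds
    simpa using h2.abs.add h3
  have hn : Tendsto (fun z : ℂ => ‖z‖) (𝓝[≠] 0) (𝓝[>] 0) := tendsto_norm_nhdsNE_zero
  refine squeeze_zero' (Eventually.of_forall fun z => norm_nonneg _) ?_ (h1.comp hn)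
  have hsmall : ∀ᶠ z : ℂ in 𝓝[≠] 0, ‖z‖ < 1 := by
    refine eventually_nhdsWithin_of_eventually_nhds ?_
    filter_upwards [Metric.ball_mem_nhds (0 : ℂ) one_pos] with z hz
    simpa using hz
  filter_upwards [hsmall] with z hz1
  simp only [Function.comp]
  rw [norm_mul, norm_pow]
  have h4 : ‖z‖ ^ k ≤ ‖z‖ := pow_le_of_le_one (norm_nonneg _) hz1.le (by omega)
  have h5 : ‖log (z * ρ)‖ ≤ |Real.log ‖z‖| + Real.pi := by
    refine (norm_le_abs_re_add_abs_im _).trans ?_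
    rw [log_re, log_im, norm_mul, hρ, mul_one]
    gcongr
    exact abs_arg_le_pi _
  calc ‖z‖ ^ k * ‖log (z * ρ)‖ ≤ ‖z‖ * (|Real.log ‖z‖| + Real.pi) := by gcongr
    _ = |Real.log ‖z‖ * ‖z‖| + Real.pi * ‖z‖ := by rw [abs_mul, abs_norm]; ring

lemma tendsto_mul_pow_of_timeCoordinate {k : ℕ} (hk : 1 ≤ k) {b c : ℂ} {θ : ℝ} {S : Set ℂ}
    (hS : S ⊆ {0}ᶜ) {φ : ℂ → ℂ}
    (hφ : Tendsto (fun z => φ z - timeCoordinate k b θ z) (𝓝[S] 0) (𝓝 c)) :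
    Tendsto (fun z => φ z * z ^ k) (𝓝[S] 0) (𝓝 (-1 / k)) := by
  have hk0 : (k : ℂ) ≠ 0 := by exact_mod_cast (by omega : k ≠ 0)
  have hle : 𝓝[S] (0 : ℂ) ≤ 𝓝[≠] 0 := nhdsWithin_mono _ hS
  have h1 : Tendsto (fun z : ℂ => z ^ k) (𝓝[S] 0) (𝓝 0) := by
    have : Tendsto (fun z : ℂ => z ^ k) (𝓝 0) (𝓝 (0 ^ k)) := (continuous_pow k).tendsto 0
    rw [zero_pow (by omega)] at this
    exact this.mono_left nhdsWithin_le_nhds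
  have h2 := (tendsto_pow_mul_log hk (exp (-(θ * I))) (by rw [norm_exp]; simp)).mono_left hle
  have h3 := ((hφ.mul h1).add (h2.const_mul b)).add_const (-1 / k : ℂ)
  simp only [mul_zero, zero_add] at h3
  refine h3.congr' ?_
  filter_upwards [hle self_mem_nhdsWithin] with z hz
  have hz' : z ^ k ≠ 0 := pow_ne_zero _ hz
  rw [timeCoordinate]
  field_simp
  ring

/-! ### Indices modulo `2k` and rays -/

lemma sector_add_two_pi (θ α r : ℝ) (m : ℤ) : sector (θ + 2 * Real.pi * m) α r = sector θ α r := by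
  have h : exp (-(((θ + 2 * Real.pi * m : ℝ) : ℂ) * I)) = exp (-(θ * I)) := by
    rw [exp_eq_exp_iff_exists_int]
    exact ⟨-m, by push_cast; ring⟩
  simp only [sector, h]

lemma timeCoordinate_add_two_pi (k : ℕ) (b : ℂ) (θ : ℝ) (m : ℤ) :
    timeCoordinate k b (θ + 2 * Real.pi * m) = timeCoordinate k b θ := by
  have h : exp (-(((θ + 2 * Real.pi * m : ℝ) : ℂ) * I)) = exp (-(θ * I)) := by
    rw [exp_eq_exp_iff_exists_int]
    exact ⟨-m, by push_cast; ring⟩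
  ext z
  simp only [timeCoordinate, h]

lemma exists_val_intCast {k : ℕ} (hk : 1 ≤ k) (a : ℤ) :
    ∃ m : ℤ, (((a : ZMod (2 * k)).val : ℕ) : ℤ) = a + 2 * k * m := by
  have : NeZero (2 * k) := ⟨by omega⟩
  rw [ZMod.val_intCast]
  refine ⟨-(a / (2 * k)), ?_⟩
  have := Int.emod_add_mul_ediv a (2 * k)
  push_cast
  linarith

lemma ray_intCast {k : ℕ} (hk : 1 ≤ k) (a : ℤ) :
    ∃ m : ℤ, ((a : ZMod (2 * k)).val * Real.pi / k : ℝ) = a * Real.pi / k + 2 * Real.pi * m := by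
  obtain ⟨m, hm⟩ := exists_val_intCast hk a
  refine ⟨m, ?_⟩
  have hk0 : (k : ℝ) ≠ 0 := by exact_mod_cast (by omega : k ≠ 0)
  have h : (((a : ZMod (2 * k)).val : ℕ) : ℝ) = a + 2 * k * m := by exact_mod_cast hm
  rw [h]; field_simp

lemma sector_intCast {k : ℕ} (hk : 1 ≤ k) (a : ℤ) (α r : ℝ) :
    sector ((a : ZMod (2 * k)).val * Real.pi / k) α r = sector (a * Real.pi / k) α r := by
  obtain ⟨m, hm⟩ := ray_intCast hk a
  rw [hm, sector_add_two_pi]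

lemma timeCoordinate_intCast {k : ℕ} (hk : 1 ≤ k) (b : ℂ) (a : ℤ) :
    timeCoordinate k b ((a : ZMod (2 * k)).val * Real.pi / k) =
      timeCoordinate k b (a * Real.pi / k) := by
  obtain ⟨m, hm⟩ := ray_intCast hk a
  rw [hm, timeCoordinate_add_two_pi]

lemma natCast_zmod_val' {k : ℕ} (hk : 1 ≤ k) (j : ZMod (2 * k)) : ((j.val : ℤ) : ZMod (2 * k)) = j := by
  have : NeZero (2 * k) := ⟨by omega⟩
  simp

lemma timeCoordinate_of_mem {k : ℕ} {b : ℂ} {θ : ℝ} {ζ : ℂ} (h : |ζ.im - θ| < Real.pi) :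
    timeCoordinate k b θ (exp ζ) = -exp (-(k * ζ)) / k + b * (ζ - θ * I) := by
  have h1 := abs_lt.1 h
  rw [timeCoordinate, ← exp_add, log_exp]
  · rw [← exp_nat_mul, exp_neg]
    field_simp
    ring
  · simp; linarith
  · simp; linarith

/-! ### Ends of the cylinder -/

/-- The sign of the imaginary parts at the end with index `j`. -/
def endSign (k : ℕ) (j : ZMod (2 * k)) : ℝ := if Odd j.val then 1 else -1

lemma endSign_eq (k : ℕ) (j : ZMod (2 * k)) : endSign k j = 1 ∨ endSign k j = -1 := by
  unfold endSign; split_ifs <;> simp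

lemma eventually_cylinderEnd {k : ℕ} {j : ZMod (2 * k)} {P : ℂ → Prop} :
    (∀ᶠ W in cylinderEnd k j, P W) ↔ ∃ R, ∀ W : ℂ, R < endSign k j * W.im → P W := by
  unfold cylinderEnd endSign
  split_ifs with h
  · rw [(atTop_basis_Ioi.comap _).eventually_iff]
    simp
  · rw [(atBot_basis_Iio.comap _).eventually_iff]
    simp only [true_and, Set.mem_preimage, Set.mem_Iio, neg_mul, one_mul]
    constructor
    · rintro ⟨R, hR⟩
      exact ⟨-R, fun W hW => hR (by linarith)⟩
    · rintro ⟨R, hR⟩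
      exact ⟨-R, fun W hW => hR W (by linarith)⟩

/-- The repelling petal on the boundary of the sector `j`. -/
def srcIndex (k : ℕ) (j : ZMod (2 * k)) : ZMod (2 * k) := if Odd j.val then j - 1 else j

/-- The attracting petal on the boundary of the sector `j`. -/
def tgtIndex (k : ℕ) (j : ZMod (2 * k)) : ZMod (2 * k) := if Odd j.val then j else j - 1

/-- The argument of the middle ray of the sector `j`. -/
def midAngle (k : ℕ) (j : ZMod (2 * k)) : ℝ := (2 * j.val - 1) * Real.pi / (2 * k)

lemma exp_midAngle {k : ℕ} (hk : 1 ≤ k) (j : ZMod (2 * k)) :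
    exp (k * (midAngle k j * I)) = endSign k j * I := by
  have hk0 : (k : ℂ) ≠ 0 := by exact_mod_cast (by omega : k ≠ 0)
  have h1 : (k : ℂ) * (midAngle k j * I) = j.val * (Real.pi * I) + -(Real.pi / 2 * I) := by
    rw [midAngle]; push_cast; field_simp; ring
  rw [h1, exp_add, exp_nat_mul, exp_pi_mul_I, exp_neg, exp_pi_div_two_mul_I, endSign, inv_I]
  split_ifs with h
  · rw [h.neg_one_pow]; simp
  · rw [(Nat.not_odd_iff_even.1 h).neg_one_pow]; simp

lemma tendsto_im_end {k : ℕ} (hk : 1 ≤ k) {θ σ α r : ℝ} {φ : ℂ → ℂ} (hσ : σ = 1 ∨ σ = -1)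
    (hθ : exp (k * (θ * I)) = σ * I) (hα0 : 0 < α) (hα : k * α < Real.pi / 2) (hr : 0 < r)
    (hlim : Tendsto (fun z => φ z * z ^ k) (𝓝[sector θ α r] 0) (𝓝 (-1 / k))) (R : ℝ) :
    ∃ r₁ > 0, ∀ z ∈ sector θ α r₁, R < σ * (φ z).im := by
  have hkR : (1 : ℝ) ≤ k := by exact_mod_cast hk
  have hk0 : (k : ℂ) ≠ 0 := by exact_mod_cast (by omega : k ≠ 0)
  have hαπ : α ≤ Real.pi := by nlinarith [Real.pi_pos]
  have hc : 0 < Real.cos (k * α) :=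
    Real.cos_pos_of_mem_Ioo ⟨by nlinarith [Real.pi_pos], hα⟩
  set c := Real.cos (k * α) / (2 * k) with hcdef
  have hcpos : 0 < c := by positivity
  have h1 := (Metric.tendsto_nhds.1 hlim) c hcpos
  rw [eventually_nhdsWithin_iff] at h1
  obtain ⟨δ, hδ, h2⟩ := Metric.eventually_nhds_iff.1 h1
  have h3 : ∃ ρ > 0, c / ρ ^ k > |R| := by
    have : Tendsto (fun ρ : ℝ => |R| * ρ ^ k) (𝓝 0) (𝓝 (|R| * 0 ^ k)) :=
      (continuous_const.mul (continuous_pow k)).tendsto 0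
    rw [zero_pow (by omega), mul_zero] at this
    obtain ⟨δ', hδ', h4⟩ := Metric.eventually_nhds_iff.1 (this.eventually (gt_mem_nhds hcpos))
    refine ⟨δ' / 2, by positivity, ?_⟩
    rw [gt_iff_lt, lt_div_iff₀ (by positivity)]
    refine h4 ?_
    rw [dist_zero_right, Real.norm_of_nonneg (by positivity)]
    linarith
  obtain ⟨ρ, hρ, hρR⟩ := h3
  refine ⟨min ρ (min δ r), by positivity, fun z hz => ?_⟩
  have hzd := h2 (y := z) (by
    rw [dist_zero_right]
    exact hz.2.1.trans_le ((min_le_right _ _).trans (min_le_left _ _)))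
    (sector_mono le_rfl ((min_le_right _ _).trans (min_le_right _ _)) hz)
  have hzρ : ‖z‖ < ρ := hz.2.1.trans_le (min_le_left _ _)
  have hz0 := ne_zero_of_mem_sector hz
  obtain ⟨ζ, -, hζ2, rfl⟩ := (mem_sector_iff hαπ).1 hz
  set N := ‖exp ζ‖ ^ k with hN
  have hNpos : 0 < N := by positivity
  -- decomposition of the imaginary part
  have h4 : φ (exp ζ) = -exp (-(k * ζ)) / k +
      (φ (exp ζ) * exp ζ ^ k - -1 / k) * exp (-(k * ζ)) := by
    have h6 : (exp ζ) ^ k * exp (-(k * ζ)) = 1 := by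
      rw [← exp_nat_mul, ← exp_add]; simp
    linear_combination (-φ (exp ζ)) * h6
  have h5 : -exp (-((k : ℂ) * ζ)) = (σ * I) * exp (-(k * (ζ - θ * I))) := by
    have h6 : exp (-((k : ℂ) * ζ)) = exp (-(k * (ζ - θ * I))) * exp (-(k * (θ * I))) := by
      rw [← exp_add]; ring_nf
    rw [h6, exp_neg (k * (θ * I)), hθ]
    rcases hσ with rfl | rfl <;> field_simp <;> push_cast <;> ring_nf <;> simp
  have hnorm : ‖exp (-((k : ℂ) * ζ))‖ = 1 / N := by
    rw [hN, ← norm_pow, ← exp_nat_mul, exp_neg, norm_inv, one_div]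
  have h7 : σ * (-exp (-((k : ℂ) * ζ)) / k).im = Real.cos (k * (ζ.im - θ)) / k / N := by
    have hσ2 : σ * σ = 1 := by rcases hσ with rfl | rfl <;> norm_num
    have h8 : (-exp (-((k : ℂ) * ζ)) / k).im = (-exp (-((k : ℂ) * ζ))).im / k := div_natCast_im _ _
    have h9 : ((σ * I : ℂ) * exp (-((k : ℂ) * (ζ - θ * I)))).im =
        σ * (exp (-((k : ℂ) * (ζ - θ * I)))).re := by
      rw [mul_assoc, im_ofReal_mul, I_mul_im]
    have h10 : (exp (-((k : ℂ) * (ζ - θ * I)))).re = Real.cos (k * (ζ.im - θ)) / N := by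
      rw [exp_re]
      have h11 : (-((k : ℂ) * (ζ - θ * I))).im = -(k * (ζ.im - θ)) := by simp
      have h12 : (-((k : ℂ) * (ζ - θ * I))).re = (-((k : ℂ) * ζ)).re := by simp
      rw [h11, h12, Real.cos_neg, ← norm_exp, hnorm]
      ring
    rw [h8, h5, h9, h10]
    rw [show σ * (σ * (Real.cos (k * (ζ.im - θ)) / N) / k) =
      σ * σ * (Real.cos (k * (ζ.im - θ)) / N / k) by ring, hσ2]
    ring
  have h8 : Real.cos (k * α) ≤ Real.cos (k * (ζ.im - θ)) := by
    rw [← Real.cos_abs (k * (ζ.im - θ)), abs_mul, abs_of_pos (by positivity : (0 : ℝ) < k)]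
    exact Real.cos_le_cos_of_nonneg_of_le_pi (by positivity) (by linarith [Real.pi_pos])
      (by gcongr)
  have h9 : ‖(φ (exp ζ) * exp ζ ^ k - -1 / k) * exp (-(k * ζ))‖ ≤ c / N := by
    rw [norm_mul, hnorm, mul_one_div]
    rw [dist_eq_norm] at hzd
    gcongr
  have h10 := (abs_im_le_norm _).trans h9
  have h11 : |σ * ((φ (exp ζ) * exp ζ ^ k - -1 / k) * exp (-(k * ζ))).im| ≤ c / N := by
    rw [abs_mul]
    rcases hσ with rfl | rfl <;> simpa using h10
  have h12 := (abs_le.1 h11).1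
  rw [h4, add_im, mul_add, h7]
  have h13 : c / N < Real.cos (k * (ζ.im - θ)) / k / N - c / N + 1 * 0 ∨
      c / N ≤ Real.cos (k * (ζ.im - θ)) / k / N - c / N := by
    right
    have : 2 * c ≤ Real.cos (k * (ζ.im - θ)) / k := by
      rw [hcdef, le_div_iff₀ (by positivity)]
      field_simp
      linarith
    rw [← sub_div]
    gcongr
    linarith
  have h14 : |R| < c / N := by
    refine hρR.trans_le ?_
    have : N ≤ ρ ^ k := by rw [hN]; gcongr
    gcongr
  have h15 := le_abs_self R
  rcases h13 with h13 | h13 <;> linarith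

/-- A vertical strip at the end of the cylinder is covered by the values on a thin sector. -/
theorem exists_preimage_strip {k : ℕ} (hk : 1 ≤ k) {θ σ α α₂ r r₁ M : ℝ} {φ : ℂ → ℂ}
    (hσ : σ = 1 ∨ σ = -1) (hθ : exp (k * (θ * I)) = σ * I)
    (hα : α ≤ Real.pi) (hr : 0 < r) (hφ : DifferentiableOn ℂ φ (sector θ α r))
    (hlim : Tendsto (fun z => φ z * z ^ k) (𝓝[sector θ α r] 0) (𝓝 (-1 / k)))
    (h0 : 0 < α₂) (h2 : α₂ ≤ α) (hr₁ : 0 < r₁) :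
    ∃ R > 0, ∀ W : ℂ, R < σ * W.im → |W.re| ≤ M →
      ∃ z ∈ sector θ α₂ r₁, deriv φ z ≠ 0 ∧ φ z = W := by
  have hkR : (1 : ℝ) ≤ k := by exact_mod_cast hk
  obtain ⟨R, hR, hpre⟩ := exists_preimage (α₁ := α₂ / 2) hk hα hr hφ hlim (by linarith) h2 hr₁
  have hcont : ∀ᶠ V : ℂ in 𝓝 1, |arg V| < k * (α₂ / 2) := by
    have : Tendsto (fun V : ℂ => |arg V|) (𝓝 1) (𝓝 |arg 1|) :=
      (continuousAt_arg (by simp)).abs.tendsto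
    rw [arg_one, abs_zero] at this
    exact this.eventually (gt_mem_nhds (by positivity))
  obtain ⟨δ, hδ, hd⟩ := Metric.eventually_nhds_iff.1 hcont
  refine ⟨max R (M / δ), lt_max_of_lt_left hR, fun W hW hWM => ?_⟩
  have hW1 : R < σ * W.im := (le_max_left _ _).trans_lt hW
  have hW2 : M / δ < σ * W.im := (le_max_right _ _).trans_lt hW
  have hpos : 0 < σ * W.im := hR.trans hW1
  have hσ2 : (σ : ℂ) * σ = 1 := by rcases hσ with rfl | rfl <;> norm_num
  -- `V` is close to the positive axis once `σ * W.im` is large compared with `M`.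
  set V : ℂ := -W * (σ * I) with hV
  have hVre : V.re = σ * W.im := by rw [hV]; simp; ring
  have hVim : |V.im| ≤ M := by
    have : |V.im| = |W.re| := by
      rw [hV]
      rcases hσ with rfl | rfl <;> simp
    rwa [this]
  have hVeq : V = ((σ * W.im : ℝ) : ℂ) * (1 + (V.im / (σ * W.im) : ℝ) * I) := by
    have hx : σ * W.im * (V.im / (σ * W.im)) = V.im := mul_div_cancel₀ _ hpos.ne'
    generalize V.im / (σ * W.im) = x at hx
    apply Complex.ext
    · rw [re_ofReal_mul, hVre]; simp
    · rw [im_ofReal_mul, ← hx]; simp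
  obtain ⟨z, hz, hzd, hzv⟩ := hpre V (hW1.trans_le (hVre ▸ re_le_norm V)) (by
    rw [hVeq, arg_real_mul _ hpos]
    refine hd ?_
    rw [dist_eq_norm, add_sub_cancel_left, norm_mul, norm_I, mul_one, norm_real, Real.norm_eq_abs,
      abs_div, abs_of_pos hpos, div_lt_iff₀ hpos]
    rw [div_lt_iff₀ hδ] at hW2
    linarith)
  refine ⟨z, hz, hzd, ?_⟩
  rw [hzv, exp_neg, hθ, hV]
  have hσ0 : (σ : ℂ) ≠ 0 := by
    rintro h
    rw [h] at hσ2
    simp at hσ2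
  have hσI : (σ : ℂ) * I ≠ 0 := mul_ne_zero hσ0 I_ne_zero
  rw [neg_mul, mul_assoc, mul_inv_cancel₀ hσI, mul_one, neg_neg]

/-- The transition between two Fatou coordinates on a sector between two rays: it is defined on a
strip by inverting the first one and extended periodically. -/
theorem exists_transition {k : ℕ} (hk : 1 ≤ k) {G : ℂ → ℂ} (hG0 : G 0 = 0)
    (hG1 : HasDerivAt G 1 0) {θ σ α r : ℝ} (hσ : σ = 1 ∨ σ = -1)
    (hθ : exp (k * (θ * I)) = σ * I) (hα0 : 0 < α) (hα : k * α < Real.pi / 2) (hr : 0 < r)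
    {φs φt : ℂ → ℂ} (hs : IsFatouCoordinate G (sector θ α r) φs)
    (ht : IsFatouCoordinate G (sector θ α r) φt)
    (hslim : Tendsto (fun z => φs z * z ^ k) (𝓝[sector θ α r] 0) (𝓝 (-1 / k)))
    {c : ℂ} (hc : Tendsto (fun z => φt z - φs z) (𝓝[sector θ α r] 0) (𝓝 c)) :
    ∃ Ψ : ℂ → ℂ, (∃ R, ∀ W : ℂ, R < σ * W.im → DifferentiableAt ℂ Ψ W) ∧
      (∀ W, Ψ (W + 1) = Ψ W + 1) ∧
      (∀ ε > 0, ∃ R, ∀ W : ℂ, R < σ * W.im → ‖Ψ W - W - c‖ < ε) ∧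
      ∀ᶠ z in 𝓝[sector θ α r] 0, Ψ (φs z) = φt z := by
  have hkR : (1 : ℝ) ≤ k := by exact_mod_cast hk
  have hαπ : α ≤ Real.pi := by nlinarith [Real.pi_pos]
  have hopen : IsOpen (sector θ α r) := isOpen_sector hαπ
  obtain ⟨rG, hrG, hGx⟩ := exists_exp_of_hasDerivAt_one hG1 hG0 (half_pos hα0)
  set r₁ := min (r / Real.exp (α / 2)) rG with hr₁
  have hr₁pos : 0 < r₁ := lt_min (div_pos hr (Real.exp_pos _)) hrG
  have hGS : ∀ z ∈ sector θ (α / 2) r₁, G z ∈ sector θ α r := by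
    intro z hz
    obtain ⟨x, hx, hGz⟩ := hGx z (ne_zero_of_mem_sector hz) (hz.2.1.trans_le (min_le_right _ _))
    rw [hGz]
    have h1 := mul_exp_mem_sector (by linarith) hz hx.le
    refine sector_mono (by linarith) ?_ h1
    have : r₁ ≤ r / Real.exp (α / 2) := min_le_left _ _
    rwa [le_div_iff₀ (Real.exp_pos _)] at this
  have hr₁r : r₁ ≤ r := by
    refine (min_le_left _ _).trans (div_le_self hr.le ?_)
    exact Real.one_le_exp (by positivity)
  have hS1 : sector θ (α / 2) r₁ ⊆ sector θ α r := sector_mono (by linarith) hr₁r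
  -- `g` is an inverse of the source coordinate.
  let g := Function.invFunOn φs (sector θ α r)
  have hpre : ∀ ρ, 0 < ρ → ∃ R > 0, ∀ W : ℂ, R < σ * W.im → |W.re| ≤ 2 →
      g W ∈ sector θ (α / 2) (min ρ r₁) ∧ deriv φs (g W) ≠ 0 ∧ φs (g W) = W := by
    intro ρ hρ
    obtain ⟨R, hR, h1⟩ := exists_preimage_strip (M := 2) hk hσ hθ hαπ hr hs.1 hslim
      (half_pos hα0) (by linarith) (lt_min hρ hr₁pos)
    refine ⟨R, hR, fun W hW hW2 => ?_⟩
    obtain ⟨z, hz, hd, hv⟩ := h1 W hW hW2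
    have : g W = z := invFunOn_eq hs.2.1 (hS1 (sector_mono le_rfl (min_le_right _ _) hz)) hv
    rw [this]
    exact ⟨hz, hd, hv⟩
  obtain ⟨R, hR, hg'⟩ := hpre r₁ hr₁pos
  rw [min_self] at hg'
  let Ψ₀ : ℂ → ℂ := fun W => φt (g W)
  have hΨ₀d : ∀ W : ℂ, R < σ * W.im → |W.re| ≤ 2 → DifferentiableAt ℂ Ψ₀ W := by
    intro W h1 h2
    obtain ⟨a1, a2, a3⟩ := hg' W h1 h2
    have h3 := hasDerivAt_invFunOn hopen hs.1 hs.2.1 (hS1 a1) a2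
    rw [a3] at h3
    exact (ht.1.differentiableAt (hopen.mem_nhds (hS1 a1))).comp W h3.differentiableAt
  have hΨ₀1 : ∀ W : ℂ, R < σ * W.im → |W.re| ≤ 2 → |(W + 1).re| ≤ 2 → Ψ₀ (W + 1) = Ψ₀ W + 1 := by
    intro W h1 h2 _
    obtain ⟨a1, a2, a3⟩ := hg' W h1 h2
    have h4 := hs.2.2 _ (hS1 a1) (hGS _ a1)
    have h5 : g (W + 1) = G (g W) := by
      refine invFunOn_eq hs.2.1 (hGS _ a1) ?_
      rw [h4, a3]
    simp only [Ψ₀]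
    rw [h5]
    exact ht.2.2 _ (hS1 a1) (hGS _ a1)
  -- Periodic extension from the strip `0 ≤ W.re < 1`.
  let Ψ : ℂ → ℂ := fun W => Ψ₀ (W - (⌊W.re⌋ : ℤ)) + (⌊W.re⌋ : ℤ)
  have hfl : ∀ W : ℂ, 0 ≤ (W - (⌊W.re⌋ : ℤ)).re ∧ (W - (⌊W.re⌋ : ℤ)).re < 1 := by
    intro W
    rw [sub_re, intCast_re]
    have := Int.floor_le W.re
    have := Int.lt_floor_add_one W.re
    constructor <;> linarith
  have hloc : ∀ (m : ℤ) (W : ℂ), R < σ * W.im → (m : ℝ) - 1 < W.re → W.re < m + 1 →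
      Ψ W = Ψ₀ (W - m) + m := by
    intro m W hW h1 h2
    have h3 : ⌊W.re⌋ = m ∨ ⌊W.re⌋ = m - 1 := by
      have h4 : m - 1 ≤ ⌊W.re⌋ := Int.le_floor.2 (by push_cast; linarith)
      have h5 : ⌊W.re⌋ < m + 1 := Int.floor_lt.2 (by push_cast; linarith)
      omega
    rcases h3 with h3 | h3
    · simp only [Ψ, h3]
    · simp only [Ψ, h3]
      have h4 : W - ((m - 1 : ℤ) : ℂ) = (W - m) + 1 := by push_cast; ring
      have him : (W - (m : ℂ)).im = W.im := by simp
      rw [h4, hΨ₀1]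
      · push_cast; ring
      · rwa [him]
      · rw [sub_re, intCast_re, abs_le]; constructor <;> linarith
      · rw [add_re, sub_re, intCast_re, one_re, abs_le]; constructor <;> linarith
  have himfl : ∀ (W : ℂ) (m : ℤ), (W - (m : ℂ)).im = W.im := by simp
  have hΨd : ∀ W : ℂ, R < σ * W.im → DifferentiableAt ℂ Ψ W := by
    intro W hW
    set m := ⌊W.re⌋ with hm
    have h1 : ∀ᶠ V : ℂ in 𝓝 W, Ψ V = Ψ₀ (V - m) + m := by
      have hfl' := hfl W
      rw [← hm, sub_re, intCast_re] at hfl'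
      have a1 : ∀ᶠ V : ℂ in 𝓝 W, R < σ * V.im :=
        (isOpen_lt continuous_const (by fun_prop)).mem_nhds hW
      have a2 : ∀ᶠ V : ℂ in 𝓝 W, (m : ℝ) - 1 < V.re :=
        (isOpen_lt continuous_const continuous_re).mem_nhds (by
          show (m : ℝ) - 1 < W.re; linarith)
      have a3 : ∀ᶠ V : ℂ in 𝓝 W, V.re < m + 1 :=
        (isOpen_lt continuous_re continuous_const).mem_nhds (by
          show W.re < (m : ℝ) + 1; linarith)
      filter_upwards [a1, a2, a3] with V b1 b2 b3 using hloc m V b1 b2 b3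
    have h2 : DifferentiableAt ℂ Ψ₀ (W - m) := by
      refine hΨ₀d _ (by rwa [himfl]) ?_
      have := hfl W
      rw [abs_le]; constructor <;> linarith
    have h3 : DifferentiableAt ℂ (fun V => Ψ₀ (V - m) + m) W :=
      (h2.comp W (differentiableAt_id.sub_const _)).add_const _
    exact h3.congr_of_eventuallyEq h1
  refine ⟨Ψ, ⟨R, hΨd⟩, fun W => ?_, fun ε hε => ?_, ?_⟩
  · have h1 : ⌊(W + 1).re⌋ = ⌊W.re⌋ + 1 := by rw [add_re, one_re, Int.floor_add_one]
    simp only [Ψ, h1]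
    have h2 : W + 1 - ((⌊W.re⌋ + 1 : ℤ) : ℂ) = W - (⌊W.re⌋ : ℤ) := by push_cast; ring
    rw [h2]; push_cast; ring
  · have h1 := (Metric.tendsto_nhds.1 hc) ε hε
    rw [eventually_nhdsWithin_iff] at h1
    obtain ⟨δ, hδ, h2⟩ := Metric.eventually_nhds_iff.1 h1
    obtain ⟨R', -, h3⟩ := hpre δ hδ
    refine ⟨R', fun W hW => ?_⟩
    have hf := hfl W
    obtain ⟨a1, -, a3⟩ := h3 (W - (⌊W.re⌋ : ℤ)) (by rwa [himfl]) (by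
      rw [abs_le]; constructor <;> linarith)
    have h4 := h2 (y := g (W - (⌊W.re⌋ : ℤ))) (by
      rw [dist_zero_right]; exact a1.2.1.trans_le (min_le_left _ _))
      (hS1 (sector_mono le_rfl (min_le_right _ _) a1))
    rw [dist_eq_norm, a3] at h4
    have h5 : Ψ W - W - c = φt (g (W - (⌊W.re⌋ : ℤ))) - (W - (⌊W.re⌋ : ℤ)) - c := by
      simp only [Ψ, Ψ₀]; ring
    rwa [h5]
  · obtain ⟨r₃, hr₃, him⟩ := tendsto_im_end hk hσ hθ hα0 hα hr hslim R
    set r₄ := min r₃ r with hr₄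
    have hr₄pos : 0 < r₄ := lt_min hr₃ hr
    have hsub : sector θ α r₄ ⊆ sector θ α r := sector_mono le_rfl (min_le_right _ _)
    have hopen4 : IsOpen (sector θ α r₄) := isOpen_sector hαπ
    have hA : AnalyticOnNhd ℂ (fun z => Ψ (φs z)) (sector θ α r₄) := by
      refine DifferentiableOn.analyticOnNhd (fun z hz => ?_) hopen4
      have h1 := hΨd (φs z) (him z (sector_mono le_rfl (min_le_left _ _) hz))
      exact (h1.comp z (hs.1.differentiableAt (hopen.mem_nhds (hsub hz)))).differentiableWithinAt
    have hB : AnalyticOnNhd ℂ φt (sector θ α r₄) := (ht.1.mono hsub).analyticOnNhd hopen4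
    obtain ⟨R', hR', h3⟩ := hpre r₄ hr₄pos
    set W₀ : ℂ := ((1 / 2 : ℝ) : ℂ) + ((σ * (max R R' + 1) : ℝ) : ℂ) * I with hW₀
    have hσ2 : σ * σ = 1 := by rcases hσ with rfl | rfl <;> norm_num
    have hW₀im : σ * W₀.im = max R R' + 1 := by
      have : W₀.im = σ * (max R R' + 1) := by simp [hW₀]
      rw [this, ← mul_assoc, hσ2, one_mul]
    have hW₀re : W₀.re = 1 / 2 := by simp [hW₀]
    obtain ⟨a1, -, a3⟩ := h3 W₀ (by rw [hW₀im]; linarith [le_max_right R R'])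
      (by rw [hW₀re]; norm_num)
    have ha4 : g W₀ ∈ sector θ α r₄ := sector_mono (by linarith) (min_le_left _ _) a1
    have hcont : ContinuousAt φs (g W₀) :=
      (hs.1.differentiableAt (hopen.mem_nhds (hsub ha4))).continuousAt
    have hEq : ∀ᶠ z in 𝓝 (g W₀), Ψ (φs z) = φt z := by
      have b1 : ∀ᶠ W : ℂ in 𝓝 (φs (g W₀)), R < σ * W.im ∧ 0 < W.re ∧ W.re < 1 := by
        rw [a3]
        have c1 : ∀ᶠ V : ℂ in 𝓝 W₀, R < σ * V.im :=
          (isOpen_lt continuous_const (by fun_prop)).mem_nhds (by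
            show R < σ * W₀.im
            rw [hW₀im]; linarith [le_max_left R R'])
        have c2 : ∀ᶠ V : ℂ in 𝓝 W₀, 0 < V.re :=
          (isOpen_lt continuous_const continuous_re).mem_nhds (by
            show 0 < W₀.re; rw [hW₀re]; norm_num)
        have c3 : ∀ᶠ V : ℂ in 𝓝 W₀, V.re < 1 :=
          (isOpen_lt continuous_re continuous_const).mem_nhds (by
            show W₀.re < 1; rw [hW₀re]; norm_num)
        filter_upwards [c1, c2, c3] with V d1 d2 d3 using ⟨d1, d2, d3⟩
      filter_upwards [hcont.eventually b1, hopen4.mem_nhds ha4] with z ⟨d1, d2, d3⟩ d4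
      rw [hloc 0 (φs z) d1 (by push_cast; linarith) (by push_cast; linarith)]
      simp only [Int.cast_zero, sub_zero, add_zero, Ψ₀, g]
      rw [invFunOn_eq hs.2.1 (hsub d4) rfl]
    -- The identity theorem spreads the relation from a neighbourhood of one point of the
    -- overlap.
    have hfin := hA.eqOn_of_preconnected_of_eventuallyEq hB (isPreconnected_sector hαπ) ha4 hEq
    rw [eventually_nhdsWithin_iff]
    filter_upwards [Metric.ball_mem_nhds (0 : ℂ) hr₄pos] with z hz hzS
    rw [mem_ball_zero_iff] at hz
    exact hfin ⟨hzS.1, hz, hzS.2.2⟩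

/-! ### Parity of indices and reflections of sectors -/

lemma odd_val_intCast {k : ℕ} (hk : 1 ≤ k) (a : ℤ) : Odd (a : ZMod (2 * k)).val ↔ Odd a := by
  obtain ⟨m, hm⟩ := exists_val_intCast hk a
  rw [← Int.odd_coe_nat, hm, mul_assoc, Int.odd_add]
  simp

lemma exists_intCast_eq {k : ℕ} (hk : 1 ≤ k) (j : ZMod (2 * k)) : ∃ a : ℤ, (a : ZMod (2 * k)) = j :=
  ⟨j.val, natCast_zmod_val' hk j⟩

lemma reflectIndex_intCast (k ℓ : ℕ) (a : ℤ) :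
    reflectIndex k ℓ (a : ZMod (2 * k)) = ((2 * ℓ + 1 - a : ℤ) : ZMod (2 * k)) := by
  simp [reflectIndex]

lemma reflectIndex_reflectIndex (k ℓ : ℕ) (j : ZMod (2 * k)) :
    reflectIndex k ℓ (reflectIndex k ℓ j) = j := by
  simp [reflectIndex]

lemma odd_reflectIndex {k : ℕ} (hk : 1 ≤ k) (ℓ : ℕ) (j : ZMod (2 * k)) :
    Odd (reflectIndex k ℓ j).val ↔ ¬ Odd j.val := by
  obtain ⟨a, rfl⟩ := exists_intCast_eq hk j
  rw [reflectIndex_intCast, odd_val_intCast hk, odd_val_intCast hk]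
  rw [Int.not_odd_iff_even]
  constructor
  · rintro ⟨m, hm⟩; exact ⟨ℓ - m, by linarith⟩
  · rintro ⟨m, hm⟩; exact ⟨ℓ - m, by linarith⟩

lemma endSign_reflectIndex {k : ℕ} (hk : 1 ≤ k) (ℓ : ℕ) (j : ZMod (2 * k)) :
    endSign k (reflectIndex k ℓ j) = -endSign k j := by
  unfold endSign
  by_cases h : Odd j.val
  · rw [if_pos h, if_neg (by rw [odd_reflectIndex hk]; exact not_not.2 h)]
  · rw [if_neg h, if_pos ((odd_reflectIndex hk ℓ j).2 h), neg_neg]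

lemma srcIndex_reflectIndex {k : ℕ} (hk : 1 ≤ k) (ℓ : ℕ) (j : ZMod (2 * k)) :
    srcIndex k (reflectIndex k ℓ j) = 2 * (ℓ : ZMod (2 * k)) - srcIndex k j := by
  unfold srcIndex
  by_cases h : Odd j.val
  · rw [if_pos h, if_neg (by rw [odd_reflectIndex hk]; exact not_not.2 h), reflectIndex]; ring
  · rw [if_neg h, if_pos ((odd_reflectIndex hk ℓ j).2 h), reflectIndex]; ring

lemma tgtIndex_reflectIndex {k : ℕ} (hk : 1 ≤ k) (ℓ : ℕ) (j : ZMod (2 * k)) :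
    tgtIndex k (reflectIndex k ℓ j) = 2 * (ℓ : ZMod (2 * k)) - tgtIndex k j := by
  unfold tgtIndex
  by_cases h : Odd j.val
  · rw [if_pos h, if_neg (by rw [odd_reflectIndex hk]; exact not_not.2 h), reflectIndex]; ring
  · rw [if_neg h, if_pos ((odd_reflectIndex hk ℓ j).2 h), reflectIndex]; ring

lemma sector_midAngle_intCast {k : ℕ} (hk : 1 ≤ k) (a : ℤ) (α r : ℝ) :
    sector (midAngle k (a : ZMod (2 * k))) α r = sector ((2 * a - 1) * Real.pi / (2 * k)) α r := by
  obtain ⟨m, hm⟩ := exists_val_intCast hk a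
  have hk0 : (k : ℝ) ≠ 0 := by exact_mod_cast (by omega : k ≠ 0)
  have h : (((a : ZMod (2 * k)).val : ℕ) : ℝ) = a + 2 * k * m := by exact_mod_cast hm
  have h2 : midAngle k (a : ZMod (2 * k)) = (2 * a - 1) * Real.pi / (2 * k) + 2 * Real.pi * m := by
    rw [midAngle, h]; field_simp; ring
  rw [h2, sector_add_two_pi]

lemma axisCoeff_mul_conj_mem_sector {k : ℕ} (ℓ : ℕ) {ψ α r ε : ℝ} (hα : α + ε ≤ Real.pi)
    {z x : ℂ} (hz : z ∈ sector ψ α r) (hx : ‖x‖ ≤ ε) :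
    axisCoeff k ℓ * conj z * exp x ∈
      sector (2 * ℓ * Real.pi / k - ψ) (α + ε) (r * Real.exp ε) := by
  have hε : 0 ≤ ε := (norm_nonneg x).trans hx
  obtain ⟨ζ, h1, h2, rfl⟩ := (mem_sector_iff (by linarith)).1 hz
  refine mul_exp_mem_sector hα ?_ hx
  have him : (2 * (Real.pi : ℂ) * I * ℓ / k).im = 2 * ℓ * Real.pi / k := by
    have : (2 * (Real.pi : ℂ) * I * ℓ / k) = ((2 * ℓ * Real.pi / k : ℝ) : ℂ) * I := by
      push_cast; ring
    rw [this]; simp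
  have hre : (2 * (Real.pi : ℂ) * I * ℓ / k).re = 0 := by
    have : (2 * (Real.pi : ℂ) * I * ℓ / k) = ((2 * ℓ * Real.pi / k : ℝ) : ℂ) * I := by
      push_cast; ring
    rw [this]; simp
  refine (mem_sector_iff (by linarith)).2 ⟨2 * Real.pi * I * ℓ / k + conj ζ, ?_, ?_, ?_⟩
  · rw [add_re, hre, conj_re, zero_add]; exact h1
  · rw [add_im, him, conj_im, ← abs_neg]
    convert h2 using 2
    ring
  · rw [exp_add, axisCoeff, exp_conj]

lemma sector_reflect_petal {k : ℕ} (hk : 1 ≤ k) (ℓ : ℕ) (i : ZMod (2 * k)) (α r : ℝ) :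
    sector (2 * ℓ * Real.pi / k - i.val * Real.pi / k) α r =
      sector ((2 * (ℓ : ZMod (2 * k)) - i).val * Real.pi / k) α r := by
  have h : (2 * (ℓ : ZMod (2 * k)) - i) = ((2 * ℓ - (i.val : ℤ) : ℤ) : ZMod (2 * k)) := by
    push_cast
    congr 1
    exact_mod_cast (natCast_zmod_val' hk i).symm
  rw [h, sector_intCast hk]
  congr 1
  push_cast
  ring

lemma sector_reflect_mid {k : ℕ} (hk : 1 ≤ k) (ℓ : ℕ) (j : ZMod (2 * k)) (α r : ℝ) :
    sector (2 * ℓ * Real.pi / k - midAngle k j) α r =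
      sector (midAngle k (reflectIndex k ℓ j)) α r := by
  have hk0 : (k : ℝ) ≠ 0 := by exact_mod_cast (by omega : k ≠ 0)
  have h : reflectIndex k ℓ j = ((2 * ℓ + 1 - (j.val : ℤ) : ℤ) : ZMod (2 * k)) := by
    rw [← reflectIndex_intCast, natCast_zmod_val' hk]
  rw [h, sector_midAngle_intCast hk, midAngle]
  congr 1
  push_cast
  field_simp
  ring

/-! ### Families of Fatou coordinates -/

/-- A family of Fatou coordinates on all petals of half-opening `α` and radius `r`, asymptotic to
the time coordinates up to the constants `c`. -/
structure IsFatouFamily (k : ℕ) (b : ℂ) (G : ℂ → ℂ) (α r : ℝ) (c : ZMod (2 * k) → ℂ)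
    (φ : ZMod (2 * k) → ℂ → ℂ) : Prop where
  coord : ∀ j, IsFatouCoordinate G (sector (j.val * Real.pi / k) α r) (φ j)
  asymp : ∀ j, Tendsto (fun z => φ j z - timeCoordinate k b (j.val * Real.pi / k) z)
    (𝓝[sector (j.val * Real.pi / k) α r] 0) (𝓝 (c j))

namespace IsFatouFamily

variable {k : ℕ} {b : ℂ} {G : ℂ → ℂ} {α r : ℝ} {c : ZMod (2 * k) → ℂ} {φ : ZMod (2 * k) → ℂ → ℂ}

lemma mono (h : IsFatouFamily k b G α r c φ) {α' r' : ℝ} (hα : α' ≤ α) (hr : r' ≤ r) :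
    IsFatouFamily k b G α' r' c φ where
  coord j := ⟨(h.coord j).1.mono (sector_mono hα hr), (h.coord j).2.1.mono (sector_mono hα hr),
    fun z hz hz' => (h.coord j).2.2 z (sector_mono hα hr hz) (sector_mono hα hr hz')⟩
  asymp j := (h.asymp j).mono_left (nhdsWithin_mono _ (sector_mono hα hr))

lemma tendsto_mul_pow (h : IsFatouFamily k b G α r c φ) (hk : 1 ≤ k) (j : ZMod (2 * k)) :
    Tendsto (fun z => φ j z * z ^ k) (𝓝[sector (j.val * Real.pi / k) α r] 0) (𝓝 (-1 / k)) :=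
  tendsto_mul_pow_of_timeCoordinate hk (fun _ hz => ne_zero_of_mem_sector hz) (h.asymp j)

lemma add_const (h : IsFatouFamily k b G α r c φ) (D : ZMod (2 * k) → ℂ) :
    IsFatouFamily k b G α r (fun j => c j + D j) (fun j z => φ j z + D j) where
  coord j := by
    refine ⟨(h.coord j).1.add_const _, fun z hz z' hz' hzz' => ?_, fun z hz hz' => ?_⟩
    · exact (h.coord j).2.1 hz hz' (add_right_cancel hzz')
    · beta_reduce
      rw [(h.coord j).2.2 z hz hz']; ring
  asymp j := ((h.asymp j).add_const (D j)).congr fun z => by ring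

end IsFatouFamily

lemma sub_one_eq_intCast {k : ℕ} (hk : 1 ≤ k) (j : ZMod (2 * k)) :
    j - 1 = (((j.val : ℤ) - 1 : ℤ) : ZMod (2 * k)) := by
  rw [Int.cast_sub, natCast_zmod_val' hk]; simp

lemma pi_div_two_mul_lt {k : ℕ} (hk : 1 ≤ k) {α : ℝ} (hα : α < Real.pi / k) :
    k * (α - Real.pi / (2 * k)) < Real.pi / 2 := by
  have hkR : (0 : ℝ) < k := by exact_mod_cast hk
  rw [lt_div_iff₀ hkR] at hα
  have : (k : ℝ) * (α - Real.pi / (2 * k)) = α * k - Real.pi / 2 := by field_simp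
  linarith

lemma lt_pi_of_lt {k : ℕ} (hk : 1 ≤ k) {α : ℝ} (hα : α < Real.pi / k) : α ≤ Real.pi := by
  have hkR : (1 : ℝ) ≤ k := by exact_mod_cast hk
  rw [lt_div_iff₀ (by linarith)] at hα
  nlinarith [Real.pi_pos]

/-- Points of the sector `j` in logarithmic coordinates, with their position relative to the two
adjacent rays. -/
lemma mem_mid_sector {k : ℕ} (hk : 1 ≤ k) {α r : ℝ} (hα : α < Real.pi / k) {j : ZMod (2 * k)} {z : ℂ}
    (hz : z ∈ sector (midAngle k j) (α - Real.pi / (2 * k)) r) :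
    ∃ ζ : ℂ, Real.exp ζ.re < r ∧ |ζ.im - j.val * Real.pi / k| < α ∧
      |ζ.im - (j.val - 1) * Real.pi / k| < α ∧ exp ζ = z := by
  have hkR : (0 : ℝ) < k := by exact_mod_cast hk
  have hpos : 0 < Real.pi / (2 * k) := by positivity
  obtain ⟨ζ, h1, h2, h3⟩ := (mem_sector_iff (by linarith [lt_pi_of_lt hk hα])).1 hz
  have h4 := abs_lt.1 h2
  have e1 : midAngle k j = j.val * Real.pi / k - Real.pi / (2 * k) := by
    rw [midAngle]; field_simp
  have e2 : midAngle k j = (j.val - 1) * Real.pi / k + Real.pi / (2 * k) := by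
    rw [midAngle]; field_simp; ring
  refine ⟨ζ, h1, abs_lt.2 ⟨?_, ?_⟩, abs_lt.2 ⟨?_, ?_⟩, h3⟩
  · linarith
  · linarith
  · linarith
  · linarith

lemma mid_sector_subset {k : ℕ} (hk : 1 ≤ k) {α r : ℝ} (hα : α < Real.pi / k) (j : ZMod (2 * k)) :
    sector (midAngle k j) (α - Real.pi / (2 * k)) r ⊆ sector (j.val * Real.pi / k) α r ∧
    sector (midAngle k j) (α - Real.pi / (2 * k)) r ⊆ sector ((j - 1).val * Real.pi / k) α r := by
  constructor
  · intro z hz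
    obtain ⟨ζ, h1, h2, -, h3⟩ := mem_mid_sector hk hα hz
    exact (mem_sector_iff (lt_pi_of_lt hk hα)).2 ⟨ζ, h1, h2, h3⟩
  · intro z hz
    obtain ⟨ζ, h1, -, h2, h3⟩ := mem_mid_sector hk hα hz
    rw [sub_one_eq_intCast hk, sector_intCast hk]
    exact (mem_sector_iff (lt_pi_of_lt hk hα)).2 ⟨ζ, h1, by push_cast; exact h2, h3⟩

lemma mid_sector_subset_src {k : ℕ} (hk : 1 ≤ k) {α r : ℝ} (hα : α < Real.pi / k)
    (j : ZMod (2 * k)) : sector (midAngle k j) (α - Real.pi / (2 * k)) r ⊆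
      sector ((srcIndex k j).val * Real.pi / k) α r := by
  unfold srcIndex
  split_ifs
  · exact (mid_sector_subset hk hα j).2
  · exact (mid_sector_subset hk hα j).1

lemma mid_sector_subset_tgt {k : ℕ} (hk : 1 ≤ k) {α r : ℝ} (hα : α < Real.pi / k)
    (j : ZMod (2 * k)) : sector (midAngle k j) (α - Real.pi / (2 * k)) r ⊆
      sector ((tgtIndex k j).val * Real.pi / k) α r := by
  unfold tgtIndex
  split_ifs
  · exact (mid_sector_subset hk hα j).1
  · exact (mid_sector_subset hk hα j).2

lemma timeCoordinate_sub {k : ℕ} (hk : 1 ≤ k) {b : ℂ} {α r : ℝ} (hα : α < Real.pi / k)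
    {j : ZMod (2 * k)} {z : ℂ} (hz : z ∈ sector (midAngle k j) (α - Real.pi / (2 * k)) r) :
    timeCoordinate k b ((tgtIndex k j).val * Real.pi / k) z -
      timeCoordinate k b ((srcIndex k j).val * Real.pi / k) z = normalizedConstant k b j := by
  have hαπ := lt_pi_of_lt hk hα
  have hk0 : (k : ℂ) ≠ 0 := by exact_mod_cast (by omega : k ≠ 0)
  obtain ⟨ζ, h1, h2, h3, rfl⟩ := mem_mid_sector hk hα hz
  have e1 := timeCoordinate_of_mem (k := k) (b := b) (h2.trans_le hαπ)
  have e2 := timeCoordinate_of_mem (k := k) (b := b) (h3.trans_le hαπ)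
  have e3 : timeCoordinate k b ((j - 1).val * Real.pi / k) =
      timeCoordinate k b ((j.val - 1) * Real.pi / k) := by
    rw [sub_one_eq_intCast hk, timeCoordinate_intCast hk]; push_cast; rfl
  unfold tgtIndex srcIndex normalizedConstant
  split_ifs
  · rw [e3, e1, e2]; push_cast; field_simp; ring
  · rw [e3, e1, e2]; push_cast; field_simp; ring

namespace IsFatouFamily

variable {k : ℕ} {b : ℂ} {G : ℂ → ℂ} {α r : ℝ} {c : ZMod (2 * k) → ℂ} {φ : ZMod (2 * k) → ℂ → ℂ}

lemma coord_src (h : IsFatouFamily k b G α r c φ) (hk : 1 ≤ k) (hα : α < Real.pi / k)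
    (j : ZMod (2 * k)) :
    IsFatouCoordinate G (sector (midAngle k j) (α - Real.pi / (2 * k)) r) (φ (srcIndex k j)) := by
  have hsub := mid_sector_subset_src (r := r) hk hα j
  exact ⟨(h.coord _).1.mono hsub, (h.coord _).2.1.mono hsub,
    fun z hz hz' => (h.coord _).2.2 z (hsub hz) (hsub hz')⟩

lemma coord_tgt (h : IsFatouFamily k b G α r c φ) (hk : 1 ≤ k) (hα : α < Real.pi / k)
    (j : ZMod (2 * k)) :
    IsFatouCoordinate G (sector (midAngle k j) (α - Real.pi / (2 * k)) r) (φ (tgtIndex k j)) := by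
  have hsub := mid_sector_subset_tgt (r := r) hk hα j
  exact ⟨(h.coord _).1.mono hsub, (h.coord _).2.1.mono hsub,
    fun z hz hz' => (h.coord _).2.2 z (hsub hz) (hsub hz')⟩

lemma tendsto_src (h : IsFatouFamily k b G α r c φ) (hk : 1 ≤ k) (hα : α < Real.pi / k)
    (j : ZMod (2 * k)) :
    Tendsto (fun z => φ (srcIndex k j) z * z ^ k)
      (𝓝[sector (midAngle k j) (α - Real.pi / (2 * k)) r] 0) (𝓝 (-1 / k)) :=
  (h.tendsto_mul_pow hk _).mono_left (nhdsWithin_mono _ (mid_sector_subset_src hk hα j))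

/-- Transition functions of a family of Fatou coordinates with a common constant: they form a
representative of the modulus. -/
theorem exists_modulus (hk : 1 ≤ k) (hG0 : G 0 = 0) (hG1 : HasDerivAt G 1 0)
    (hα1 : Real.pi / (2 * k) < α) (hα : α < Real.pi / k) (hr : 0 < r) {D : ℂ}
    (h : IsFatouFamily k b G α r (fun _ => D) φ) :
    ∃ Ψ : ZMod (2 * k) → ℂ → ℂ, IsModulusRepresentative k b G Ψ ∧
      ∀ j, ∀ᶠ z in 𝓝[sector (midAngle k j) (α - Real.pi / (2 * k)) r] 0,
        Ψ j (φ (srcIndex k j) z) = φ (tgtIndex k j) z := by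
  have hkey : ∀ j : ZMod (2 * k), ∃ Ψ : ℂ → ℂ, IsNormalizedGerm k b j Ψ ∧
      ∀ᶠ z in 𝓝[sector (midAngle k j) (α - Real.pi / (2 * k)) r] 0,
        Ψ (φ (srcIndex k j) z) = φ (tgtIndex k j) z := by
    intro j
    have hc : Tendsto (fun z => φ (tgtIndex k j) z - φ (srcIndex k j) z)
        (𝓝[sector (midAngle k j) (α - Real.pi / (2 * k)) r] 0) (𝓝 (normalizedConstant k b j)) := by
      have h1 := (h.asymp (tgtIndex k j)).mono_left
        (nhdsWithin_mono _ (mid_sector_subset_tgt hk hα j))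
      have h2 := (h.asymp (srcIndex k j)).mono_left
        (nhdsWithin_mono _ (mid_sector_subset_src hk hα j))
      have h3 := (h1.sub h2).add_const (normalizedConstant k b j)
      rw [sub_self, zero_add] at h3
      refine h3.congr' ?_
      filter_upwards [self_mem_nhdsWithin] with z hz
      rw [← timeCoordinate_sub (b := b) hk hα hz]
      ring
    obtain ⟨Ψ, ⟨R, h1⟩, h2, h3, h4⟩ := exists_transition hk hG0 hG1 (endSign_eq k j)
      (exp_midAngle hk j) (by linarith) (pi_div_two_mul_lt hk hα) hr (h.coord_src hk hα j)
      (h.coord_tgt hk hα j) (h.tendsto_src hk hα j) hc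
    refine ⟨Ψ, ⟨eventually_cylinderEnd.2 ⟨R, h1⟩, Eventually.of_forall h2, ?_⟩, h4⟩
    rw [Metric.tendsto_nhds]
    intro ε hε
    obtain ⟨R', hR'⟩ := h3 ε hε
    refine eventually_cylinderEnd.2 ⟨R', fun W hW => ?_⟩
    rw [dist_eq_norm]
    exact hR' W hW
  choose Ψ hΨ1 hΨ2 using hkey
  refine ⟨Ψ, ⟨α, r, φ, hα1, hα, hr, h.coord, hΨ1, fun j => ?_⟩, hΨ2⟩
  refine (hΨ2 j).mono fun z hz => ?_
  unfold srcIndex tgtIndex at hz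
  split_ifs at hz ⊢ <;> exact hz

/-- A property of points of the cylinder which holds at the values of a Fatou coordinate near the
origin holds near the end of the cylinder. -/
theorem end_induction (h : IsFatouFamily k b G α r c φ) (hk : 1 ≤ k)
    (hα1 : Real.pi / (2 * k) < α) (hα : α < Real.pi / k) (hr : 0 < r) (j : ZMod (2 * k))
    {P : ℂ → Prop}
    (hP : ∀ᶠ z in 𝓝[sector (midAngle k j) (α - Real.pi / (2 * k)) r] 0, P (φ (srcIndex k j) z))
    (hper : ∀ᶠ W in cylinderEnd k j, (P (W + 1) ↔ P W)) : ∀ᶠ W in cylinderEnd k j, P W := by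
  rw [eventually_nhdsWithin_iff] at hP
  obtain ⟨δ, hδ, hP'⟩ := Metric.eventually_nhds_iff.1 hP
  obtain ⟨R₁, hR₁⟩ := eventually_cylinderEnd.1 hper
  have hpos : 0 < α - Real.pi / (2 * k) := by linarith
  have hle : α - Real.pi / (2 * k) ≤ Real.pi := by
    have : 0 ≤ Real.pi / (2 * k) := by positivity
    linarith [lt_pi_of_lt hk hα]
  obtain ⟨R₂, -, hR₂⟩ := exists_preimage_strip (M := 1) hk (endSign_eq k j) (exp_midAngle hk j) hle hr
    (h.coord_src hk hα j).1 (h.tendsto_src hk hα j) hpos le_rfl (lt_min hδ hr)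
  refine eventually_cylinderEnd.2 ⟨max R₁ R₂, fun W hW => ?_⟩
  -- By periodicity it is enough to treat the points with `|W.re| ≤ 1`.
  have hint : ∀ (m : ℕ) (V : ℂ), R₁ < endSign k j * V.im → (P (V + m) ↔ P V) := by
    intro m
    induction m with
    | zero => simp
    | succ m ih =>
      intro V hV
      have h1 := hR₁ (V + m) (by simpa using hV)
      rw [show V + ((m + 1 : ℕ) : ℂ) = V + m + 1 by push_cast; ring, h1, ih V hV]
  have hintZ : ∀ (m : ℤ) (V : ℂ), R₁ < endSign k j * V.im → (P (V + m) ↔ P V) := by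
    intro m V hV
    obtain ⟨n, rfl | rfl⟩ := m.eq_nat_or_neg
    · exact_mod_cast hint n V hV
    · have h1 := hint n (V + ((-(n : ℤ) : ℤ) : ℂ)) (by simpa using hV)
      rw [← h1]
      push_cast
      rw [neg_add_cancel_right]
  have hW1 : R₁ < endSign k j * W.im := (le_max_left _ _).trans_lt hW
  have hW2 : R₂ < endSign k j * W.im := (le_max_right _ _).trans_lt hW
  have h1 := hintZ (-⌊W.re⌋) W hW1
  rw [← h1]
  obtain ⟨z, hz, -, hv⟩ := hR₂ (W + ((-⌊W.re⌋ : ℤ) : ℂ)) (by simpa using hW2) (by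
    have e1 := Int.floor_le W.re
    have e2 := Int.lt_floor_add_one W.re
    rw [add_re, intCast_re, abs_le]
    push_cast
    constructor <;> linarith)
  rw [← hv]
  exact hP' (by rw [dist_zero_right]; exact hz.2.1.trans_le (min_le_left _ _))
    (sector_mono le_rfl (min_le_right _ _) hz)

end IsFatouFamily

/-! ### Gluing functions on the petals -/

/-- Every point `≠ 0` lies within the half-opening `π/(2k)` of a ray of some petal. -/
lemma exists_nearest_ray {k : ℕ} (hk : 1 ≤ k) (x : ℝ) :
    ∃ a : ℤ, |x - a * Real.pi / k| ≤ Real.pi / (2 * k) := by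
  have hkR : (0 : ℝ) < k := by exact_mod_cast hk
  refine ⟨round (x * k / Real.pi), ?_⟩
  have h := abs_sub_round (x * k / Real.pi)
  have e : x - round (x * k / Real.pi) * Real.pi / k =
      (x * k / Real.pi - round (x * k / Real.pi)) * (Real.pi / k) := by
    have := Real.pi_ne_zero
    field_simp
  rw [e, abs_mul, abs_of_pos (by positivity : 0 < Real.pi / k)]
  calc _ ≤ 1 / 2 * (Real.pi / k) := by gcongr
    _ = _ := by field_simp

/-- The petals cover a punctured disc. -/
lemma exists_mem_petal {k : ℕ} (hk : 1 ≤ k) {α r : ℝ} (hα1 : Real.pi / (2 * k) < α)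
    (hα : α < Real.pi / k) {z : ℂ} (hz : z ≠ 0) (hr : ‖z‖ < r) :
    ∃ j : ZMod (2 * k), z ∈ sector (j.val * Real.pi / k) α r := by
  obtain ⟨a, ha⟩ := exists_nearest_ray hk (log z).im
  refine ⟨(a : ZMod (2 * k)), ?_⟩
  rw [sector_intCast hk]
  refine (mem_sector_iff (lt_pi_of_lt hk hα)).2 ⟨log z, ?_, ha.trans_lt hα1, exp_log hz⟩
  rw [log_re, Real.exp_log (norm_pos_iff.2 hz)]
  exact hr

lemma eventually_punctured_of_petals {k : ℕ} (hk : 1 ≤ k) {α r : ℝ} (hr : 0 < r)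
    (hα1 : Real.pi / (2 * k) < α) (hα : α < Real.pi / k) {P : ℂ → Prop}
    (h : ∀ j : ZMod (2 * k), ∀ᶠ z in 𝓝[sector (j.val * Real.pi / k) α r] 0, P z) :
    ∀ᶠ z in 𝓝[≠] (0 : ℂ), P z := by
  have : NeZero (2 * k) := ⟨by omega⟩
  have h1 : ∀ᶠ z in 𝓝 (0 : ℂ), ∀ j : ZMod (2 * k), z ∈ sector (j.val * Real.pi / k) α r → P z :=
    eventually_all.2 fun j => eventually_nhdsWithin_iff.1 (h j)
  rw [eventually_nhdsWithin_iff]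
  filter_upwards [h1, Metric.ball_mem_nhds (0 : ℂ) hr] with z hz hz2 hz0
  obtain ⟨j, hj⟩ := exists_mem_petal hk hα1 hα hz0 (by simpa using hz2)
  exact hz j hj

/-- Functions on the petals that agree on the intersections of consecutive petals come from one
function on the punctured disc. -/
lemma exists_glue {k : ℕ} (hk : 1 ≤ k) {α r : ℝ}
    (hα : α < Real.pi / k) (f : ZMod (2 * k) → ℂ → ℂ)
    (h : ∀ j : ZMod (2 * k), ∀ z ∈ sector (midAngle k j) (α - Real.pi / (2 * k)) r,
      f (j - 1) z = f j z) :
    ∃ F : ℂ → ℂ, ∀ j : ZMod (2 * k), ∀ z ∈ sector (j.val * Real.pi / k) α r, F z = f j z := by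
  have hkR : (0 : ℝ) < k := by exact_mod_cast hk
  have hαπ := lt_pi_of_lt hk hα
  choose a ha using exists_nearest_ray hk
  refine ⟨fun z => f (a (log z).im : ZMod (2 * k)) z, fun j z hz => ?_⟩
  obtain ⟨ζ, h1, h2, rfl⟩ := (mem_sector_iff hαπ).1 hz
  obtain ⟨m, hm⟩ := exp_eq_exp_iff_exists_int.1 (exp_log (exp_ne_zero ζ))
  have hre : (log (exp ζ)).re = ζ.re := by rw [hm]; simp
  have him : (log (exp ζ)).im = ζ.im + 2 * Real.pi * m := by rw [hm]; simp; ring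
  -- the index of the petal, lifted so that it belongs to the principal argument
  obtain ⟨c, hc, hcj⟩ : ∃ c : ℤ, |(log (exp ζ)).im - c * Real.pi / k| < α ∧
      (c : ZMod (2 * k)) = j := by
    refine ⟨(j.val : ℤ) + 2 * k * m, ?_, ?_⟩
    · rw [him]; convert h2 using 2; push_cast; field_simp; ring
    · have : ((2 * k : ℤ) : ZMod (2 * k)) = 0 := by exact_mod_cast ZMod.natCast_self (2 * k)
      rw [Int.cast_add, natCast_zmod_val' hk, Int.cast_mul, this, zero_mul, add_zero]
  rw [← hcj]
  have h3 := ha (log (exp ζ)).im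
  beta_reduce
  generalize a (log (exp ζ)).im = d at *
  have h4 := abs_lt.1 hc
  have h5 := abs_le.1 h3
  have e : ∀ x : ℝ, x * Real.pi / k = x * (Real.pi / k) := fun x => by ring
  have e2 : Real.pi / (2 * k) = (Real.pi / k) / 2 := by field_simp
  have hp : 0 < Real.pi / k := by positivity
  rw [e] at h4 h5
  rw [e2] at h5
  generalize hq : Real.pi / k = q at *
  have h6 : (d - c : ℝ) < 2 := by by_contra hcon; nlinarith
  have h7 : (-2 : ℝ) < d - c := by by_contra hcon; nlinarith
  have h8 : d - c < 2 := by exact_mod_cast h6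
  have h9 : -2 < d - c := by exact_mod_cast h7
  have hmem : ∀ i : ℤ, |(log (exp ζ)).im - (i * q - q / 2)| < α - q / 2 →
      exp ζ ∈ sector (midAngle k (i : ZMod (2 * k))) (α - Real.pi / (2 * k)) r := by
    intro i hi
    rw [sector_midAngle_intCast hk]
    refine (mem_sector_iff (by rw [e2]; linarith)).2 ⟨log (exp ζ), by rw [hre]; exact h1, ?_,
      exp_log (exp_ne_zero _)⟩
    rw [e2]
    convert hi using 3
    rw [← hq]; field_simp
  obtain hd | hd | hd : d = c ∨ d = c + 1 ∨ d = c - 1 := by omega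
  · rw [hd]
  · have := h (d : ZMod (2 * k)) (exp ζ) (hmem d (abs_lt.2 (by
      subst hd; push_cast at *; constructor <;> nlinarith)))
    rw [← this, hd]; push_cast; congr 1; ring
  · have := h (c : ZMod (2 * k)) (exp ζ) (hmem c (abs_lt.2 (by
      subst hd; push_cast at *; constructor <;> nlinarith)))
    rw [← this, hd]; push_cast; rfl

/-- Holomorphic functions on the petals that agree on the intersections of consecutive petals and
have the limit `L` at the origin come from one germ of a holomorphic function. -/
theorem exists_analyticAt_glue {k : ℕ} (hk : 1 ≤ k) {α r : ℝ} (hr : 0 < r)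
    (hα1 : Real.pi / (2 * k) < α) (hα : α < Real.pi / k) (f : ZMod (2 * k) → ℂ → ℂ) {L : ℂ}
    (hd : ∀ j, DifferentiableOn ℂ (f j) (sector (j.val * Real.pi / k) α r))
    (h : ∀ j : ZMod (2 * k), ∀ z ∈ sector (midAngle k j) (α - Real.pi / (2 * k)) r,
      f (j - 1) z = f j z)
    (hL : ∀ j : ZMod (2 * k), Tendsto (f j) (𝓝[sector (j.val * Real.pi / k) α r] 0) (𝓝 L)) :
    ∃ F : ℂ → ℂ, AnalyticAt ℂ F 0 ∧ F 0 = L ∧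
      ∀ j : ZMod (2 * k), ∀ z ∈ sector (j.val * Real.pi / k) α r, F z = f j z := by
  obtain ⟨F, hF⟩ := exists_glue hk hα f h
  have hF' : ∀ j : ZMod (2 * k), ∀ z ∈ sector (j.val * Real.pi / k) α r,
      Function.update F 0 L z = f j z := by
    intro j z hz
    rw [Function.update_of_ne (ne_zero_of_mem_sector hz), hF j z hz]
  refine ⟨Function.update F 0 L, ?_, by simp, hF'⟩
  refine Complex.analyticAt_of_differentiable_on_punctured_nhds_of_continuousAt ?_ ?_
  · rw [eventually_nhdsWithin_iff]
    filter_upwards [Metric.ball_mem_nhds (0 : ℂ) hr] with z hz hz0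
    obtain ⟨j, hj⟩ := exists_mem_petal hk hα1 hα hz0 (by simpa using hz)
    have hn := (isOpen_sector (θ := j.val * Real.pi / k) (r := r) (lt_pi_of_lt hk hα)).mem_nhds hj
    exact ((hd j).differentiableAt hn).congr_of_eventuallyEq
      (Filter.eventuallyEq_of_mem hn fun w hw => hF' j w hw)
  · rw [continuousAt_update_same, tendsto_def]
    intro s hs
    refine eventually_punctured_of_petals hk hr hα1 hα fun j => ?_
    filter_upwards [hL j hs, self_mem_nhdsWithin] with z hz hz'
    rw [hF j z hz']
    exact hz

/-! ### Germs at the vertex of a sector -/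

/-- Neighbourhoods of the vertex in the sector of half-opening `β` about the ray of argument `θ`. -/
def sectorNhds (θ β : ℝ) : Filter ℂ := 𝓝[sector θ β 1] 0

lemma nhdsWithin_sector {θ β r : ℝ} (hr : 0 < r) : 𝓝[sector θ β r] 0 = sectorNhds θ β := by
  refine nhdsWithin_eq_nhdsWithin (s := Metric.ball 0 (min r 1)) (by simp [hr]) Metric.isOpen_ball ?_
  ext z
  simp only [sector, Set.mem_inter_iff, Set.mem_ofPred_eq, Metric.mem_ball, dist_zero_right, lt_min_iff]
  tauto

lemma eventually_sectorNhds {θ β r : ℝ} (hr : 0 < r) {P : ℂ → Prop} (h : ∀ z ∈ sector θ β r, P z) :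
    ∀ᶠ z in sectorNhds θ β, P z := by
  rw [← nhdsWithin_sector hr]
  exact eventually_nhdsWithin_of_forall h

lemma sectorNhds_mono {θ β β' : ℝ} (h : β ≤ β') : sectorNhds θ β ≤ sectorNhds θ β' :=
  nhdsWithin_mono _ (sector_mono h le_rfl)

lemma sectorNhds_le_nhds {θ β : ℝ} : sectorNhds θ β ≤ 𝓝 0 := nhdsWithin_le_nhds

lemma sectorNhds_neBot {θ β : ℝ} (hβ : 0 < β) (hβ' : β ≤ Real.pi) : (sectorNhds θ β).NeBot := by
  refine mem_closure_iff_nhdsWithin_neBot.1 ?_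
  rw [Metric.mem_closure_iff]
  intro ε hε
  refine ⟨exp (Real.log (min (ε / 2) (1 / 2)) + θ * I),
    (mem_sector_iff hβ').2 ⟨_, ?_, ?_, rfl⟩, ?_⟩
  · have hp : 0 < min (ε / 2) (1 / 2) := by positivity
    simp only [add_re, ofReal_re, mul_re, I_re, mul_zero, ofReal_im, I_im, mul_one, sub_self, add_zero]
    rw [Real.exp_log hp]
    exact (min_le_right _ _).trans_lt (by norm_num)
  · simpa using hβ
  · have hp : 0 < min (ε / 2) (1 / 2) := by positivity
    rw [dist_comm, dist_zero_right, norm_exp]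
    simp only [add_re, ofReal_re, mul_re, I_re, mul_zero, ofReal_im, I_im, mul_one, sub_self, add_zero]
    rw [Real.exp_log hp]
    exact (min_le_left _ _).trans_lt (by linarith)

lemma exists_sector_of_eventually {θ β : ℝ} {P : ℂ → Prop} (h : ∀ᶠ z in sectorNhds θ β, P z) :
    ∃ r > 0, ∀ z ∈ sector θ β r, P z := by
  rw [sectorNhds, eventually_nhdsWithin_iff, Metric.eventually_nhds_iff] at h
  obtain ⟨ε, hε, h⟩ := h
  refine ⟨min ε 1, by positivity, fun z hz => h ?_ (sector_mono le_rfl (min_le_right _ _) hz)⟩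
  rw [dist_zero_right]
  exact hz.2.1.trans_le (min_le_left _ _)

lemma tendsto_sectorNhds_of_exp {a : ℂ} {θ θ' β β' : ℝ} {K : ℂ → ℂ} {c : ℂ → ℂ}
    (hc : ∀ ε r : ℝ, 0 < ε → ∀ z ∈ sector θ β r, ∀ x : ℂ, ‖x‖ ≤ ε → β + ε ≤ Real.pi →
      a * c z * exp x ∈ sector θ' (β + ε) (r * Real.exp ε))
    (hK : ∀ ε > 0, ∀ᶠ z in sectorNhds θ β, ∃ x, ‖x‖ ≤ ε ∧ K z = a * c z * exp x)
    (hβ : β < β') (hβ' : β' ≤ Real.pi) : Tendsto K (sectorNhds θ β) (sectorNhds θ' β') := by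
  rw [sectorNhds, sectorNhds, tendsto_nhdsWithin_iff]
  obtain ⟨r, hr, h⟩ := exists_sector_of_eventually (hK (β' - β) (by linarith))
  have hmem : ∀ ρ : ℝ, 0 < ρ → ρ ≤ r → ∀ z ∈ sector θ β ρ,
      K z ∈ sector θ' β' (ρ * Real.exp (β' - β)) := by
    intro ρ hρ hρr z hz
    obtain ⟨x, hx, h2⟩ := h z (sector_mono le_rfl hρr hz)
    have := hc (β' - β) ρ (by linarith) z hz x hx (by linarith)
    rw [add_sub_cancel] at this
    rwa [h2]
  have key : ∀ δ > 0, ∀ᶠ z in 𝓝[sector θ β 1] 0, K z ∈ sector θ' β' δ := by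
    intro δ hδ
    have hp : 0 < min r (δ * Real.exp (-(β' - β))) := by positivity
    refine eventually_sectorNhds hp fun z hz => sector_mono le_rfl ?_ (hmem _ hp (min_le_left _ _) z hz)
    calc _ ≤ δ * Real.exp (-(β' - β)) * Real.exp (β' - β) := by gcongr; exact min_le_right _ _
      _ = δ := by rw [mul_assoc, ← Real.exp_add]; simp
  refine ⟨?_, key 1 one_pos⟩
  rw [Metric.tendsto_nhds]
  intro δ hδ
  refine (key δ hδ).mono fun z hz => ?_
  rw [dist_zero_right]
  exact hz.2.1

lemma tendsto_sectorNhds_of_hasDerivAt_one {K : ℂ → ℂ} (hK : HasDerivAt K 1 0) (hK0 : K 0 = 0)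
    {θ β β' : ℝ} (hβ : β < β') (hβ' : β' ≤ Real.pi) :
    Tendsto K (sectorNhds θ β) (sectorNhds θ β') := by
  refine tendsto_sectorNhds_of_exp (a := 1) (c := id) (fun ε r _ z hz x hx h => ?_)
    (fun ε hε => ?_) hβ hβ'
  · rw [one_mul]; exact mul_exp_mem_sector h hz hx
  · obtain ⟨r, hr, h⟩ := exists_exp_of_hasDerivAt_one hK hK0 hε
    refine eventually_sectorNhds hr fun z hz => ?_
    obtain ⟨x, hx, h2⟩ := h z (ne_zero_of_mem_sector hz) hz.2.1
    exact ⟨x, hx.le, by simpa using h2⟩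

/-! ### Antiholomorphic germs near the vertex of a sector -/

lemma axisCoeff_ne_zero (k ℓ : ℕ) : axisCoeff k ℓ ≠ 0 := exp_ne_zero _

lemma IsAntiholomorphicGerm.hasDerivAt {F : ℂ → ℂ} (hF : IsAntiholomorphicGerm F) :
    HasDerivAt (fun z => F (conj z)) (antiLinearCoeff F) 0 :=
  hF.1.differentiableAt.hasDerivAt

lemma IsAntiholomorphicGerm.continuousAt {F : ℂ → ℂ} (hF : IsAntiholomorphicGerm F) :
    ContinuousAt F 0 := by
  have h1 : ContinuousAt (fun z => F (conj z)) (conj (0 : ℂ)) := by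
    rw [map_zero]; exact hF.1.continuousAt
  have h2 := ContinuousAt.comp h1 (continuous_conj.continuousAt (x := (0 : ℂ)))
  simpa [Function.comp_def] using h2

lemma IsAntiholomorphicGerm.tendsto {F : ℂ → ℂ} (hF : IsAntiholomorphicGerm F) :
    Tendsto F (𝓝 0) (𝓝 0) := by
  have := hF.continuousAt
  rwa [ContinuousAt, hF.2] at this

/-- Near the origin, `F` is differentiable as an antiholomorphic map. -/
lemma IsAntiholomorphicGerm.eventually_differentiableAt {F : ℂ → ℂ} (hF : IsAntiholomorphicGerm F) :
    ∀ᶠ z in 𝓝 (0 : ℂ), DifferentiableAt ℂ (fun w => conj (F w)) z := by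
  have h1 : ∀ᶠ z in 𝓝 (0 : ℂ), DifferentiableAt ℂ (fun z => F (conj z)) z :=
    hF.1.eventually_analyticAt.mono fun z hz => hz.differentiableAt
  have hc : Tendsto (fun z : ℂ => conj z) (𝓝 0) (𝓝 0) := by
    simpa using continuous_conj.tendsto (0 : ℂ)
  filter_upwards [hc.eventually h1] with z hz
  have := hz.conj_conj
  simpa [Function.comp_def] using this

/-- A germ with nonzero antilinear part is injective near the origin. -/
lemma IsAntiholomorphicGerm.exists_injOn {F : ℂ → ℂ} (hF : IsAntiholomorphicGerm F)
    (h : antiLinearCoeff F ≠ 0) : ∃ r > 0, Set.InjOn F (Metric.ball 0 r) := by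
  obtain ⟨g, -, -, -, h1, -⟩ := exists_analytic_inverse hF.1 (by simp [hF.2]) h
  obtain ⟨r, hr, h2⟩ := Metric.eventually_nhds_iff.1 h1
  refine ⟨r, hr, fun z hz w hw hzw => ?_⟩
  have hz' := h2 (y := conj z) (by rw [dist_zero_right, RCLike.norm_conj]; simpa using hz)
  have hw' := h2 (y := conj w) (by rw [dist_zero_right, RCLike.norm_conj]; simpa using hw)
  rw [conj_conj] at hz' hw'
  rw [hzw, hw'] at hz'
  exact ((starRingEnd ℂ).injective hz').symm

lemma IsAntiholomorphicGerm.eventually_exists_exp {F : ℂ → ℂ} (hF : IsAntiholomorphicGerm F)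
    {k ℓ : ℕ} (h : antiLinearCoeff F = axisCoeff k ℓ) {θ β ε : ℝ} (hε : 0 < ε) :
    ∀ᶠ z in sectorNhds θ β, ∃ x, ‖x‖ ≤ ε ∧ F z = axisCoeff k ℓ * conj z * exp x := by
  have h1 := (hF.hasDerivAt).const_mul (axisCoeff k ℓ)⁻¹
  rw [h, inv_mul_cancel₀ (axisCoeff_ne_zero k ℓ)] at h1
  obtain ⟨r, hr, h2⟩ := exists_exp_of_hasDerivAt_one h1 (by simp [hF.2]) hε
  refine eventually_sectorNhds hr fun z hz => ?_
  obtain ⟨x, hx, h3⟩ := h2 (conj z) (by simpa using ne_zero_of_mem_sector hz) (by simpa using hz.2.1)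
  refine ⟨x, hx.le, ?_⟩
  rw [conj_conj, inv_mul_eq_iff_eq_mul₀ (axisCoeff_ne_zero k ℓ)] at h3
  rw [h3]; ring

lemma IsAntiholomorphicGerm.tendsto_sectorNhds {F : ℂ → ℂ} (hF : IsAntiholomorphicGerm F) {k ℓ : ℕ}
    (h : antiLinearCoeff F = axisCoeff k ℓ) {ψ β β' : ℝ} (hβ : β < β') (hβ' : β' ≤ Real.pi) :
    Tendsto F (sectorNhds ψ β) (sectorNhds (2 * ℓ * Real.pi / k - ψ) β') :=
  tendsto_sectorNhds_of_exp (fun _ _ _ _ hz _ hx h => axisCoeff_mul_conj_mem_sector ℓ h hz hx)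
    (fun _ hε => hF.eventually_exists_exp h hε) hβ hβ'

/-- Neighbourhoods of the origin in the petal `j` with half-opening `β`. -/
def petalNhds (k : ℕ) (j : ZMod (2 * k)) (β : ℝ) : Filter ℂ := sectorNhds (j.val * Real.pi / k) β

/-- Neighbourhoods of the origin in the intersection of the petals `j - 1` and `j` of half-opening
`β`. -/
def overlapNhds (k : ℕ) (j : ZMod (2 * k)) (β : ℝ) : Filter ℂ :=
  sectorNhds (midAngle k j) (β - Real.pi / (2 * k))

lemma IsAntiholomorphicGerm.tendsto_petalNhds {F : ℂ → ℂ} (hF : IsAntiholomorphicGerm F) {k ℓ : ℕ}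
    (hk : 1 ≤ k) (h : antiLinearCoeff F = axisCoeff k ℓ) (j : ZMod (2 * k)) {β β' : ℝ} (hβ : β < β')
    (hβ' : β' ≤ Real.pi) : Tendsto F (petalNhds k j β) (petalNhds k (2 * (ℓ : ZMod (2 * k)) - j) β') := by
  have := hF.tendsto_sectorNhds h (ψ := j.val * Real.pi / k) hβ hβ'
  unfold petalNhds
  unfold sectorNhds at *
  rwa [sector_reflect_petal hk] at this

lemma IsAntiholomorphicGerm.tendsto_overlapNhds {F : ℂ → ℂ} (hF : IsAntiholomorphicGerm F) {k ℓ : ℕ}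
    (hk : 1 ≤ k) (h : antiLinearCoeff F = axisCoeff k ℓ) (j : ZMod (2 * k)) {β β' : ℝ} (hβ : β < β')
    (hβ' : β' ≤ Real.pi) : Tendsto F (overlapNhds k j β) (overlapNhds k (reflectIndex k ℓ j) β') := by
  have := hF.tendsto_sectorNhds h (ψ := midAngle k j) (sub_lt_sub_right hβ (Real.pi / (2 * k)))
    (by have : 0 ≤ Real.pi / (2 * k) := by positivity
        linarith)
  unfold overlapNhds
  unfold sectorNhds at *
  rwa [sector_reflect_mid hk] at this

lemma petalNhds_mono {k : ℕ} {j : ZMod (2 * k)} {β β' : ℝ} (h : β ≤ β') :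
    petalNhds k j β ≤ petalNhds k j β' := sectorNhds_mono h

lemma overlapNhds_mono {k : ℕ} {j : ZMod (2 * k)} {β β' : ℝ} (h : β ≤ β') :
    overlapNhds k j β ≤ overlapNhds k j β' := sectorNhds_mono (by linarith)

lemma overlapNhds_le_src {k : ℕ} (hk : 1 ≤ k) {β : ℝ} (hβ : β < Real.pi / k) (j : ZMod (2 * k)) :
    overlapNhds k j β ≤ petalNhds k (srcIndex k j) β :=
  nhdsWithin_mono _ (mid_sector_subset_src hk hβ j)

lemma overlapNhds_le_tgt {k : ℕ} (hk : 1 ≤ k) {β : ℝ} (hβ : β < Real.pi / k) (j : ZMod (2 * k)) :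
    overlapNhds k j β ≤ petalNhds k (tgtIndex k j) β :=
  nhdsWithin_mono _ (mid_sector_subset_tgt hk hβ j)

lemma overlapNhds_neBot {k : ℕ} (hk : 1 ≤ k) {β : ℝ} (hβ1 : Real.pi / (2 * k) < β)
    (hβ : β < Real.pi / k) (j : ZMod (2 * k)) : (overlapNhds k j β).NeBot :=
  sectorNhds_neBot (by linarith) (by
    have : 0 ≤ Real.pi / (2 * k) := by positivity
    linarith [lt_pi_of_lt hk hβ])

lemma petalNhds_neBot {k : ℕ} (hk : 1 ≤ k) {β : ℝ} (hβ1 : 0 < β)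
    (hβ : β < Real.pi / k) (j : ZMod (2 * k)) : (petalNhds k j β).NeBot :=
  sectorNhds_neBot hβ1 (lt_pi_of_lt hk hβ)

namespace IsFatouFamily

variable {k : ℕ} {b : ℂ} {G : ℂ → ℂ} {α r : ℝ} {c : ZMod (2 * k) → ℂ} {φ : ZMod (2 * k) → ℂ → ℂ}

lemma eventually_abel (h : IsFatouFamily k b G α r c φ) (hr : 0 < r) (hα : α ≤ Real.pi) (hG0 : G 0 = 0)
    (hG1 : HasDerivAt G 1 0) (j : ZMod (2 * k)) {β : ℝ} (hβ : β < α) :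
    ∀ᶠ z in petalNhds k j β, φ j (G z) = φ j z + 1 := by
  have h1 := tendsto_sectorNhds_of_hasDerivAt_one hG1 hG0 (θ := j.val * Real.pi / k) hβ hα
  have h2 : ∀ᶠ z in sectorNhds (j.val * Real.pi / k) α, z ∈ sector (j.val * Real.pi / k) α r :=
    eventually_sectorNhds hr fun z hz => hz
  filter_upwards [h1.eventually h2, sectorNhds_mono hβ.le h2] with z hz hz'
  exact (h.coord j).2.2 z hz' hz

/-- The jump of the Fatou coordinates across the overlap of two petals. -/
lemma tendsto_jump (h : IsFatouFamily k b G α r c φ) (hk : 1 ≤ k) (hr : 0 < r)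
    (hα : α < Real.pi / k) (j : ZMod (2 * k)) :
    Tendsto (fun z => φ (tgtIndex k j) z - φ (srcIndex k j) z) (overlapNhds k j α)
      (𝓝 (c (tgtIndex k j) - c (srcIndex k j) + normalizedConstant k b j)) := by
  have h1 := h.asymp (tgtIndex k j)
  have h2 := h.asymp (srcIndex k j)
  rw [nhdsWithin_sector hr] at h1 h2
  have h3 := ((h1.mono_left (overlapNhds_le_tgt hk hα j)).sub
    (h2.mono_left (overlapNhds_le_src hk hα j))).add_const (normalizedConstant k b j)
  refine h3.congr' ?_
  refine eventually_sectorNhds one_pos fun z hz => ?_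
  rw [← timeCoordinate_sub (b := b) hk hα hz]
  ring

/-- Fatou coordinates near the origin are injective on a petal. -/
lemma eventually_injOn (h : IsFatouFamily k b G α r c φ) (hr : 0 < r) (j : ZMod (2 * k)) {ι : Type*}
    {l : Filter ι} {u v : ι → ℂ} (hu : Tendsto u l (petalNhds k j α))
    (hv : Tendsto v l (petalNhds k j α)) (huv : ∀ᶠ x in l, φ j (u x) = φ j (v x)) : u =ᶠ[l] v := by
  have h2 : ∀ᶠ z in petalNhds k j α, z ∈ sector (j.val * Real.pi / k) α r :=
    eventually_sectorNhds hr fun z hz => hz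
  filter_upwards [hu.eventually h2, hv.eventually h2, huv] with x h3 h4 h5
  exact (h.coord j).2.1 h3 h4 h5

end IsFatouFamily

/-! ### Germs acting as translations in the Fatou coordinates -/

/-- The germ `K` maps the petal `j` to the petal `j + d`, and is the translation by `T` in the
Fatou coordinates. -/
structure IsShift (k : ℕ) (α : ℝ) (φ : ZMod (2 * k) → ℂ → ℂ) (d : ZMod (2 * k)) (T : ℂ)
    (K : ℂ → ℂ) : Prop where
  maps : ∀ j β β', β < β' → β' ≤ Real.pi → Tendsto K (petalNhds k j β) (petalNhds k (j + d) β')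
  eq : ∀ j β, β < α → ∀ᶠ z in petalNhds k j β, φ (j + d) (K z) = φ j z + T

/-- The antiholomorphic germ `F` maps the petal `j` to its mirror image in the axis
`e^{iπℓ/k} ℝ`, and is the map `W ↦ conj (W + C)` in the Fatou coordinates. -/
structure IsAntiShift (k : ℕ) (α : ℝ) (φ : ZMod (2 * k) → ℂ → ℂ) (ℓ : ℕ) (C : ℂ)
    (F : ℂ → ℂ) : Prop where
  maps : ∀ j β β', β < β' → β' ≤ Real.pi →
    Tendsto F (petalNhds k j β) (petalNhds k (2 * (ℓ : ZMod (2 * k)) - j) β')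
  eq : ∀ j β, β < α → ∀ᶠ z in petalNhds k j β,
    φ (2 * (ℓ : ZMod (2 * k)) - j) (F z) = conj (φ j z + C)

lemma IsShift.comp {k : ℕ} {α : ℝ} {φ : ZMod (2 * k) → ℂ → ℂ} {d₁ d₂ : ZMod (2 * k)} {T₁ T₂ : ℂ}
    {K₁ K₂ : ℂ → ℂ} (hα : α ≤ Real.pi) (h₂ : IsShift k α φ d₂ T₂ K₂) (h₁ : IsShift k α φ d₁ T₁ K₁) :
    IsShift k α φ (d₁ + d₂) (T₁ + T₂) (K₂ ∘ K₁) where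
  maps j β β' hβ hβ' := by
    rw [← add_assoc]
    exact (h₂.maps (j + d₁) ((β + β') / 2) β' (by linarith) hβ').comp
      (h₁.maps j β ((β + β') / 2) (by linarith) (by linarith))
  eq j β hβ := by
    have h := (h₁.maps j β ((β + α) / 2) (by linarith) (by linarith)).eventually
      (h₂.eq (j + d₁) ((β + α) / 2) (by linarith))
    filter_upwards [h, h₁.eq j β hβ] with z hz hz'
    rw [← add_assoc, Function.comp_apply, hz, hz', add_assoc]

lemma IsShift.iterate {k : ℕ} {α : ℝ} {φ : ZMod (2 * k) → ℂ → ℂ} {d : ZMod (2 * k)} {T : ℂ}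
    {K : ℂ → ℂ} (hα : α ≤ Real.pi) (h : IsShift k α φ d T K) (m : ℕ) :
    IsShift k α φ (m * d) (m * T) K^[m] := by
  induction m with
  | zero =>
    refine ⟨fun j β β' hβ _ => ?_, fun j β _ => ?_⟩
    · simpa using tendsto_id.mono_right (petalNhds_mono hβ.le)
    · simp
  | succ m ih =>
    have := IsShift.comp hα h ih
    rw [← Function.iterate_succ'] at this
    convert this using 1
    · push_cast; ring
    · push_cast; ring

lemma IsAntiShift.comp {k : ℕ} {α : ℝ} {φ : ZMod (2 * k) → ℂ → ℂ} {ℓ₁ ℓ₂ : ℕ} {C₁ C₂ : ℂ}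
    {F₁ F₂ : ℂ → ℂ} (hα : α ≤ Real.pi) (h₂ : IsAntiShift k α φ ℓ₂ C₂ F₂)
    (h₁ : IsAntiShift k α φ ℓ₁ C₁ F₁) :
    IsShift k α φ (2 * (ℓ₂ : ZMod (2 * k)) - 2 * ℓ₁) (C₁ + conj C₂) (F₂ ∘ F₁) := by
  have e : ∀ j : ZMod (2 * k), j + (2 * (ℓ₂ : ZMod (2 * k)) - 2 * ℓ₁) = 2 * ℓ₂ - (2 * ℓ₁ - j) :=
    fun j => by ring
  refine ⟨fun j β β' hβ hβ' => ?_, fun j β hβ => ?_⟩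
  · rw [e]
    exact (h₂.maps _ ((β + β') / 2) β' (by linarith) hβ').comp
      (h₁.maps j β ((β + β') / 2) (by linarith) (by linarith))
  · have h := (h₁.maps j β ((β + α) / 2) (by linarith) (by linarith)).eventually
      (h₂.eq _ ((β + α) / 2) (by linarith))
    filter_upwards [h, h₁.eq j β hβ] with z hz hz'
    rw [e, Function.comp_apply, hz, hz', map_add, conj_conj, add_assoc]

lemma exists_exp_petal {k : ℕ} (hk : 1 ≤ k) (j : ZMod (2 * k)) :
    ∃ s : ℝ, (s = 1 ∨ s = -1) ∧ exp (k * (((j.val * Real.pi / k : ℝ) : ℂ) * I)) = -s := by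
  have hk0 : (k : ℂ) ≠ 0 := by exact_mod_cast (by omega : k ≠ 0)
  have h : exp (k * (((j.val * Real.pi / k : ℝ) : ℂ) * I)) = (-1) ^ j.val := by
    rw [← exp_pi_mul_I, ← exp_nat_mul]
    congr 1
    push_cast
    field_simp
  rw [h]
  rcases neg_one_pow_eq_or ℂ j.val with h | h
  · exact ⟨-1, Or.inr rfl, by rw [h]; simp⟩
  · exact ⟨1, Or.inl rfl, by rw [h]; simp⟩

lemma normalizedConstant_reflectIndex {k : ℕ} (hk : 1 ≤ k) (b : ℂ) (ℓ : ℕ) (j : ZMod (2 * k)) :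
    normalizedConstant k b (reflectIndex k ℓ j) = -normalizedConstant k b j := by
  unfold normalizedConstant
  by_cases h : Odd j.val
  · rw [if_pos h, if_neg (by rw [odd_reflectIndex hk]; exact not_not.2 h), neg_neg]
  · rw [if_neg h, if_pos ((odd_reflectIndex hk ℓ j).2 h)]

/-- An arithmetic progression indexed by `ZMod N` is constant. -/
lemma sub_eq_zero_of_zmod {N : ℕ} (hN : N ≠ 0) {C : ZMod N → ℂ} {δ : ℂ}
    (h : ∀ j, C j - C (j - 1) = δ) : δ = 0 ∧ ∀ j, C j = C 0 := by
  have : NeZero N := ⟨hN⟩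
  have h1 : ∀ m : ℕ, C (m : ZMod N) = C 0 + m * δ := by
    intro m
    induction m with
    | zero => simp
    | succ m ih =>
      have := h ((m + 1 : ℕ) : ZMod N)
      rw [Nat.cast_succ, add_sub_cancel_right, ih] at this
      rw [Nat.cast_succ]
      push_cast
      linear_combination this
  have h2 : δ = 0 := by
    have h3 := h1 N
    rw [ZMod.natCast_self] at h3
    have hN' : (N : ℂ) ≠ 0 := by exact_mod_cast hN
    have h4 : (N : ℂ) * δ = 0 := by linear_combination -h3
    exact (mul_eq_zero.1 h4).resolve_left hN'
  refine ⟨h2, fun j => ?_⟩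
  have := h1 j.val
  rwa [h2, mul_zero, add_zero, ZMod.natCast_zmod_val] at this

namespace IsFatouFamily

variable {k : ℕ} {b : ℂ} {G : ℂ → ℂ} {α r : ℝ} {φ : ZMod (2 * k) → ℂ → ℂ}

/-- An antiholomorphic germ commuting with `G` transports the Fatou coordinate of a petal to the
complex conjugate of a Fatou coordinate of the mirror image, which is unique up to a constant. -/
lemma exists_const_of_commute {c : ZMod (2 * k) → ℂ} (h : IsFatouFamily k b G α r c φ) (hk : 1 ≤ k)
    (hr : 0 < r) (hα1 : Real.pi / (2 * k) < α) (hα : α < Real.pi / k) (hG0 : G 0 = 0)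
    (hG1 : HasDerivAt G 1 0) {F : ℂ → ℂ} {ℓ : ℕ} (hF : IsAntiholomorphicGerm F)
    (hFℓ : antiLinearCoeff F = axisCoeff k ℓ) (hFG : ∀ᶠ z in 𝓝 0, F (G z) = G (F z))
    (j : ZMod (2 * k)) {β : ℝ} (hβ1 : Real.pi / (2 * k) < β) (hβ : β < α) :
    ∃ C, ∀ᶠ z in petalNhds k j β, φ (2 * (ℓ : ZMod (2 * k)) - j) (F z) = conj (φ j z + C) := by
  have hαπ := lt_pi_of_lt hk hα
  set i := 2 * (ℓ : ZMod (2 * k)) - j with hi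
  have h1 : ∀ᶠ z in petalNhds k i α, z ∈ sector (i.val * Real.pi / k) α r :=
    eventually_sectorNhds hr fun z hz => hz
  have h2 := (hF.tendsto_petalNhds hk hFℓ j hβ hαπ).eventually h1
  obtain ⟨r₁, hr₁, hinj⟩ := hF.exists_injOn (by rw [hFℓ]; exact axisCoeff_ne_zero k ℓ)
  obtain ⟨ρ, hρ, h3⟩ := exists_sector_of_eventually (h2.and (sectorNhds_le_nhds
    (hF.eventually_differentiableAt.and (hFG.and (Metric.ball_mem_nhds (0 : ℂ) hr₁)))))
  obtain ⟨s, hs, hθ⟩ := exists_exp_petal hk j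
  have hS := isOpen_sector (θ := i.val * Real.pi / k) (r := r) hαπ
  -- `conj ∘ φ ∘ F` is again a Fatou coordinate, on the reflected petal.
  have hφ' : IsFatouCoordinate G (sector (j.val * Real.pi / k) β ρ)
      (fun z => conj (φ i (F z))) := by
    refine ⟨fun z hz => ?_, fun z hz w hw hzw => ?_, fun z hz hz' => ?_⟩
    · obtain ⟨h4, h5, -⟩ := h3 z hz
      have h6 := ((h.coord i).1.differentiableAt (hS.mem_nhds h4))
      rw [← conj_conj (F z)] at h6
      have h7 := h6.conj_conj
      rw [conj_conj] at h7
      have h8 := h7.comp z h5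
      refine DifferentiableAt.differentiableWithinAt (h8.congr_of_eventuallyEq ?_)
      exact Eventually.of_forall fun w => by simp
    · have h4 := (h.coord i).2.1 (h3 z hz).1 (h3 w hw).1 ((starRingEnd ℂ).injective hzw)
      exact hinj (h3 z hz).2.2.2 (h3 w hw).2.2.2 h4
    · have h4 := (h3 z hz).2.2.1
      have h5 := (h3 _ hz').1
      rw [h4] at h5
      beta_reduce
      rw [h4, (h.coord i).2.2 _ (h3 z hz).1 h5, map_add, map_one]
  obtain ⟨C, hC⟩ := fatou_unique hk hG0 hG1 hs hθ hαπ hα1 hβ1 hr hρ (h.coord j)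
    (h.tendsto_mul_pow hk j) hφ'
  refine ⟨C, eventually_sectorNhds (lt_min hr hρ) fun z hz => ?_⟩
  rw [min_eq_right hβ.le] at hC
  rw [← hC z hz, conj_conj]

/-- A germ commuting with `G` and tangent to an axis is, in the Fatou coordinates, complex
conjugation followed by one and the same translation on all petals; the invariant `b` is real. The
constants on two consecutive petals differ by a multiple of `b - conj b` that is independent of the
petals, so that it vanishes after one turn about the origin. -/
theorem exists_antiShift {c : ℂ} (h : IsFatouFamily k b G α r (fun _ => c) φ) (hk : 1 ≤ k)
    (hr : 0 < r) (hα1 : Real.pi / (2 * k) < α) (hα : α < Real.pi / k) (hG0 : G 0 = 0)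
    (hG1 : HasDerivAt G 1 0) {F : ℂ → ℂ} {ℓ : ℕ} (hF : IsAntiholomorphicGerm F)
    (hFℓ : antiLinearCoeff F = axisCoeff k ℓ) (hFG : ∀ᶠ z in 𝓝 0, F (G z) = G (F z)) :
    b.im = 0 ∧ ∃ C, IsAntiShift k α φ ℓ C F := by
  have hαπ := lt_pi_of_lt hk hα
  have hp : 0 < Real.pi / (2 * k) := by
    have : (0 : ℝ) < k := by exact_mod_cast hk
    positivity
  have hA := fun j β hβ1 hβ =>
    h.exists_const_of_commute hk hr hα1 hα hG0 hG1 hF hFℓ hFG j (β := β) hβ1 hβ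
  set β₀ := (Real.pi / (2 * k) + α) / 2 with hβ₀
  have hβ₀1 : Real.pi / (2 * k) < β₀ := by linarith
  have hβ₀2 : β₀ < α := by linarith
  choose C hC using fun j => hA j β₀ hβ₀1 hβ₀2
  -- The constant does not depend on the half-opening of the petals.
  have hB : ∀ j β, β < α → ∀ᶠ z in petalNhds k j β,
      φ (2 * (ℓ : ZMod (2 * k)) - j) (F z) = conj (φ j z + C j) := by
    intro j β hβ
    rcases le_or_gt β β₀ with hle | hlt
    · exact petalNhds_mono hle (hC j)
    · obtain ⟨C', hC'⟩ := hA j β (hβ₀1.trans hlt) hβ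
      have : (petalNhds k j β₀).NeBot := petalNhds_neBot hk (hp.trans hβ₀1) (hβ₀2.trans hα) j
      obtain ⟨z, h1, h2⟩ := ((hC j).and (petalNhds_mono hlt.le hC')).exists
      have h3 : C j = C' := by
        have := (starRingEnd ℂ).injective (h1.symm.trans h2)
        exact add_left_cancel this
      rw [h3]; exact hC'
  -- Compare the jumps of the coordinates across an overlap and across its mirror image.
  have hjump : ∀ j, -normalizedConstant k b j =
      conj (normalizedConstant k b j + (C (tgtIndex k j) - C (srcIndex k j))) := by
    intro j
    have : (overlapNhds k j β₀).NeBot := overlapNhds_neBot hk hβ₀1 (hβ₀2.trans hα) j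
    have h1 := (h.tendsto_jump hk hr hα (reflectIndex k ℓ j)).comp
      (hF.tendsto_overlapNhds hk hFℓ j hβ₀2 hαπ)
    have h2 := ((h.tendsto_jump hk hr hα j).mono_left (overlapNhds_mono hβ₀2.le)).add_const
      (C (tgtIndex k j) - C (srcIndex k j))
    have h3 := (continuous_conj.tendsto _).comp h2
    rw [sub_self, zero_add, normalizedConstant_reflectIndex hk] at h1
    rw [sub_self, zero_add] at h3
    refine tendsto_nhds_unique h1 (h3.congr' ?_)
    filter_upwards [overlapNhds_le_src hk (hβ₀2.trans hα) j (hC _),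
      overlapNhds_le_tgt hk (hβ₀2.trans hα) j (hC _)] with z hs ht
    simp only [Function.comp_apply]
    rw [tgtIndex_reflectIndex hk, srcIndex_reflectIndex hk, hs, ht]
    simp only [map_add, map_sub]
    ring
  have hk0 : (k : ℂ) ≠ 0 := by exact_mod_cast (by omega : k ≠ 0)
  -- The constants change by a fixed step from petal to petal; a full turn shows that the step
  -- is zero, so the constants agree and `b` is real.
  have hstep : ∀ j, C j - C (j - 1) = -(I * Real.pi * (conj b - b) / k) := by
    intro j
    have h1 := congrArg conj (hjump j)
    rw [conj_conj] at h1
    unfold normalizedConstant srcIndex tgtIndex at h1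
    split_ifs at h1
    · simp only [map_mul, map_div₀, conj_I, conj_ofReal, map_natCast, neg_neg] at h1
      linear_combination -h1
    · simp only [map_neg, map_mul, map_div₀, conj_I, conj_ofReal, map_natCast] at h1
      linear_combination h1
  obtain ⟨h1, h2⟩ := sub_eq_zero_of_zmod (by omega) hstep
  refine ⟨?_, C 0, fun j β β' hβ hβ' => hF.tendsto_petalNhds hk hFℓ j hβ hβ', fun j β hβ => ?_⟩
  · rw [← conj_eq_iff_im]
    have h3 : (I * Real.pi * (conj b - b)) = 0 := by
      rw [neg_eq_zero, div_eq_zero_iff] at h1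
      exact h1.resolve_right hk0
    have h4 : (I * (Real.pi : ℂ)) ≠ 0 := mul_ne_zero I_ne_zero (by exact_mod_cast Real.pi_ne_zero)
    exact sub_eq_zero.1 ((mul_eq_zero.1 h3).resolve_left h4)
  · rw [← h2 j]; exact hB j β hβ

/-- The translation constant of a root of `G` of even order `n` has the real part `1/n`. -/
theorem antiShift_const {c : ZMod (2 * k) → ℂ} (h : IsFatouFamily k b G α r c φ) (hk : 1 ≤ k)
    (hr : 0 < r) (hα0 : 0 < α) (hα : α < Real.pi / k) (hG0 : G 0 = 0) (hG1 : HasDerivAt G 1 0)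
    {F : ℂ → ℂ} {ℓ n : ℕ} (hn : Even n) (hn0 : 0 < n) (hFG : F^[n] =ᶠ[𝓝 0] G) {C : ℂ}
    (hC : IsAntiShift k α φ ℓ C F) : ∃ y : ℝ, C = 1 / n + I * y := by
  have hαπ := lt_pi_of_lt hk hα
  obtain ⟨m, rfl⟩ := hn
  -- `F ∘ F` is the translation by `C + conj C`; its `m`-th iterate is `G`, the translation by
  -- `1`.
  have h1 := IsShift.iterate hαπ (hC.comp hαπ hC) m
  have : (petalNhds k 0 (α / 2)).NeBot := petalNhds_neBot hk (by linarith) (by linarith) 0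
  have h2 := h1.eq 0 (α / 2) (by linarith)
  have h3 := h.eventually_abel hr hαπ hG0 hG1 0 (β := α / 2) (by linarith)
  obtain ⟨z, h4, h5, h6⟩ := (h2.and (h3.and (sectorNhds_le_nhds hFG))).exists
  have h7 : (F ∘ F)^[m] z = G z := by
    rw [← h6, ← two_mul, Function.iterate_mul]; rfl
  rw [h7, sub_self, mul_zero, add_zero, h5] at h4
  have h8 : (m : ℂ) * (C + conj C) = 1 := (add_left_cancel h4).symm
  have hm : (m : ℂ) ≠ 0 := by exact_mod_cast (by omega : m ≠ 0)
  refine ⟨C.im, ?_⟩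
  rw [add_conj] at h8
  have h9 : (C.re : ℂ) = 1 / ((m + m : ℕ) : ℂ) := by
    push_cast at h8 ⊢
    field_simp
    linear_combination h8
  rw [← h9]
  conv_lhs => rw [← re_add_im C]
  ring

end IsFatouFamily

/-! ### Symmetries of the modulus of a germ with roots -/

lemma tendsto_conjTranslate {k : ℕ} (hk : 1 ≤ k) (n ℓ : ℕ) (j : ZMod (2 * k)) :
    Tendsto (conjTranslate n) (cylinderEnd k (reflectIndex k ℓ j)) (cylinderEnd k j) := by
  intro P hP
  obtain ⟨R, hR⟩ := eventually_cylinderEnd.1 hP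
  refine eventually_cylinderEnd.2 ⟨R, fun W hW => hR _ ?_⟩
  have h1 : (conjTranslate n W).im = -W.im := by
    have h2 : ((1 : ℂ) / n).im = 0 := by
      rw [one_div, ← ofReal_natCast, ← ofReal_inv, ofReal_im]
    rw [conjTranslate, conj_im, add_im, h2, add_zero]
  rw [endSign_reflectIndex hk] at hW
  rw [h1]
  linarith

lemma conjTranslate_add_one (n : ℕ) (W : ℂ) : conjTranslate n (W + 1) = conjTranslate n W + 1 := by
  simp only [conjTranslate, map_add, map_one]; ring

lemma IsAntiShift.add_const {k : ℕ} {α : ℝ} {φ : ZMod (2 * k) → ℂ → ℂ} {ℓ : ℕ} {C : ℂ}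
    {F : ℂ → ℂ} (h : IsAntiShift k α φ ℓ C F) (D : ℂ) :
    IsAntiShift k α (fun j z => φ j z + D) ℓ (C - D + conj D) F where
  maps := h.maps
  eq j β hβ := by
    filter_upwards [h.eq j β hβ] with z hz
    rw [hz]
    simp only [map_add, map_sub, conj_conj]
    ring

/-- If germs act in the Fatou coordinates as complex conjugation followed by the translation by
`1/n`, then the transition functions have the corresponding symmetries. -/
theorem IsFatouFamily.exists_modulus_symmetric {k n : ℕ} {b : ℂ} {G : ℂ → ℂ} {α r : ℝ} {c : ℂ}
    {φ : ZMod (2 * k) → ℂ → ℂ} (h : IsFatouFamily k b G α r (fun _ => c) φ) (hk : 1 ≤ k)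
    (hr : 0 < r) (hα1 : Real.pi / (2 * k) < α) (hα : α < Real.pi / k) (hG0 : G 0 = 0)
    (hG1 : HasDerivAt G 1 0) (L : Set ℕ)
    (hL : ∀ ℓ ∈ L, ∃ F, IsAntiholomorphicGerm F ∧ antiLinearCoeff F = axisCoeff k ℓ ∧
      IsAntiShift k α φ ℓ (1 / n) F) :
    ∃ Ψ : ZMod (2 * k) → ℂ → ℂ, IsModulusRepresentative k b G Ψ ∧ ∀ ℓ ∈ L, HasAxisSymmetry k n ℓ Ψ := by
  have hαπ := lt_pi_of_lt hk hα
  obtain ⟨Ψ, hΨ, hΨφ⟩ := h.exists_modulus hk hG0 hG1 hα1 hα hr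
  refine ⟨Ψ, hΨ, fun ℓ hℓ j => ?_⟩
  obtain ⟨-, -, -, -, -, -, -, hnorm, -⟩ := hΨ
  obtain ⟨F, hF, hFℓ, hC⟩ := hL ℓ hℓ
  set i := reflectIndex k ℓ j with hi
  have hij : reflectIndex k ℓ i = j := reflectIndex_reflectIndex k ℓ j
  set β := (Real.pi / (2 * k) + α) / 2 with hβ
  have hβ1 : Real.pi / (2 * k) < β := by linarith
  have hβ2 : β < α := by linarith
  -- Both sides commute with the unit translation, so it is enough to compare them at the values
  -- that the Fatou coordinate takes near the origin.
  refine (h.mono hβ2.le le_rfl).end_induction hk hβ1 (hβ2.trans hα) hr i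
    (P := fun W => Ψ j (conjTranslate n W) = conjTranslate n (Ψ i W)) ?_ ?_
  · rw [nhdsWithin_sector hr]
    have h1 := hΨφ j
    have h2 := hΨφ i
    rw [nhdsWithin_sector hr] at h1 h2
    have h3 := hF.tendsto_overlapNhds hk hFℓ i hβ2 hαπ
    rw [hij] at h3
    filter_upwards [h3.eventually h1, overlapNhds_mono hβ2.le h2,
      overlapNhds_le_src hk (hβ2.trans hα) i (hC.eq _ β hβ2),
      overlapNhds_le_tgt hk (hβ2.trans hα) i (hC.eq _ β hβ2)] with z h4 h5 h6 h7
    rw [← srcIndex_reflectIndex hk, hij] at h6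
    rw [← tgtIndex_reflectIndex hk, hij] at h7
    rw [h5, conjTranslate, ← h6, h4, h7, conjTranslate]
  · filter_upwards [(hnorm i).2.1, (tendsto_conjTranslate hk n ℓ j).eventually (hnorm j).2.1]
      with W h1 h2
    rw [conjTranslate_add_one, h2, h1, conjTranslate_add_one, add_left_inj]

/-! ### Construction of a root from a symmetric modulus -/

lemma axisCoeff_pow {k : ℕ} (hk : 1 ≤ k) (ℓ : ℕ) : axisCoeff k ℓ ^ k = 1 := by
  have hk0 : (k : ℂ) ≠ 0 := by exact_mod_cast (by omega : k ≠ 0)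
  rw [axisCoeff, ← exp_nat_mul, exp_eq_one_iff]
  exact ⟨ℓ, by push_cast; field_simp⟩

lemma exists_axisCoeff_eq {k : ℕ} (hk : 1 ≤ k) {a : ℂ} (hak : a ^ k = 1) :
    ∃ ℓ : Fin k, a = axisCoeff k ℓ := by
  have hprim := Complex.isPrimitiveRoot_exp k (by omega)
  have : NeZero k := ⟨by omega⟩
  obtain ⟨i, hi, h⟩ := hprim.eq_pow_of_pow_eq_one hak
  refine ⟨⟨i, hi⟩, ?_⟩
  rw [← h, ← exp_nat_mul, axisCoeff]
  congr 1
  push_cast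
  ring

lemma analyticAt_conj_conj {f : ℂ → ℂ} (hf : AnalyticAt ℂ f 0) :
    AnalyticAt ℂ (fun z => conj (f (conj z))) 0 := by
  rw [analyticAt_iff_eventually_differentiableAt]
  have h1 : ∀ᶠ z in 𝓝 (0 : ℂ), DifferentiableAt ℂ f z :=
    hf.eventually_analyticAt.mono fun z hz => hz.differentiableAt
  have hc : Tendsto (fun z : ℂ => conj z) (𝓝 0) (𝓝 0) := by
    simpa using continuous_conj.tendsto (0 : ℂ)
  filter_upwards [hc.eventually h1] with z hz
  have := hz.conj_conj
  rwa [conj_conj] at this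

namespace IsFatouFamily

variable {k n ℓ : ℕ} {b : ℂ} {G : ℂ → ℂ} {α r : ℝ} {c : ZMod (2 * k) → ℂ} {φ : ZMod (2 * k) → ℂ → ℂ}

lemma tendsto_cylinderEnd (h : IsFatouFamily k b G α r c φ) (hk : 1 ≤ k) (hr : 0 < r)
    (hα1 : Real.pi / (2 * k) < α) (hα : α < Real.pi / k) (j : ZMod (2 * k)) :
    Tendsto (φ (srcIndex k j)) (overlapNhds k j α) (cylinderEnd k j) := by
  intro P hP
  obtain ⟨R, hR⟩ := eventually_cylinderEnd.1 hP
  obtain ⟨r₁, hr₁, h1⟩ := tendsto_im_end hk (endSign_eq k j) (exp_midAngle hk j) (by linarith)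
    (pi_div_two_mul_lt hk hα) hr (h.tendsto_src hk hα j) R
  exact eventually_sectorNhds hr₁ fun z hz => hR _ (h1 z hz)

/-- The equation `φ_{2ℓ-j}(w) = conj (φ_j(z) + 1/n)` has a solution `w` close to the mirror image
of `z`. -/
lemma eventually_exists_image (h : IsFatouFamily k b G α r c φ) (hk : 1 ≤ k) (hr : 0 < r)
    (hα : α < Real.pi / k) (n ℓ : ℕ) (j : ZMod (2 * k)) {β ε : ℝ} (hβ : β < α) (hε : 0 < ε) :
    ∀ᶠ z in petalNhds k j β, ∃ x, ‖x‖ ≤ ε ∧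
      axisCoeff k ℓ * conj z * exp x ∈ sector ((2 * (ℓ : ZMod (2 * k)) - j).val * Real.pi / k) α r ∧
      deriv (φ (2 * (ℓ : ZMod (2 * k)) - j)) (axisCoeff k ℓ * conj z * exp x) ≠ 0 ∧
      φ (2 * (ℓ : ZMod (2 * k)) - j) (axisCoeff k ℓ * conj z * exp x) = conjTranslate n (φ j z) := by
  have hαπ := lt_pi_of_lt hk hα
  have hkR : (0 : ℝ) < k := by exact_mod_cast hk
  set i := 2 * (ℓ : ZMod (2 * k)) - j with hi
  set δ := min ε (min ((α - β) / 3) (1 / (4 * k))) with hδ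
  have hδpos : 0 < δ := by
    have : 0 < α - β := by linarith
    positivity
  have hδε : δ ≤ ε := min_le_left _ _
  have hδα : δ ≤ (α - β) / 3 := (min_le_right _ _).trans (min_le_left _ _)
  have hδk : k * δ ≤ 1 / 4 := by
    have : δ ≤ 1 / (4 * k) := (min_le_right _ _).trans (min_le_right _ _)
    rw [le_div_iff₀ (by positivity)] at this
    linarith
  obtain ⟨r', hr', hctl⟩ := sector_local_control hk hαπ hr (h.coord i).1 (h.tendsto_mul_pow hk i)
    hδpos hδk
  -- The prescribed value times `conj z ^ k` tends to `-1 / k`, so `sector_local_control` finds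
  -- it near the mirror image of `z`.
  have hlim : Tendsto (fun z => conj (φ j z * z ^ k) + conj (1 / n * z ^ k)) (petalNhds k j β)
      (𝓝 (-1 / k)) := by
    have h1 := h.tendsto_mul_pow hk j
    rw [nhdsWithin_sector hr] at h1
    have h2 := (continuous_conj.tendsto _).comp (h1.mono_left (petalNhds_mono hβ.le))
    have h3 : Tendsto (fun z : ℂ => conj (1 / n * z ^ k)) (petalNhds k j β) (𝓝 0) := by
      have : Continuous fun z : ℂ => conj (1 / (n : ℂ) * z ^ k) := by fun_prop
      have h4 := this.tendsto 0
      rw [zero_pow (by omega), mul_zero, map_zero] at h4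
      exact h4.mono_left sectorNhds_le_nhds
    have h5 := h2.add h3
    rw [add_zero] at h5
    simpa using h5
  have hclose := (Metric.tendsto_nhds.1 hlim) (δ / 32) (by positivity)
  have hρ : 0 < r' * Real.exp (-δ) := by positivity
  have hsec : ∀ᶠ z in petalNhds k j β, z ∈ sector (j.val * Real.pi / k) β (r' * Real.exp (-δ)) :=
    eventually_sectorNhds hρ fun z hz => hz
  filter_upwards [hclose, hsec] with z hz hzs
  have hz₀ : axisCoeff k ℓ * conj z ∈ sector (i.val * Real.pi / k) β (r' * Real.exp (-δ)) := by
    have := axisCoeff_mul_conj_mem_sector (k := k) ℓ (ε := 0) (x := 0) (by linarith) hzs (by simp)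
    rw [sector_reflect_petal hk] at this
    simpa using this
  have hz₀' : axisCoeff k ℓ * conj z ∈ sector (i.val * Real.pi / k) (α - 2 * δ) r' :=
    sector_mono (by linarith) (by
      calc r' * Real.exp (-δ) ≤ r' * 1 := by gcongr; rw [Real.exp_le_one_iff]; linarith
        _ = r' := mul_one _) hz₀
  obtain ⟨x, hx, h1, h2⟩ := (hctl _ hz₀').2 (conjTranslate n (φ j z)) (by
    rw [dist_eq_norm] at hz
    refine le_of_eq_of_le (congrArg _ ?_) hz.le
    rw [mul_pow, axisCoeff_pow hk, conjTranslate]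
    simp only [map_add, map_mul, map_pow]
    ring)
  refine ⟨x, hx.trans hδε, h1, ?_, h2⟩
  have h3 := mul_exp_mem_sector (by linarith) hz₀ hx
  rw [mul_assoc, ← Real.exp_add, neg_add_cancel, Real.exp_zero, mul_one] at h3
  exact (hctl _ (sector_mono (by linarith) le_rfl h3)).1

/-- The `n`-th power of a germ acting as `conj (W + 1/n)` in the Fatou coordinates is `G`. -/
lemma iterate_eq_of_antiShift (h : IsFatouFamily k b G α r c φ) (hk : 1 ≤ k)
    (hr : 0 < r) (hα : α < Real.pi / k) (hG0 : G 0 = 0)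
    (hG1 : HasDerivAt G 1 0) {F : ℂ → ℂ} (hn : Even n) (hn0 : 0 < n) (hF0 : F 0 = 0) {β : ℝ}
    (hβ1 : Real.pi / (2 * k) < β) (hβ : β < α) (hC : IsAntiShift k β φ ℓ (1 / n) F) :
    F^[n] =ᶠ[𝓝 0] G := by
  have hαπ := lt_pi_of_lt hk hα
  obtain ⟨m, rfl⟩ := hn
  have hβπ : β ≤ Real.pi := by linarith
  have h1 := IsShift.iterate hβπ (hC.comp hβπ hC) m
  have hm : (m : ℂ) ≠ 0 := by exact_mod_cast (by omega : m ≠ 0)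
  have hT : (m : ℂ) * (1 / ((m + m : ℕ) : ℂ) + conj (1 / ((m + m : ℕ) : ℂ))) = 1 := by
    simp only [map_div₀, map_one, map_natCast]
    push_cast
    field_simp
  rw [hT, sub_self, mul_zero] at h1
  have h2 : (F ∘ F)^[m] = F^[m + m] := by
    rw [← two_mul, Function.iterate_mul]; rfl
  rw [h2] at h1
  set γ := (Real.pi / (2 * k) + β) / 2 with hγ
  have hγ1 : Real.pi / (2 * k) < γ := by linarith
  have hγβ : γ < β := by linarith
  -- Both germs act as the translation by `1` in the Fatou coordinates, which are injective.
  have h3 : ∀ᶠ z in 𝓝[≠] (0 : ℂ), F^[m + m] z = G z := by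
    refine eventually_punctured_of_petals hk one_pos hγ1 (by linarith : γ < Real.pi / k) fun j => ?_
    have h4 := h1.maps j γ α (by linarith) hαπ
    rw [add_zero] at h4
    have h5 := tendsto_sectorNhds_of_hasDerivAt_one hG1 hG0 (θ := j.val * Real.pi / k)
      (by linarith : γ < α) hαπ
    refine h.eventually_injOn hr j h4 h5 ?_
    have h6 := h1.eq j γ hγβ
    rw [add_zero] at h6
    filter_upwards [h6, h.eventually_abel hr hαπ hG0 hG1 j (by linarith : γ < α)] with z h7 h8
    rw [h7, h8]
  rw [eventually_nhdsWithin_iff] at h3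
  filter_upwards [h3] with z hz
  rcases eq_or_ne z 0 with rfl | hz0
  · have : ∀ i, F^[i] 0 = 0 := fun i => Function.iterate_fixed hF0 i
    rw [this, hG0]
  · exact hz hz0

/-- The converse construction: a modulus with the symmetry in the axis `e^{iπℓ/k} ℝ` yields a root
tangent to this axis. On each petal the root is defined by its expression `W ↦ conj (W + 1/n)` in
the Fatou coordinates; the symmetry says that these definitions agree on the overlaps. -/
theorem exists_root_of_symmetric (h : IsFatouFamily k b G α r c φ) (hk : 1 ≤ k)
    (hr : 0 < r) (hα1 : Real.pi / (2 * k) < α) (hα : α < Real.pi / k) (hG0 : G 0 = 0)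
    (hG1 : HasDerivAt G 1 0) (hn : Even n) (hn0 : 0 < n) {Ψ : ZMod (2 * k) → ℂ → ℂ}
    (hΨ : ∀ j, ∀ᶠ z in overlapNhds k j α, Ψ j (φ (srcIndex k j) z) = φ (tgtIndex k j) z)
    (hsym : HasAxisSymmetry k n ℓ Ψ) :
    ∃ F, IsAntiholomorphicGerm F ∧ antiLinearCoeff F = axisCoeff k ℓ ∧ F^[n] =ᶠ[𝓝 0] G := by
  have hαπ := lt_pi_of_lt hk hα
  have hp : 0 ≤ Real.pi / (2 * k) := by positivity
  have hfin : NeZero (2 * k) := ⟨by omega⟩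
  set β := (Real.pi / (2 * k) + α) / 2 with hβ
  have hβ1 : Real.pi / (2 * k) < β := by linarith
  have hβα : β < α := by linarith
  have hβk : β < Real.pi / k := hβα.trans hα
  have himg := fun (j : ZMod (2 * k)) (ε : ℝ) (hε : 0 < ε) =>
    h.eventually_exists_image hk hr hα n ℓ j hβα hε
  -- The local root `F₀ j` maps the petal `j` to its mirror image and is `conjTranslate n` in
  -- the Fatou coordinates.
  set F₀ : ZMod (2 * k) → ℂ → ℂ := fun j z => Function.invFunOn (φ (2 * (ℓ : ZMod (2 * k)) - j))
    (sector ((2 * (ℓ : ZMod (2 * k)) - j).val * Real.pi / k) α r) (conjTranslate n (φ j z)) with hF₀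
  have hF₀eq : ∀ j z w, w ∈ sector ((2 * (ℓ : ZMod (2 * k)) - j).val * Real.pi / k) α r →
      φ (2 * (ℓ : ZMod (2 * k)) - j) w = conjTranslate n (φ j z) → F₀ j z = w :=
    fun j z w hw hφw => invFunOn_eq (h.coord _).2.1 hw hφw
  have hnear : ∀ j, ∀ ε > 0, ∀ᶠ z in petalNhds k j β, ∃ x, ‖x‖ ≤ ε ∧
      F₀ j z = axisCoeff k ℓ * conj z * exp x := by
    intro j ε hε
    filter_upwards [himg j ε hε] with z hz
    obtain ⟨x, hx, h1, -, h2⟩ := hz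
    exact ⟨x, hx, hF₀eq j z _ h1 h2⟩
  have hval : ∀ j, ∀ᶠ z in petalNhds k j β,
      φ (2 * (ℓ : ZMod (2 * k)) - j) (F₀ j z) = conjTranslate n (φ j z) := by
    intro j
    filter_upwards [himg j 1 one_pos] with z hz
    obtain ⟨x, hx, h1, -, h2⟩ := hz
    rw [hF₀eq j z _ h1 h2, h2]
  have hdiff : ∀ j, ∀ᶠ z in petalNhds k j β, DifferentiableAt ℂ (fun w => conj (F₀ j w)) z := by
    intro j
    have h1 : ∀ᶠ z in petalNhds k j β, z ∈ sector (j.val * Real.pi / k) β r :=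
      eventually_sectorNhds hr fun z hz => hz
    filter_upwards [himg j 1 one_pos, h1] with z hz h5
    obtain ⟨x, hx, h2, h3, h4⟩ := hz
    have h6 := (hasDerivAt_invFunOn (isOpen_sector hαπ) (h.coord _).1 (h.coord _).2.1 h2
      h3).differentiableAt
    rw [h4, conjTranslate] at h6
    have h7 := h6.conj_conj
    rw [conj_conj] at h7
    have h8 : DifferentiableAt ℂ (fun w => φ j w + 1 / n) z :=
      ((h.coord j).1.differentiableAt ((isOpen_sector hαπ).mem_nhds
        (sector_mono hβα.le le_rfl h5))).add_const _
    exact (h7.comp z h8).congr_of_eventuallyEq (Eventually.of_forall fun w => rfl)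
  have htend : ∀ j, Tendsto (F₀ j) (petalNhds k j β) (petalNhds k (2 * (ℓ : ZMod (2 * k)) - j) α) := by
    intro j
    have := tendsto_sectorNhds_of_exp (θ := j.val * Real.pi / k)
      (fun _ _ _ _ hz _ hx h => axisCoeff_mul_conj_mem_sector ℓ h hz hx) (hnear j) hβα hαπ
    unfold petalNhds
    unfold sectorNhds at *
    rwa [sector_reflect_petal hk] at this
  have htendO : ∀ j i, overlapNhds k j β ≤ petalNhds k i β →
      Tendsto (F₀ i) (overlapNhds k j β) (overlapNhds k (reflectIndex k ℓ j) α) := by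
    intro j i hle
    have := tendsto_sectorNhds_of_exp (θ := midAngle k j)
      (fun _ _ _ _ hz _ hx h => axisCoeff_mul_conj_mem_sector ℓ h hz hx)
      (fun ε hε => hle (hnear i ε hε)) (sub_lt_sub_right hβα (Real.pi / (2 * k))) (by linarith)
    unfold overlapNhds
    unfold sectorNhds at *
    rwa [sector_reflect_mid hk] at this
  -- The symmetry of the modulus says that these local roots agree on the overlaps.
  have hagree : ∀ j, ∀ᶠ z in overlapNhds k j β, F₀ (srcIndex k j) z = F₀ (tgtIndex k j) z := by
    intro j
    have hs := overlapNhds_le_src hk hβk j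
    have ht := overlapNhds_le_tgt hk hβk j
    have h1 := htendO j _ hs
    have h2 := h1.mono_right (overlapNhds_le_tgt hk hα (reflectIndex k ℓ j))
    rw [tgtIndex_reflectIndex hk] at h2
    refine h.eventually_injOn hr _ h2 ((htend _).mono_left ht) ?_
    have h3 := hsym (reflectIndex k ℓ j)
    rw [reflectIndex_reflectIndex] at h3
    have h4 := ((h.tendsto_cylinderEnd hk hr hα1 hα j).mono_left
      (overlapNhds_mono hβα.le)).eventually h3
    filter_upwards [h4, h1.eventually (hΨ (reflectIndex k ℓ j)), overlapNhds_mono hβα.le (hΨ j),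
      hs (hval _), ht (hval _)] with z h5 h6 h7 h8 h9
    rw [tgtIndex_reflectIndex hk, srcIndex_reflectIndex hk, h8, h5, h7] at h6
    rw [← h6, h9]
  have hagree' : ∀ j, ∀ᶠ z in overlapNhds k j β, F₀ (j - 1) z = F₀ j z := by
    intro j
    have := hagree j
    unfold srcIndex tgtIndex at this
    split_ifs at this
    · exact this
    · exact this.mono fun z hz => hz.symm
  choose ρ₁ hρ₁ hd using fun j => exists_sector_of_eventually (hdiff j)
  choose ρ₂ hρ₂ ha using fun j => exists_sector_of_eventually (hagree' j)
  obtain ⟨ρ, hρ, hρle⟩ : ∃ ρ > 0, ∀ j, ρ ≤ ρ₁ j ∧ ρ ≤ ρ₂ j := by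
    obtain ⟨j₀, hj₀⟩ := Finite.exists_min fun j => min (ρ₁ j) (ρ₂ j)
    exact ⟨min (ρ₁ j₀) (ρ₂ j₀), lt_min (hρ₁ _) (hρ₂ _), fun j =>
      ⟨(hj₀ j).trans (min_le_left _ _), (hj₀ j).trans (min_le_right _ _)⟩⟩
  -- The complex conjugates of the local roots are holomorphic and glue to a germ.
  obtain ⟨f, hf, hf0, hfF⟩ := exists_analyticAt_glue hk hρ hβ1 hβk (fun j z => conj (F₀ j z)) (L := 0)
    (fun j z hz => (hd j z (sector_mono le_rfl (hρle j).1 hz)).differentiableWithinAt)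
    (fun j z hz => by
      rw [ha j z (sector_mono le_rfl (hρle j).2 hz)])
    (fun j => by
      rw [nhdsWithin_sector hρ]
      have h1 := (continuous_conj.tendsto (0 : ℂ)).comp ((htend j).mono_right sectorNhds_le_nhds)
      rw [map_zero] at h1
      exact h1)
  have hFf : ∀ j, ∀ᶠ z in petalNhds k j β, conj (f z) = F₀ j z :=
    fun j => eventually_sectorNhds hρ fun z hz => by rw [hfF j z hz, conj_conj]
  have hanti : IsAntiholomorphicGerm fun z => conj (f z) := by
    exact ⟨analyticAt_conj_conj hf, by simp [hf0]⟩
  -- The linear coefficient can be read off on the petal `0`, by `hnear`.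
  have hcoeff : antiLinearCoeff (fun z => conj (f z)) = axisCoeff k ℓ := by
    have : (petalNhds k 0 β).NeBot := petalNhds_neBot hk (by linarith) hβk 0
    have h1 := tendsto_div_of_hasDerivAt hanti.hasDerivAt (by simp [hf0])
    have hc : Tendsto (fun z : ℂ => conj z) (petalNhds k 0 β) (𝓝[≠] 0) := by
      refine tendsto_nhdsWithin_iff.2 ⟨?_, eventually_sectorNhds one_pos fun z hz => ?_⟩
      · have : Tendsto (fun z : ℂ => conj z) (𝓝 0) (𝓝 0) := by
          simpa using continuous_conj.tendsto (0 : ℂ)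
        exact this.mono_left sectorNhds_le_nhds
      · simpa using ne_zero_of_mem_sector hz
    refine tendsto_nhds_unique (h1.comp hc) ?_
    rw [Metric.tendsto_nhds]
    intro ε hε
    have hA : 0 < ‖axisCoeff k ℓ‖ := norm_pos_iff.2 (axisCoeff_ne_zero k ℓ)
    filter_upwards [hFf 0, hnear 0 (min 1 (ε / (4 * ‖axisCoeff k ℓ‖))) (by positivity),
      eventually_sectorNhds (θ := (0 : ZMod (2 * k)).val * Real.pi / k) (β := β) one_pos
        fun z hz => ne_zero_of_mem_sector hz] with z hz hzx hz0
    obtain ⟨x, hx, h2⟩ := hzx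
    have hz0' : conj z ≠ 0 := by simpa using hz0
    have h3 : ((fun z => conj (f (conj z)) / z) ∘ fun z => conj z) z = axisCoeff k ℓ * exp x := by
      simp only [Function.comp_apply, conj_conj]
      rw [hz, h2]; field_simp
    have h4 := norm_exp_sub_one_le (hx.trans (min_le_left _ _))
    have h5 := hx.trans (min_le_right _ _)
    rw [le_div_iff₀ (by positivity)] at h5
    rw [h3, dist_eq_norm, show axisCoeff k ℓ * exp x - axisCoeff k ℓ =
      axisCoeff k ℓ * (exp x - 1) by ring, norm_mul]
    calc _ ≤ ‖axisCoeff k ℓ‖ * (2 * ‖x‖) := by gcongr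
      _ < ε := by linarith
  refine ⟨fun z => conj (f z), hanti, hcoeff, ?_⟩
  have hC : IsAntiShift k β φ ℓ (1 / n) fun z => conj (f z) := by
    refine ⟨fun j β₁ β₂ h1 h2 => hanti.tendsto_petalNhds hk hcoeff j h1 h2, fun j β₁ h1 => ?_⟩
    filter_upwards [petalNhds_mono h1.le (hFf j), petalNhds_mono h1.le (hval j)] with z h2 h3
    rw [h2, h3, conjTranslate]
  exact h.iterate_eq_of_antiShift hk hr hα hG0 hG1 hn hn0 (by simp [hf0]) hβ1 hβα hC

end IsFatouFamily

/-! ### Roots of a prenormalized germ and their axes -/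

lemma IsPrenormalized.hasDerivAt {k : ℕ} {b : ℂ} {G : ℂ → ℂ} (hk : 1 ≤ k)
    (hG : IsPrenormalized k b G) : HasDerivAt G 1 0 := by
  obtain ⟨γ, hγ, hγ0, hGγ, -⟩ := exists_exponent hk hG
  exact deriv_eq_one_of_exponent hγ hγ0 hGγ

lemma lt_petalOpening {k : ℕ} (hk : 1 ≤ k) : Real.pi / (2 * k) < petalOpening k := by
  have : (0 : ℝ) < k := by exact_mod_cast hk
  rw [petalOpening, div_lt_div_iff₀ (by positivity) (by positivity)]
  nlinarith [Real.pi_pos, mul_pos Real.pi_pos this]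

lemma petalOpening_lt {k : ℕ} (hk : 1 ≤ k) : petalOpening k < Real.pi / k := by
  have : (0 : ℝ) < k := by exact_mod_cast hk
  rw [petalOpening, div_lt_div_iff₀ (by positivity) (by positivity)]
  nlinarith [Real.pi_pos, mul_pos Real.pi_pos this]

lemma exists_isFatouFamily {k : ℕ} {b : ℂ} {G : ℂ → ℂ} (hk : 1 ≤ k) (hG : IsPrenormalized k b G) :
    ∃ (r : ℝ) (φ : ZMod (2 * k) → ℂ → ℂ), 0 < r ∧
      IsFatouFamily k b G (petalOpening k) r (fun _ => 0) φ := by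
  obtain ⟨r, φ, hr, h1, h2⟩ := exists_fatou_family hk hG
  exact ⟨r, φ, hr, h1, h2⟩

/-- All Fatou coordinates used for a representative of the modulus are translates of the standard
ones, so that a symmetry of the representative yields a root. -/
theorem exists_root_of_modulus {k n ℓ : ℕ} {b : ℂ} {G : ℂ → ℂ} (hk : 1 ≤ k)
    (hG : IsPrenormalized k b G) (hn : Even n) (hn0 : 0 < n) {Ψ : ZMod (2 * k) → ℂ → ℂ}
    (hΨ : IsModulusRepresentative k b G Ψ) (hsym : HasAxisSymmetry k n ℓ Ψ) :
    ∃ F, IsAntiholomorphicGerm F ∧ antiLinearCoeff F = axisCoeff k ℓ ∧ F^[n] =ᶠ[𝓝 0] G := by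
  have hG0 := hG.map_zero hk
  have hG1 := hG.hasDerivAt hk
  obtain ⟨r, φ, hr, hφ⟩ := exists_isFatouFamily hk hG
  obtain ⟨α', r', φ', hα'1, hα', hr', hφ', -, htr⟩ := hΨ
  have hC : ∀ j : ZMod (2 * k), ∃ C, ∀ z ∈ sector (j.val * Real.pi / k) (min (petalOpening k) α')
      (min r r'), φ' j z = φ j z + C := by
    intro j
    obtain ⟨s, hs, hθ⟩ := exists_exp_petal hk j
    exact fatou_unique hk hG0 hG1 hs hθ (petalOpening_le_pi hk) (lt_petalOpening hk) hα'1 hr hr'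
      (hφ.coord j) (hφ.tendsto_mul_pow hk j) (hφ' j)
  choose C hC using hC
  have hfam := (hφ.mono (min_le_left _ α') (min_le_left r r')).add_const C
  have hα : min (petalOpening k) α' < Real.pi / k := (min_le_right _ _).trans_lt hα'
  refine hfam.exists_root_of_symmetric hk (lt_min hr hr') (lt_min (lt_petalOpening hk) hα'1) hα
    hG0 hG1 hn hn0 (fun j => ?_) hsym
  have h1 := htr j
  rw [nhdsWithin_sector hr'] at h1
  have h2 : ∀ᶠ z in overlapNhds k j (min (petalOpening k) α'), z ∈ sector (midAngle k j)
      (min (petalOpening k) α' - Real.pi / (2 * k)) (min r r') :=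
    eventually_sectorNhds (lt_min hr hr') fun z hz => hz
  filter_upwards [overlapNhds_mono (min_le_right (petalOpening k) α') h1, h2] with z h3 h4
  rw [← hC _ z (mid_sector_subset_src hk hα j h4), ← hC _ z (mid_sector_subset_tgt hk hα j h4)]
  unfold srcIndex tgtIndex
  split_ifs at h3 ⊢ <;> exact h3

lemma tendsto_iterate {f : ℂ → ℂ} (hf : Tendsto f (𝓝 0) (𝓝 0)) (m : ℕ) :
    Tendsto f^[m] (𝓝 0) (𝓝 0) := by
  induction m with
  | zero => exact tendsto_id
  | succ m ih => rw [Function.iterate_succ']; exact hf.comp ih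

lemma commute_of_iterate_eq {F G : ℂ → ℂ} {n : ℕ} (hF : Tendsto F (𝓝 0) (𝓝 0))
    (h : F^[n] =ᶠ[𝓝 0] G) : ∀ᶠ z in 𝓝 0, F (G z) = G (F z) := by
  filter_upwards [h, hF.eventually h] with z h1 h2
  rw [← h1, ← h2]
  exact (Function.iterate_succ_apply' F n z).symm.trans (Function.iterate_succ_apply F n z)

lemma IsAntiholomorphicGerm.conjugate {f p q : ℂ → ℂ} (hf : IsAntiholomorphicGerm f)
    (hp : AnalyticAt ℂ p 0) (hp0 : p 0 = 0) (hq : AnalyticAt ℂ q 0) (hq0 : q 0 = 0) :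
    IsAntiholomorphicGerm (p ∘ f ∘ q) ∧
      antiLinearCoeff (p ∘ f ∘ q) = deriv p 0 * antiLinearCoeff f * conj (deriv q 0) := by
  have hq' := analyticAt_conj_conj hq
  have hq0' : conj (q (conj 0)) = 0 := by simp [hq0]
  have hfq : AnalyticAt ℂ (fun z => f (q (conj z))) 0 := by
    have h1 : AnalyticAt ℂ (fun z => f (conj z)) (conj (q (conj 0))) := by rw [hq0']; exact hf.1
    have := AnalyticAt.comp (f := fun z => conj (q (conj z))) h1 hq'
    simpa [Function.comp_def] using this
  have hfq0 : f (q (conj 0)) = 0 := by simp [hq0, hf.2]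
  have hpfq : AnalyticAt ℂ (fun z => p (f (q (conj z)))) 0 := by
    have h1 : AnalyticAt ℂ p (f (q (conj 0))) := by rw [hfq0]; exact hp
    exact AnalyticAt.comp (f := fun z => f (q (conj z))) h1 hfq
  refine ⟨⟨hpfq, by simp [hq0, hf.2, hp0]⟩, ?_⟩
  have hd1 : HasDerivAt (fun z => conj (q (conj z))) (conj (deriv q 0)) 0 := by
    have h1 : HasDerivAt q (deriv q 0) (conj 0) := by
      rw [map_zero]; exact hq.differentiableAt.hasDerivAt
    have := h1.conj_conj
    rw [conj_conj] at this
    exact this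
  have hd2 : HasDerivAt (fun z => f (q (conj z))) (antiLinearCoeff f * conj (deriv q 0)) 0 := by
    have h1 : HasDerivAt (fun z => f (conj z)) (antiLinearCoeff f) (conj (q (conj 0))) := by
      rw [hq0']; exact hf.hasDerivAt
    have := HasDerivAt.comp (0 : ℂ) h1 hd1
    simpa [Function.comp_def] using this
  have hd3 : HasDerivAt (fun z => p (f (q (conj z))))
      (deriv p 0 * (antiLinearCoeff f * conj (deriv q 0))) 0 := by
    have h1 : HasDerivAt p (deriv p 0) (f (q (conj 0))) := by
      rw [hfq0]; exact hp.differentiableAt.hasDerivAt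
    exact HasDerivAt.comp (0 : ℂ) h1 hd2
  rw [mul_assoc]
  exact hd3.deriv

lemma iterate_conjugate {f p q : ℂ → ℂ} (hf : Tendsto f (𝓝 0) (𝓝 0)) (hq : Tendsto q (𝓝 0) (𝓝 0))
    (hpq : ∀ᶠ z in 𝓝 0, p (q z) = z) (hqp : ∀ᶠ z in 𝓝 0, q (p z) = z) (m : ℕ) :
    (p ∘ f ∘ q)^[m] =ᶠ[𝓝 0] p ∘ f^[m] ∘ q := by
  induction m with
  | zero => filter_upwards [hpq] with z hz using hz.symm
  | succ m ih =>
    filter_upwards [ih, hq.eventually ((tendsto_iterate hf m).eventually hqp)] with z h1 h2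
    rw [Function.iterate_succ_apply', h1]
    simp only [Function.comp_apply]
    rw [h2, Function.iterate_succ_apply']

lemma IsPrenormalized.tendsto_sub_div {k : ℕ} {b : ℂ} {G : ℂ → ℂ} (hk : 1 ≤ k)
    (hG : IsPrenormalized k b G) :
    Tendsto (fun z => (G z - z) / z ^ (k + 1)) (𝓝[≠] 0) (𝓝 1) := by
  have h1 : Tendsto (fun z => (G z - (z + z ^ (k + 1) + (((k : ℂ) + 1) / 2 - b) * z ^ (2 * k + 1)))
      / z ^ (2 * k + 1)) (𝓝[≠] 0) (𝓝 0) := (hG.2.mono nhdsWithin_le_nhds).tendsto_div_nhds_zero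
  have h2 : Tendsto (fun z : ℂ => z ^ k) (𝓝[≠] 0) (𝓝 0) := by
    have : Tendsto (fun z : ℂ => z ^ k) (𝓝 0) (𝓝 (0 ^ k)) := (continuous_pow k).tendsto 0
    rw [zero_pow (by omega)] at this
    exact this.mono_left nhdsWithin_le_nhds
  have h3 := (h1.mul h2).add ((h2.const_mul (((k : ℂ) + 1) / 2 - b)).add_const 1)
  rw [mul_zero, mul_zero, zero_add, zero_add] at h3
  refine h3.congr' ?_
  filter_upwards [self_mem_nhdsWithin] with z hz
  have hz0 : z ≠ 0 := hz
  have e : z ^ (2 * k + 1) = z ^ (k + 1) * z ^ k := by rw [← pow_add]; congr 1; omega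
  rw [e]
  have := pow_ne_zero k hz0
  have := pow_ne_zero (k + 1) hz0
  field_simp
  ring

/-- The antilinear part of a root of a prenormalized germ is the reflection in one of the axes:
comparing the terms of degree `k + 1` in `F ∘ G = G ∘ F` gives `a = a ^ (k + 1)` for the linear
coefficient `a`. -/
theorem exists_axis_of_root {k n : ℕ} {b : ℂ} {F G : ℂ → ℂ} (hk : 1 ≤ k) (hn0 : 0 < n)
    (hG : IsPrenormalized k b G) (hF : IsAntiholomorphicGerm F) (hFG : F^[n] =ᶠ[𝓝 0] G) :
    ∃ ℓ : Fin k, antiLinearCoeff F = axisCoeff k ℓ := by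
  have hG0 := hG.map_zero hk
  have hG1 := hG.hasDerivAt hk
  set a := antiLinearCoeff F with ha
  set A : ℂ → ℂ := fun z => F (conj z) with hA
  have hA0 : A 0 = 0 := by simp [hA, hF.2]
  have hcc : Tendsto (fun z : ℂ => conj z) (𝓝 0) (𝓝 0) := by
    simpa using continuous_conj.tendsto (0 : ℂ)
  have hc : Tendsto (fun z : ℂ => conj z) (𝓝[≠] 0) (𝓝[≠] 0) :=
    tendsto_nhdsWithin_iff.2 ⟨hcc.mono_left nhdsWithin_le_nhds, by
      filter_upwards [self_mem_nhdsWithin] with z hz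
      simpa using hz⟩
  -- If `a = 0`, then `F` contracts by a factor `1 / 2` near the origin, and so does its iterate
  -- `G`, although `G` is tangent to the identity.
  have ha0 : a ≠ 0 := by
    intro h0
    have h1 : ∀ᶠ z in 𝓝 (0 : ℂ), ‖F z‖ ≤ 1 / 2 * ‖z‖ := by
      have h2 := hF.hasDerivAt
      rw [← ha, h0, hasDerivAt_iff_isLittleO] at h2
      have h3 := hcc.eventually (h2.bound (by norm_num : (0 : ℝ) < 1 / 2))
      filter_upwards [h3] with z hz
      simpa [hF.2] using hz
    have h4 : ∀ m : ℕ, ∀ᶠ z in 𝓝 (0 : ℂ), ‖F^[m] z‖ ≤ (1 / 2) ^ m * ‖z‖ := by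
      intro m
      induction m with
      | zero => simp
      | succ m ih =>
        filter_upwards [ih, (tendsto_iterate hF.tendsto m).eventually h1] with z h5 h6
        rw [Function.iterate_succ_apply', pow_succ]
        linarith
    have h5 : Tendsto (fun z => ‖G z / z‖) (𝓝[≠] 0) (𝓝 ‖(1 : ℂ)‖) :=
      (tendsto_div_of_hasDerivAt hG1 hG0).norm
    rw [norm_one] at h5
    have h6 : ∀ᶠ z in 𝓝[≠] (0 : ℂ), ‖G z / z‖ ≤ 1 / 2 := by
      filter_upwards [nhdsWithin_le_nhds (h4 n), nhdsWithin_le_nhds hFG, self_mem_nhdsWithin]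
        with z h7 h8 hz
      rw [norm_div, div_le_iff₀ (norm_pos_iff.2 hz), ← h8]
      refine h7.trans ?_
      gcongr
      exact pow_le_of_le_one (by norm_num) (by norm_num) hn0.ne'
    have := le_of_tendsto h5 h6
    norm_num at this
  have hG' : Tendsto (fun z => (conj (G (conj z)) - z) / z ^ (k + 1)) (𝓝[≠] 0) (𝓝 1) := by
    have h1 := (continuous_conj.tendsto (1 : ℂ)).comp ((hG.tendsto_sub_div hk).comp hc)
    rw [map_one] at h1
    refine h1.congr fun z => ?_
    simp
  have hGc : Tendsto (fun z => conj (G (conj z))) (𝓝 0) (𝓝 0) := by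
    have h1 := hG1.continuousAt.tendsto
    rw [hG0] at h1
    exact hcc.comp (h1.comp hcc)
  -- The terms of degree `k + 1` of `F ∘ G` and of `G ∘ F`.
  have hL : Tendsto (fun z => (A (conj (G (conj z))) - A z) / z ^ (k + 1)) (𝓝[≠] 0) (𝓝 a) := by
    have hs := (hF.1.hasStrictDerivAt).isLittleO
    have h1 : Tendsto (fun z : ℂ => (conj (G (conj z)), z)) (𝓝[≠] 0) (𝓝 ((0 : ℂ), (0 : ℂ))) := by
      rw [nhds_prod_eq]
      exact (hGc.mono_left nhdsWithin_le_nhds).prodMk (tendsto_id.mono_left nhdsWithin_le_nhds)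
    have h2 := (hs.comp_tendsto h1)
    have h3 : (fun z : ℂ => conj (G (conj z)) - z) =O[𝓝[≠] 0] fun z => z ^ (k + 1) :=
      Asymptotics.isBigO_of_div_tendsto_nhds (by
        filter_upwards [self_mem_nhdsWithin] with z hz h
        exact absurd h (pow_ne_zero _ hz)) 1 hG'
    have h4 := (h2.trans_isBigO h3).tendsto_div_nhds_zero
    have h5 := h4.add (hG'.mul_const a)
    rw [zero_add, one_mul] at h5
    refine h5.congr fun z => ?_
    have e : deriv (fun z => F (conj z)) 0 = a := rfl
    simp [e, A]
    ring
  have hR : Tendsto (fun z => (G (A z) - A z) / z ^ (k + 1)) (𝓝[≠] 0) (𝓝 (a ^ (k + 1))) := by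
    have hAz := tendsto_div_of_hasDerivAt hF.hasDerivAt hA0
    have hne : ∀ᶠ z in 𝓝[≠] (0 : ℂ), A z ≠ 0 := by
      filter_upwards [hAz.eventually_ne ha0] with z hz h0
      exact hz (by show A z / z = 0; rw [h0, zero_div])
    have hAt : Tendsto A (𝓝[≠] 0) (𝓝[≠] 0) := by
      refine tendsto_nhdsWithin_iff.2 ⟨?_, hne⟩
      have := hF.1.continuousAt.tendsto
      simp only [map_zero, hF.2] at this
      exact this.mono_left nhdsWithin_le_nhds
    have h1 := ((hG.tendsto_sub_div hk).comp hAt).mul (hAz.pow (k + 1))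
    rw [one_mul] at h1
    refine h1.congr' ?_
    filter_upwards [hne] with z hz
    simp only [Function.comp_apply]
    rw [div_pow]
    have := pow_ne_zero (k + 1) hz
    exact div_mul_div_cancel₀ this
  have hak : a ^ k = 1 := by
    have h1 : a = a ^ (k + 1) := by
      refine tendsto_nhds_unique hL (hR.congr' ?_)
      have h2 := hcc.eventually (commute_of_iterate_eq hF.tendsto hFG)
      filter_upwards [nhdsWithin_le_nhds h2] with z hz
      simp only [A, conj_conj]
      rw [hz]
    rw [pow_succ] at h1
    exact mul_right_cancel₀ ha0 (by rw [one_mul]; exact h1.symm)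
  exact exists_axisCoeff_eq hk hak

/-! ### Solving the time equation -/

/-- The time needed to go from `z` to `z e^u` along the vector field `z^{k+1}/(1 + b z^k)`,
multiplied by `z^k`. -/
def timeIncrement (k : ℕ) (b z u : ℂ) : ℂ := (1 - exp (-(k * u))) / k + b * z ^ k * u

lemma timeIncrement_add {k : ℕ} (hk : 1 ≤ k) (b z u v : ℂ) :
    timeIncrement k b z (u + v) =
      timeIncrement k b z u + exp (-(k * u)) * timeIncrement k b (z * exp u) v := by
  have hk0 : (k : ℂ) ≠ 0 := by exact_mod_cast (by omega : k ≠ 0)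
  have e1 : exp (-(k * (u + v))) = exp (-(k * u)) * exp (-(k * v)) := by rw [← exp_add]; congr 1; ring
  have e2 : exp (-(k * u)) * exp u ^ k = 1 := by
    rw [← exp_nat_mul, ← exp_add, neg_add_cancel, exp_zero]
  simp only [timeIncrement, e1, mul_pow]
  linear_combination (-(b * z ^ k * v)) * e2

/-- The point reached from `z` after the time `p(z) / z^k` is `z e^{u(z)}` for a unique germ `u`
vanishing at the origin, by the implicit function theorem. -/
lemma exists_timeIncrement_eq {k : ℕ} (hk : 1 ≤ k) (b : ℂ) {p : ℂ → ℂ} (hp : AnalyticAt ℂ p 0)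
    (hp0 : p 0 = 0) : ∃ u : ℂ → ℂ, AnalyticAt ℂ u 0 ∧ u 0 = 0 ∧
      ∀ᶠ v in 𝓝 ((0 : ℂ), (0 : ℂ)), timeIncrement k b v.1 v.2 = p v.1 ↔ u v.1 = v.2 := by
  have hk0 : (k : ℂ) ≠ 0 := by exact_mod_cast (by omega : k ≠ 0)
  set f : ℂ × ℂ → ℂ := fun v => timeIncrement k b v.1 v.2 - p v.1 with hf
  have hfa : AnalyticAt ℂ f (0, 0) := by
    have h1 : AnalyticAt ℂ (fun v : ℂ × ℂ => p v.1) (0, 0) :=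
      AnalyticAt.comp (f := fun v : ℂ × ℂ => v.1) hp analyticAt_fst
    have h2 : AnalyticAt ℂ (fun v : ℂ × ℂ => timeIncrement k b v.1 v.2) (0, 0) := by
      unfold timeIncrement
      have h3 : AnalyticAt ℂ (fun v : ℂ × ℂ => v.1) (0, 0) := analyticAt_fst
      have h4 : AnalyticAt ℂ (fun v : ℂ × ℂ => v.2) (0, 0) := analyticAt_snd
      exact ((analyticAt_const.sub ((analyticAt_const.mul h4).neg.cexp)).div analyticAt_const
        hk0).add ((analyticAt_const.mul (h3.pow k)).mul h4)
    exact h2.sub h1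
  have cdf : ContDiffAt ℂ ⊤ f (0, 0) := hfa.contDiffAt
  -- The derivative of the equation in the unknown is `1` at the origin, so the implicit
  -- function theorem applies.
  have hder : HasDerivAt (fun u => f (0, u)) 1 0 := by
    have h1 : HasDerivAt (fun u : ℂ => (1 - exp (-(k * u))) / k) 1 0 := by
      have h2 := (((hasDerivAt_id' (0 : ℂ)).const_mul (k : ℂ)).fun_neg.cexp.const_sub 1).div_const
        (k : ℂ)
      have e : -(exp (-((k : ℂ) * 0)) * -((k : ℂ) * 1)) / k = 1 := by
        rw [mul_zero, neg_zero, exp_zero]; field_simp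
      rw [e] at h2
      exact h2
    have h3 := h1.sub_const (p 0)
    refine h3.congr_of_eventuallyEq (Eventually.of_forall fun u => ?_)
    simp [hf, timeIncrement, show k ≠ 0 by omega]
  have hinr : fderiv ℂ f (0, 0) ∘L .inr ℂ ℂ ℂ = ContinuousLinearMap.id ℂ ℂ := by
    have h1 : HasFDerivAt (fun u : ℂ => f (0, u)) (fderiv ℂ f (0, 0) ∘L .inr ℂ ℂ ℂ) 0 := by
      have h2 : HasFDerivAt f (fderiv ℂ f (0, 0)) ((0 : ℂ), (0 : ℂ)) :=
        hfa.differentiableAt.hasFDerivAt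
      exact HasFDerivAt.comp (f := fun u : ℂ => ((0 : ℂ), u)) (0 : ℂ) h2 (hasFDerivAt_prodMk_right 0 0)
    refine h1.unique ?_
    have h3 : ContinuousLinearMap.id ℂ ℂ = ContinuousLinearMap.toSpanSingleton ℂ (1 : ℂ) := by
      ext; simp
    rw [h3]
    exact hder.hasFDerivAt
  have if₂ : (fderiv ℂ f (0, 0) ∘L .inr ℂ ℂ ℂ).IsInvertible := by
    rw [hinr]; exact ⟨ContinuousLinearEquiv.refl ℂ ℂ, rfl⟩
  have hn : (⊤ : WithTop ℕ∞) ≠ 0 := by simp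
  refine ⟨cdf.implicitFunction hn if₂, ?_, cdf.implicitFunction_apply_self hn if₂, ?_⟩
  · exact (cdf.contDiffAt_implicitFunction hn if₂).analyticAt
  · filter_upwards [cdf.eventually_apply_eq_iff_implicitFunction hn if₂] with v hv
    have h0 : f ((0 : ℂ), (0 : ℂ)) = 0 := by simp [hf, timeIncrement, hp0]
    rw [h0] at hv
    rw [← hv, hf, sub_eq_zero]

/-- `N` is the convergent time-one map of the vector field `z^{k+1}/(1 + b z^k)`. -/
def IsTimeOneMap (k : ℕ) (b : ℂ) (N : ℂ → ℂ) : Prop :=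
  ∃ ν : ℂ → ℂ, AnalyticAt ℂ ν 0 ∧ ν 0 = 0 ∧
    (∀ᶠ z in 𝓝 (0 : ℂ), timeIncrement k b z (ν z) = z ^ k) ∧ ∀ z, N z = z * exp (ν z)

/-- A germ is conjugate to the time-one map if the Abel equation has a solution that differs from
the time coordinate by an analytic germ `Q`. -/
theorem exists_conjugacy_timeOneMap {k : ℕ} (hk : 1 ≤ k) {b : ℂ} {G γ Q : ℂ → ℂ}
    (hγ : AnalyticAt ℂ γ 0) (hγ0 : γ 0 = 0) (hG : ∀ᶠ z in 𝓝 (0 : ℂ), G z = z * exp (γ z))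
    (hQ : AnalyticAt ℂ Q 0)
    (h : ∀ᶠ z in 𝓝[≠] (0 : ℂ), timeIncrement k b z (γ z) = z ^ k * (1 + Q z - Q (G z))) :
    ∃ N H : ℂ → ℂ, IsTimeOneMap k b N ∧ AnalyticAt ℂ H 0 ∧ H 0 = 0 ∧ deriv H 0 = 1 ∧
      ∀ᶠ z in 𝓝 (0 : ℂ), H (G z) = N (H z) := by
  have hk' : k ≠ 0 := by omega
  -- `H z = z * exp (u z)` is the flow for time `Q z` and `ν` defines the flow for time `1`;
  -- only the uniqueness of the solution `w` for time `Q z + 1` is used.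
  obtain ⟨u, hu, hu0, hux⟩ := exists_timeIncrement_eq hk b (p := fun z => z ^ k * Q z)
    ((analyticAt_id.pow k).mul hQ) (by simp [hk'])
  obtain ⟨ν, hν, hν0, hνx⟩ := exists_timeIncrement_eq hk b (p := fun z => z ^ k)
    (analyticAt_id.pow k) (by simp [hk'])
  obtain ⟨w, -, -, hwx⟩ := exists_timeIncrement_eq hk b (p := fun z => z ^ k * (Q z + 1))
    ((analyticAt_id.pow k).mul (hQ.add analyticAt_const)) (by simp [hk'])
  have hut : Tendsto u (𝓝 0) (𝓝 0) := by simpa [hu0] using hu.continuousAt.tendsto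
  have hνt : Tendsto ν (𝓝 0) (𝓝 0) := by simpa [hν0] using hν.continuousAt.tendsto
  have hγt : Tendsto γ (𝓝 0) (𝓝 0) := by simpa [hγ0] using hγ.continuousAt.tendsto
  have hpair : ∀ {s : ℂ → ℂ}, Tendsto s (𝓝 0) (𝓝 0) →
      Tendsto (fun z => (z, s z)) (𝓝 (0 : ℂ)) (𝓝 ((0 : ℂ), (0 : ℂ))) := fun hs => by
    rw [nhds_prod_eq]; exact tendsto_id.prodMk hs
  have huE : ∀ᶠ z in 𝓝 (0 : ℂ), timeIncrement k b z (u z) = z ^ k * Q z := by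
    filter_upwards [(hpair hut).eventually hux] with z hz using hz.2 rfl
  have hνE : ∀ᶠ z in 𝓝 (0 : ℂ), timeIncrement k b z (ν z) = z ^ k := by
    filter_upwards [(hpair hνt).eventually hνx] with z hz using hz.2 rfl
  have hmul : ∀ {s : ℂ → ℂ}, Tendsto s (𝓝 0) (𝓝 0) →
      Tendsto (fun z => z * exp (s z)) (𝓝 0) (𝓝 0) := fun hs => by
    have := tendsto_id.mul ((continuous_exp.tendsto 0).comp hs)
    rwa [zero_mul] at this
  have hGt : Tendsto G (𝓝 0) (𝓝 0) := (hmul hγt).congr' (hG.mono fun z hz => hz.symm)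
  have hHt := hmul hut
  set H : ℂ → ℂ := fun z => z * exp (u z) with hH
  have hd : HasDerivAt H 1 0 := deriv_eq_one_of_exponent hu hu0 (Eventually.of_forall fun z => rfl)
  refine ⟨fun z => z * exp (ν z), H, ⟨ν, hν, hν0, hνE, fun z => rfl⟩, analyticAt_id.mul hu.cexp,
    by simp [hH], hd.deriv, ?_⟩
  -- Both `H ∘ G` and the time-one map after `H` reach time `Q z + 1` from `z`.
  set u₁ : ℂ → ℂ := fun z => γ z + u (G z) with hu₁
  set u₂ : ℂ → ℂ := fun z => u z + ν (H z) with hu₂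
  have hu₁t : Tendsto u₁ (𝓝 0) (𝓝 0) := by simpa using hγt.add (hut.comp hGt)
  have hu₂t : Tendsto u₂ (𝓝 0) (𝓝 0) := by simpa using hut.add (hνt.comp hHt)
  rw [eventually_nhdsWithin_iff] at h
  have e : ∀ x : ℂ, exp (-(k * x)) * exp x ^ k = 1 := fun x => by
    rw [← exp_nat_mul, ← exp_add, neg_add_cancel, exp_zero]
  filter_upwards [(hpair hu₁t).eventually hwx, (hpair hu₂t).eventually hwx, h, hG, huE,
    hGt.eventually huE, hHt.eventually hνE] with z h1 h2 h3 h4 h5 h6 h7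
  rcases eq_or_ne z 0 with rfl | hz
  · have : G 0 = 0 := by rw [h4, zero_mul]
    simp [hH, this]
  · have h8 : timeIncrement k b z (u₁ z) = z ^ k * (Q z + 1) := by
      rw [hu₁]
      beta_reduce
      rw [timeIncrement_add hk, ← h4, h6, h3 hz]
      nth_rewrite 2 [h4]
      rw [mul_pow]
      linear_combination (z ^ k * Q (G z)) * e (γ z)
    have h9 : timeIncrement k b z (u₂ z) = z ^ k * (Q z + 1) := by
      rw [hu₂]
      beta_reduce
      rw [timeIncrement_add hk, h5]
      change _ + _ * timeIncrement k b (H z) (ν (H z)) = _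
      rw [h7, hH]
      beta_reduce
      rw [mul_pow]
      linear_combination (z ^ k) * e (u z)
    have h10 : u₁ z = u₂ z := (h1.1 h8).symm.trans (h2.1 h9)
    calc H (G z) = z * exp (u₁ z) := by
          simp only [hH, hu₁]; nth_rewrite 1 [h4]; rw [exp_add, mul_assoc]
      _ = H z * exp (ν (H z)) := by rw [h10, hu₂]; beta_reduce; rw [exp_add, hH]; ring

/-! ### Germs commuting with a non-real translation of the Fatou coordinates -/

lemma differentiableOn_timeCoordinate {k : ℕ} {b : ℂ} {θ α r : ℝ} (hα : α ≤ Real.pi) :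
    DifferentiableOn ℂ (timeCoordinate k b θ) (sector θ α r) := by
  intro z hz
  have hz0 := ne_zero_of_mem_sector hz
  have hs : z * exp (-(θ * I)) ∈ slitPlane := by
    rw [mem_slitPlane_iff_arg]
    refine ⟨fun h => ?_, mul_ne_zero hz0 (exp_ne_zero _)⟩
    have := hz.2.2
    rw [h, abs_of_pos Real.pi_pos] at this
    linarith
  have hlog : DifferentiableAt ℂ (fun z : ℂ => log (z * exp (-(θ * I)))) z :=
    (differentiableAt_fun_id.mul_const _).clog hs
  by_cases hk : k = 0
  · subst hk
    unfold timeCoordinate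
    simp only [CharP.cast_eq_zero, zero_mul, div_zero, zero_add]
    exact (hlog.const_mul b).differentiableWithinAt
  · have hk0 : (k : ℂ) * z ^ k ≠ 0 := mul_ne_zero (by exact_mod_cast hk) (pow_ne_zero _ hz0)
    have h1 : DifferentiableAt ℂ (fun z : ℂ => -1 / ((k : ℂ) * z ^ k)) z :=
      (differentiableAt_const _).fun_div ((differentiableAt_id.pow k).const_mul (k : ℂ)) hk0
    exact (h1.fun_add (hlog.const_mul b)).differentiableWithinAt

lemma tendsto_add_cylinderEnd {k : ℕ} (j : ZMod (2 * k)) (T : ℂ) :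
    Tendsto (fun W => W + T) (cylinderEnd k j) (cylinderEnd k j) := by
  intro P hP
  obtain ⟨R, hR⟩ := eventually_cylinderEnd.1 hP
  refine eventually_cylinderEnd.2 ⟨R - endSign k j * T.im, fun W hW => hR _ ?_⟩
  rw [add_im]; linarith

/-- A normalized germ commuting with a non-real translation is a translation. -/
lemma IsNormalizedGerm.eventually_eq_add {k : ℕ} {b : ℂ} {j : ZMod (2 * k)} {Ψ : ℂ → ℂ}
    (h : IsNormalizedGerm k b j Ψ) {T : ℂ} (hT : T.im ≠ 0)
    (hΨ : ∀ᶠ W in cylinderEnd k j, Ψ (W + T) = Ψ W + T) :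
    ∀ᶠ W in cylinderEnd k j, Ψ W - W = normalizedConstant k b j := by
  -- One of `T` and `-T` points to the end of the cylinder.
  obtain ⟨T', hT', hΨ'⟩ : ∃ T' : ℂ, 0 < endSign k j * T'.im ∧
      ∀ᶠ W in cylinderEnd k j, Ψ (W + T') = Ψ W + T' := by
    have hne : endSign k j * T.im ≠ 0 :=
      mul_ne_zero (by rcases endSign_eq k j with h | h <;> rw [h] <;> norm_num) hT
    rcases hne.lt_or_gt with hlt | hgt
    · refine ⟨-T, by rw [neg_im]; linarith, ?_⟩
      filter_upwards [(tendsto_add_cylinderEnd j (-T)).eventually hΨ] with W hW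
      rw [neg_add_cancel_right] at hW
      rw [hW]; ring
    · exact ⟨T, hgt, hΨ⟩
  obtain ⟨R, hR⟩ := eventually_cylinderEnd.1 hΨ'
  refine eventually_cylinderEnd.2 ⟨R, fun W hW => ?_⟩
  have him : ∀ m : ℕ, endSign k j * (W + m * T').im = endSign k j * W.im + m * (endSign k j * T'.im) := by
    intro m
    rw [add_im, ← ofReal_natCast, im_ofReal_mul]; ring
  have h1 : ∀ m : ℕ, Ψ (W + m * T') - (W + m * T') = Ψ W - W := by
    intro m
    induction m with
    | zero => simp
    | succ m ih =>
      have h2 := hR (W + m * T') (by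
        rw [him]
        have : 0 ≤ (m : ℝ) * (endSign k j * T'.im) := by positivity
        linarith)
      rw [show W + ((m + 1 : ℕ) : ℂ) * T' = W + m * T' + T' by push_cast; ring, h2, ← ih]
      ring
  have h2 : Tendsto (fun m : ℕ => W + m * T') atTop (cylinderEnd k j) := by
    intro P hP
    obtain ⟨R', hR'⟩ := eventually_cylinderEnd.1 hP
    have h3 : Tendsto (fun m : ℕ => (m : ℝ) * (endSign k j * T'.im)) atTop atTop :=
      tendsto_natCast_atTop_atTop.atTop_mul_const hT'
    rw [mem_map]
    filter_upwards [h3.eventually_gt_atTop (R' - endSign k j * W.im)] with m hm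
    refine hR' _ ?_
    rw [him]; linarith
  -- `Ψ W - W` is constant along the sequence `W + m * T'`, and its limit at the end is the
  -- normalized constant.
  have h3 := h.2.2.comp h2
  refine tendsto_nhds_unique (tendsto_const_nhds.congr fun m => ?_) h3
  exact (h1 m).symm

/-- If a germ tangent to the identity acts in the Fatou coordinates as a non-real translation, then
all transition functions are translations, the Fatou coordinates differ from the time coordinates
by an analytic germ, and `G` is conjugate to its normal form. -/
theorem IsFatouFamily.exists_conjugacy_of_shift {k : ℕ} {b : ℂ} {G : ℂ → ℂ} {α r : ℝ}
    {φ : ZMod (2 * k) → ℂ → ℂ} (h : IsFatouFamily k b G α r (fun _ => 0) φ) (hk : 1 ≤ k)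
    (hr : 0 < r) (hα1 : Real.pi / (2 * k) < α) (hα : α < Real.pi / k) (hG : IsPrenormalized k b G)
    {M : ℂ → ℂ} (hM0 : M 0 = 0) (hM1 : HasDerivAt M 1 0) {T : ℂ} (hT : T.im ≠ 0)
    (hM : IsShift k α φ 0 T M) :
    ∃ N H : ℂ → ℂ, IsTimeOneMap k b N ∧ AnalyticAt ℂ H 0 ∧ H 0 = 0 ∧ deriv H 0 = 1 ∧
      ∀ᶠ z in 𝓝 (0 : ℂ), H (G z) = N (H z) := by
  have hαπ := lt_pi_of_lt hk hα
  have hp : 0 ≤ Real.pi / (2 * k) := by positivity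
  have hfin : NeZero (2 * k) := ⟨by omega⟩
  have hk0 : (k : ℂ) ≠ 0 := by exact_mod_cast (by omega : k ≠ 0)
  have hG0 := hG.map_zero hk
  have hG1 := hG.hasDerivAt hk
  set β := (Real.pi / (2 * k) + α) / 2 with hβ
  have hβ1 : Real.pi / (2 * k) < β := by linarith
  have hβα : β < α := by linarith
  have hβk : β < Real.pi / k := hβα.trans hα
  obtain ⟨Ψ, ⟨-, -, -, -, -, -, -, hnorm, -⟩, hΨ⟩ := h.exists_modulus hk hG0 hG1 hα1 hα hr
  -- The transition functions commute with the translations by `1` and by `T`, so they are the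
  -- translations by the normalized constants.
  have hjump : ∀ j, ∀ᶠ z in overlapNhds k j β,
      φ (tgtIndex k j) z - φ (srcIndex k j) z = normalizedConstant k b j := by
    intro j
    have h1 := hΨ j
    rw [nhdsWithin_sector hr] at h1
    have hc : ∀ᶠ W in cylinderEnd k j, Ψ j (W + T) = Ψ j W + T := by
      refine (h.mono hβα.le le_rfl).end_induction hk hβ1 hβk hr j
        (P := fun W => Ψ j (W + T) = Ψ j W + T) ?_ ?_
      · rw [nhdsWithin_sector hr]
        have h2 := tendsto_sectorNhds_of_hasDerivAt_one hM1 hM0 (θ := midAngle k j)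
          (sub_lt_sub_right hβα (Real.pi / (2 * k))) (by linarith)
        have h3 := hM.eq (srcIndex k j) β hβα
        have h4 := hM.eq (tgtIndex k j) β hβα
        rw [add_zero] at h3 h4
        filter_upwards [h2.eventually h1, overlapNhds_mono hβα.le h1,
          overlapNhds_le_src hk hβk j h3, overlapNhds_le_tgt hk hβk j h4] with z h5 h6 h7 h8
        rw [h6, ← h7, h5, h8]
      · filter_upwards [(hnorm j).2.1, (tendsto_add_cylinderEnd j T).eventually (hnorm j).2.1]
          with W h2 h3
        rw [show W + 1 + T = W + T + 1 by ring, h3, h2, show Ψ j W + 1 + T = Ψ j W + T + 1 by ring,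
          add_left_inj]
    have h2 := (h.tendsto_cylinderEnd hk hr hα1 hα j).eventually ((hnorm j).eventually_eq_add hT hc)
    filter_upwards [overlapNhds_mono hβα.le h2, overlapNhds_mono hβα.le h1] with z h3 h4
    rw [← h4, h3]
  -- The time coordinates jump by the same constants, so the differences agree on the overlaps
  -- and glue to a germ `Q`.
  set q : ZMod (2 * k) → ℂ → ℂ := fun j z => φ j z - timeCoordinate k b (j.val * Real.pi / k) z with hq
  have hq' : ∀ j, ∀ᶠ z in overlapNhds k j β, q (j - 1) z = q j z := by
    intro j
    have h1 : ∀ᶠ z in overlapNhds k j β, q (srcIndex k j) z = q (tgtIndex k j) z := by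
      filter_upwards [hjump j, eventually_sectorNhds one_pos fun z hz =>
        timeCoordinate_sub (b := b) hk hβk hz] with z h2 h3
      rw [hq]
      linear_combination h3 - h2
    unfold srcIndex tgtIndex at h1
    split_ifs at h1
    · exact h1
    · exact h1.mono fun z hz => hz.symm
  choose ρ₁ hρ₁ ha using fun j => exists_sector_of_eventually (hq' j)
  obtain ⟨ρ, hρ, hρr, hρle⟩ : ∃ ρ > 0, ρ ≤ r ∧ ∀ j, ρ ≤ ρ₁ j := by
    obtain ⟨j₀, hj₀⟩ := Finite.exists_min ρ₁
    exact ⟨min r (ρ₁ j₀), lt_min hr (hρ₁ _), min_le_left _ _, fun j =>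
      (min_le_right _ _).trans (hj₀ j)⟩
  obtain ⟨Q, hQ, -, hQq⟩ := exists_analyticAt_glue hk hρ hβ1 hβk q (L := 0)
    (fun j => (((h.coord j).1.sub (differentiableOn_timeCoordinate hαπ)).mono
      (sector_mono hβα.le hρr)))
    (fun j z hz => ha j z (sector_mono le_rfl (hρle j) hz))
    (fun j => (h.asymp j).mono_left (nhdsWithin_mono _ (sector_mono hβα.le hρr)))
  obtain ⟨γ, hγ, hγ0, hGγ, -⟩ := exists_exponent hk hG
  -- The Abel equation for the glued function.
  refine exists_conjugacy_timeOneMap hk hγ hγ0 hGγ hQ ?_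
  set β₂ := (Real.pi / (2 * k) + β) / 2 with hβ₂
  have hβ₂1 : Real.pi / (2 * k) < β₂ := by linarith
  have hβ₂β : β₂ < β := by linarith
  refine eventually_punctured_of_petals hk one_pos hβ₂1 (hβ₂β.trans hβk) fun j => ?_
  have hmem : ∀ᶠ z in sectorNhds (j.val * Real.pi / k) β, z ∈ sector (j.val * Real.pi / k) β ρ :=
    eventually_sectorNhds hρ fun z hz => hz
  have hmem₂ : ∀ᶠ z in sectorNhds (j.val * Real.pi / k) β₂, z ∈ sector (j.val * Real.pi / k) β₂ 1 :=
    eventually_sectorNhds one_pos fun z hz => hz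
  have hGs := tendsto_sectorNhds_of_hasDerivAt_one hG1 hG0 (θ := j.val * Real.pi / k) hβ₂β
    (hβα.le.trans hαπ)
  have hγs : ∀ᶠ z in sectorNhds (j.val * Real.pi / k) β₂, ‖γ z‖ < β - β₂ := by
    have h1 : Tendsto γ (𝓝 0) (𝓝 0) := by simpa [hγ0] using hγ.continuousAt.tendsto
    have h2 : ∀ᶠ z in sectorNhds (j.val * Real.pi / k) β₂, dist (γ z) 0 < β - β₂ := sectorNhds_le_nhds
      ((Metric.tendsto_nhds.1 h1) (β - β₂) (by linarith))
    exact h2.mono fun z hz => by simpa using hz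
  filter_upwards [hGs.eventually hmem, sectorNhds_mono hβ₂β.le hmem, hmem₂, hγs,
    h.eventually_abel hr hαπ hG0 hG1 j (hβ₂β.trans hβα), sectorNhds_le_nhds hGγ] with z h1 h2 h3 h4 h5 h6
  have h7 := hQq j z h2
  have h8 := hQq j _ h1
  obtain ⟨ζ, -, h9, rfl⟩ := (mem_sector_iff (by linarith)).1 h3
  have h10 := abs_le.1 ((abs_im_le_norm (γ (exp ζ))).trans h4.le)
  have h11 := abs_lt.1 h9
  have e1 := timeCoordinate_of_mem (k := k) (b := b) (θ := j.val * Real.pi / k) (ζ := ζ)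
    (by linarith)
  have e2 := timeCoordinate_of_mem (k := k) (b := b) (θ := j.val * Real.pi / k)
    (ζ := ζ + γ (exp ζ)) (by rw [abs_lt, add_im]; constructor <;> linarith)
  rw [exp_add, ← h6] at e2
  simp only [hq] at h7 h8
  rw [h7, h8, h5, e1, e2, timeIncrement]
  have e3 : exp (-((k : ℂ) * (ζ + γ (exp ζ)))) = exp (-(k * ζ)) * exp (-(k * γ (exp ζ))) := by
    rw [← exp_add]; congr 1; ring
  have e4 : exp (-((k : ℂ) * ζ)) * exp ζ ^ k = 1 := by
    rw [← exp_nat_mul, ← exp_add, neg_add_cancel, exp_zero]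
  rw [e3]
  linear_combination (-(1 - exp (-(k * γ (exp ζ)))) / k) * e4

/-! ### Uniqueness of roots and simultaneous symmetries -/

/-- `G` is analytically conjugate to the time-one map, as a germ. -/
def IsConjugateToTimeOneMap (k : ℕ) (b : ℂ) (G : ℂ → ℂ) : Prop :=
  ∃ N H : ℂ → ℂ, IsTimeOneMap k b N ∧ AnalyticAt ℂ H 0 ∧ H 0 = 0 ∧ deriv H 0 = 1 ∧
    ∀ᶠ z in 𝓝 (0 : ℂ), H (G z) = N (H z)

namespace IsFatouFamily

variable {k n : ℕ} {b : ℂ} {G : ℂ → ℂ} {α r : ℝ} {φ : ZMod (2 * k) → ℂ → ℂ}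

/-- A root is described by its axis and the imaginary part of its translation constant. -/
lemma exists_antiShift_of_root (h : IsFatouFamily k b G α r (fun _ => 0) φ) (hk : 1 ≤ k)
    (hr : 0 < r) (hα1 : Real.pi / (2 * k) < α) (hα : α < Real.pi / k) (hG : IsPrenormalized k b G)
    (hn : Even n) (hn0 : 0 < n) {F : ℂ → ℂ} {ℓ : ℕ} (hF : IsAntiholomorphicRoot n G F)
    (hFℓ : antiLinearCoeff F = axisCoeff k ℓ) :
    b.im = 0 ∧ ∃ y : ℝ, IsAntiShift k α φ ℓ (1 / n + I * y) F := by
  have hG0 := hG.map_zero hk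
  have hG1 := hG.hasDerivAt hk
  obtain ⟨hb, C, hC⟩ := h.exists_antiShift hk hr hα1 hα hG0 hG1 hF.1 hFℓ
    (commute_of_iterate_eq hF.1.tendsto hF.2)
  have hp : 0 ≤ Real.pi / (2 * k) := by positivity
  obtain ⟨y, rfl⟩ := h.antiShift_const hk hr (by linarith) hα hG0 hG1 hn hn0 hF.2 hC
  exact ⟨hb, y, hC⟩

/-- Two roots with different translation constants compose to a germ an iterate of which acts in
the Fatou coordinates as a non-real translation. -/
theorem eq_of_not_conjugate (h : IsFatouFamily k b G α r (fun _ => 0) φ) (hk : 1 ≤ k)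
    (hr : 0 < r) (hα1 : Real.pi / (2 * k) < α) (hα : α < Real.pi / k) (hG : IsPrenormalized k b G)
    (hnc : ¬ IsConjugateToTimeOneMap k b G) (hn : Even n) (hn0 : 0 < n)
    {F₁ F₂ : ℂ → ℂ} {ℓ₁ ℓ₂ : ℕ} (hF₁ : IsAntiholomorphicGerm F₁) (hF₂ : IsAntiholomorphicGerm F₂)
    (h₁ : antiLinearCoeff F₁ = axisCoeff k ℓ₁) (h₂ : antiLinearCoeff F₂ = axisCoeff k ℓ₂) {y₁ y₂ : ℝ}
    (hC₁ : IsAntiShift k α φ ℓ₁ (1 / n + I * y₁) F₁)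
    (hC₂ : IsAntiShift k α φ ℓ₂ (1 / n + I * y₂) F₂) : y₁ = y₂ := by
  by_contra hne
  have hαπ := lt_pi_of_lt hk hα
  obtain ⟨m, rfl⟩ := hn
  -- The linear part of `F₂ ∘ F₁` has order dividing `k`, so its iterate of order `k * m` is
  -- tangent to the identity and maps each petal to itself; it acts as a translation with
  -- imaginary part `k * m * (y₁ - y₂)` up to sign.
  have hM := IsShift.iterate hαπ (hC₂.comp hαπ hC₁) (k * m)
  have hd : ((k * m : ℕ) : ZMod (2 * k)) * (2 * (ℓ₂ : ZMod (2 * k)) - 2 * ℓ₁) = 0 := by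
    have h0 : (2 : ZMod (2 * k)) * k = 0 := by exact_mod_cast ZMod.natCast_self (2 * k)
    push_cast
    linear_combination (m * ((ℓ₂ : ZMod (2 * k)) - ℓ₁)) * h0
  rw [hd] at hM
  have hK : HasDerivAt (F₂ ∘ F₁) (axisCoeff k ℓ₂ * conj (axisCoeff k ℓ₁)) 0 := by
    have h3 := hF₁.hasDerivAt
    rw [h₁] at h3
    have h4 : HasDerivAt (fun z => F₁ (conj z)) (axisCoeff k ℓ₁) (conj 0) := by rwa [map_zero]
    have h5 := h4.conj_conj
    rw [conj_conj] at h5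
    have h6 := hF₂.hasDerivAt
    rw [h₂] at h6
    have h7 : HasDerivAt (fun z => F₂ (conj z)) (axisCoeff k ℓ₂)
        ((conj ∘ (fun z => F₁ (conj z)) ∘ conj) (0 : ℂ)) := by
      simpa [hF₁.2] using h6
    have h8 := h7.comp (0 : ℂ) h5
    refine h8.congr_of_eventuallyEq (Eventually.of_forall fun z => ?_)
    simp
  have hfix : (F₂ ∘ F₁) 0 = 0 := by simp [hF₁.2, hF₂.2]
  have hM1 := HasDerivAt.iterate (x := 0) hK hfix (k * m)
  have h1 : (axisCoeff k ℓ₂ * conj (axisCoeff k ℓ₁)) ^ (k * m) = 1 := by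
    rw [pow_mul, mul_pow, ← map_pow, axisCoeff_pow hk, axisCoeff_pow hk]; simp
  rw [h1] at hM1
  refine hnc (h.exists_conjugacy_of_shift hk hr hα1 hα hG
    (Function.iterate_fixed hfix _) hM1 ?_ hM)
  have e : ((k * m : ℕ) : ℂ) * (1 / ((m + m : ℕ) : ℂ) + I * y₁ + conj (1 / ((m + m : ℕ) : ℂ) + I * y₂)) =
      ((k * m * (2 / (m + m)) : ℝ) : ℂ) + ((k * m * (y₁ - y₂) : ℝ) : ℂ) * I := by
    simp only [map_add, map_mul, map_div₀, map_one, map_natCast, conj_I, conj_ofReal]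
    push_cast
    ring
  rw [e, add_im, ofReal_im, im_ofReal_mul, I_im, mul_one]
  have hkm : (0 : ℝ) < k * m := by
    have h2 : 0 < k * m := Nat.mul_pos (by omega) (by omega)
    exact_mod_cast h2
  rw [zero_add]
  exact mul_ne_zero hkm.ne' (sub_ne_zero.2 hne)

/-- A root is determined by its axis and its translation constant. -/
lemma eq_of_antiShift {c : ZMod (2 * k) → ℂ} (h : IsFatouFamily k b G α r c φ) (hk : 1 ≤ k)
    (hr : 0 < r) (hα1 : Real.pi / (2 * k) < α) (hα : α < Real.pi / k) {F₁ F₂ : ℂ → ℂ} {ℓ : ℕ} {C : ℂ}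
    (h₁ : F₁ 0 = 0) (h₂ : F₂ 0 = 0) (hC₁ : IsAntiShift k α φ ℓ C F₁) (hC₂ : IsAntiShift k α φ ℓ C F₂) :
    F₁ =ᶠ[𝓝 0] F₂ := by
  have hαπ := lt_pi_of_lt hk hα
  set β := (Real.pi / (2 * k) + α) / 2 with hβ
  have hβ1 : Real.pi / (2 * k) < β := by linarith
  have hβα : β < α := by linarith
  have h3 : ∀ᶠ z in 𝓝[≠] (0 : ℂ), F₁ z = F₂ z := by
    refine eventually_punctured_of_petals hk one_pos hβ1 (hβα.trans hα) fun j => ?_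
    refine h.eventually_injOn hr (2 * (ℓ : ZMod (2 * k)) - j) (hC₁.maps j β α hβα hαπ)
      (hC₂.maps j β α hβα hαπ) ?_
    filter_upwards [hC₁.eq j β hβα, hC₂.eq j β hβα] with z h4 h5
    rw [h4, h5]
  rw [eventually_nhdsWithin_iff] at h3
  filter_upwards [h3] with z hz
  rcases eq_or_ne z 0 with rfl | hz0
  · rw [h₁, h₂]
  · exact hz hz0

end IsFatouFamily

/-- Simultaneous symmetries of the modulus of a germ with roots, whose translation constants agree. -/
theorem exists_modulus_of_roots {k n : ℕ} {b : ℂ} {G : ℂ → ℂ} (hk : 1 ≤ k)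
    (hG : IsPrenormalized k b G) (hn : Even n) (hn0 : 0 < n) (L : Set ℕ)
    (hL : ∀ ℓ ∈ L, ∃ F, IsAntiholomorphicRoot n G F ∧ antiLinearCoeff F = axisCoeff k ℓ)
    (hL' : L.Subsingleton ∨ ¬ IsConjugateToTimeOneMap k b G) :
    ∃ Ψ : ZMod (2 * k) → ℂ → ℂ, IsModulusRepresentative k b G Ψ ∧ ∀ ℓ ∈ L, HasAxisSymmetry k n ℓ Ψ := by
  obtain ⟨r, φ, hr, hφ⟩ := exists_isFatouFamily hk hG
  have hα1 := lt_petalOpening hk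
  have hα := petalOpening_lt hk
  have hG0 := hG.map_zero hk
  have hG1 := hG.hasDerivAt hk
  obtain ⟨y, hy⟩ : ∃ y : ℝ, ∀ ℓ ∈ L, ∃ F, IsAntiholomorphicGerm F ∧
      antiLinearCoeff F = axisCoeff k ℓ ∧ IsAntiShift k (petalOpening k) φ ℓ (1 / n + I * y) F := by
    rcases L.eq_empty_or_nonempty with rfl | ⟨ℓ₀, hℓ₀⟩
    · exact ⟨0, by simp⟩
    obtain ⟨F₀, hF₀, hF₀ℓ⟩ := hL ℓ₀ hℓ₀
    obtain ⟨-, y, hy⟩ := hφ.exists_antiShift_of_root hk hr hα1 hα hG hn hn0 hF₀ hF₀ℓ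
    refine ⟨y, fun ℓ hℓ => ?_⟩
    rcases hL' with hs | hnc
    · rw [hs hℓ hℓ₀]; exact ⟨F₀, hF₀.1, hF₀ℓ, hy⟩
    · obtain ⟨F, hF, hFℓ⟩ := hL ℓ hℓ
      obtain ⟨-, y', hy'⟩ := hφ.exists_antiShift_of_root hk hr hα1 hα hG hn hn0 hF hFℓ
      have := hφ.eq_of_not_conjugate hk hr hα1 hα hG hnc hn hn0 hF.1 hF₀.1 hFℓ hF₀ℓ hy' hy
      rw [this] at hy'
      exact ⟨F, hF.1, hFℓ, hy'⟩
  -- the translation by `iy/2` makes the constants real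
  have hfam := hφ.add_const fun _ => I * y / 2
  refine IsFatouFamily.exists_modulus_symmetric (c := 0 + I * y / 2) hfam hk hr hα1 hα hG0 hG1 L
    fun ℓ hℓ => ?_
  obtain ⟨F, hF, hFℓ, hC⟩ := hy ℓ hℓ
  refine ⟨F, hF, hFℓ, ?_⟩
  have := hC.add_const (I * y / 2)
  have e : 1 / (n : ℂ) + I * y - I * y / 2 + conj (I * y / 2) = 1 / n := by
    simp only [map_mul, map_div₀, conj_I, conj_ofReal, map_ofNat]; ring
  rwa [e] at this

/-- At most one root is tangent to a given axis. -/
theorem root_unique {k n ℓ : ℕ} {b : ℂ} {G : ℂ → ℂ} (hk : 1 ≤ k)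
    (hG : IsPrenormalized k b G) (hnc : ¬ IsConjugateToTimeOneMap k b G) (hn : Even n) (hn0 : 0 < n)
    {F₁ F₂ : ℂ → ℂ} (hF₁ : IsAntiholomorphicRoot n G F₁) (hF₂ : IsAntiholomorphicRoot n G F₂)
    (h₁ : antiLinearCoeff F₁ = axisCoeff k ℓ) (h₂ : antiLinearCoeff F₂ = axisCoeff k ℓ) :
    F₁ =ᶠ[𝓝 0] F₂ := by
  obtain ⟨r, φ, hr, hφ⟩ := exists_isFatouFamily hk hG
  have hα1 := lt_petalOpening hk
  have hα := petalOpening_lt hk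
  obtain ⟨-, y₁, hy₁⟩ := hφ.exists_antiShift_of_root hk hr hα1 hα hG hn hn0 hF₁ h₁
  obtain ⟨-, y₂, hy₂⟩ := hφ.exists_antiShift_of_root hk hr hα1 hα hG hn hn0 hF₂ h₂
  have := hφ.eq_of_not_conjugate hk hr hα1 hα hG hnc hn hn0 hF₁.1 hF₂.1 h₁ h₂ hy₁ hy₂
  rw [this] at hy₁
  exact hφ.eq_of_antiShift hk hr hα1 hα hF₁.1.2 hF₂.1.2 hy₁ hy₂

lemma im_eq_zero_of_root {k n ℓ : ℕ} {b : ℂ} {G : ℂ → ℂ} (hk : 1 ≤ k)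
    (hG : IsPrenormalized k b G) (hn : Even n) (hn0 : 0 < n)
    {F : ℂ → ℂ} (hF : IsAntiholomorphicRoot n G F) (h : antiLinearCoeff F = axisCoeff k ℓ) :
    b.im = 0 := by
  obtain ⟨r, φ, hr, hφ⟩ := exists_isFatouFamily hk hG
  exact (hφ.exists_antiShift_of_root hk hr (lt_petalOpening hk) (petalOpening_lt hk) hG hn hn0 hF h).1

/-! ### Roots in two coordinates -/

lemma IsAntiholomorphicRoot.conjugate {n : ℕ} {f g G p q : ℂ → ℂ} (hf : IsAntiholomorphicRoot n g f)
    (hp : AnalyticAt ℂ p 0) (hp0 : p 0 = 0) (hq : AnalyticAt ℂ q 0) (hq0 : q 0 = 0)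
    (hpq : ∀ᶠ z in 𝓝 0, p (q z) = z) (hqp : ∀ᶠ z in 𝓝 0, q (p z) = z)
    (hpg : ∀ᶠ z in 𝓝 0, p (g z) = G (p z)) : IsAntiholomorphicRoot n G (p ∘ f ∘ q) := by
  have hqt : Tendsto q (𝓝 0) (𝓝 0) := by simpa [hq0] using hq.continuousAt.tendsto
  refine ⟨(hf.1.conjugate hp hp0 hq hq0).1, ?_⟩
  filter_upwards [iterate_conjugate hf.1.tendsto hqt hpq hqp n, hqt.eventually hf.2,
    hqt.eventually hpg, hpq] with z h1 h2 h3 h4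
  rw [h1, Function.comp_apply, Function.comp_apply, h2, h3, h4]

/-- Roots of `g` correspond to roots of the prenormalized germ `G` by conjugation with `h`, whose
inverse is `q`, and tangency to an axis is preserved. -/
structure RootTransfer (k n : ℕ) (g h G q : ℂ → ℂ) : Prop where
  push : ∀ f, IsAntiholomorphicRoot n g f → IsAntiholomorphicRoot n G (h ∘ f ∘ q)
  pull : ∀ F, IsAntiholomorphicRoot n G F → IsAntiholomorphicRoot n g (q ∘ F ∘ h)
  push_tangent : ∀ f ℓ, IsAntiholomorphicRoot n g f →
    (IsTangentToAxis k ℓ h (antiLinearCoeff f) ↔ antiLinearCoeff (h ∘ f ∘ q) = axisCoeff k ℓ)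
  pull_tangent : ∀ F ℓ, IsAntiholomorphicRoot n G F →
    (IsTangentToAxis k ℓ h (antiLinearCoeff (q ∘ F ∘ h)) ↔ antiLinearCoeff F = axisCoeff k ℓ)
  push_inj : ∀ f₁ f₂, IsAntiholomorphicRoot n g f₁ → IsAntiholomorphicRoot n g f₂ →
    h ∘ f₁ ∘ q =ᶠ[𝓝 0] h ∘ f₂ ∘ q → f₁ =ᶠ[𝓝 0] f₂

lemma IsPrenormalization.exists_rootTransfer {k : ℕ} (n : ℕ) {b : ℂ} {g h G : ℂ → ℂ}
    (hg : IsParabolicGerm k g) (hG : IsPrenormalization k b g h G) : ∃ q, RootTransfer k n g h G q := by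
  obtain ⟨⟨hh, hh0, hh'⟩, hpre, hgG⟩ := hG
  obtain ⟨q, hq, hq0, hq', hqh, hhq⟩ := exists_analytic_inverse hh hh0 hh'
  have hc : conj (deriv h 0) ≠ 0 := by simpa using hh'
  have hqt : Tendsto q (𝓝 0) (𝓝 0) := by simpa [hq0] using hq.continuousAt.tendsto
  have hht : Tendsto h (𝓝 0) (𝓝 0) := by simpa [hh0] using hh.continuousAt.tendsto
  refine ⟨q, fun f hf => hf.conjugate hh hh0 hq hq0 hhq hqh hgG,
    fun F hF => hF.conjugate hq hq0 hh hh0 hqh hhq ?_, fun f ℓ hf => ?_, fun F ℓ hF => ?_,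
    fun f₁ f₂ hf₁ hf₂ he => ?_⟩
  · have hgt : Tendsto g (𝓝 0) (𝓝 0) := by simpa [hg.2.2.1] using hg.2.1.continuousAt.tendsto
    filter_upwards [hqt.eventually hgG, hhq, (hgt.comp hqt).eventually hqh] with z h1 h2 h3
    rw [h2] at h1
    rw [← h1]
    exact h3
  · rw [(hf.1.conjugate hh hh0 hq hq0).2, hq', map_inv₀, IsTangentToAxis, mul_inv_eq_iff_eq_mul₀ hc]
  · rw [(hF.1.conjugate hq hq0 hh hh0).2, hq', IsTangentToAxis]
    constructor
    · intro h1
      rw [← mul_assoc, ← mul_assoc, mul_inv_cancel₀ hh', one_mul] at h1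
      exact mul_right_cancel₀ hc h1
    · intro h1
      rw [h1, ← mul_assoc, ← mul_assoc, mul_inv_cancel₀ hh', one_mul]
  · have h1 := (hf₁.1.tendsto).eventually hqh
    have h2 := (hf₂.1.tendsto).eventually hqh
    filter_upwards [h1, h2, hht.eventually he, hqh] with z h3 h4 h5 h6
    simp only [Function.comp_apply, h6] at h5
    rw [← h3, ← h4, h5]

/-! ### Independent transition functions -/

/-- The inverse of `Σ ∘ T_{1/n}`. -/
def conjTranslateInv (n : ℕ) (W : ℂ) : ℂ := conj W - 1 / n

lemma conj_one_div_natCast (n : ℕ) : conj (1 / (n : ℂ)) = 1 / n := by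
  rw [map_div₀, map_one, map_natCast]

lemma conjTranslate_inv (n : ℕ) (W : ℂ) : conjTranslate n (conjTranslateInv n W) = W := by
  rw [conjTranslate, conjTranslateInv, sub_add_cancel, conj_conj]

lemma conjTranslateInv_conjTranslate (n : ℕ) (W : ℂ) :
    conjTranslateInv n (conjTranslate n W) = W := by
  rw [conjTranslate, conjTranslateInv, conj_conj, add_sub_cancel_right]

lemma conjTranslate_conjTranslate (n : ℕ) (W : ℂ) :
    conjTranslate n (conjTranslate n W) = W + 2 / n := by
  rw [conjTranslate, conjTranslate, map_add, conj_conj, conj_one_div_natCast]; ring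

lemma conjTranslateInv_add (n : ℕ) (W : ℂ) :
    conjTranslateInv n W + 2 / n = conjTranslate n W := by
  rw [conjTranslate, conjTranslateInv, map_add, conj_one_div_natCast]; ring

lemma conjTranslateInv_add_one (n : ℕ) (W : ℂ) :
    conjTranslateInv n (W + 1) = conjTranslateInv n W + 1 := by
  simp only [conjTranslateInv, map_add, map_one]; ring

lemma tendsto_conjTranslateInv {k : ℕ} (hk : 1 ≤ k) (n ℓ : ℕ) (j : ZMod (2 * k)) :
    Tendsto (conjTranslateInv n) (cylinderEnd k j) (cylinderEnd k (reflectIndex k ℓ j)) := by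
  have h := tendsto_conjTranslate hk n ℓ (reflectIndex k ℓ j)
  rw [reflectIndex_reflectIndex] at h
  refine ((tendsto_add_cylinderEnd _ (-(2 / (n : ℂ)))).comp h).congr fun W => ?_
  rw [Function.comp_apply, ← conjTranslateInv_add, add_neg_cancel_right]

lemma cylinderEnd_congr {k : ℕ} {i j : ZMod (2 * k)} (h : Odd i.val ↔ Odd j.val) :
    cylinderEnd k i = cylinderEnd k j := by
  unfold cylinderEnd; simp only [h]

lemma IsNormalizedGerm.congr_index {k : ℕ} {b : ℂ} {i j : ZMod (2 * k)} (h : Odd i.val ↔ Odd j.val)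
    {Ψ : ℂ → ℂ} (hΨ : IsNormalizedGerm k b i Ψ) : IsNormalizedGerm k b j Ψ := by
  have e : normalizedConstant k b i = normalizedConstant k b j := by
    unfold normalizedConstant; simp only [h]
  unfold IsNormalizedGerm at *
  rwa [cylinderEnd_congr h, e] at hΨ

/-- Conjugation by `Σ ∘ T_{1/n}` exchanges the normalized germs of the two ends, for real `b`. -/
lemma IsNormalizedGerm.conj_reflect {k n : ℕ} {b : ℂ} (hk : 1 ≤ k) (hb : b.im = 0) (ℓ : ℕ)
    {j : ZMod (2 * k)} {Ψ : ℂ → ℂ} (hΨ : IsNormalizedGerm k b (reflectIndex k ℓ j) Ψ) :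
    IsNormalizedGerm k b j fun W => conjTranslate n (Ψ (conjTranslateInv n W)) := by
  have ht := tendsto_conjTranslateInv hk n ℓ j
  refine ⟨?_, ?_, ?_⟩
  · filter_upwards [ht.eventually hΨ.1] with W hW
    have h1 : DifferentiableAt ℂ (fun V => Ψ (V - 1 / n)) (conj W) := by
      have h2 : DifferentiableAt ℂ (fun V : ℂ => V - 1 / (n : ℂ)) (conj W) :=
        differentiableAt_fun_id.sub_const _
      exact DifferentiableAt.comp (conj W) (f := fun V : ℂ => V - 1 / (n : ℂ)) hW h2
    have h3 := (h1.add_const (1 / (n : ℂ))).conj_conj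
    rw [conj_conj] at h3
    exact h3
  · filter_upwards [ht.eventually hΨ.2.1] with W hW
    rw [conjTranslateInv_add_one, hW, conjTranslate_add_one]
  · have h1 := (continuous_conj.tendsto _).comp (hΨ.2.2.comp ht)
    have e : conj (normalizedConstant k b (reflectIndex k ℓ j)) = normalizedConstant k b j := by
      rw [normalizedConstant_reflectIndex hk]
      unfold normalizedConstant
      split_ifs <;> simp [conj_eq_iff_im.2 hb] <;> ring
    rw [e] at h1
    refine h1.congr fun W => ?_
    simp only [Function.comp_apply, conjTranslate, conjTranslateInv, map_add, map_sub, conj_conj]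
    ring

/-- Two reflections compose to a translation of the indices. -/
lemma reflectIndex_comp (k ℓ ℓ' : ℕ) (j : ZMod (2 * k)) :
    reflectIndex k ℓ (reflectIndex k ℓ' j) = j + 2 * ((ℓ : ZMod (2 * k)) - ℓ') := by
  unfold reflectIndex; ring

/-- The representative of an even index among `0, 2, …, 2(d - 1)`. -/
def evenRep (k d : ℕ) (j : ZMod (2 * k)) : ZMod (2 * k) := ((2 * (j.val / 2 % d) : ℕ) : ZMod (2 * k))

lemma evenRep_intCast {k d : ℕ} (hk : 1 ≤ k) (hdk : d ∣ k) (a : ℤ) :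
    evenRep k d ((2 * a : ℤ) : ZMod (2 * k)) = ((2 * (a % d) : ℤ) : ZMod (2 * k)) := by
  obtain ⟨m, hm⟩ := exists_val_intCast hk (2 * a)
  have h1 : ((((2 * a : ℤ) : ZMod (2 * k)).val / 2 : ℕ) : ℤ) = a + k * m := by
    rw [mul_assoc] at hm
    generalize (k : ℤ) * m = x at *
    generalize ((2 * a : ℤ) : ZMod (2 * k)).val = v at *
    omega
  have h2 : ((((2 * a : ℤ) : ZMod (2 * k)).val / 2 % d : ℕ) : ℤ) = a % d := by
    rw [Int.natCast_mod, h1]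
    obtain ⟨e, he⟩ := hdk
    rw [he, Nat.cast_mul, mul_assoc, Int.add_mul_emod_self_left]
  rw [evenRep, ← h2]
  generalize ((2 * a : ℤ) : ZMod (2 * k)).val / 2 % d = x
  push_cast
  rfl

lemma exists_even_intCast {k : ℕ} (hk : 1 ≤ k) {j : ZMod (2 * k)} (hj : ¬ Odd j.val) :
    ∃ a : ℤ, ((2 * a : ℤ) : ZMod (2 * k)) = j := by
  obtain ⟨c, hc⟩ := Nat.not_odd_iff_even.1 hj
  refine ⟨c, ?_⟩
  rw [← natCast_zmod_val' hk j, hc]; push_cast; ring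

lemma evenRep_add {k d : ℕ} (hk : 1 ≤ k) (hdk : d ∣ k) {j : ZMod (2 * k)} (hj : ¬ Odd j.val)
    {t : ℤ} (ht : (d : ℤ) ∣ t) : evenRep k d (j + 2 * (t : ZMod (2 * k))) = evenRep k d j := by
  obtain ⟨a, rfl⟩ := exists_even_intCast hk hj
  have e : ((2 * a : ℤ) : ZMod (2 * k)) + 2 * (t : ZMod (2 * k)) = ((2 * (a + t) : ℤ) : ZMod (2 * k)) := by
    push_cast; ring
  obtain ⟨u, rfl⟩ := ht
  rw [e, evenRep_intCast hk hdk, evenRep_intCast hk hdk, Int.add_mul_emod_self_left]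

/-- The even indices `0, 2, …, 2(d - 1)`, one for each orbit of indices under the reflections. -/
def independentIndices (k d : ℕ) : Finset (ZMod (2 * k)) :=
  (Finset.range d).image fun i => ((2 * i : ℕ) : ZMod (2 * k))

lemma card_independentIndices {k d : ℕ} (hdk : d ≤ k) : (independentIndices k d).card = d := by
  rw [independentIndices, Finset.card_image_of_injOn, Finset.card_range]
  intro i hi i' hi' h
  simp only [Finset.coe_range, Set.mem_Iio] at hi hi'
  rw [ZMod.natCast_eq_natCast_iff, Nat.ModEq, Nat.mod_eq_of_lt (by omega),
    Nat.mod_eq_of_lt (by omega)] at h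
  omega

lemma evenRep_mem {k d : ℕ} (hd : 0 < d) (j : ZMod (2 * k)) :
    evenRep k d j ∈ independentIndices k d :=
  Finset.mem_image.2 ⟨j.val / 2 % d, Finset.mem_range.2 (Nat.mod_lt _ hd), rfl⟩

lemma not_odd_of_mem {k d : ℕ} (hk : 1 ≤ k) {j : ZMod (2 * k)} (hj : j ∈ independentIndices k d) :
    ¬ Odd j.val := by
  obtain ⟨i, -, rfl⟩ := Finset.mem_image.1 hj
  have := odd_val_intCast hk (2 * i)
  push_cast at this ⊢
  rw [this]
  simp

lemma evenRep_of_mem {k d : ℕ} (hk : 1 ≤ k) (hdk : d ∣ k) {j : ZMod (2 * k)}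
    (hj : j ∈ independentIndices k d) : evenRep k d j = j := by
  obtain ⟨i, hi, rfl⟩ := Finset.mem_image.1 hj
  have h := evenRep_intCast hk hdk (i : ℤ)
  have hi' := Finset.mem_range.1 hi
  rw [Int.emod_eq_of_lt (by positivity) (by exact_mod_cast hi')] at h
  push_cast at h ⊢
  exact h

lemma HasAxisSymmetry.eventuallyEq {k n ℓ : ℕ} (hk : 1 ≤ k) {Ψ Ψ' : ZMod (2 * k) → ℂ → ℂ}
    (h : HasAxisSymmetry k n ℓ Ψ) (h' : HasAxisSymmetry k n ℓ Ψ') {j : ZMod (2 * k)}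
    (he : Ψ (reflectIndex k ℓ j) =ᶠ[cylinderEnd k (reflectIndex k ℓ j)] Ψ' (reflectIndex k ℓ j)) :
    Ψ j =ᶠ[cylinderEnd k j] Ψ' j := by
  have ht := tendsto_conjTranslateInv hk n ℓ j
  filter_upwards [ht.eventually (h j), ht.eventually (h' j), ht.eventually he] with W h1 h2 h3
  rw [conjTranslate_inv] at h1 h2
  rw [h1, h2, h3]

/-- The gcd of integers belongs to every subgroup that contains them. -/
lemma gcd_mem_addSubgroup {ι : Type*} (s : Finset ι) (t : ι → ℤ) (k : ℕ) (S : AddSubgroup ℤ)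
    (ht : ∀ i ∈ s, t i ∈ S) (hk : (k : ℤ) ∈ S) :
    ((Nat.gcd (s.gcd fun i => (t i).natAbs) k : ℕ) : ℤ) ∈ S := by
  obtain ⟨a, ha⟩ := Int.subgroup_cyclic S
  have hmem : ∀ x : ℤ, x ∈ S ↔ a ∣ x := by
    intro x
    rw [ha, AddSubgroup.mem_closure_singleton]
    constructor
    · rintro ⟨c, rfl⟩; exact ⟨c, by rw [smul_eq_mul, mul_comm]⟩
    · rintro ⟨c, rfl⟩; exact ⟨c, by rw [smul_eq_mul, mul_comm]⟩
  rw [hmem, ← Int.natAbs_dvd_natAbs, Int.natAbs_natCast]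
  refine Nat.dvd_gcd (Finset.dvd_gcd fun i hi => ?_) ?_
  · exact Int.natAbs_dvd_natAbs.2 ((hmem _).1 (ht i hi))
  · simpa using Int.natAbs_dvd_natAbs.2 ((hmem _).1 hk)

/-- The symmetries in the axes identify the transition functions along the orbits of the indices
under the group generated by the reflections: the translations by multiples of `2d`, and one
reflection, which exchanges even and odd indices. -/
theorem hasIndependentCount {k n m : ℕ} {b : ℂ} (hk : 1 ≤ k) (hb : b.im = 0)
    (ℓ : Fin (m + 1) → Fin k) :
    HasIndependentCount k b n (Set.range fun i => (ℓ i : ℕ))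
      (Nat.gcd (Finset.univ.gcd fun i =>
        (((ℓ (Fin.last m) : ℕ) : ℤ) - ((ℓ i : ℕ) : ℤ)).natAbs) k) := by
  set d := Nat.gcd (Finset.univ.gcd fun i =>
        (((ℓ (Fin.last m) : ℕ) : ℤ) - ((ℓ i : ℕ) : ℤ)).natAbs) k with hd
  have hdk : d ∣ k := Nat.gcd_dvd_right _ _
  have hd0 : 0 < d := Nat.pos_of_dvd_of_pos hdk hk
  have hdle : d ≤ k := Nat.le_of_dvd hk hdk
  have hdℓ : ∀ i, (d : ℤ) ∣ ((ℓ (Fin.last m) : ℕ) : ℤ) - ((ℓ i : ℕ) : ℤ) := by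
    intro i
    rw [Int.natCast_dvd]
    exact (Nat.gcd_dvd_left _ _).trans (Finset.gcd_dvd (Finset.mem_univ i))
  set ℓ₀ : ℕ := (ℓ (Fin.last m) : ℕ) with hℓ₀
  have hrep : ∀ i, ∀ j : ZMod (2 * k), ¬ Odd j.val →
      evenRep k d (j + 2 * ((ℓ₀ : ZMod (2 * k)) - ((ℓ i : ℕ) : ZMod (2 * k)))) = evenRep k d j := by
    intro i j hj
    have := evenRep_add hk hdk hj (hdℓ i)
    push_cast at this
    exact this
  -- Members of even index are prescribed on the orbit through its representative, and those of
  -- odd index are obtained by the reflection in the last axis.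
  refine ⟨independentIndices k d, card_independentIndices hdle, fun Θ hΘ => ?_, ?_⟩
  · refine ⟨fun j => if Odd j.val then fun W => conjTranslate n
      (Θ (evenRep k d (reflectIndex k ℓ₀ j)) (conjTranslateInv n W)) else Θ (evenRep k d j),
      fun j => ?_, ?_, fun j hj => ?_⟩
    · beta_reduce
      by_cases hj : Odd j.val
      · rw [if_pos hj]
        refine IsNormalizedGerm.conj_reflect hk hb ℓ₀ (IsNormalizedGerm.congr_index ?_
          (hΘ _ (evenRep_mem hd0 _)).1)
        have h1 := not_odd_of_mem hk (evenRep_mem hd0 (reflectIndex k ℓ₀ j))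
        have h2 : ¬ Odd (reflectIndex k ℓ₀ j).val := by rw [odd_reflectIndex hk]; exact not_not.2 hj
        exact iff_of_false h1 h2
      · rw [if_neg hj]
        exact IsNormalizedGerm.congr_index (iff_of_false (not_odd_of_mem hk (evenRep_mem hd0 j)) hj)
          (hΘ _ (evenRep_mem hd0 _)).1
    · rintro _ ⟨i, rfl⟩ j
      by_cases hj : Odd j.val
      · have h2 : ¬ Odd (reflectIndex k (ℓ i) j).val := by rw [odd_reflectIndex hk]; exact not_not.2 hj
        have h3 : evenRep k d (reflectIndex k ℓ₀ j) = evenRep k d (reflectIndex k (ℓ i) j) := by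
          rw [← hrep i _ h2]
          congr 1
          unfold reflectIndex; ring
        refine Eventually.of_forall fun W => ?_
        simp only [if_pos hj, if_neg h2]
        rw [conjTranslateInv_conjTranslate, h3]
      · have h2 : Odd (reflectIndex k (ℓ i) j).val := (odd_reflectIndex hk _ j).2 hj
        have h3 : evenRep k d (reflectIndex k ℓ₀ (reflectIndex k (ℓ i) j)) = evenRep k d j := by
          rw [reflectIndex_comp, hrep i j hj]
        have h4 := (hΘ _ (evenRep_mem hd0 j)).2
        rw [cylinderEnd_congr (iff_of_false (not_odd_of_mem hk (evenRep_mem hd0 j)) hj)] at h4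
        have ht := tendsto_conjTranslateInv hk n (ℓ i) (reflectIndex k (ℓ i) j)
        rw [reflectIndex_reflectIndex] at ht
        filter_upwards [ht.eventually h4] with W hW
        simp only [if_pos h2, if_neg hj]
        rw [conjTranslate_conjTranslate, h3, ← hW, conjTranslateInv_add]
    · simp only [if_neg (not_odd_of_mem hk hj), evenRep_of_mem hk hdk hj]
      exact EventuallyEq.rfl
  · intro Ψ Ψ' _ _ hΨ hΨ' hR
    set E : Set (ZMod (2 * k)) := {j | Ψ j =ᶠ[cylinderEnd k j] Ψ' j} with hE
    have href : ∀ i, ∀ j, reflectIndex k (ℓ i) j ∈ E → j ∈ E := fun i j hj =>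
      (hΨ _ ⟨i, rfl⟩).eventuallyEq hk (hΨ' _ ⟨i, rfl⟩) hj
    have href' : ∀ i, ∀ j, j ∈ E → reflectIndex k (ℓ i) j ∈ E := fun i j hj =>
      href i _ (by rwa [reflectIndex_reflectIndex])
    -- the group of translations of indices that preserve `E`
    let S : AddSubgroup ℤ :=
      { carrier := {t | ∀ j, j ∈ E ↔ j + 2 * (t : ZMod (2 * k)) ∈ E}
        zero_mem' := fun j => by simp
        add_mem' := fun {s t} hs ht j => by
          rw [hs j, ht]; push_cast; rw [mul_add, add_assoc]
        neg_mem' := fun {t} ht j => by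
          rw [ht (j + 2 * ((-t : ℤ) : ZMod (2 * k)))]; push_cast
          rw [mul_neg, neg_add_cancel_right] }
    have hS : (d : ℤ) ∈ S := by
      refine gcd_mem_addSubgroup _ _ _ _ (fun i _ j => ?_) fun j => ?_
      · push_cast
        have e := reflectIndex_comp k ℓ₀ (ℓ i) j
        constructor
        · intro hj
          rw [← e]; exact href' _ _ (href' i _ hj)
        · intro hj
          rw [← e] at hj
          exact href i _ (href (Fin.last m) _ hj)
      · have h0 : (2 : ZMod (2 * k)) * k = 0 := by exact_mod_cast ZMod.natCast_self (2 * k)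
        push_cast
        rw [h0, add_zero]
    have heven : ∀ j : ZMod (2 * k), ¬ Odd j.val → j ∈ E := by
      intro j hj
      obtain ⟨a, rfl⟩ := exists_even_intCast hk hj
      have h1 : evenRep k d ((2 * a : ℤ) : ZMod (2 * k)) ∈ E := hR _ (evenRep_mem hd0 _)
      rw [evenRep_intCast hk hdk] at h1
      have h2 : (d : ℤ) * (a / d) ∈ S := by
        rw [mul_comm, ← smul_eq_mul]; exact S.zsmul_mem hS _
      have h3 := (h2 _).1 h1
      have h4 := Int.emod_add_mul_ediv a d
      have e : ((2 * (a % d) : ℤ) : ZMod (2 * k)) + 2 * (((d : ℤ) * (a / d) : ℤ) : ZMod (2 * k)) =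
          ((2 * (a % d + d * (a / d)) : ℤ) : ZMod (2 * k)) := by push_cast; ring
      rwa [e, h4] at h3
    intro j
    by_cases hj : Odd j.val
    · exact href (Fin.last m) j (heven _ (by rw [odd_reflectIndex hk]; exact not_not.2 hj))
    · exact heven j hj

/-! ### Composition of formal power series and Taylor series -/

section Composition

open PowerSeries

variable {A B D : PowerSeries ℂ}

lemma comp_add (hD : constantCoeff D = 0) : comp (A + B) D = comp A D + comp B D :=
  subst_add (HasSubst.of_constantCoeff_zero' hD) A B

lemma comp_sub (hD : constantCoeff D = 0) : comp (A - B) D = comp A D - comp B D := by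
  have h := HasSubst.of_constantCoeff_zero' hD
  simp only [comp, ← coe_substAlgHom h, map_sub]

lemma comp_mul (hD : constantCoeff D = 0) : comp (A * B) D = comp A D * comp B D :=
  subst_mul (HasSubst.of_constantCoeff_zero' hD) A B

lemma comp_pow (hD : constantCoeff D = 0) (m : ℕ) : comp (A ^ m) D = comp A D ^ m :=
  subst_pow (HasSubst.of_constantCoeff_zero' hD) A m

lemma comp_C (hD : constantCoeff D = 0) (c : ℂ) : comp (C c) D = C c := by
  have h := HasSubst.of_constantCoeff_zero' hD
  simp only [comp, ← coe_substAlgHom h]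
  exact (substAlgHom h).commutes c

lemma comp_one (hD : constantCoeff D = 0) : comp 1 D = 1 := by
  simpa using comp_C hD 1

lemma X_comp (hD : constantCoeff D = 0) : comp X D = D :=
  subst_X (HasSubst.of_constantCoeff_zero' hD)

lemma comp_X (A : PowerSeries ℂ) : comp A X = A := by
  simp only [comp, ← map_algebraMap_eq_subst_X]
  ext; simp

lemma comp_assoc (hB : constantCoeff B = 0) (hD : constantCoeff D = 0) :
    comp (comp A B) D = comp A (comp B D) :=
  subst_comp_subst_apply (HasSubst.of_constantCoeff_zero' hB) (HasSubst.of_constantCoeff_zero' hD) A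

lemma derivative_comp (hB : constantCoeff B = 0) :
    derivative ℂ (comp A B) = comp (derivative ℂ A) B * derivative ℂ B :=
  derivative_subst (HasSubst.of_constantCoeff_zero' hB)

lemma exists_eq_C_add_X_mul (A : PowerSeries ℂ) :
    ∃ A₁, A = C (constantCoeff A) + X * A₁ ∧ constantCoeff A₁ = coeff 1 A := by
  obtain ⟨A₁, h⟩ := X_dvd_iff.2 (show constantCoeff (A - C (constantCoeff A)) = 0 by simp)
  have h' : A = C (constantCoeff A) + X * A₁ := by rw [← h]; ring
  refine ⟨A₁, h', ?_⟩
  conv_rhs => rw [h']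
  rw [map_add, show (1 : ℕ) = 0 + 1 from rfl, coeff_succ_X_mul]
  simp

lemma constantCoeff_comp (hB : constantCoeff B = 0) :
    constantCoeff (comp A B) = constantCoeff A := by
  obtain ⟨A₁, h, -⟩ := exists_eq_C_add_X_mul A
  rw [h, comp_add hB, comp_mul hB, comp_C hB, X_comp hB]
  simp [hB]

lemma coeff_one_comp (hB : constantCoeff B = 0) :
    coeff 1 (comp A B) = coeff 1 A * coeff 1 B := by
  obtain ⟨A₁, h, h₁⟩ := exists_eq_C_add_X_mul A
  obtain ⟨B₁, hB₁, h₂⟩ := exists_eq_C_add_X_mul B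
  rw [hB, map_zero, zero_add] at hB₁
  conv_lhs => rw [h, comp_add hB, comp_mul hB, comp_C hB, X_comp hB]
  rw [← h₁, ← h₂]
  nth_rewrite 1 [hB₁]
  rw [mul_assoc, map_add, show (1 : ℕ) = 0 + 1 from rfl, coeff_succ_X_mul]
  simp [constantCoeff_comp hB, mul_comm]

lemma conjSeries_comp (hB : constantCoeff B = 0) :
    conjSeries (comp A B) = comp (conjSeries A) (conjSeries B) :=
  map_subst (HasSubst.of_constantCoeff_zero' hB) A

@[simp] lemma conjSeries_conjSeries (A : PowerSeries ℂ) : conjSeries (conjSeries A) = A := by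
  ext m; simp [conjSeries]

@[simp] lemma coeff_conjSeries (m : ℕ) (A : PowerSeries ℂ) :
    coeff m (conjSeries A) = conj (coeff m A) := by simp [conjSeries]

lemma constantCoeff_conjSeries (hA : constantCoeff A = 0) : constantCoeff (conjSeries A) = 0 := by
  rw [← coeff_zero_eq_constantCoeff_apply] at *
  simp [hA]

/-- A formal series with invertible linear part has a compositional inverse. -/
lemma exists_comp_inverse (h₀ : constantCoeff A = 0) (h₁ : coeff 1 A ≠ 0) :
    ∃ B, constantCoeff B = 0 ∧ comp A B = X ∧ comp B A = X := by
  have h := isUnit_iff_ne_zero.2 h₁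
  exact ⟨A.substInvOfIsUnit h, constantCoeff_substInvOfIsUnit A h,
    subst_substInvOfIsUnit_right A h₀ h, subst_substInvOfIsUnit_left A h₀ h⟩

/-- Substituting series which agree to a given order gives series which agree to this order. -/
lemma X_pow_dvd_comp_sub_comp {N : ℕ} (hB : constantCoeff B = 0) (hD : constantCoeff D = 0)
    (h : X ^ N ∣ B - D) (A : PowerSeries ℂ) : X ^ N ∣ comp A B - comp A D := by
  suffices ∀ M ≤ N, ∀ A : PowerSeries ℂ, X ^ M ∣ comp A B - comp A D from this N le_rfl A
  intro M
  induction M with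
  | zero => intro _ A; simp
  | succ M ih =>
    intro hM A
    obtain ⟨A₁, hA, -⟩ := exists_eq_C_add_X_mul A
    rw [hA, comp_add hB, comp_mul hB, comp_C hB, X_comp hB, comp_add hD, comp_mul hD, comp_C hD,
      X_comp hD, show ∀ c x y z w : PowerSeries ℂ, c + x * y - (c + z * w)
        = (x - z) * y + z * (y - w) by intros; ring]
    refine dvd_add (((pow_dvd_pow X hM).trans h).mul_right _) ?_
    rw [pow_succ']
    exact mul_dvd_mul (X_dvd_iff.2 hD) (ih (by omega) A₁)

end Composition

section Taylor

open PowerSeries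

variable {f g : ℂ → ℂ}

lemma coeff_taylor (f : ℂ → ℂ) (m : ℕ) :
    coeff m (taylor f) = iteratedDeriv m f 0 / (m.factorial : ℂ) := by simp [taylor]

lemma taylor_congr (h : f =ᶠ[𝓝 0] g) : taylor f = taylor g := by
  ext m
  rw [coeff_taylor, coeff_taylor, h.iteratedDeriv_eq]

lemma constantCoeff_taylor (f : ℂ → ℂ) : constantCoeff (taylor f) = f 0 := by
  rw [← coeff_zero_eq_constantCoeff_apply, coeff_taylor]; simp

lemma coeff_one_taylor (f : ℂ → ℂ) : coeff 1 (taylor f) = deriv f 0 := by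
  rw [coeff_taylor]; simp

lemma derivative_taylor (f : ℂ → ℂ) : derivative ℂ (taylor f) = taylor (deriv f) := by
  ext m
  rw [coeff_derivative, coeff_taylor, coeff_taylor, iteratedDeriv_succ', Nat.factorial_succ]
  have : ((m : ℂ) + 1) ≠ 0 := by exact_mod_cast m.succ_ne_zero
  push_cast
  field_simp

lemma taylor_add (hf : AnalyticAt ℂ f 0) (hg : AnalyticAt ℂ g 0) :
    taylor (fun z => f z + g z) = taylor f + taylor g := by
  ext m
  rw [map_add, coeff_taylor, coeff_taylor, coeff_taylor,
    iteratedDeriv_fun_add hf.contDiffAt hg.contDiffAt, add_div]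

lemma taylor_const (c : ℂ) : taylor (fun _ => c) = C c := by
  ext m
  rw [coeff_taylor, iteratedDeriv_const, coeff_C]
  split_ifs with h <;> simp [h]

lemma taylor_id : taylor (fun z => z) = X := by
  ext m
  rcases m with _ | _ | m
  · simp [coeff_taylor]
  · simp [coeff_taylor, coeff_X]
  · have : deriv (fun z : ℂ => z) = fun _ => 1 := by ext; simp
    rw [coeff_taylor, coeff_X, iteratedDeriv_succ', this, iteratedDeriv_const]
    simp

lemma taylor_mul (hf : AnalyticAt ℂ f 0) (hg : AnalyticAt ℂ g 0) :
    taylor (fun z => f z * g z) = taylor f * taylor g := by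
  ext m
  rw [coeff_taylor, coeff_mul, iteratedDeriv_fun_mul hf.contDiffAt hg.contDiffAt,
    Finset.Nat.sum_antidiagonal_eq_sum_range_succ
      (fun i j => coeff i (taylor f) * coeff j (taylor g)), Finset.sum_div]
  refine Finset.sum_congr rfl fun i hi => ?_
  have hi : i ≤ m := by simpa [Nat.lt_succ_iff] using hi
  rw [coeff_taylor, coeff_taylor, Nat.cast_choose ℂ hi]
  have h₁ : (m.factorial : ℂ) ≠ 0 := by exact_mod_cast m.factorial_ne_zero
  field_simp

lemma taylor_pow (hf : AnalyticAt ℂ f 0) (m : ℕ) :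
    taylor (fun z => f z ^ m) = taylor f ^ m := by
  induction m with
  | zero => simpa using taylor_const 1
  | succ m ih => simp only [pow_succ]; rw [taylor_mul (hf.fun_pow m) hf, ih]

/-- The Taylor series of a composition is the composition of the Taylor series. Both sides
satisfy the chain rule, which determines their coefficients recursively. -/
lemma taylor_comp (hf : AnalyticAt ℂ f 0) (hg : AnalyticAt ℂ g 0) (hg₀ : g 0 = 0) :
    taylor (fun z => f (g z)) = comp (taylor f) (taylor g) := by
  have h₀ : constantCoeff (taylor g) = 0 := by rw [constantCoeff_taylor, hg₀]
  suffices ∀ m, ∀ i ≤ m, ∀ f : ℂ → ℂ, AnalyticAt ℂ f 0 →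
      coeff i (taylor (fun z => f (g z))) = coeff i (comp (taylor f) (taylor g)) by
    ext m; exact this m m le_rfl f hf
  intro m
  induction m with
  | zero =>
    intro i hi f hf
    obtain rfl : i = 0 := by omega
    rw [coeff_zero_eq_constantCoeff_apply, coeff_zero_eq_constantCoeff_apply,
      constantCoeff_comp h₀, constantCoeff_taylor, constantCoeff_taylor, hg₀]
  | succ m ih =>
    intro i hi f hf
    rcases Nat.lt_or_ge i (m + 1) with hi' | hi'
    · exact ih i (by omega) f hf
    obtain rfl : i = m + 1 := by omega
    have hne : ((m : ℂ) + 1) ≠ 0 := by exact_mod_cast m.succ_ne_zero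
    refine mul_right_cancel₀ hne ?_
    rw [← coeff_derivative, ← coeff_derivative, derivative_comp h₀, derivative_taylor,
      derivative_taylor, derivative_taylor]
    have hf' : AnalyticAt ℂ f (g 0) := by rwa [hg₀]
    have hd : deriv (fun z => f (g z)) =ᶠ[𝓝 0] fun z => deriv f (g z) * deriv g z := by
      filter_upwards [hg.eventually_analyticAt,
        hg.continuousAt.eventually hf'.eventually_analyticAt] with z h₁ h₂
      exact deriv_comp z h₂.differentiableAt h₁.differentiableAt
    have hd₀ : AnalyticAt ℂ (fun z => deriv f (g z)) 0 := hf'.deriv.fun_comp hg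
    rw [taylor_congr hd, taylor_mul hd₀ hg.deriv, coeff_mul, coeff_mul]
    refine Finset.sum_congr rfl fun p hp => ?_
    rw [ih p.1 (by have := Finset.HasAntidiagonal.mem_antidiagonal.1 hp; omega) _ hf.deriv]

end Taylor

/-! ### Triangular equations for formal series tangent to the identity -/

section Triangular

open PowerSeries

variable {k : ℕ}

/-- The formal series `X + ⋯`. -/
def IsTangentToId (A : PowerSeries ℂ) : Prop := constantCoeff A = 0 ∧ coeff 1 A = 1

/-- If `A` is changed by `c X ^ N + ⋯`, then the operator `F` on series tangent to the identity
changes by `(N - k - 1) c X ^ (N + k) + ⋯`. -/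
def IsTriangular (k : ℕ) (F : PowerSeries ℂ → PowerSeries ℂ) : Prop :=
  ∀ (N : ℕ) (A B : PowerSeries ℂ), IsTangentToId A → IsTangentToId B → X ^ N ∣ A - B →
    X ^ (N + k + 1) ∣ F A - F B - C ((N : ℂ) - k - 1) * X ^ k * (A - B)

lemma IsTangentToId.of_dvd {A B : PowerSeries ℂ} (hA : IsTangentToId A) {N : ℕ} (hN : 2 ≤ N)
    (h : X ^ N ∣ B - A) : IsTangentToId B := by
  rw [X_pow_dvd_iff] at h
  have h₀ := h 0 (by omega)
  have h₁ := h 1 (by omega)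
  rw [map_sub, sub_eq_zero] at h₀ h₁
  exact ⟨by simpa [hA.1] using h₀, h₁.trans hA.2⟩

lemma IsTangentToId.exists_eq {A : PowerSeries ℂ} (hA : IsTangentToId A) :
    ∃ A₁, A = X * A₁ ∧ constantCoeff A₁ = 1 := by
  obtain ⟨A₁, h, h₁⟩ := exists_eq_C_add_X_mul A
  rw [hA.1, map_zero, zero_add] at h
  exact ⟨A₁, h, h₁.trans hA.2⟩

/-- `F A` is determined below the degree `N + k` by `A` below the degree `N`. -/
lemma IsTriangular.dvd {F : PowerSeries ℂ → PowerSeries ℂ} (hF : IsTriangular k F) {N : ℕ}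
    {A B : PowerSeries ℂ} (hA : IsTangentToId A) (hB : IsTangentToId B) (h : X ^ N ∣ A - B) :
    X ^ (N + k) ∣ F A - F B := by
  have h₁ := (pow_dvd_pow X (Nat.le_succ (N + k))).trans (hF N A B hA hB h)
  refine (dvd_sub_left ?_).1 h₁
  rw [add_comm N k, pow_add]
  exact mul_dvd_mul (Dvd.intro_left _ rfl) h

lemma coeff_X_pow_mul_self (N : ℕ) (A : PowerSeries ℂ) :
    coeff N (X ^ N * A) = constantCoeff A := by
  simpa using coeff_X_pow_mul A N 0

lemma IsTriangular.coeff_sub {F : PowerSeries ℂ → PowerSeries ℂ} (hF : IsTriangular k F) {N : ℕ}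
    {A B : PowerSeries ℂ} (hA : IsTangentToId A) (hB : IsTangentToId B) (h : X ^ N ∣ A - B) :
    coeff (N + k) (F A) - coeff (N + k) (F B) = ((N : ℂ) - k - 1) * (coeff N A - coeff N B) := by
  have h₁ := X_pow_dvd_iff.1 (hF N A B hA hB h) (N + k) (by omega)
  obtain ⟨D, hD⟩ := h
  rw [map_sub, map_sub, sub_eq_zero] at h₁
  rw [h₁, ← map_sub, hD, mul_assoc, ← mul_assoc (X ^ k), ← pow_add, add_comm k, coeff_C_mul,
    coeff_X_pow_mul_self, coeff_X_pow_mul_self]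

lemma cast_sub_sub_one_ne_zero {N : ℕ} (h : N ≠ k + 1) : (N : ℂ) - k - 1 ≠ 0 := by
  intro h'
  apply h
  have : (N : ℂ) = ((k + 1 : ℕ) : ℂ) := by push_cast; linear_combination h'
  exact_mod_cast this

/-- A solution of a triangular equation is determined by its resonant coefficient. -/
lemma IsTriangular.eq_of_coeff_eq {F : PowerSeries ℂ → PowerSeries ℂ} (hF : IsTriangular k F)
    {A B : PowerSeries ℂ} (hA : IsTangentToId A) (hB : IsTangentToId B) (h : F A = F B)
    (hc : coeff (k + 1) A = coeff (k + 1) B) : A = B := by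
  suffices ∀ N, X ^ N ∣ A - B by
    ext N
    have := X_pow_dvd_iff.1 (this (N + 1)) N (by omega)
    rwa [map_sub, sub_eq_zero] at this
  intro N
  induction N with
  | zero => simp
  | succ N ih =>
    have hN : coeff N A = coeff N B := by
      by_cases hN : N = k + 1
      · rw [hN, hc]
      have := hF.coeff_sub hA hB ih
      rw [h, sub_self, eq_comm, mul_eq_zero, or_iff_right (cast_sub_sub_one_ne_zero hN),
        sub_eq_zero] at this
      exact this
    rw [X_pow_dvd_iff] at ih ⊢
    intro m hm
    rcases Nat.lt_succ_iff_lt_or_eq.1 hm with hm | rfl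
    · exact ih m hm
    · rw [map_sub, hN, sub_self]

/-- A triangular equation can be solved beyond the resonant degree. -/
lemma IsTriangular.exists_eq_zero {F : PowerSeries ℂ → PowerSeries ℂ} (hF : IsTriangular k F)
    {M : ℕ} (hM₂ : 2 ≤ M) (hM : k + 1 < M) {A : PowerSeries ℂ} (hA : IsTangentToId A)
    (h : X ^ (M + k) ∣ F A) : ∃ B, IsTangentToId B ∧ F B = 0 := by
  -- successive approximations: the correction in degree `M + j` cancels the first term of the error
  let s : ℕ → PowerSeries ℂ := fun j => Nat.rec A (fun j S =>
    S - C (coeff (M + j + k) (F S) / (((M + j : ℕ) : ℂ) - k - 1)) * X ^ (M + j)) j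
  have hs : ∀ j, s (j + 1) =
      s j - C (coeff (M + j + k) (F (s j)) / (((M + j : ℕ) : ℂ) - k - 1)) * X ^ (M + j) :=
    fun j => rfl
  have hstep : ∀ j, X ^ (M + j) ∣ s (j + 1) - s j := fun j => by
    rw [hs, sub_sub_cancel_left, dvd_neg]
    exact Dvd.intro_left _ rfl
  have hle : ∀ i j, X ^ (M + i) ∣ s (i + j) - s i := by
    intro i j
    induction j with
    | zero => simp
    | succ j ih =>
      have := (pow_dvd_pow X (by omega : M + i ≤ M + (i + j))).trans (hstep (i + j))
      have := dvd_add this ih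
      rwa [sub_add_sub_cancel] at this
  have hsA : ∀ j, IsTangentToId (s j) := fun j => by
    have h₁ := hle 0 j
    rw [zero_add] at h₁
    exact IsTangentToId.of_dvd (A := s 0) hA (by omega) h₁
  have hFs : ∀ j, X ^ (M + j + k) ∣ F (s j) := by
    intro j
    induction j with
    | zero => exact h
    | succ j ih =>
      have h₁ := hF.dvd (hsA (j + 1)) (hsA j) (hstep j)
      have h₂ := hF.coeff_sub (hsA (j + 1)) (hsA j) (hstep j)
      rw [X_pow_dvd_iff] at ih h₁ ⊢
      intro m hm
      rcases (by omega : m < M + j + k ∨ m = M + j + k) with hm | rfl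
      · have := h₁ m hm
        rwa [map_sub, ih m hm, sub_zero] at this
      · have h₃ : coeff (M + j) (s (j + 1)) - coeff (M + j) (s j)
            = - (coeff (M + j + k) (F (s j)) / (((M + j : ℕ) : ℂ) - k - 1)) := by
          rw [hs, map_sub, coeff_C_mul, coeff_X_pow_self]; ring
        have h₄ := cast_sub_sub_one_ne_zero (k := k) (N := M + j) (by omega)
        rw [h₃, mul_neg, mul_div_cancel₀ _ h₄] at h₂
        linear_combination h₂
  let B : PowerSeries ℂ := PowerSeries.mk fun N => coeff N (s (N + 1))
  have hBs : ∀ j, X ^ (M + j) ∣ B - s j := by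
    intro j
    rw [X_pow_dvd_iff]
    intro m hm
    rw [map_sub, sub_eq_zero, coeff_mk]
    rcases le_total j (m + 1) with hj | hj
    · obtain ⟨i, hi⟩ := Nat.exists_eq_add_of_le hj
      have := X_pow_dvd_iff.1 (hle j i) m hm
      rw [hi]
      rwa [map_sub, sub_eq_zero] at this
    · obtain ⟨i, rfl⟩ := Nat.exists_eq_add_of_le hj
      have := X_pow_dvd_iff.1 (hle (m + 1) i) m (by omega)
      rw [map_sub, sub_eq_zero] at this
      exact this.symm
  have hB : IsTangentToId B := IsTangentToId.of_dvd (A := s 0) hA (N := M) hM₂ (hBs 0)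
  refine ⟨B, hB, ?_⟩
  ext N
  have h₁ := X_pow_dvd_iff.1 (hF.dvd hB (hsA N) (hBs N)) N (by omega)
  have h₂ := X_pow_dvd_iff.1 (hFs N) N (by omega)
  rw [map_sub, h₂, sub_zero] at h₁
  rw [h₁, map_zero]

lemma constantCoeff_dvd_iff {A : PowerSeries ℂ} {c : ℂ} (h : constantCoeff A = c) :
    X ∣ A - C c := X_dvd_iff.2 (by simp [h])

/-- The derivative of `A ↦ U ∘ A`, for `U` of order `k + 1`. -/
lemma dvd_comp_sub_comp {A B W : PowerSeries ℂ} (hA : IsTangentToId A) (hB : IsTangentToId B)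
    {N : ℕ} (h : X ^ N ∣ A - B) (hW : constantCoeff W = 1) :
    X ^ (N + k + 1) ∣ comp (X ^ (k + 1) * W) A - comp (X ^ (k + 1) * W) B
      - C ((k : ℂ) + 1) * X ^ k * (A - B) := by
  obtain ⟨A₁, hA₁, hA₁'⟩ := hA.exists_eq
  obtain ⟨B₁, hB₁, hB₁'⟩ := hB.exists_eq
  have hWA := constantCoeff_comp (A := W) hA.1
  have h₁ := X_pow_dvd_comp_sub_comp hA.1 hB.1 h W
  rw [comp_mul hA.1, comp_mul hB.1, comp_pow hA.1, comp_pow hB.1, X_comp hA.1, X_comp hB.1]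
  -- `A ^ (k + 1) - B ^ (k + 1)` is the product of `A - B` and of `S X ^ k`
  let S : PowerSeries ℂ := ∑ i ∈ Finset.range (k + 1), A₁ ^ i * B₁ ^ (k - i)
  have hS : A ^ (k + 1) - B ^ (k + 1) = (A - B) * (X ^ k * S) := by
    rw [← (Commute.all A B).mul_geom_sum₂ (k + 1)]
    refine congrArg _ ?_
    rw [Finset.mul_sum]
    refine Finset.sum_congr rfl fun i hi => ?_
    have : k = i + (k - i) := by have := Finset.mem_range.1 hi; omega
    rw [hA₁, hB₁, mul_pow, mul_pow, show k + 1 - 1 - i = k - i by omega]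
    conv_rhs => rw [this, pow_add]
    rw [Nat.add_sub_cancel_left]
    ring
  have hS₀ : constantCoeff (S * comp W A) = (k : ℂ) + 1 := by
    simp [S, hA₁', hB₁', hWA, hW]
  have e : A ^ (k + 1) * comp W A - B ^ (k + 1) * comp W B - C ((k : ℂ) + 1) * X ^ k * (A - B)
      = (A - B) * X ^ k * (S * comp W A - C ((k : ℂ) + 1))
        + B ^ (k + 1) * (comp W A - comp W B) := by
    linear_combination (comp W A) * hS
  rw [e]
  refine dvd_add ?_ ?_
  · rw [pow_succ, pow_add]
    exact mul_dvd_mul (mul_dvd_mul h dvd_rfl) (constantCoeff_dvd_iff hS₀)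
  · rw [add_assoc, pow_add, mul_comm]
    exact mul_dvd_mul (pow_dvd_pow_of_dvd (X_dvd_iff.2 hB.1) _) h₁

/-- The equation `A ∘ G = V ∘ A` is triangular. -/
lemma isTriangular_comp {G V W Y : PowerSeries ℂ} (hk : 1 ≤ k) (hG : G = X + X ^ (k + 1) * Y)
    (hY : constantCoeff Y = 1) (hV : V = X + X ^ (k + 1) * W) (hW : constantCoeff W = 1) :
    IsTriangular k fun A => comp A G - comp V A := by
  intro N A B hA hB h
  have hG₀ : constantCoeff G = 0 := by simp [hG]
  have h₁ := dvd_comp_sub_comp (k := k) hA hB h hW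
  have e : comp A G - comp V A - (comp B G - comp V B) - C ((N : ℂ) - k - 1) * X ^ k * (A - B)
      = comp (A - B) G - (A - B) - C (N : ℂ) * X ^ k * (A - B)
        - (comp (X ^ (k + 1) * W) A - comp (X ^ (k + 1) * W) B
          - C ((k : ℂ) + 1) * X ^ k * (A - B)) := by
    rw [comp_sub hG₀, hV, comp_add hA.1, comp_add hB.1, X_comp hA.1, X_comp hB.1]
    simp only [map_sub, map_add, map_one]
    ring
  rw [e]
  refine dvd_sub ?_ h₁
  obtain ⟨D, hD⟩ := h
  rw [hD, comp_mul hG₀, comp_pow hG₀, X_comp hG₀]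
  -- With `A - B = X ^ N * D`, the composite of the difference with `G` is `G ^ N * (D ∘ G)`,
  -- where `G ^ N = X ^ N * (1 + N X ^ k + …)` and `D ∘ G` agrees with `D` modulo `X ^ (k + 1)`.
  have h₂ : X ^ (k + 1) ∣ comp D G - D := by
    have := X_pow_dvd_comp_sub_comp (N := k + 1) (D := X) hG₀ (by simp)
      (by rw [hG, add_sub_cancel_left]; exact Dvd.intro _ rfl) D
    rwa [comp_X] at this
  obtain ⟨Q, hQ⟩ : ∃ Q, (1 + X ^ k * Y) ^ N = 1 + C (N : ℂ) * (X ^ k * Y) + (X ^ k * Y) ^ 2 * Q := by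
    obtain ⟨Q, hQ⟩ := (Polynomial.binomExpansion (Polynomial.X ^ N) (1 : PowerSeries ℂ) (X ^ k * Y))
    refine ⟨Q, ?_⟩
    simp only [Polynomial.eval_pow, Polynomial.eval_X, one_pow, Polynomial.derivative_X_pow,
      Polynomial.eval_mul, Polynomial.eval_C, mul_one] at hQ
    rw [hQ, map_natCast]
    ring
  have e₂ : G ^ N * comp D G - X ^ N * D - C (N : ℂ) * X ^ k * (X ^ N * D)
      = X ^ N * ((1 + X ^ k * Y) ^ N * (comp D G - D) +
        X ^ k * (C (N : ℂ) * (Y - C 1) + X ^ k * Y ^ 2 * Q) * D) := by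
    have : G = X * (1 + X ^ k * Y) := by rw [hG]; ring
    have hGN : G ^ N = X ^ N * (1 + X ^ k * Y) ^ N := by rw [this, mul_pow]
    rw [hGN, map_one]
    linear_combination X ^ N * D * hQ
  rw [e₂, add_assoc, pow_add]
  refine mul_dvd_mul dvd_rfl (dvd_add (h₂.mul_left _) (Dvd.dvd.mul_right ?_ _))
  rw [pow_succ]
  refine mul_dvd_mul dvd_rfl (dvd_add ((constantCoeff_dvd_iff hY).mul_left _) ?_)
  exact ((dvd_pow_self X (by omega)).mul_right _).mul_right _

/-- The equation `v A' = v ∘ A` of the flow of a vector field of order `k + 1` is triangular. -/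
lemma isTriangular_derivative {U W : PowerSeries ℂ} (hU : U = X ^ (k + 1) * W)
    (hW : constantCoeff W = 1) :
    IsTriangular k fun A => U * derivative ℂ A - comp U A := by
  intro N A B hA hB h
  have h₁ := dvd_comp_sub_comp (k := k) hA hB h hW
  have e : U * derivative ℂ A - comp U A - (U * derivative ℂ B - comp U B)
        - C ((N : ℂ) - k - 1) * X ^ k * (A - B)
      = U * derivative ℂ (A - B) - C (N : ℂ) * X ^ k * (A - B)
        - (comp U A - comp U B - C ((k : ℂ) + 1) * X ^ k * (A - B)) := by
    simp only [map_sub, map_add, map_one]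
    ring
  rw [e]
  rw [← hU] at h₁
  refine dvd_sub ?_ h₁
  obtain ⟨D, hD⟩ := h
  have hX : X * derivative ℂ (X ^ N : PowerSeries ℂ) = C (N : ℂ) * X ^ N := by
    rcases N with _ | N
    · simp
    · rw [derivative_pow, derivative_X]
      push_cast
      simp
      ring
  have e₂ : U * derivative ℂ (A - B) - C (N : ℂ) * X ^ k * (A - B)
      = X ^ N * (X ^ k * (C (N : ℂ) * D * (W - C 1) + X * W * derivative ℂ D)) := by
    rw [hD, hU, Derivation.leibniz, smul_eq_mul, smul_eq_mul, map_one]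
    linear_combination X ^ k * W * D * hX
  rw [e₂, add_assoc, pow_add, pow_succ]
  refine mul_dvd_mul dvd_rfl (mul_dvd_mul dvd_rfl (dvd_add ?_ ?_))
  · exact (constantCoeff_dvd_iff hW).mul_left _
  · exact (Dvd.intro _ rfl).mul_right _

end Triangular

/-! ### The formal flow of the vector field -/

section Flow

open PowerSeries

variable {k : ℕ} {b : ℂ}

lemma X_pow_dvd_derivative {N : ℕ} {A : PowerSeries ℂ} (h : X ^ N ∣ A) :
    X ^ (N - 1) ∣ derivative ℂ A := by
  rw [X_pow_dvd_iff] at h ⊢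
  intro m hm
  rw [coeff_derivative, h (m + 1) (by omega), zero_mul]

lemma exists_vectorField_eq (hk : 1 ≤ k) (b : ℂ) : ∃ W, vectorField k b = X ^ (k + 1) * W ∧
    constantCoeff W = 1 ∧ (1 + C b * X ^ k) * W = 1 := by
  have h : constantCoeff (1 + C b * X ^ k : PowerSeries ℂ) = 1 := by simp; omega
  exact ⟨_, rfl, by rw [constantCoeff_inv, h, inv_one], PowerSeries.mul_inv_cancel _ (by simp [h])⟩

lemma X_pow_dvd_vectorField (k : ℕ) (b : ℂ) : X ^ (k + 1) ∣ vectorField k b := Dvd.intro _ rfl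

/-- The derivation `v d/dz` raises the order by `k`. -/
lemma X_pow_dvd_lie {N : ℕ} {A : PowerSeries ℂ} (h : X ^ N ∣ A) :
    X ^ (N + k) ∣ vectorField k b * derivative ℂ A := by
  refine (pow_dvd_pow X (by omega : N + k ≤ (k + 1) + (N - 1))).trans ?_
  rw [pow_add]
  exact mul_dvd_mul (X_pow_dvd_vectorField k b) (X_pow_dvd_derivative h)

lemma X_pow_dvd_lieIterate (k : ℕ) (b : ℂ) (m : ℕ) : X ^ (m * k + 1) ∣ lieIterate k b m := by
  induction m with
  | zero => simp [lieIterate]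
  | succ m ih =>
    rw [lieIterate, show (m + 1) * k + 1 = (m * k + 1) + k by ring]
    exact X_pow_dvd_lie ih

lemma coeff_flow (hk : 1 ≤ k) {N M : ℕ} (h : N < M * k + 1) (t : ℂ) :
    coeff N (flow k b t) =
      ∑ m ∈ Finset.range M, t ^ m / (m.factorial : ℂ) * coeff N (lieIterate k b m) := by
  have key : ∀ M, N < M * k + 1 → ∀ M' ≥ M,
      ∑ m ∈ Finset.range M', t ^ m / (m.factorial : ℂ) * coeff N (lieIterate k b m) =
      ∑ m ∈ Finset.range M, t ^ m / (m.factorial : ℂ) * coeff N (lieIterate k b m) := by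
    intro M hM M' hM'
    refine (Finset.sum_subset (Finset.range_mono hM') fun m _ hm => ?_).symm
    have : M * k ≤ m * k := Nat.mul_le_mul_right k (by simpa using hm)
    rw [X_pow_dvd_iff.1 (X_pow_dvd_lieIterate k b m) N (by omega), mul_zero]
  rw [flow, coeff_mk]
  have h' : N < (N + 1) * k + 1 := by nlinarith
  rcases le_total M (N + 1) with hM | hM
  · exact key M h _ hM
  · exact (key _ h' _ hM).symm

lemma X_pow_dvd_flow_sub (hk : 1 ≤ k) (M : ℕ) (t : ℂ) :
    X ^ (M * k + 1) ∣ flow k b t -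
      ∑ m ∈ Finset.range M, C (t ^ m / (m.factorial : ℂ)) * lieIterate k b m := by
  rw [X_pow_dvd_iff]
  intro N hN
  rw [map_sub, coeff_flow hk hN, map_sum]
  simp

/-- `v^t(z) = z + t z ^ (k + 1) + ⋯`. -/
lemma exists_flow_eq (hk : 1 ≤ k) (b t : ℂ) :
    ∃ Y, flow k b t = X + X ^ (k + 1) * Y ∧ constantCoeff Y = t := by
  obtain ⟨D, hD⟩ := X_pow_dvd_flow_sub (b := b) hk 2 t
  obtain ⟨W, hW, hW₁, -⟩ := exists_vectorField_eq hk b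
  simp only [Finset.sum_range_succ, Finset.sum_range_zero, lieIterate, hW] at hD
  obtain ⟨j, rfl⟩ := Nat.exists_eq_add_of_le hk
  refine ⟨C t * W + X ^ (1 + j) * D, ?_, by simp [hW₁]⟩
  simp only [derivative_X, pow_zero, pow_one, Nat.factorial] at hD
  simp only [Nat.cast_one, div_one, map_one] at hD
  norm_num at hD
  linear_combination hD

lemma isTangentToId_of_eq {A Y : PowerSeries ℂ} (hk : 1 ≤ k) (h : A = X + X ^ (k + 1) * Y) :
    IsTangentToId A := by
  obtain ⟨j, rfl⟩ := Nat.exists_eq_add_of_le hk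
  refine ⟨by simp [h], ?_⟩
  rw [h, map_add, coeff_one_X, coeff_X_pow_mul', if_neg (by omega), add_zero]

lemma coeff_of_eq {A Y : PowerSeries ℂ} (hk : 1 ≤ k) (h : A = X + X ^ (k + 1) * Y) :
    coeff (k + 1) A = constantCoeff Y := by
  rw [h, map_add, coeff_X_pow_mul_self, coeff_X, if_neg (by omega), zero_add]

lemma isTangentToId_flow (hk : 1 ≤ k) (b t : ℂ) : IsTangentToId (flow k b t) := by
  obtain ⟨Y, hY, -⟩ := exists_flow_eq hk b t
  exact isTangentToId_of_eq hk hY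

lemma coeff_flow_resonant (hk : 1 ≤ k) (b t : ℂ) : coeff (k + 1) (flow k b t) = t := by
  obtain ⟨Y, hY, h⟩ := exists_flow_eq hk b t
  rw [coeff_of_eq hk hY, h]

lemma flow_zero (hk : 1 ≤ k) (b : ℂ) : flow k b 0 = X := by
  ext N
  have : coeff N (flow k b 0) = _ := coeff_flow hk (M := N + 1) (by nlinarith) 0
  rw [this, Finset.sum_range_succ']
  simp [lieIterate]

/-- The expansion of `v^1` through the degree `2 k + 1`. -/
lemma X_pow_dvd_flow_one_sub (hk : 1 ≤ k) (b : ℂ) :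
    X ^ (2 * k + 2) ∣ flow k b 1 -
      (X + X ^ (k + 1) + C (((k : ℂ) + 1) / 2 - b) * X ^ (2 * k + 1)) := by
  obtain ⟨D, hD⟩ := X_pow_dvd_flow_sub (b := b) hk 3 1
  obtain ⟨W, hW, hW₁, hW₂⟩ := exists_vectorField_eq hk b
  obtain ⟨j, rfl⟩ := Nat.exists_eq_add_of_le hk
  obtain ⟨W₁, hW₁', -⟩ := exists_eq_C_add_X_mul W
  simp only [Finset.sum_range_succ, Finset.sum_range_zero, lieIterate, hW] at hD
  have hf : derivative ℂ (X ^ (1 + j + 1) * W : PowerSeries ℂ)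
      = X ^ (1 + j + 1) * derivative ℂ W + C ((j : ℂ) + 2) * X ^ (1 + j) * W := by
    rw [Derivation.leibniz, derivative_pow, derivative_X, map_add, show (C (2 : ℂ)) = 2 from rfl]
    simp
    ring
  rw [derivative_X, mul_one, hf] at hD
  simp only [one_pow, Nat.factorial, map_one, Nat.cast_one, div_one, one_mul, zero_add] at hD
  norm_num only at hD
  rw [map_one] at hD
  rw [hW₁, map_one] at hW₁'
  have hC : C ((((1 + j : ℕ) : ℂ) + 1) / 2 - b)
      = C (1 / 2 : ℂ) * C ((j : ℂ) + 2) - C b := by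
    rw [← map_mul, ← map_sub]; congr 1; push_cast; ring
  rw [hC]
  refine ⟨- C b * W₁ + C (1 / 2 : ℂ) * W * derivative ℂ W +
    C (1 / 2 : ℂ) * C ((j : ℂ) + 2) * (2 * W₁ + X * W₁ ^ 2) + X ^ j * D, ?_⟩
  linear_combination hD + X ^ (j + 2) * hW₂ - C b * X ^ (2 * j + 3) * hW₁' +
    C (1 / 2 : ℂ) * C ((j : ℂ) + 2) * X ^ (2 * j + 3) * (W + 1 + X * W₁) * hW₁'

/-- The family `S'` of series is the derivative of the family `S`. -/
def HasCoeffDeriv (S S' : ℂ → PowerSeries ℂ) : Prop :=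
  ∀ N t, HasDerivAt (fun t => coeff N (S t)) (coeff N (S' t)) t

lemma HasCoeffDeriv.mul {S S' R R' : ℂ → PowerSeries ℂ} (hS : HasCoeffDeriv S S')
    (hR : HasCoeffDeriv R R') :
    HasCoeffDeriv (fun t => S t * R t) (fun t => S' t * R t + S t * R' t) := by
  intro N t
  simp only [coeff_mul, map_add]
  rw [← Finset.sum_add_distrib]
  exact HasDerivAt.fun_sum fun p _ => (hS p.1 t).mul (hR p.2 t)

lemma HasCoeffDeriv.sub {S S' R R' : ℂ → PowerSeries ℂ} (hS : HasCoeffDeriv S S')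
    (hR : HasCoeffDeriv R R') : HasCoeffDeriv (fun t => S t - R t) (fun t => S' t - R' t) := by
  intro N t
  simp only [map_sub]
  exact (hS N t).fun_sub (hR N t)

lemma hasCoeffDeriv_const (A : PowerSeries ℂ) : HasCoeffDeriv (fun _ => A) (fun _ => 0) := by
  intro N t
  simpa using hasDerivAt_const t (coeff N A)

lemma HasCoeffDeriv.add_const {S S' : ℂ → PowerSeries ℂ} (hS : HasCoeffDeriv S S')
    (A : PowerSeries ℂ) : HasCoeffDeriv (fun t => A + S t) S' := by
  intro N t
  simp only [map_add]
  exact (hS N t).const_add _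

lemma HasCoeffDeriv.pow {S S' : ℂ → PowerSeries ℂ} (hS : HasCoeffDeriv S S') (m : ℕ) :
    HasCoeffDeriv (fun t => S t ^ (m + 1)) (fun t => C ((m : ℂ) + 1) * S t ^ m * S' t) := by
  induction m with
  | zero => simpa using hS
  | succ m ih =>
    have := ih.mul hS
    simp only [pow_succ _ (m + 1)]
    convert this using 2 with t
    push_cast
    simp only [map_add, map_one, map_natCast]
    ring

lemma HasCoeffDeriv.derivative {S S' : ℂ → PowerSeries ℂ} (hS : HasCoeffDeriv S S') :
    HasCoeffDeriv (fun t => PowerSeries.derivative ℂ (S t))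
      (fun t => PowerSeries.derivative ℂ (S' t)) := by
  intro N t
  simp only [coeff_derivative]
  exact (hS (N + 1) t).mul_const _

/-- A family of series with `∂ₜ S = v ∂_z S` which vanishes for `t = 0` is zero. -/
lemma HasCoeffDeriv.eq_zero (hk : 1 ≤ k) {S : ℂ → PowerSeries ℂ}
    (hS : HasCoeffDeriv S fun t => vectorField k b * PowerSeries.derivative ℂ (S t))
    (h₀ : S 0 = 0) (t : ℂ) : S t = 0 := by
  suffices ∀ N t, X ^ N ∣ S t by
    ext N
    rw [X_pow_dvd_iff.1 (this (N + 1) t) N (by omega), map_zero]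
  intro N
  induction N with
  | zero => simp
  | succ N ih =>
    intro t
    rw [X_pow_dvd_iff]
    intro m hm
    rcases Nat.lt_succ_iff_lt_or_eq.1 hm with hm | rfl
    · exact X_pow_dvd_iff.1 (ih t) m hm
    have hd : ∀ t, HasDerivAt (fun t => coeff m (S t)) 0 t := fun t => by
      have := hS m t
      rwa [X_pow_dvd_iff.1 (X_pow_dvd_lie (k := k) (b := b) (ih t)) m (by omega)] at this
    have := is_const_of_deriv_eq_zero (fun t => (hd t).differentiableAt) (fun t => (hd t).deriv) t 0
    simpa [h₀] using this

lemma hasCoeffDeriv_flow (hk : 1 ≤ k) (b : ℂ) : HasCoeffDeriv (flow k b)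
    fun t => vectorField k b * PowerSeries.derivative ℂ (flow k b t) := by
  intro N t
  have hN : N < (N + 1) * k + 1 := by nlinarith
  have h₁ : (fun t => coeff N (flow k b t)) = fun t =>
      ∑ m ∈ Finset.range N, t ^ (m + 1) / ((m + 1).factorial : ℂ) * coeff N (lieIterate k b (m + 1))
        + coeff N (lieIterate k b 0) := by
    ext t
    rw [coeff_flow hk hN, Finset.sum_range_succ']
    simp
  have h₂ : coeff N (vectorField k b * PowerSeries.derivative ℂ (flow k b t)) =
      ∑ m ∈ Finset.range N, t ^ m / (m.factorial : ℂ) * coeff N (lieIterate k b (m + 1)) := by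
    have hd := X_pow_dvd_lie (k := k) (b := b) (X_pow_dvd_flow_sub (b := b) hk N t)
    have := X_pow_dvd_iff.1 hd N (by nlinarith)
    rw [map_sub, mul_sub, map_sub, sub_eq_zero] at this
    rw [this, map_sum, Finset.mul_sum, map_sum]
    refine Finset.sum_congr rfl fun m _ => ?_
    rw [← smul_eq_C_mul, Derivation.map_smul, mul_smul_comm, coeff_smul, lieIterate, smul_eq_mul]
  rw [h₁, h₂]
  refine (HasDerivAt.fun_sum fun m _ => ?_).add_const _
  refine HasDerivAt.mul_const ?_ _
  have := (hasDerivAt_pow (m + 1) t).div_const ((m + 1).factorial : ℂ)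
  convert this using 1
  have h₃ : (m.factorial : ℂ) ≠ 0 := by exact_mod_cast m.factorial_ne_zero
  have h₄ : (m : ℂ) + 1 ≠ 0 := by exact_mod_cast m.succ_ne_zero
  rw [Nat.factorial_succ]
  push_cast
  field_simp

/-- The time-`t` map transports the vector field to itself. -/
lemma vectorField_mul_derivative_flow (hk : 1 ≤ k) (b t : ℂ) :
    vectorField k b * PowerSeries.derivative ℂ (flow k b t) =
      comp (vectorField k b) (flow k b t) := by
  obtain ⟨W, hW, hW₁, hW₂⟩ := exists_vectorField_eq hk b
  have hV := hasCoeffDeriv_flow hk b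
  -- the defect of the equation, cleared of denominators, is transported by the flow
  have key : (1 + C b * flow k b t ^ k) * (vectorField k b * PowerSeries.derivative ℂ (flow k b t))
      - flow k b t ^ (k + 1) = 0 := by
    obtain ⟨j, rfl⟩ := Nat.exists_eq_add_of_le' hk
    have h₁ := (((hasCoeffDeriv_const (C b)).mul (hV.pow j)).add_const 1).mul
      ((hasCoeffDeriv_const (vectorField (j + 1) b)).mul hV.derivative)
    refine HasCoeffDeriv.eq_zero hk (S := fun t => (1 + C b * flow (j + 1) b t ^ (j + 1)) *
      (vectorField (j + 1) b * PowerSeries.derivative ℂ (flow (j + 1) b t))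
        - flow (j + 1) b t ^ (j + 1 + 1)) (b := b) ?_ ?_ t
    · convert h₁.sub (hV.pow (j + 1)) using 2 with t
      rw [map_sub, Derivation.leibniz _ (1 + C b * flow (j + 1) b t ^ (j + 1)), derivative_pow,
        map_add, Derivation.leibniz _ (C b), derivative_pow, Derivation.map_one_eq_zero,
        derivative_C]
      simp only [smul_eq_mul, Nat.add_sub_cancel, map_add, map_one, map_natCast]
      push_cast
      ring
    · rw [flow_zero hk, derivative_X, mul_one, hW]
      linear_combination X ^ (j + 1 + 1) * hW₂
  have h₀ := (isTangentToId_flow hk b t).1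
  have hW₃ : (1 + C b * flow k b t ^ k) * comp W (flow k b t) = 1 := by
    have := congrArg (fun S => comp S (flow k b t)) hW₂
    simpa only [comp_mul h₀, comp_add h₀, comp_pow h₀, comp_C h₀, X_comp h₀, comp_one h₀] using this
  rw [hW, comp_mul h₀, comp_pow h₀, X_comp h₀, ← hW]
  linear_combination (comp W (flow k b t)) * key
    - (vectorField k b * PowerSeries.derivative ℂ (flow k b t)) * hW₃

/-- The flow maps are the solutions, tangent to the identity, of `v A' = v ∘ A`. -/
lemma eq_flow (hk : 1 ≤ k) {A : PowerSeries ℂ} (hA : IsTangentToId A)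
    (h : vectorField k b * PowerSeries.derivative ℂ A = comp (vectorField k b) A) :
    A = flow k b (coeff (k + 1) A) := by
  obtain ⟨W, hW, hW₁, -⟩ := exists_vectorField_eq hk b
  refine (isTriangular_derivative hW hW₁).eq_of_coeff_eq hA (isTangentToId_flow hk b _) ?_ ?_
  · rw [h, vectorField_mul_derivative_flow hk, sub_self, sub_self]
  · rw [coeff_flow_resonant hk]

lemma flow_comp_flow (hk : 1 ≤ k) (b s t : ℂ) :
    comp (flow k b s) (flow k b t) = flow k b (s + t) := by
  obtain ⟨Y, hY, hYs⟩ := exists_flow_eq hk b s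
  obtain ⟨Z, hZ, hZt⟩ := exists_flow_eq hk b t
  have hs := isTangentToId_flow hk b s
  have ht := isTangentToId_flow hk b t
  obtain ⟨Z₁, hZ₁, hZ₁'⟩ := ht.exists_eq
  have e : comp (flow k b s) (flow k b t) =
      X + X ^ (k + 1) * (Z + Z₁ ^ (k + 1) * comp Y (flow k b t)) := by
    rw [hY, comp_add ht.1, comp_mul ht.1, comp_pow ht.1, X_comp ht.1]
    nth_rewrite 2 [hZ₁]
    linear_combination hZ
  rw [eq_flow (b := b) hk (isTangentToId_of_eq hk e), coeff_of_eq hk e]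
  · simp [hZt, hZ₁', constantCoeff_comp ht.1, hYs, add_comm]
  · rw [derivative_comp ht.1]
    have h₁ := vectorField_mul_derivative_flow hk b t
    have h₂ := vectorField_mul_derivative_flow hk b s
    rw [← comp_assoc hs.1 ht.1, ← h₂, comp_mul ht.1, ← h₁]
    ring

end Flow

/-! ### Symmetries of the formal flow, and formal conjugacy to the normal form -/

section FlowSymmetry

open PowerSeries

variable {k : ℕ} {b : ℂ}

lemma conjSeries_mul (A B : PowerSeries ℂ) : conjSeries (A * B) = conjSeries A * conjSeries B :=
  map_mul _ A B

lemma conjSeries_X : conjSeries X = X := PowerSeries.map_X _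

lemma conjSeries_C (a : ℂ) : conjSeries (C a) = C (conj a) := PowerSeries.map_C _ a

lemma derivative_conjSeries (A : PowerSeries ℂ) :
    derivative ℂ (conjSeries A) = conjSeries (derivative ℂ A) := by
  ext m; simp [coeff_derivative]

lemma conjSeries_vectorField (hk : 1 ≤ k) (hb : b.im = 0) :
    conjSeries (vectorField k b) = vectorField k b := by
  obtain ⟨W, hW, -, hW₂⟩ := exists_vectorField_eq hk b
  have h := congrArg conjSeries hW₂
  have e : conjSeries (1 + C b * X ^ k) = 1 + C b * X ^ k := by
    simp [conjSeries, conj_eq_iff_im.2 hb]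
  rw [conjSeries_mul, e, show conjSeries 1 = 1 from map_one _] at h
  have h' : conjSeries W = W := by
    linear_combination W * h - conjSeries W * hW₂
  rw [hW, conjSeries_mul, h', show conjSeries (X ^ (k + 1)) = X ^ (k + 1) by simp [conjSeries]]

lemma conjSeries_lieIterate (hk : 1 ≤ k) (hb : b.im = 0) (m : ℕ) :
    conjSeries (lieIterate k b m) = lieIterate k b m := by
  induction m with
  | zero => exact conjSeries_X
  | succ m ih =>
    rw [lieIterate, conjSeries_mul, conjSeries_vectorField hk hb, ← derivative_conjSeries, ih]

lemma conjSeries_flow (hk : 1 ≤ k) (hb : b.im = 0) (t : ℂ) :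
    conjSeries (flow k b t) = flow k b (conj t) := by
  ext N
  rw [coeff_conjSeries, flow, flow, coeff_mk, coeff_mk, map_sum]
  refine Finset.sum_congr rfl fun m _ => ?_
  rw [map_mul, map_div₀, map_pow, ← coeff_conjSeries, conjSeries_lieIterate hk hb]
  simp

lemma rescale_derivative (a : ℂ) (A : PowerSeries ℂ) :
    derivative ℂ (rescale a A) = C a * rescale a (derivative ℂ A) := by
  ext m
  rw [coeff_derivative, coeff_rescale, coeff_C_mul, coeff_rescale, coeff_derivative]
  ring

lemma rescale_C' (a c : ℂ) : rescale a (C c) = C c := by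
  ext m
  rw [coeff_rescale, coeff_C]
  split_ifs with h <;> simp [h]

/-- The vector field is invariant under the rotations of order `k`. -/
lemma rescale_vectorField (hk : 1 ≤ k) {a : ℂ} (ha : a ^ k = 1) :
    rescale a (vectorField k b) = C a * vectorField k b := by
  obtain ⟨W, hW, -, hW₂⟩ := exists_vectorField_eq hk b
  have hX : ∀ m, rescale a (X ^ m : PowerSeries ℂ) = C (a ^ m) * X ^ m := fun m => by
    rw [map_pow, rescale_X, mul_pow, map_pow]
  have h := congrArg (rescale a) hW₂
  rw [map_mul, map_add, map_mul, hX, rescale_C', ha, map_one, map_one, one_mul] at h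
  have h' : rescale a W = W := by linear_combination W * h - rescale a W * hW₂
  rw [hW, map_mul, h', hX, pow_succ, ha, one_mul, mul_assoc]

lemma rescale_lieIterate (hk : 1 ≤ k) {a : ℂ} (ha : a ^ k = 1) (m : ℕ) :
    rescale a (lieIterate k b m) = C a * lieIterate k b m := by
  induction m with
  | zero => exact rescale_X a
  | succ m ih =>
    have h := rescale_derivative a (lieIterate k b m)
    rw [ih, ← smul_eq_C_mul, Derivation.map_smul, smul_eq_C_mul] at h
    rw [lieIterate, map_mul, rescale_vectorField hk ha]
    linear_combination (-vectorField k b) * h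

lemma comp_C_mul_X (a : ℂ) (A : PowerSeries ℂ) : comp A (C a * X) = rescale a A := by
  rw [rescale_eq_subst, smul_eq_C_mul]; rfl

/-- The flow commutes with the rotations of order `k`. -/
lemma flow_comp_rotation (hk : 1 ≤ k) {a : ℂ} (ha : a ^ k = 1) (t : ℂ) :
    comp (flow k b t) (C a * X) = C a * flow k b t := by
  rw [comp_C_mul_X]
  ext N
  rw [coeff_rescale, coeff_C_mul, flow, coeff_mk, Finset.mul_sum, Finset.mul_sum]
  refine Finset.sum_congr rfl fun m _ => ?_
  have h := congrArg (coeff N) (rescale_lieIterate (b := b) hk ha m)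
  rw [coeff_rescale, coeff_C_mul] at h
  linear_combination t ^ m / (m.factorial : ℂ) * h

lemma C_mul_comp {A D : PowerSeries ℂ} (hD : constantCoeff D = 0) (a : ℂ) :
    comp (C a * A) D = C a * comp A D := by rw [comp_mul hD, comp_C hD]

lemma comp_C_mul {A D : PowerSeries ℂ} (hD : constantCoeff D = 0) (a : ℂ) :
    comp A (C a * D) = comp (comp A (C a * X)) D := by
  rw [comp_assoc (by simp) hD, C_mul_comp hD, X_comp hD]

/-- The series tangent to the identity which commute with `v^1` are the `v^s`. -/
lemma eq_flow_of_commute (hk : 1 ≤ k) {A : PowerSeries ℂ} (hA : IsTangentToId A)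
    (h : comp A (flow k b 1) = comp (flow k b 1) A) : A = flow k b (coeff (k + 1) A) := by
  obtain ⟨Y, hY, hY₁⟩ := exists_flow_eq hk b 1
  refine (isTriangular_comp hk hY hY₁ hY hY₁).eq_of_coeff_eq hA (isTangentToId_flow hk b _) ?_ ?_
  · rw [h, flow_comp_flow hk, flow_comp_flow hk, add_comm, sub_self, sub_self]
  · rw [coeff_flow_resonant hk]

lemma X_pow_dvd_taylor_sub {G : ℂ → ℂ} (hG : IsPrenormalized k b G) :
    X ^ (2 * k + 2) ∣ taylor G -
      (X + X ^ (k + 1) + C (((k : ℂ) + 1) / 2 - b) * X ^ (2 * k + 1)) := by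
  have hp : ∀ m : ℕ, AnalyticAt ℂ (fun z : ℂ => z ^ m) 0 := fun m => by fun_prop
  have hp₁ : AnalyticAt ℂ (fun z : ℂ => z + z ^ (k + 1)) 0 := by fun_prop
  have hp₂ : AnalyticAt ℂ (fun z : ℂ => (((k : ℂ) + 1) / 2 - b) * z ^ (2 * k + 1)) 0 := by fun_prop
  have hX : ∀ m, taylor (fun z => z ^ m) = X ^ m := fun m => by
    rw [taylor_pow (f := fun z => z) analyticAt_id, taylor_id]
  obtain ⟨R, hR, h⟩ := exists_eq_pow_mul_of_isLittleO (hG.1.fun_sub (hp₁.fun_add hp₂)) hG.2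
  have h' : G =ᶠ[𝓝 0] fun z => (z + z ^ (k + 1) + (((k : ℂ) + 1) / 2 - b) * z ^ (2 * k + 1)) +
      z ^ (2 * k + 2) * R z := by
    filter_upwards [h] with z hz
    linear_combination hz
  rw [taylor_congr h', taylor_add (hp₁.fun_add hp₂) ((hp _).fun_mul hR), taylor_add hp₁ hp₂,
    taylor_add (f := fun z => z) analyticAt_id (hp _), taylor_mul (hp _) hR, taylor_mul analyticAt_const (hp _),
    hX, hX, hX, taylor_const, taylor_id, add_sub_cancel_left]
  exact Dvd.intro _ rfl

/-- The formal conjugacy of a prenormalized germ to its normal form. -/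
lemma exists_formal_conjugacy (hk : 1 ≤ k) {G : ℂ → ℂ} (hG : IsPrenormalized k b G) :
    ∃ A, IsTangentToId A ∧ comp A (taylor G) = comp (flow k b 1) A := by
  obtain ⟨Y, hY, hY₁⟩ := exists_flow_eq hk b 1
  have h := dvd_sub (X_pow_dvd_taylor_sub hG) (X_pow_dvd_flow_one_sub hk b)
  rw [sub_sub_sub_cancel_right] at h
  obtain ⟨D, hD⟩ := h
  have hT : taylor G = X + X ^ (k + 1) * (Y + X ^ (k + 1) * D) := by
    linear_combination hD + hY
  have hX : IsTangentToId (X : PowerSeries ℂ) := ⟨by simp, by simp⟩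
  obtain ⟨A, hA, h₀⟩ := (isTriangular_comp hk hT (by simp [hY₁]) hY hY₁).exists_eq_zero
    (M := k + 2) (by omega) (by omega) hX (by
      rw [X_comp, comp_X, hD, show k + 2 + k = 2 * k + 2 by ring]
      · exact Dvd.intro _ rfl
      · simp [hT])
  exact ⟨A, hA, sub_eq_zero.1 h₀⟩

/-- The formal flow at the time `1` is the Taylor series of the time-one map: the latter
satisfies the same differential equation. -/
lemma IsTimeOneMap.taylor_eq (hk : 1 ≤ k) {N : ℂ → ℂ} (hN : IsTimeOneMap k b N) :
    AnalyticAt ℂ N 0 ∧ taylor N = flow k b 1 := by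
  obtain ⟨ν, hν, hν₀, hE, hNν⟩ := hN
  obtain rfl : N = fun z => z * exp (ν z) := funext hNν
  set N : ℂ → ℂ := fun z => z * exp (ν z) with hN
  have hNa : AnalyticAt ℂ N 0 := analyticAt_id.fun_mul hν.cexp'
  refine ⟨hNa, ?_⟩
  have hk0 : (k : ℂ) ≠ 0 := by exact_mod_cast (by omega : k ≠ 0)
  have hT : ∃ Y, taylor N = X + X ^ (k + 1) * Y ∧ constantCoeff Y = 1 := by
    -- `exp u = 1 + u p(u)` with `p 0 = 1`
    obtain ⟨p, hp, hp₀, hpe⟩ : ∃ p : ℂ → ℂ, AnalyticAt ℂ p 0 ∧ p 0 = 1 ∧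
        ∀ u, exp u = 1 + u * p u := by
      obtain ⟨P, hP⟩ := analyticAt_cexp (z := (0 : ℂ))
      refine ⟨_, hP.has_fpower_series_dslope_fslope.analyticAt, by simp [dslope_same], fun u => ?_⟩
      have := sub_smul_dslope exp 0 u
      simp only [sub_zero, smul_eq_mul, exp_zero] at this
      rw [this]; ring
    set D : ℂ → ℂ := fun z => p (-(k * ν z)) + b * z ^ k with hD
    have hpow : AnalyticAt ℂ (fun z : ℂ => b * z ^ k) 0 := by fun_prop
    have hDa : AnalyticAt ℂ D 0 := by
      refine AnalyticAt.fun_add ?_ hpow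
      refine AnalyticAt.fun_comp (f := fun z => -(k * ν z)) ?_ (analyticAt_const.fun_mul hν).fun_neg
      simpa [hν₀] using hp
    have hD₀ : D 0 = 1 := by
      simp [hD, hν₀, hp₀]; omega
    have hpν : AnalyticAt ℂ (fun z => p (ν z)) 0 :=
      AnalyticAt.fun_comp (by rwa [hν₀]) hν
    have hY : AnalyticAt ℂ (fun z => p (ν z) / D z) 0 := hpν.fun_div hDa (by simp [hD₀])
    have hz : AnalyticAt ℂ (fun z : ℂ => z ^ (k + 1)) 0 := by fun_prop
    have e : N =ᶠ[𝓝 0] fun z => z + z ^ (k + 1) * (p (ν z) / D z) := by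
      filter_upwards [hE, hDa.continuousAt.eventually_ne (hD₀.trans_ne one_ne_zero)] with z h₁ h₂
      have h₃ : ν z * D z = z ^ k := by
        rw [← h₁, timeIncrement, hpe (-(k * ν z))]
        simp only [hD]
        field_simp
        ring
      simp only [hN, hpe (ν z)]
      field_simp
      rw [pow_succ, ← h₃]
      ring
    refine ⟨taylor (fun z => p (ν z) / D z), ?_, by simp [constantCoeff_taylor, hν₀, hp₀, hD₀]⟩
    rw [taylor_congr e, taylor_add (f := fun z => z) analyticAt_id (hz.fun_mul hY),
      taylor_mul hz hY, taylor_pow (f := fun z => z) analyticAt_id, taylor_id]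
  -- the differential equation of the flow, without denominators
  have hODE : ∀ᶠ z in 𝓝 (0 : ℂ), (1 + b * N z ^ k) * (z ^ (k + 1) * deriv N z)
      = N z ^ (k + 1) * (1 + b * z ^ k) := by
    filter_upwards [hE.eventually_nhds, hν.eventually_analyticAt] with z hz hνz
    have hd := hνz.differentiableAt.hasDerivAt
    have h₁ : HasDerivAt (fun z => timeIncrement k b z (ν z))
        (-(exp (-(k * ν z)) * -(k * deriv ν z)) / k
          + (b * (k * z ^ (k - 1)) * ν z + b * z ^ k * deriv ν z)) z :=
      ((((hd.const_mul (k : ℂ)).fun_neg.cexp).const_sub 1).div_const (k : ℂ)).fun_add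
        (((hasDerivAt_pow k z).const_mul b).fun_mul hd)
    have h₂ := (h₁.congr_of_eventuallyEq (EventuallyEq.symm hz)).unique (hasDerivAt_pow k z)
    have h₃ := hz.self_of_nhds
    have h₄ : HasDerivAt N (1 * exp (ν z) + z * (exp (ν z) * deriv ν z)) z :=
      (hasDerivAt_id' z).fun_mul hd.cexp
    rw [h₄.deriv]
    have e₁ : exp (-(k * ν z)) * exp (ν z) ^ k = 1 := by
      rw [← exp_nat_mul, ← exp_add, neg_add_cancel, exp_zero]
    have e₂ : z * z ^ (k - 1) = z ^ k := by rw [← pow_succ', Nat.sub_add_cancel hk]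
    rw [timeIncrement] at h₃
    have h₅ : exp (-(k * ν z)) * deriv ν z + b * (k * z ^ (k - 1)) * ν z + b * z ^ k * deriv ν z
        = k * z ^ (k - 1) := by
      have e₃ : -(exp (-(k * ν z)) * -(k * deriv ν z)) / k = exp (-(k * ν z)) * deriv ν z := by
        field_simp
      rw [e₃] at h₂
      linear_combination h₂
    have h₆ : 1 - exp (-(k * ν z)) + k * b * z ^ k * ν z = k * z ^ k := by
      have e₄ := div_mul_cancel₀ (1 - exp (-(k * ν z))) hk0
      linear_combination k * h₃ - e₄
    -- multiply by `z` and eliminate `z ^ k - b z ^ k ν`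
    have h₇ : (exp (-(k * ν z)) + b * z ^ k) * (1 + z * deriv ν z) = 1 + b * z ^ k := by
      linear_combination z * h₅ - h₆ + (k - b * k * ν z) * e₂
    simp only [hN]
    linear_combination z ^ (k + 1) * exp (ν z) ^ (k + 1) * h₇
      - z ^ (k + 1) * exp (ν z) * (1 + z * deriv ν z) * e₁
  obtain ⟨Y, hY, hY₁⟩ := hT
  have hNT := isTangentToId_of_eq hk hY
  have h₁ := eq_flow (b := b) hk hNT ?_
  · rwa [coeff_of_eq hk hY, hY₁] at h₁
  obtain ⟨W, hW, -, hW₂⟩ := exists_vectorField_eq hk b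
  have hp : ∀ m : ℕ, AnalyticAt ℂ (fun z : ℂ => z ^ m) 0 := fun m => by fun_prop
  have hX : ∀ m, taylor (fun z => z ^ m) = X ^ m := fun m => by
    rw [taylor_pow (f := fun z => z) analyticAt_id, taylor_id]
  have hc : ∀ c : ℂ, AnalyticAt ℂ (fun _ : ℂ => c) 0 := fun c => analyticAt_const
  have hF : (1 + C b * taylor N ^ k) * (X ^ (k + 1) * derivative ℂ (taylor N))
      = taylor N ^ (k + 1) * (1 + C b * X ^ k) := by
    have h := taylor_congr hODE
    rw [taylor_mul ((hc 1).fun_add ((hc b).fun_mul (hNa.fun_pow k)))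
        ((hp (k + 1)).fun_mul hNa.deriv),
      taylor_add (hc 1) ((hc b).fun_mul (hNa.fun_pow k)), taylor_mul (hc b) (hNa.fun_pow k),
      taylor_mul (hp (k + 1)) hNa.deriv, taylor_pow hNa, hX, taylor_const, taylor_const,
      taylor_mul (hNa.fun_pow (k + 1)) ((hc 1).fun_add ((hc b).fun_mul (hp k))),
      taylor_add (hc 1) ((hc b).fun_mul (hp k)), taylor_mul (hc b) (hp k), taylor_pow hNa, hX,
      taylor_const, taylor_const, ← derivative_taylor, map_one] at h
    exact h
  have hW₃ : (1 + C b * taylor N ^ k) * comp W (taylor N) = 1 := by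
    have := congrArg (fun S => comp S (taylor N)) hW₂
    simpa only [comp_mul hNT.1, comp_add hNT.1, comp_pow hNT.1, comp_C hNT.1, X_comp hNT.1,
      comp_one hNT.1] using this
  rw [hW, comp_mul hNT.1, comp_pow hNT.1, X_comp hNT.1]
  linear_combination (W * comp W (taylor N)) * hF
    - (X ^ (k + 1) * W * derivative ℂ (taylor N)) * hW₃
    + (taylor N ^ (k + 1) * comp W (taylor N)) * hW₂

end FlowSymmetry

/-! ### Classification of the formal antiholomorphic roots -/

section FormalRoots

open PowerSeries

variable {k n : ℕ} {b : ℂ}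

lemma constantCoeff_antiIterate {A : PowerSeries ℂ} (hA : constantCoeff A = 0) (m : ℕ) :
    constantCoeff (antiIterate A m) = 0 := by
  induction m with
  | zero => simp [antiIterate]
  | succ m ih => rw [antiIterate, constantCoeff_comp (constantCoeff_conjSeries ih), hA]

lemma constantCoeff_conjSeries_iterate {A : PowerSeries ℂ} (hA : constantCoeff A = 0) (m : ℕ) :
    constantCoeff (conjSeries^[m] A) = 0 := by
  induction m with
  | zero => exact hA
  | succ m ih => rw [Function.iterate_succ_apply']; exact constantCoeff_conjSeries ih

lemma conjSeries_iterate_of_even (hn : Even n) (A : PowerSeries ℂ) : conjSeries^[n] A = A := by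
  rw [Function.Involutive.iterate_even conjSeries_conjSeries hn, id]

lemma antiIterate_succ' {A : PowerSeries ℂ} (hA : constantCoeff A = 0) (m : ℕ) :
    antiIterate A (m + 1) = comp (antiIterate A m) (conjSeries^[m] A) := by
  induction m with
  | zero =>
    change comp A (conjSeries X) = comp X A
    rw [conjSeries_X, comp_X, X_comp hA]
  | succ m ih =>
    have h := constantCoeff_conjSeries_iterate hA m
    change comp A (conjSeries (antiIterate A (m + 1))) =
      comp (comp A (conjSeries (antiIterate A m))) (conjSeries^[m + 1] A)
    rw [ih, conjSeries_comp h, Function.iterate_succ_apply',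
      comp_assoc (constantCoeff_conjSeries (constantCoeff_antiIterate hA m))
        (constantCoeff_conjSeries h)]

/-- An antiholomorphic formal germ commutes with its even iterates. -/
lemma comp_conjSeries_antiIterate (hn : Even n) {A : PowerSeries ℂ} (hA : constantCoeff A = 0) :
    comp A (conjSeries (antiIterate A n)) = comp (antiIterate A n) A := by
  have h := antiIterate_succ' hA n
  rwa [antiIterate, conjSeries_iterate_of_even hn] at h

/-- Change of coordinate in the iterates of an antiholomorphic formal germ. -/
lemma antiIterate_conjugate {A p q : PowerSeries ℂ} (hA : constantCoeff A = 0)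
    (hp : constantCoeff p = 0) (hq : constantCoeff q = 0) (hpq : comp p q = X)
    (hqp : comp q p = X) (m : ℕ) :
    antiIterate (comp p (comp A (conjSeries q))) m =
      comp p (comp (antiIterate A m) (conjSeries^[m] q)) := by
  induction m with
  | zero =>
    change X = comp p (comp X q)
    rw [X_comp hq, hpq]
  | succ m ih =>
    have h₁ := constantCoeff_antiIterate hA m
    have h₁' := constantCoeff_conjSeries h₁
    have hq' := constantCoeff_conjSeries hq
    have hp' := constantCoeff_conjSeries hp
    have h₂ := constantCoeff_conjSeries_iterate hq m
    have h₂' := constantCoeff_conjSeries h₂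
    have h₃ : constantCoeff (comp (antiIterate A m) (conjSeries^[m] q)) = 0 := by
      rw [constantCoeff_comp h₂, h₁]
    have h₃' : constantCoeff (comp (conjSeries (antiIterate A m)) (conjSeries (conjSeries^[m] q))) = 0 := by
      rw [constantCoeff_comp h₂', h₁']
    have h₄ : constantCoeff (comp A (conjSeries q)) = 0 := by rw [constantCoeff_comp hq', hA]
    have h₅ : comp (conjSeries q) (conjSeries p) = X := by
      rw [← conjSeries_comp hp, hqp, conjSeries_X]
    rw [antiIterate, ih, conjSeries_comp h₃, conjSeries_comp h₂, Function.iterate_succ_apply',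
      comp_assoc h₄ (by rw [constantCoeff_comp h₃', hp']),
      comp_assoc hq' (by rw [constantCoeff_comp h₃', hp']),
      ← comp_assoc (D := comp (conjSeries (antiIterate A m)) _) hp' h₃', h₅, X_comp h₃',
      antiIterate, comp_assoc h₁' h₂']

lemma axisCoeff_mul_conj (hk : 1 ≤ k) (ℓ : ℕ) : axisCoeff k ℓ * conj (axisCoeff k ℓ) = 1 := by
  have h : ‖axisCoeff k ℓ‖ = 1 := norm_eq_one_of_pow_eq_one (axisCoeff_pow hk ℓ) (by omega)
  rw [mul_conj, normSq_eq_norm_sq, h]; simp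

lemma axisCoeff_injective (hk : 1 ≤ k) : Function.Injective fun ℓ : Fin k => axisCoeff k ℓ := by
  have hprim := Complex.isPrimitiveRoot_exp k (by omega)
  have e : ∀ ℓ : ℕ, axisCoeff k ℓ = exp (2 * Real.pi * I / k) ^ ℓ := fun ℓ => by
    rw [← exp_nat_mul, axisCoeff]; congr 1; ring
  intro i j h
  simp only [e] at h
  exact Fin.ext (hprim.pow_inj i.2 j.2 h)

/-- The even iterates of the antiholomorphic map with series `a v^s`, when `a ^ k = 1`, are flow
maps, since `v` is invariant under the rotation by `a` and under the complex conjugation. -/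
lemma antiIterate_axis_flow (hk : 1 ≤ k) (hb : b.im = 0) (ℓ : ℕ) (s : ℂ) (j : ℕ) :
    antiIterate (C (axisCoeff k ℓ) * flow k b s) (j + j) = flow k b (j * (s + conj s)) := by
  set a := axisCoeff k ℓ with ha
  have ha' : conj a ^ k = 1 := by rw [← map_pow, axisCoeff_pow hk, map_one]
  have h₀ : ∀ t, constantCoeff (flow k b t) = 0 := fun t => (isTangentToId_flow hk b t).1
  have h₁ : ∀ c t, constantCoeff (C c * flow k b t) = 0 := fun c t => by simp [h₀]
  have hcomp : ∀ t, comp (C a * flow k b s) (C (conj a) * flow k b t) = flow k b (s + t) := by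
    intro t
    rw [C_mul_comp (h₁ _ _), comp_C_mul (h₀ t), flow_comp_rotation hk ha', C_mul_comp (h₀ t),
      flow_comp_flow hk, ← mul_assoc, ← map_mul, axisCoeff_mul_conj hk, map_one, one_mul]
  induction j with
  | zero => simp [antiIterate, flow_zero hk]
  | succ j ih =>
    have e : antiIterate (C a * flow k b s) (j + 1 + (j + 1)) = comp (C a * flow k b s)
        (conjSeries (comp (C a * flow k b s) (conjSeries (antiIterate (C a * flow k b s) (j + j))))) := by
      rw [show j + 1 + (j + 1) = j + j + 1 + 1 by ring]; rfl
    have e₁ : conjSeries (comp (C a * flow k b s) (conjSeries (flow k b (j * (s + conj s)))))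
        = C (conj a) * flow k b (conj s + j * (s + conj s)) := by
      rw [conjSeries_comp (constantCoeff_conjSeries (h₀ _)), conjSeries_conjSeries, conjSeries_mul,
        conjSeries_C, conjSeries_flow hk hb, C_mul_comp (h₀ _), flow_comp_flow hk]
    rw [e, ih, e₁, hcomp]
    congr 1
    push_cast
    ring

/-- The multiplier of a formal series commuting with a series `X + X ^ (k + 1) + ⋯` is a `k`-th
root of unity. -/
lemma coeff_one_pow_of_commute {A V Y : PowerSeries ℂ} (hA : constantCoeff A = 0)
    (hA₁ : coeff 1 A ≠ 0) (hV : V = X + X ^ (k + 1) * Y) (hY : constantCoeff Y = 1)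
    (h : comp A V = comp V A) : coeff 1 A ^ k = 1 := by
  have hV₀ : constantCoeff V = 0 := by simp [hV]
  obtain ⟨A₁, hA', h₁⟩ := exists_eq_C_add_X_mul A
  rw [hA, map_zero, zero_add] at hA'
  obtain ⟨D, hD⟩ : X ^ (k + 1) ∣ comp A₁ V - A₁ := by
    have := X_pow_dvd_comp_sub_comp (N := k + 1) (D := X) hV₀ (by simp)
      (by rw [hV, add_sub_cancel_left]; exact Dvd.intro _ rfl) A₁
    rwa [comp_X] at this
  have e₁ : comp A V = A + X ^ (k + 1) * (Y * comp A₁ V + X * D) := by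
    nth_rewrite 1 [hA']
    rw [comp_mul hV₀, X_comp hV₀]
    linear_combination (comp A₁ V) * hV + X * hD - hA'
  have e₂ : comp V A = A + X ^ (k + 1) * (A₁ ^ (k + 1) * comp Y A) := by
    rw [hV, comp_add hA, comp_mul hA, comp_pow hA, X_comp hA]
    nth_rewrite 2 [hA']
    ring
  have h₂ := congrArg (coeff (k + 1)) (e₁.symm.trans (h.trans e₂))
  rw [map_add, map_add, add_right_inj, coeff_X_pow_mul_self, coeff_X_pow_mul_self] at h₂
  simp only [map_add, map_mul, map_pow, constantCoeff_X, zero_mul, add_zero, hY, one_mul, mul_one,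
    constantCoeff_comp hV₀, constantCoeff_comp hA, h₁] at h₂
  rw [pow_succ] at h₂
  exact mul_right_cancel₀ hA₁ (by rw [one_mul]; exact h₂.symm)

/-- The formal antiholomorphic roots of the normal form. -/
theorem antiIterate_eq_flow_one_iff (hk : 1 ≤ k) (hb : b.im = 0) (hn : Even n) (hn0 : 0 < n)
    {A : PowerSeries ℂ} (hA : constantCoeff A = 0) :
    antiIterate A n = flow k b 1 ↔
      ∃ (ℓ : Fin k) (y : ℝ), A = C (axisCoeff k ℓ) * conjSeries (flow k b (1 / n + I * y)) := by
  have hn0' : (n : ℂ) ≠ 0 := by exact_mod_cast hn0.ne'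
  obtain ⟨j, hj⟩ := hn
  constructor
  · intro h
    -- `A` commutes with its even iterate `v ^ 1`.
    have hcomm : comp A (flow k b 1) = comp (flow k b 1) A := by
      have := comp_conjSeries_antiIterate ⟨j, hj⟩ hA
      rwa [h, conjSeries_flow hk hb, map_one] at this
    have hA₁ : coeff 1 A ≠ 0 := by
      intro h₁
      obtain ⟨m, rfl⟩ := Nat.exists_eq_succ_of_ne_zero hn0.ne'
      have h₂ := (isTangentToId_flow hk b 1).2
      rw [← h, antiIterate, coeff_one_comp (constantCoeff_conjSeries (constantCoeff_antiIterate hA m)),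
        h₁, zero_mul] at h₂
      exact zero_ne_one h₂
    obtain ⟨Y, hY, hY₁⟩ := exists_flow_eq hk b 1
    obtain ⟨ℓ, hℓ⟩ := exists_axisCoeff_eq hk (coeff_one_pow_of_commute hA hA₁ hY hY₁ hcomm)
    set a := coeff 1 A with ha
    have ha' : a⁻¹ ^ k = 1 := by rw [hℓ, inv_pow, axisCoeff_pow hk, inv_one]
    have hV := (isTangentToId_flow hk b 1).1
    have hB : IsTangentToId (C a⁻¹ * A) := ⟨by simp [hA], by
      rw [coeff_C_mul, ← ha, inv_mul_cancel₀ hA₁]⟩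
    -- `a⁻¹ * A` commutes with `v ^ 1` and is tangent to the identity.
    have hBV := eq_flow_of_commute (b := b) hk hB (by
      rw [C_mul_comp hV, hcomm, comp_C_mul hA, flow_comp_rotation hk ha', C_mul_comp hA])
    set s := coeff (k + 1) (C a⁻¹ * A)
    have hAs : A = C (axisCoeff k ℓ) * flow k b s := by
      rw [← hBV, ← hℓ, ← mul_assoc, ← map_mul, mul_inv_cancel₀ hA₁, map_one, one_mul]
    have h₁ := antiIterate_axis_flow hk hb ℓ s j
    rw [← hAs, ← hj, h] at h₁
    have h₂ := congrArg (coeff (k + 1)) h₁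
    rw [coeff_flow_resonant hk, coeff_flow_resonant hk, add_conj] at h₂
    refine ⟨ℓ, -s.im, ?_⟩
    rw [hAs, conjSeries_flow hk hb]
    congr 2
    have h₃ : (s.re : ℂ) = 1 / n := by
      rw [eq_div_iff hn0', hj]
      push_cast at h₂ ⊢
      linear_combination -h₂
    rw [map_add, map_mul, conj_I, conj_ofReal, map_div₀, map_one, Complex.conj_natCast]
    push_cast
    rw [← h₃]
    nth_rewrite 1 [← re_add_im s]
    ring
  · rintro ⟨ℓ, y, rfl⟩
    rw [conjSeries_flow hk hb, hj, antiIterate_axis_flow hk hb]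
    congr 1
    have : (j : ℂ) ≠ 0 := by
      rw [hj] at hn0'; push_cast at hn0'; intro h; simp [h] at hn0'
    simp only [map_add, map_mul, map_div₀, map_one, map_neg, conj_I, conj_ofReal,
      Complex.conj_natCast]
    push_cast
    field_simp
    ring

/-- The formal roots of `g`, in a formal coordinate which conjugates `g` to its normal form. -/
theorem exists_formal_roots (hk : 1 ≤ k) (hb : b.im = 0) (hn : Even n) (hn0 : 0 < n)
    {g h G : ℂ → ℂ} (hga : AnalyticAt ℂ g 0) (hg0 : g 0 = 0) (hG : IsPrenormalization k b g h G) :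
    ∃ (hhat : PowerSeries ℂ) (F : Fin k → ℝ → PowerSeries ℂ),
      constantCoeff hhat = 0 ∧ coeff 1 hhat = deriv h 0 ∧
      comp hhat (taylor g) = comp (flow k b 1) hhat ∧
      (∀ ℓ y, constantCoeff (F ℓ y) = 0 ∧
        comp hhat (F ℓ y) = C (axisCoeff k ℓ) *
          comp (conjSeries (flow k b (1 / n + I * y))) (conjSeries hhat) ∧
        IsTangentToAxis k ℓ h (coeff 1 (F ℓ y))) ∧
      Function.Injective (fun p : Fin k × ℝ => F p.1 p.2) ∧
      ∀ A : PowerSeries ℂ, IsFormalAntiholomorphicRoot n g A ↔ ∃ ℓ y, A = F ℓ y := by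
  obtain ⟨⟨hh, hh0, hh'⟩, hpre, hgG⟩ := hG
  obtain ⟨S, hS, hSG⟩ := exists_formal_conjugacy hk hpre
  have hG0 := hpre.map_zero hk
  have hT : constantCoeff (taylor h) = 0 := by rw [constantCoeff_taylor, hh0]
  have hTg : constantCoeff (taylor g) = 0 := by rw [constantCoeff_taylor, hg0]
  have hTG : constantCoeff (taylor G) = 0 := by rw [constantCoeff_taylor, hG0]
  -- `p` is a formal conjugacy of `g` to the normal form, `q` will be its inverse.
  set p := comp S (taylor h) with hp
  have hp₀ : constantCoeff p = 0 := by rw [hp, constantCoeff_comp hT, hS.1]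
  have hp₁ : coeff 1 p = deriv h 0 := by
    rw [hp, coeff_one_comp hT, hS.2, one_mul, coeff_one_taylor]
  have hpg : comp p (taylor g) = comp (flow k b 1) p := by
    have e := taylor_congr hgG
    rw [taylor_comp hh hga hg0, taylor_comp hpre.1 hh hh0] at e
    rw [hp, comp_assoc hT hTg, e, ← comp_assoc hTG hT, hSG, comp_assoc hS.1 hT]
  obtain ⟨q, hq₀, hpq, hqp⟩ := exists_comp_inverse hp₀ (by rwa [hp₁])
  have hp₀' := constantCoeff_conjSeries hp₀
  have hq₀' := constantCoeff_conjSeries hq₀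
  have hcqp : comp (conjSeries q) (conjSeries p) = X := by
    rw [← conjSeries_comp hp₀, hqp, conjSeries_X]
  have hcpq : comp (conjSeries p) (conjSeries q) = X := by
    rw [← conjSeries_comp hq₀, hpq, conjSeries_X]
  have hflow : ∀ t, constantCoeff (conjSeries (flow k b t)) = 0 := fun t =>
    constantCoeff_conjSeries (isTangentToId_flow hk b t).1
  -- The roots `R` of the normal form, and their conjugates `F` by `p`.
  set R : Fin k → ℝ → PowerSeries ℂ := fun ℓ y =>
    C (axisCoeff k ℓ) * conjSeries (flow k b (1 / n + I * y)) with hR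
  have hR₀ : ∀ ℓ y, constantCoeff (R ℓ y) = 0 := fun ℓ y => by simp [hR, hflow]
  have hRp : ∀ ℓ y, constantCoeff (comp (R ℓ y) (conjSeries p)) = 0 := fun ℓ y => by
    rw [constantCoeff_comp hp₀', hR₀]
  set F : Fin k → ℝ → PowerSeries ℂ := fun ℓ y => comp q (comp (R ℓ y) (conjSeries p)) with hF
  have hF₀ : ∀ ℓ y, constantCoeff (F ℓ y) = 0 := fun ℓ y => by
    rw [hF, constantCoeff_comp (hRp ℓ y), hq₀]
  have hpF : ∀ ℓ y, comp p (F ℓ y) = comp (R ℓ y) (conjSeries p) := fun ℓ y => by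
    rw [hF, ← comp_assoc hq₀ (hRp ℓ y), hpq, X_comp (hRp ℓ y)]
  have hRF : ∀ ℓ y, comp p (comp (F ℓ y) (conjSeries q)) = R ℓ y := fun ℓ y => by
    rw [← comp_assoc (hF₀ ℓ y) hq₀', hpF, comp_assoc hp₀' hq₀', hcpq, comp_X]
  refine ⟨p, F, hp₀, hp₁, hpg, fun ℓ y => ⟨hF₀ ℓ y, ?_, ?_⟩, ?_, fun A => ?_⟩
  · rw [hpF, hR, C_mul_comp hp₀']
  · have e := congrArg (coeff 1) (hpF ℓ y)
    rw [coeff_one_comp (hF₀ ℓ y), coeff_one_comp hp₀', hp₁, coeff_conjSeries, hp₁, hR, coeff_C_mul,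
      coeff_conjSeries, (isTangentToId_flow hk b _).2, map_one, mul_one] at e
    exact e
  · rintro ⟨ℓ₁, y₁⟩ ⟨ℓ₂, y₂⟩ h
    have hRR : R ℓ₁ y₁ = R ℓ₂ y₂ := by
      rw [← hRF, ← hRF]
      exact congrArg (fun A => comp p (comp A (conjSeries q))) h
    have h₁ := congrArg (coeff 1) hRR
    have h₂ := congrArg (coeff (k + 1)) hRR
    simp only [hR, coeff_C_mul, coeff_conjSeries, (isTangentToId_flow hk b _).2, map_one, mul_one,
      coeff_flow_resonant hk] at h₁ h₂
    obtain rfl := axisCoeff_injective hk h₁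
    have h₃ := congrArg im (mul_left_cancel₀ (axisCoeff_ne_zero k _) h₂)
    have hn1 : ((1 : ℂ) / n).im = 0 := by
      rw [show (1 : ℂ) / n = ((1 / n : ℝ) : ℂ) by push_cast; rfl, ofReal_im]
    rw [conj_im, conj_im, add_im, add_im, hn1] at h₃
    simp at h₃
    rw [h₃]
  · rw [IsFormalAntiholomorphicRoot]
    constructor
    · rintro ⟨hA, hAn⟩
      have hA' : constantCoeff (comp A (conjSeries q)) = 0 := by rw [constantCoeff_comp hq₀', hA]
      have h₁ : antiIterate (comp p (comp A (conjSeries q))) n = flow k b 1 := by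
        rw [antiIterate_conjugate hA hp₀ hq₀ hpq hqp, conjSeries_iterate_of_even hn, hAn,
          ← comp_assoc hTg hq₀, hpg, comp_assoc hp₀ hq₀, hpq, comp_X]
      obtain ⟨ℓ, y, h₂⟩ := (antiIterate_eq_flow_one_iff hk hb hn hn0
        (by rw [constantCoeff_comp hA', hp₀])).1 h₁
      refine ⟨ℓ, y, ?_⟩
      have h₃ : comp q (comp (comp p (comp A (conjSeries q))) (conjSeries p)) = A := by
        rw [comp_assoc hA' hp₀', comp_assoc hq₀' hp₀', hcqp, comp_X, ← comp_assoc hp₀ hA, hqp,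
          X_comp hA]
      rw [h₂] at h₃
      exact h₃.symm
    · rintro ⟨ℓ, y, rfl⟩
      refine ⟨hF₀ ℓ y, ?_⟩
      have h₁ := (antiIterate_eq_flow_one_iff hk hb hn hn0 (hR₀ ℓ y)).2 ⟨ℓ, y, rfl⟩
      have h₂ := antiIterate_conjugate (hR₀ ℓ y) hq₀ hp₀ hqp hpq n
      have h₃ : constantCoeff (comp p (taylor g)) = 0 := by rw [constantCoeff_comp hTg, hp₀]
      rw [conjSeries_iterate_of_even hn, h₁, ← hpg, ← comp_assoc hp₀ hTg, hqp, X_comp hTg] at h₂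
      exact h₂

end FormalRoots

/-- The time-one map is the analytic normal form, so that a germ which is conjugate to it in the
coordinate `h` is conjugate to the normal form. -/
lemma IsConjugateToTimeOneMap.isConjugateToNormalForm {k : ℕ} {b : ℂ} {g h G : ℂ → ℂ} (hk : 1 ≤ k)
    (hG : IsPrenormalization k b g h G) (hc : IsConjugateToTimeOneMap k b G) :
    IsConjugateToNormalForm k b g := by
  obtain ⟨⟨hh, hh0, hh'⟩, -, hgG⟩ := hG
  obtain ⟨N, H, hN, hH, hH0, hH', hHG⟩ := hc
  have hHh : AnalyticAt ℂ H (h 0) := by rwa [hh0]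
  have hht : Tendsto h (𝓝 0) (𝓝 0) := by simpa [hh0] using hh.continuousAt.tendsto
  refine ⟨N, fun z => H (h z), (hN.taylor_eq hk).1, (hN.taylor_eq hk).2,
    ⟨hHh.fun_comp hh, by simp [hh0, hH0], ?_⟩, ?_⟩
  · have := (hHh.differentiableAt.hasDerivAt.comp (0 : ℂ) hh.differentiableAt.hasDerivAt).deriv
    rw [hh0, hH', one_mul] at this
    exact this.trans_ne hh'
  · filter_upwards [hgG, hht.eventually hHG] with z h₁ h₂
    rw [h₁, h₂]

end AntiholomorphicRoot

end

theorem mainTheorem3 (k n : ℕ) (b : ℂ) (g h G : ℂ → ℂ)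
    (hn : Even n) (hn0 : 0 < n) (hg : IsParabolicGerm k g)
    (hG : IsPrenormalization k b g h G) :
    -- (1) the `k` one-parameter families of formal roots
    (b.im = 0 →
      ∃ (hhat : PowerSeries ℂ) (F : Fin k → ℝ → PowerSeries ℂ),
        PowerSeries.constantCoeff hhat = 0 ∧ PowerSeries.coeff 1 hhat = deriv h 0 ∧
        comp hhat (taylor g) = comp (flow k b 1) hhat ∧
        (∀ ℓ y, PowerSeries.constantCoeff (F ℓ y) = 0 ∧
          comp hhat (F ℓ y) = PowerSeries.C (axisCoeff k ℓ) *
            comp (conjSeries (flow k b (1 / n + I * y))) (conjSeries hhat) ∧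
          IsTangentToAxis k ℓ h (PowerSeries.coeff 1 (F ℓ y))) ∧
        Function.Injective (fun p : Fin k × ℝ => F p.1 p.2) ∧
        ∀ A : PowerSeries ℂ, IsFormalAntiholomorphicRoot n g A ↔ ∃ ℓ y, A = F ℓ y) ∧
    -- (2) existence of a convergent root tangent to a given axis
    (∀ ℓ : Fin k,
      (∃ f : ℂ → ℂ, IsAntiholomorphicRoot n g f ∧ IsTangentToAxis k ℓ h (antiLinearCoeff f)) ↔
        ∃ Ψ : ZMod (2 * k) → ℂ → ℂ, IsModulusRepresentative k b G Ψ ∧ HasAxisSymmetry k n ℓ Ψ) ∧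
    -- (3) uniqueness, and the number of independent transition functions
    (¬ IsConjugateToNormalForm k b g →
      (∀ (ℓ : Fin k) (f₁ f₂ : ℂ → ℂ),
        IsAntiholomorphicRoot n g f₁ → IsTangentToAxis k ℓ h (antiLinearCoeff f₁) →
        IsAntiholomorphicRoot n g f₂ → IsTangentToAxis k ℓ h (antiLinearCoeff f₂) →
        f₁ =ᶠ[𝓝 0] f₂) ∧
      {γ : Germ (𝓝 (0 : ℂ)) ℂ | ∃ f : ℂ → ℂ, IsAntiholomorphicRoot n g f ∧ γ = ↑f}.encard ≤ k ∧
      ∀ (m : ℕ) (ℓ : Fin (m + 1) → Fin k), Function.Injective ℓ →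
        (∀ i, ∃ f : ℂ → ℂ, IsAntiholomorphicRoot n g f ∧
          IsTangentToAxis k (ℓ i) h (antiLinearCoeff f)) →
        (∃ Ψ : ZMod (2 * k) → ℂ → ℂ, IsModulusRepresentative k b G Ψ ∧
          ∀ i, HasAxisSymmetry k n (ℓ i) Ψ) ∧
        HasIndependentCount k b n (Set.range fun i => (ℓ i : ℕ))
          (Nat.gcd (Finset.univ.gcd fun i =>
            (((ℓ (Fin.last m) : ℕ) : ℤ) - ((ℓ i : ℕ) : ℤ)).natAbs) k)) := by
  have hk := hg.1
  have hpre := hG.2.1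
  obtain ⟨q, hq⟩ := hG.exists_rootTransfer n hg
  -- a root of `g` tangent to the axis `ℓ`, written in the coordinate `h`
  have hpush : ∀ ℓ : ℕ, (∃ f : ℂ → ℂ, IsAntiholomorphicRoot n g f ∧
      IsTangentToAxis k ℓ h (antiLinearCoeff f)) →
      ∃ F, IsAntiholomorphicRoot n G F ∧ antiLinearCoeff F = axisCoeff k ℓ := by
    rintro ℓ ⟨f, hf, hfℓ⟩
    exact ⟨_, hq.push f hf, (hq.push_tangent f ℓ hf).1 hfℓ⟩
  refine ⟨fun hb => exists_formal_roots hk hb hn hn0 hg.2.1 hg.2.2.1 hG, fun ℓ => ⟨fun hf => ?_, ?_⟩,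
    fun hnf => ?_⟩
  · obtain ⟨Ψ, hΨ, hs⟩ := exists_modulus_of_roots hk hpre hn hn0 {(ℓ : ℕ)}
      (fun ℓ' hℓ' => by rw [Set.mem_singleton_iff.1 hℓ']; exact hpush ℓ hf)
      (Or.inl Set.subsingleton_singleton)
    exact ⟨Ψ, hΨ, hs ℓ rfl⟩
  · rintro ⟨Ψ, hΨ, hs⟩
    obtain ⟨F, hF, hFℓ, hFG⟩ := exists_root_of_modulus hk hpre hn hn0 hΨ hs
    exact ⟨_, hq.pull F ⟨hF, hFG⟩, (hq.pull_tangent F ℓ ⟨hF, hFG⟩).2 hFℓ⟩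
  have hnc : ¬ IsConjugateToTimeOneMap k b G := fun hc => hnf (hc.isConjugateToNormalForm hk hG)
  have huniq : ∀ (ℓ : Fin k) (f₁ f₂ : ℂ → ℂ),
      IsAntiholomorphicRoot n g f₁ → IsTangentToAxis k ℓ h (antiLinearCoeff f₁) →
      IsAntiholomorphicRoot n g f₂ → IsTangentToAxis k ℓ h (antiLinearCoeff f₂) →
      f₁ =ᶠ[𝓝 0] f₂ := by
    intro ℓ f₁ f₂ h₁ t₁ h₂ t₂
    exact hq.push_inj f₁ f₂ h₁ h₂ (root_unique hk hpre hnc hn hn0 (hq.push f₁ h₁) (hq.push f₂ h₂)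
      ((hq.push_tangent f₁ ℓ h₁).1 t₁) ((hq.push_tangent f₂ ℓ h₂).1 t₂))
  refine ⟨huniq, ?_, fun m ℓ _ hf => ⟨?_, ?_⟩⟩
  · -- every root is tangent to an axis, and the axis determines the root
    have haxis : ∀ γ : {γ : Germ (𝓝 (0 : ℂ)) ℂ |
        ∃ f : ℂ → ℂ, IsAntiholomorphicRoot n g f ∧ γ = ↑f}, ∃ ℓ : Fin k, ∃ f : ℂ → ℂ,
        IsAntiholomorphicRoot n g f ∧ IsTangentToAxis k ℓ h (antiLinearCoeff f) ∧ γ.1 = ↑f := by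
      rintro ⟨γ, f, hf, rfl⟩
      have hF := hq.push f hf
      obtain ⟨ℓ, hℓ⟩ := exists_axis_of_root hk hn0 hpre hF.1 hF.2
      exact ⟨ℓ, f, hf, (hq.push_tangent f ℓ hf).2 hℓ, rfl⟩
    choose a f hf ht he using haxis
    have hinj : Function.Injective a := by
      intro γ₁ γ₂ h₁₂
      apply Subtype.ext
      rw [he γ₁, he γ₂, Germ.coe_eq]
      exact huniq (a γ₁) _ _ (hf γ₁) (ht γ₁) (hf γ₂) (h₁₂ ▸ ht γ₂)
    have := ENat.card_le_card_of_injective hinj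
    simpa using this
  · obtain ⟨Ψ, hΨ, hs⟩ := exists_modulus_of_roots hk hpre hn hn0 (Set.range fun i => (ℓ i : ℕ))
      (by rintro _ ⟨i, rfl⟩; exact hpush _ (hf i)) (Or.inr hnc)
    exact ⟨Ψ, hΨ, fun i => hs _ ⟨i, rfl⟩⟩
  · obtain ⟨F, hF, hFℓ⟩ := hpush _ (hf 0)
    exact hasIndependentCount hk (im_eq_zero_of_root hk hpre hn hn0 hF hFℓ) ℓ
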